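/- Let $k$ be a field of characteristic $0$ and let $A$ be a finite-dimensional $\mathbb Z/2\mathbb Z$-graded associative (not necessarily unital) $k$-algebra. Let $I:A\to A$ be an odd derivation, $I(ab)=I(a)b+(-1)^{|a|}aI(b)$ (with $I^2\ne 0$ allowed), and let $H:A\to A$ be an odd operator commuting with $I^2$ such that $P=\mathrm{Id}-[I,H]=\mathrm{Id}-(IH+HI)$ is idempotent; put $B=P(A)$. Let $\widetilde A=A\oplus(\Pi A)^\vee$ (odd case) or $\widetilde A=A\oplus A^\vee$ (even case), with its natural odd, respectively even, supersymmetric pairing $\beta$, and with the associative product extending that of $A$ for which the product of two functionals is $0$ and $\beta(xy,z)=\beta(x,yz)$. Extend $I$ and $H$ to $\widetilde A$ by $\beta(Ix,y)+(-1)^{|x|}\beta(x,Iy)=0$ and $\beta(Hx,y)=(-1)^{|x|}\beta(x,Hy)$. The image of $P$ on $\widetilde A$ is $\widetilde B=B\oplus(\Pi B)^\vee$, respectively $B\oplus B^\vee$, with the restricted pairing. Consider connected trivalent ribbon graphs $\Gamma$ with legs, with every edge oriented so that each vertex has exactly one exit flag (each edge joins an exit flag to an entry flag, and legs are marked as exits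 or entries), and with at least one leg on every boundary component of the ribbon surface $\Sigma_\Gamma$. Let $W_\Gamma$ be the contraction (with Koszul signs) of the tensors $m(\pi x,\pi y,\pi z)=(-1)^{|y|}\beta(xy,z)$ at the vertices with the propagators $\beta_H^\vee(u,v)=\beta^\vee(H^\vee u,v)$ at the edges and with elements of $\Pi\widetilde B$ at the legs, where entry flags are paired with $\Pi A$ and exit flags with the dual summand. It is a functional on the product of the cyclic words formed by the legs on the boundary components of $\Sigma_\Gamma$. In the even case the vertices and edges carry odd tensors, $\Gamma$ is taken with an orientation, and $W_\Gamma$ is a functional on the exterior product of these words. For given cyclic words with labelled letters and given $\chi(\Sigma_\Gamma)=|\mathrm{Vert}(\Gamma)|-|\mathrm{Edge}(\Gamma)|$ there are only finitely many isomorphism classes of such graphs with legs labelled by the letters. Put $$S^B=\sum_{\{\Gamma\}}\hbar^{1-\chi(\Sigma_\Gamma)}W^B_\Gamma,\qquad S^{\Pi B}=\sum_{\{\Gamma\}}\hbar^{1-\chi(\Sigma_\Gamma)}W^{\Pi B}_\Gamma$$ in the odd, respectively even, case, the sums being over isomorphism classes. Then $S^B$ is an even element of $\mathrm{Symm}\big(\bigoplus_{j\ge1}((\Pi\widetilde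 B)^{\otimes j})^{\mathbb Z/j}\big)^\vee[[\hbar]]$ (symmetric products of cyclic words with letters in $\Pi B^\vee$ and $B$), $S^{\Pi B}$ is an even element of $\mathrm{Symm}\big(\bigoplus_{j\ge1}\Pi((\Pi\widetilde B)^{\otimes j})^{\mathbb Z/j}\big)^\vee[[\hbar]]$ (exterior products of cyclic words with letters in $\Pi B^\vee$ and $\Pi B$), and they solve the equivariant noncommutative Batalin–Vilkovisky equations $$\hbar\Delta S^B+\tfrac12\{S^B,S^B\}+I^\vee S^B=0,\qquad \hbar\Delta S^{\Pi B}+\tfrac12\{S^{\Pi B},S^{\Pi B}\}+I^\vee S^{\Pi B}=0 .$$ Here $\Delta$ and $\{\cdot,\cdot\}$ are given by cutting out and gluing pairs of letters contracted with the inverse of $\beta|_{\widetilde B}$: $\Delta$ sums over all unordered pairs of positions of one product of words (two positions of one word cut it in two, positions of two words join them), and $\{F,G\}$ over one position from $F$ and one from $G$; gluings that leave a word without letters (neighbouring positions of one word, or two words of length one) do not contribute. $I^\vee$ is the derivation given by the contragredient action of $I|_{\widetilde B}$. -/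

import Mathlib

/-!
Conventions.  Everything lives in super vector spaces over a field `k` of characteristic zero,
parities are elements of `ZMod 2`, and signs follow the Koszul rule.  Multilinear functionals on a
finite-dimensional super vector space are given by their values on words in a homogeneous basis
(the *letters*).  The parity `d` of the scalar product is `1` (odd) or `0` (even).
-/

noncomputable section

namespace NCBV

open Equiv (Perm swap)

/-! ### Signs -/

/-- `(-1)^a`. -/
def sgn (a : ZMod 2) : ℤ := if a = 0 then 1 else -1

/-- The Koszul sign of rearranging a product of letters `x : X` of parities `p x` from the order
given by the rank function `r` to the order given by the rank function `s`. -/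
def koszulSign {X : Type*} [Fintype X] (p : X → ZMod 2) (r s : X → ℕ) : ℤ :=
  (-1) ^ (Finset.univ.filter fun xy : X × X =>
    r xy.1 < r xy.2 ∧ s xy.2 < s xy.1 ∧ p xy.1 = 1 ∧ p xy.2 = 1).card

/-! ### Boundary words -/

/-- `φ` permutes a set `Y`, and `j` embeds a set of labels `X` in `Y`.  `Induces φ j σ` says that
every cycle of `φ` carries at least one label, and that `σ` is the permutation of the labels which
sends a label to the next label met on its cycle of `φ`. -/
def Induces {X Y : Type*} (φ : Perm Y) (j : X → Y) (σ : Perm X) : Prop :=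
  (∀ y, ∃ x, φ.SameCycle y (j x)) ∧
  ∀ x, ∃ m : ℕ, 0 < m ∧ (φ ^ m) (j x) = j (σ x) ∧
    ∀ l : ℕ, 0 < l → l < m → (φ ^ l) (j x) ∉ Set.range j

/-! ### Symmetric products of cyclic words

A product of cyclic words of total length `n`, with letters in `K`, is given by a map
`v : Fin n → K` (all letters, in the order in which they are tensored) and a permutation
`σ` of `Fin n`, whose cycles are the cyclic words. -/

/-- Functionals on products of cyclic words with letters in a homogeneous basis `K`. -/
abbrev WordFunctional (k K : Type*) := ∀ n : ℕ, Perm (Fin n) → (Fin n → K) → k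

section Symmetric

variable {k : Type*} [Field k] {K : Type*} [Fintype K]

/-- `F` is an even element of the space `Symm(⨁_{j ≥ 1} (V^{⊗ j})^{ℤ/j})^∨`, where `V` has the
homogeneous basis `K` with parities `par`: it does not depend on how the letters are listed, up to
the Koszul sign (this contains the invariance under rotation of each word, `τ` being a cycle of `σ`,
and the symmetry in the words, `τ` exchanging cycles of `σ`), and it vanishes on odd products. -/
structure IsSymmetricFunctional (par : K → ZMod 2) (F : WordFunctional k K) : Prop where
  equivariant : ∀ (n : ℕ) (σ τ : Perm (Fin n)) (v : Fin n → K),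
    F n (τ * σ * τ⁻¹) (v ∘ τ.symm) =
      (koszulSign (par ∘ v) (fun i => (i : ℕ)) (fun i => (τ i : ℕ)) : k) * F n σ v
  even : ∀ (n : ℕ) (σ : Perm (Fin n)) (v : Fin n → K), F n σ v ≠ 0 → ∑ i, par (v i) = 0

open Classical in
/-- The noncommutative Batalin-Vilkovisky operator of the two-tensor `t = ∑ t_{μν} e_μ ⊗ e_ν`
(inverse to the scalar product).  Two letters `e_μ, e_ν`, contracted with `t`, are put in the
positions `0, 1` of a product of words `σ'`, and the two positions are cut out and glued: if they lie
on one cyclic word it falls in two words, if they lie on two words these are joined.  Gluings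
leaving a word without letters (two neighbouring positions of a word, two words of length one)
do not contribute.  The factor `1/2` makes the sum one over unordered pairs of positions. -/
def bvOperator (t : K → K → k) (F : WordFunctional k K) : WordFunctional k K :=
  fun n σ v => (1 / 2 : k) *
    ∑ σ' ∈ Finset.univ.filter fun σ' : Perm (Fin (n + 2)) =>
        Induces (swap 0 1 * σ') (fun i : Fin n => i.succ.succ) σ,
      ∑ μ, ∑ ν, t μ ν * F (n + 2) σ' (Fin.cons μ (Fin.cons ν v))

/-- The position of the letter `i` when the letters in `X` and those outside of `X` are listed
separately, in increasing order, each list after a letter `0`. -/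
def splitLabel {n : ℕ} (X : Finset (Fin n)) (i : Fin n) : Fin (X.card + 1) ⊕ Fin (Xᶜ.card + 1) :=
  if h : i ∈ X then .inl ((X.orderIsoOfFin rfl).symm ⟨i, h⟩).succ
  else .inr ((Xᶜ.orderIsoOfFin rfl).symm ⟨i, Finset.mem_compl.mpr h⟩).succ

/-- The Koszul sign of `(e_μ, e_ν, v) ↦ (e_μ, v_X, e_ν, v_{Xᶜ})`. -/
def splitSign {n : ℕ} (par : K → ZMod 2) (v : Fin n → K) (X : Finset (Fin n)) (ν : K) : ℤ :=
  sgn (par ν * ∑ i ∈ X, par (v i)) *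
    koszulSign (par ∘ v) (fun i => (i : ℕ)) (fun i => if i ∈ X then (i : ℕ) else n + i)

open Classical in
/-- The odd Poisson bracket of even functionals: a position `0` of a product of words on which `F`
is evaluated is glued to a position `0` of a product of words on which `G` is evaluated. -/
def bracket (par : K → ZMod 2) (t : K → K → k) (F G : WordFunctional k K) :
    WordFunctional k K :=
  fun n σ v => ∑ X : Finset (Fin n),
    ∑ σ' ∈ Finset.univ.filter fun σ' : Perm (Fin (X.card + 1)) × Perm (Fin (Xᶜ.card + 1)) =>
        Induces (swap (.inl 0) (.inr 0) * Equiv.Perm.sumCongr σ'.1 σ'.2) (splitLabel X) σ,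
      ∑ μ, ∑ ν, (splitSign par v X ν : k) * t μ ν *
        F _ σ'.1 (Fin.cons μ (v ∘ X.orderEmbOfFin rfl)) *
        G _ σ'.2 (Fin.cons ν (v ∘ Xᶜ.orderEmbOfFin rfl))

open Classical in
/-- The (contragredient) action on functionals of the odd operator `e_x ↦ ∑_y J_{yx} e_y`, extended
to products of words as a derivation. -/
def dualAction (par : K → ZMod 2) (J : K → K → k) (F : WordFunctional k K) :
    WordFunctional k K :=
  fun n σ v => -∑ i : Fin n, ∑ y,
    (sgn (∑ l ∈ Finset.univ.filter (· < i), par (v l)) : k) * J y (v i) *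
      F n σ (Function.update v i y)

/-- The coefficient at `ħ^c` of `ħ Δ S + ½ {S, S} + I^∨ S`, for `S = ∑_c ħ^c S_c`. -/
def bvExpression (par : K → ZMod 2) (t J : K → K → k) (S : ℕ → WordFunctional k K) (c : ℕ) :
    WordFunctional k K :=
  fun n σ v =>
    (match c with
      | 0 => 0
      | c' + 1 => bvOperator t (S c') n σ v) +
    (1 / 2 : k) * ∑ ab ∈ Finset.HasAntidiagonal.antidiagonal c, bracket par t (S ab.1) (S ab.2) n σ v +
    dualAction par J (S c) n σ v

end Symmetric

/-! ### Exterior products of cyclic words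

For exterior products the order of the words matters up to sign: the functional on the words of
`σ` takes values in the top exterior power of the span of the cycles of `σ`.  It is realised in the
exterior algebra of `k^n`, a cycle being identified with its indicator vector. -/

section Exterior

/-- The indicator vector of the cycle of `φ` through `y`. -/
def cycleVector (k : Type*) [Field k] {Y : Type*} (φ : Perm Y) (y : Y) : Y → k :=
  open Classical in fun z => if φ.SameCycle y z then 1 else 0

/-- The line spanned by the exterior product of all the cycles of `φ`. -/
def cycleLine (k : Type*) [Field k] {Y : Type*} (φ : Perm Y) :
    Submodule k (ExteriorAlgebra k (Y → k)) :=
  Submodule.span k {D | ∃ l : List Y, l.Nodup ∧ (∀ y, ∃! x, x ∈ l ∧ φ.SameCycle x y) ∧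
    D = (l.map fun y => ExteriorAlgebra.ι k (cycleVector k φ y)).prod}

open Classical in
/-- The effect on exterior products of cycles of gluing the positions `p` and `q`, i.e. of passing
from `φ` to `φ' = swap p q * φ`.  If `p, q` lie on one cycle `C` of `φ`, it is cut in two cycles
`C_p ∋ p` and `C_q ∋ q` of `φ'` and `C ∧ ω ↦ C_p ∧ C_q ∧ ω` (which is `C_p ∧ C ∧ ω`, since
`C = C_p + C_q`).  If they lie on two cycles `C_p ∋ p` and `C_q ∋ q` of `φ`, these are joined to a
cycle `C = C_p + C_q` of `φ'` and `C_p ∧ C_q ∧ ω ↦ C ∧ ω`. -/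
def glueCycles {k : Type*} [Field k] {Y : Type*} (φ : Perm Y) (p q : Y) :
    ExteriorAlgebra k (Y → k) →ₗ[k] ExteriorAlgebra k (Y → k) :=
  if φ.SameCycle p q then
    LinearMap.mulLeft k (ExteriorAlgebra.ι k (cycleVector k (swap p q * φ) p))
  else CliffordAlgebra.contractLeft
    (LinearMap.proj (R := k) (φ := fun _ : Y => k) p - LinearMap.proj q)

/-- Restriction along `j : X → Y` of exterior products of subsets of `Y`. -/
def restrictExt (k : Type*) [Field k] {X Y : Type*} (j : X → Y) :
    ExteriorAlgebra k (Y → k) →ₐ[k] ExteriorAlgebra k (X → k) :=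
  ExteriorAlgebra.map (LinearMap.funLeft k k j)

/-- Extension by zero along an injection `j : X → Y` of exterior products of subsets of `X`. -/
def extendExt (k : Type*) [Field k] {X Y : Type*} (j : X → Y) :
    ExteriorAlgebra k (X → k) →ₐ[k] ExteriorAlgebra k (Y → k) :=
  ExteriorAlgebra.map (Function.ExtendByZero.linearMap k j)

/-- Functionals on exterior products of cyclic words with letters in a homogeneous basis `K`. -/
abbrev ExtWordFunctional (k K : Type*) [Field k] :=
  ∀ n : ℕ, Perm (Fin n) → (Fin n → K) → ExteriorAlgebra k (Fin n → k)

variable {k : Type*} [Field k] {K : Type*} [Fintype K]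

/-- `F` is an even element of the space `Symm(⨁_{j ≥ 1} Π (V^{⊗ j})^{ℤ/j})^∨`, where `V` has the
homogeneous basis `K` with parities `par`, each word contributing one odd symbol. -/
structure IsExteriorFunctional (par : K → ZMod 2) (F : ExtWordFunctional k K) : Prop where
  mem_line : ∀ (n : ℕ) (σ : Perm (Fin n)) (v : Fin n → K), F n σ v ∈ cycleLine k σ
  equivariant : ∀ (n : ℕ) (σ τ : Perm (Fin n)) (v : Fin n → K),
    F n (τ * σ * τ⁻¹) (v ∘ τ.symm) =
      (koszulSign (par ∘ v) (fun i => (i : ℕ)) (fun i => (τ i : ℕ)) : k) •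
        restrictExt k τ.symm (F n σ v)
  even : ∀ (n : ℕ) (σ : Perm (Fin n)) (v : Fin n → K), F n σ v ≠ 0 →
    ∑ i, par (v i) = (Nat.card (Quotient (Equiv.Perm.SameCycle.setoid σ)) : ZMod 2)

open Classical in
/-- The Batalin-Vilkovisky operator on exterior products of cyclic words. -/
def extBvOperator (t : K → K → k) (F : ExtWordFunctional k K) : ExtWordFunctional k K :=
  fun n σ v => (1 / 2 : k) •
    ∑ σ' ∈ Finset.univ.filter fun σ' : Perm (Fin (n + 2)) =>
        Induces (swap 0 1 * σ') (fun i : Fin n => i.succ.succ) σ,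
      ∑ μ, ∑ ν, t μ ν • restrictExt k (fun i : Fin n => i.succ.succ)
        (glueCycles σ' 0 1 (F (n + 2) σ' (Fin.cons μ (Fin.cons ν v))))

open Classical in
/-- The Poisson bracket of even functionals on exterior products of cyclic words. -/
def extBracket (par : K → ZMod 2) (t : K → K → k) (F G : ExtWordFunctional k K) :
    ExtWordFunctional k K :=
  fun n σ v => ∑ X : Finset (Fin n),
    ∑ σ' ∈ Finset.univ.filter fun σ' : Perm (Fin (X.card + 1)) × Perm (Fin (Xᶜ.card + 1)) =>
        Induces (swap (.inl 0) (.inr 0) * Equiv.Perm.sumCongr σ'.1 σ'.2) (splitLabel X) σ,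
      ∑ μ, ∑ ν, ((splitSign par v X ν : k) * t μ ν) • restrictExt k (splitLabel X)
        (glueCycles (Equiv.Perm.sumCongr σ'.1 σ'.2) (.inl 0) (.inr 0)
          (extendExt k Sum.inl (F _ σ'.1 (Fin.cons μ (v ∘ X.orderEmbOfFin rfl))) *
            extendExt k Sum.inr (G _ σ'.2 (Fin.cons ν (v ∘ Xᶜ.orderEmbOfFin rfl)))))

open Classical in
/-- The (contragredient) action of an odd operator on functionals on exterior products. -/
def extDualAction (par : K → ZMod 2) (J : K → K → k) (F : ExtWordFunctional k K) :
    ExtWordFunctional k K :=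
  fun n σ v => -∑ i : Fin n, ∑ y,
    ((sgn (∑ l ∈ Finset.univ.filter (· < i), par (v l)) : k) * J y (v i)) •
      F n σ (Function.update v i y)

/-- The coefficient at `ħ^c` of `ħ Δ S + ½ {S, S} + I^∨ S`, for `S = ∑_c ħ^c S_c`. -/
def extBvExpression (par : K → ZMod 2) (t J : K → K → k) (S : ℕ → ExtWordFunctional k K)
    (c : ℕ) : ExtWordFunctional k K :=
  fun n σ v =>
    (match c with
      | 0 => 0
      | c' + 1 => extBvOperator t (S c') n σ v) +
    (1 / 2 : k) • ∑ ab ∈ Finset.HasAntidiagonal.antidiagonal c, extBracket par t (S ab.1) (S ab.2) n σ v +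
    extDualAction par J (S c) n σ v

end Exterior

/-! ### Trivalent ribbon graphs with oriented edges -/

/-- A connected trivalent ribbon graph with `N` flags, legs labelled by `Fin n`, and oriented edges.
The vertices are the cycles of `rot`, with their cyclic orders; the edges are the two-element
orbits of the involution `inv`, the legs its fixed points.  A flag is an exit (`out f = true`) or an
entry: each vertex has exactly one exit, and each edge consists of an exit and an entry. -/
structure RibbonGraph (N n : ℕ) where
  rot : Perm (Fin N)
  inv : Perm (Fin N)
  leg : Fin n → Fin N
  out : Fin N → Bool
  rot_ne : ∀ f, rot f ≠ f
  rot_rot_rot : ∀ f, rot (rot (rot f)) = f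
  inv_inv : ∀ f, inv (inv f) = f
  leg_injective : Function.Injective leg
  isLeg_iff : ∀ f, (∃ x, leg x = f) ↔ inv f = f
  nonempty : 0 < N
  connected : ∀ f g, Relation.ReflTransGen (fun a b => b = rot a ∨ b = inv a) f g
  vertex_exit : ∀ f, ∃! g, rot.SameCycle f g ∧ out g = true
  edge_oriented : ∀ f, inv f ≠ f → out (inv f) = !out f

namespace RibbonGraph

variable {N n : ℕ} (Γ : RibbonGraph N n)

/-- The first flag of each vertex. -/
def vertexFlags : Finset (Fin N) :=
  Finset.univ.filter fun f => f ≤ Γ.rot f ∧ f ≤ Γ.rot (Γ.rot f)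

/-- The first flag of each edge. -/
def edgeFlags : Finset (Fin N) := Finset.univ.filter fun f => f < Γ.inv f

/-- `1 - χ = c`, where `χ = |Vert| - |Edge|` is the Euler characteristic of the surface `Σ_Γ`. -/
def HasOrder (c : ℕ) : Prop := Γ.edgeFlags.card + 1 = Γ.vertexFlags.card + c

/-- The legs on the boundary components of `Σ_Γ`, with their cyclic orders, are the cycles of `σ`,
and every boundary component carries a leg. -/
def HasBoundary (σ : Perm (Fin n)) : Prop := Induces (Γ.inv * Γ.rot) Γ.leg σ

/-- Isomorphisms of ribbon graphs with labelled legs and oriented edges. -/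
def Iso (Γ' : RibbonGraph N n) : Prop :=
  ∃ e : Perm (Fin N), (∀ f, e (Γ.rot f) = Γ'.rot (e f)) ∧ (∀ f, e (Γ.inv f) = Γ'.inv (e f)) ∧
    (∀ x, e (Γ.leg x) = Γ'.leg x) ∧ ∀ f, Γ'.out (e f) = Γ.out f

/-- The first flag of the vertex of `f`. -/
def vertexOf (f : Fin N) : Fin N := min f (min (Γ.rot f) (Γ.rot (Γ.rot f)))

/-- The order of the flags in the product of the vertices. -/
def vertexRank (f : Fin N) : ℕ :=
  3 * (Γ.vertexOf f : ℕ) +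
    if f = Γ.vertexOf f then 0 else if f = Γ.rot (Γ.vertexOf f) then 1 else 2

/-- The order of the flags in the product of the edges, followed by the legs. -/
def edgeRank (f : Fin N) : ℕ :=
  if Γ.inv f = f then 2 * N + ∑ x ∈ Finset.univ.filter (fun x => Γ.leg x = f), (x : ℕ)
  else 2 * (min f (Γ.inv f) : Fin N) + if f < Γ.inv f then 0 else 1

/-- The contraction `⟨⊗_v m^v, ⊗_e t^e ⊗ ⊗_l a_l⟩` of the three-tensor `m` at the vertices with the
two-tensor `t` at the edges and the vectors `a_l` at the legs.  The sum is over the markings of the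
flags by letters of `ι ⊕ ι`, exits being marked in the second and entries in the first copy. -/
def contraction {k : Type*} [Field k] {ι : Type*} [Fintype ι] (par : ι ⊕ ι → ZMod 2)
    (m : ι ⊕ ι → ι ⊕ ι → ι ⊕ ι → k) (t : ι ⊕ ι → ι ⊕ ι → k) (a : Fin n → ι ⊕ ι → k) : k :=
  open Classical in
  ∑ φ ∈ Finset.univ.filter fun φ : Fin N → ι ⊕ ι => ∀ f, (φ f).isRight = Γ.out f,
    (koszulSign (par ∘ φ) Γ.edgeRank Γ.vertexRank : k) *
      (∏ f ∈ Γ.vertexFlags, m (φ f) (φ (Γ.rot f)) (φ (Γ.rot (Γ.rot f)))) *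
      (∏ f ∈ Γ.edgeFlags, t (φ f) (φ (Γ.inv f))) *
      ∏ x, a x (φ (Γ.leg x))

/-- The orientation: the exterior product of the vertices, glued along the edges one by one to an
exterior product of the boundary components of `Σ_Γ` (recorded by the flags on them).  The vertices
and the edges are taken in the same order as in the contraction, so that the product of the
orientation and the contraction does not depend on this order. -/
def orientation (k : Type*) [Field k] : ExteriorAlgebra k (Fin N → k) :=
  (((List.finRange N).filter fun f => f ∈ Γ.edgeFlags).foldl
    (fun s f => (swap f (Γ.inv f) * s.1, glueCycles s.1 f (Γ.inv f) s.2))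
    (Γ.rot, (((List.finRange N).filter fun f => f ∈ Γ.vertexFlags).map
      fun f => ExteriorAlgebra.ι k (cycleVector k Γ.rot f)).prod)).2

end RibbonGraph

/-- Isomorphism of the ribbon graphs with boundary words `σ` and with `1 - χ = c`. -/
def ribbonSetoid (N n : ℕ) (σ : Perm (Fin n)) (c : ℕ) :
    Setoid {Γ : RibbonGraph N n // Γ.HasBoundary σ ∧ Γ.HasOrder c} where
  r Γ Γ' := Γ.1.Iso Γ'.1
  iseqv :=
    { refl := fun _ => ⟨1, fun _ => rfl, fun _ => rfl, fun _ => rfl, fun _ => rfl⟩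
      symm := by
        rintro ⟨Γ, _⟩ ⟨Γ', _⟩ ⟨e, h1, h2, h3, h4⟩
        refine ⟨e.symm, fun f => ?_, fun f => ?_, fun x => ?_, fun f => ?_⟩
        · rw [Equiv.symm_apply_eq, h1, Equiv.apply_symm_apply]
        · rw [Equiv.symm_apply_eq, h2, Equiv.apply_symm_apply]
        · rw [Equiv.symm_apply_eq, h3]
        · rw [← h4, Equiv.apply_symm_apply]
      trans := by
        rintro ⟨Γ, _⟩ ⟨Γ', _⟩ ⟨Γ'', _⟩ ⟨e, h1, h2, h3, h4⟩ ⟨e', g1, g2, g3, g4⟩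
        refine ⟨e' * e, fun f => ?_, fun f => ?_, fun x => ?_, fun f => ?_⟩
        · simp [h1, g1]
        · simp [h2, g2]
        · simp [h3, g3]
        · rw [← h4, ← g4]; rfl }

/-- Isomorphism classes of connected trivalent ribbon graphs with oriented edges and labelled legs,
with boundary words `σ` (so that every boundary component carries a leg) and `1 - χ = c`. -/
abbrev RibbonClass (n : ℕ) (σ : Perm (Fin n)) (c : ℕ) :=
  Σ N : ℕ, Quotient (ribbonSetoid N n σ c)

section Sums

variable {k : Type*} [Field k] {ι : Type*} [Fintype ι]

/-- The coefficient at `ħ^c` of `∑_Γ ħ^{1-χ} W_Γ`, the sum being over isomorphism classes. -/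
def ribbonSum (par : ι ⊕ ι → ZMod 2) (m : ι ⊕ ι → ι ⊕ ι → ι ⊕ ι → k) (t : ι ⊕ ι → ι ⊕ ι → k)
    (c n : ℕ) (σ : Perm (Fin n)) (a : Fin n → ι ⊕ ι → k) : k :=
  ∑ᶠ Γ : RibbonClass n σ c, Γ.2.out.1.contraction par m t a

/-- The same sum over oriented ribbon graphs, with values in exterior products of the words. -/
def extRibbonSum (par : ι ⊕ ι → ZMod 2) (m : ι ⊕ ι → ι ⊕ ι → ι ⊕ ι → k) (t : ι ⊕ ι → ι ⊕ ι → k)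
    (c n : ℕ) (σ : Perm (Fin n)) (a : Fin n → ι ⊕ ι → k) : ExteriorAlgebra k (Fin n → k) :=
  ∑ᶠ Γ : RibbonClass n σ c, Γ.2.out.1.contraction par m t a •
    restrictExt k Γ.2.out.1.leg (Γ.2.out.1.orientation k)

end Sums

/-! ### The doubled algebra

`Ã = A ⊕ (ΠA)^∨` (`d = 1`) or `Ã = A ⊕ A^∨` (`d = 0`), with underlying space
`A × Module.Dual k A`.  A functional supported on the part of parity `i` of `A` has parity
`i + d`. -/

section Double

variable {k : Type*} [Field k] {A : Type*} [NonUnitalRing A] [Module k A]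

/-- `a ↦ (-1)^{|a|} a`. -/
def parityOp (𝒜 : ZMod 2 → Submodule k A) [DirectSum.Decomposition 𝒜] : Module.End k A :=
  ((𝒜 0).subtype ∘ₗ DirectSum.component k (ZMod 2) (fun i => 𝒜 i) 0 -
    (𝒜 1).subtype ∘ₗ DirectSum.component k (ZMod 2) (fun i => 𝒜 i) 1) ∘ₗ
    (DirectSum.decomposeLinearEquiv 𝒜).toLinearMap

/-- `P = Id - [I, H]`. -/
def homotopyProj (I H : Module.End k A) : Module.End k A := 1 - (I * H + H * I)

variable (d : ℕ) (s : Module.End k A)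

/-- The natural supersymmetric pairing on `Ã`: `β(f, b) = f(b)` and
`β(a, g) = (-1)^{|a||g|} g(a)`, the latter being `g(a)` for `d = 1` and `(-1)^{|a|} g(a)` for
`d = 0`.  Here `s` is the parity operator of `A`. -/
def dblPairing (x y : A × Module.Dual k A) : k := x.2 y.1 + y.2 ((s ^ (d + 1)) x.1)

/-- The product of `Ã`: `(f b)(c) = f(bc)`, `(a g)(c) = (-1)^{|a|(|g|+|c|)} g(ca)` and `f g = 0`,
so that `β(xy, z) = β(x, yz)`. -/
def dblMul [IsScalarTower k A A] [SMulCommClass k A A] (x y : A × Module.Dual k A) :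
    A × Module.Dual k A :=
  (x.1 * y.1, x.2 ∘ₗ LinearMap.mulLeft k y.1 + y.2 ∘ₗ LinearMap.mulRight k ((s ^ (d + 1)) x.1))

/-- The extension of the odd operator `I`, with `β(Ix, y) + (-1)^{|x|} β(x, Iy) = 0`. -/
def dblI (I : Module.End k A) (x : A × Module.Dual k A) : A × Module.Dual k A :=
  (I x.1, ((-1 : k) ^ d) • (x.2 ∘ₗ I ∘ₗ s))

/-- The extension of the odd operator `H`, with `β(Hx, y) = (-1)^{|x|} β(x, Hy)`. -/
def dblH (H : Module.End k A) (x : A × Module.Dual k A) : A × Module.Dual k A :=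
  (H x.1, ((-1 : k) ^ (d + 1)) • (x.2 ∘ₗ H ∘ₗ s))

variable {ι : Type*}

/-- The basis of `Ã` formed by a basis of `A` and the dual basis. -/
def dblBasis (b : Module.Basis ι k A) : ι ⊕ ι → A × Module.Dual k A :=
  Sum.elim (fun i => (b i, 0)) (fun i => (0, b.coord i))

/-- The coordinates in this basis. -/
def dblCoord (b : Module.Basis ι k A) (x : A × Module.Dual k A) : ι ⊕ ι → k :=
  Sum.elim (fun i => b.repr x.1 i) (fun i => x.2 (b i))

/-- Parities in a doubled space with a basis of parities `p` and its dual basis. -/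
def dblParity (p : ι → ZMod 2) : ι ⊕ ι → ZMod 2 := Sum.elim p (fun i => p i + d)

/-- Parities of the letters, i.e. after the shift `Π`. -/
def letterParity (p : ι → ZMod 2) (i : ι ⊕ ι) : ZMod 2 := dblParity d p i + 1

/-- `m(πx, πy, πz) = (-1)^{|y|} β(xy, z)`. -/
def threeTensor [IsScalarTower k A A] [SMulCommClass k A A] (b : Module.Basis ι k A)
    (p : ι → ZMod 2) (i j l : ι ⊕ ι) : k :=
  sgn (dblParity d p j) *
    dblPairing d s (dblMul d s (dblBasis b i) (dblBasis b j)) (dblBasis b l)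

/-- The two-tensor on `ΠW` inverse to a scalar product of parity `d` on `W` with Gram matrix
`G` in a basis with parities `q`: it is `β^∨` for odd `β`, and `(π ⊗ π) β^∨` for even `β`. -/
def inverseTensor {M : Type*} [Fintype M] [DecidableEq M] (q : M → ZMod 2) (G : Matrix M M k)
    (x y : M) : k :=
  sgn ((d + 1) * q x) * G⁻¹ x y

/-- The propagator: the two-tensor on `ΠÃ` which, as a form on the dual space, is
`(u, v) ↦ β^∨(H^∨ u, v)`, where `H^∨ u = (-1)^{|u|} u ∘ πHπ⁻¹` and tensors are paired with functionals
by the Koszul rule; in components this is `(-1)^d (H ⊗ 1) β^∨`. -/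
def propagator [Fintype ι] [DecidableEq ι] (H : Module.End k A) (b : Module.Basis ι k A)
    (p : ι → ZMod 2) (i j : ι ⊕ ι) : k :=
  (-1) ^ d * ∑ l, dblCoord b (dblH d s H (dblBasis b l)) i *
    inverseTensor d (dblParity d p)
      (Matrix.of fun x y => dblPairing d s (dblBasis b x) (dblBasis b y)) l j

/-! The image `B̃` of `P` acting on `Ã`: this is `B ⊕ (ΠB)^∨` or `B ⊕ B^∨` for the image `B` of
`P` in `A`, functionals on `B` being extended to `A` by `P`. -/

variable {κ : Type*} (P : Module.End k A) (e : Module.Basis κ k (LinearMap.range P))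

/-- The basis of `B̃ ⊆ Ã` formed by a basis of `B` and the dual basis. -/
def imgBasis : κ ⊕ κ → A × Module.Dual k A :=
  Sum.elim (fun μ => ((e μ : A), 0)) (fun μ => (0, e.coord μ ∘ₗ P.rangeRestrict))

/-- The coordinates of an element of `B̃` in this basis. -/
def imgCoord (x : A × Module.Dual k A) : κ ⊕ κ → k :=
  Sum.elim (fun μ => e.coord μ (P.rangeRestrict x.1)) (fun μ => x.2 (e μ))

/-- The inverse tensor of the restriction of the scalar product to `B̃`. -/
def imgTensor [Fintype κ] [DecidableEq κ] (q : κ → ZMod 2) : κ ⊕ κ → κ ⊕ κ → k :=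
  inverseTensor d (dblParity d q)
    (Matrix.of fun x y => dblPairing d s (imgBasis P e x) (imgBasis P e y))

/-- The matrix of `I` on the letters, `πx ↦ -π(Ix)`, for `x` in `B̃`. -/
def imgI (I : Module.End k A) (y x : κ ⊕ κ) : k :=
  -imgCoord P e (dblI d s I (imgBasis P e x)) y

end Double

section Solutions

variable {k : Type*} [Field k] {A : Type*} [NonUnitalRing A] [Module k A]
  [IsScalarTower k A A] [SMulCommClass k A A]
  (𝒜 : ZMod 2 → Submodule k A) [DirectSum.Decomposition 𝒜]
  {ι : Type*} [Fintype ι] [DecidableEq ι] {κ : Type*}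

/-- `S^B = ∑_c ħ^c S^B_c`, on words with letters in `ΠB̃ = Π(B ⊕ (ΠB)^∨)`. -/
def solutionB (H : Module.End k A) (b : Module.Basis ι k A) (p : ι → ZMod 2)
    (P : Module.End k A) (e : Module.Basis κ k (LinearMap.range P)) :
    ℕ → WordFunctional k (κ ⊕ κ) :=
  fun c n σ v => ribbonSum (letterParity 1 p) (threeTensor 1 (parityOp 𝒜) b p)
    (propagator 1 (parityOp 𝒜) H b p) c n σ fun x => dblCoord b (imgBasis P e (v x))

/-- `S^{ΠB} = ∑_c ħ^c S^{ΠB}_c`, on words with letters in `ΠB̃ = Π(B ⊕ B^∨)`. -/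
def solutionPiB (H : Module.End k A) (b : Module.Basis ι k A) (p : ι → ZMod 2)
    (P : Module.End k A) (e : Module.Basis κ k (LinearMap.range P)) :
    ℕ → ExtWordFunctional k (κ ⊕ κ) :=
  fun c n σ v => extRibbonSum (letterParity 0 p) (threeTensor 0 (parityOp 𝒜) b p)
    (propagator 0 (parityOp 𝒜) H b p) c n σ fun x => dblCoord b (imgBasis P e (v x))

end Solutions

end NCBV

end

noncomputable section

namespace NCBV

open Equiv (Perm swap)
open Finset (sum_insert prod_filter prod_congr prod_mul_distrib mem_filter mem_univ univ
  sum_mul_sum sum_congr sum_smul sum_filter sum_eq_single sum_pair mem_insert mem_singleton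
  sum_singleton prod_ne_zero_iff mul_prod_erase ne_of_mem_erase smul_sum mul_sum sum_mul
  sum_add_distrib sum_eq_zero sum_comm sum_const_zero sum_map orderEmbOfFin_mem mem_compl mem_coe)
open Equiv (ofBijective swap_apply_of_ne_of_ne permCongr_apply swap_apply_left swap_apply_def
  trans_apply apply_symm_apply symm_apply_apply refl_trans)
open Function (comp_apply comp_def comp_id update update_self update_of_ne injective_id)
open Sum (map_inl map_inr inl_injective inr_injective elim_inl elim_inr)
open List (map_map nodup_cons mem_cons length_cons map_cons mem_ofFn' map_ofFn ofFn_succ ofFn)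
open Submodule (smul_mem)
open CliffordAlgebra (contractLeft_ι_mul contractLeft_comm)
open ExteriorAlgebra (map_apply_ι map_comp_map)
open Fin (ext_iff val_succ lt_def succ_injective last cons natAdd castAdd castSucc_lt_last)
open Fintype (sum_prod_type card_fin sum_prod_type' sum_sum_type card_congr)
open Finset.HasAntidiagonal (antidiagonal mem_antidiagonal)
open Equiv.Perm (mul_apply sumCongr sumCongr_apply)
open Set (range)

universe u

/-! ### Calculus of Koszul signs -/

theorem sgn_zero : sgn 0 = 1 := rfl

theorem sgn_one : sgn 1 = -1 := rfl

theorem sgn_add (a b : ZMod 2) : sgn (a + b) = sgn a * sgn b := by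
  revert a b; decide

theorem sgn_mul_self (a : ZMod 2) : sgn a * sgn a = 1 := by
  revert a; decide

theorem sgn_sum {X : Type*} (s : Finset X) (f : X → ZMod 2) :
    sgn (∑ x ∈ s, f x) = ∏ x ∈ s, sgn (f x) := by
  classical
  induction s using Finset.induction_on with
  | empty => rfl
  | insert a s ha ih => rw [sum_insert ha, Finset.prod_insert ha, sgn_add, ih]

section Koszul

variable {X Y : Type*} [Fintype X] [Fintype Y]

theorem koszulSign_eq_prod (p : X → ZMod 2) (r s : X → ℕ) :
    koszulSign p r s = ∏ x, ∏ y, if r x < r y ∧ s y < s x then sgn (p x * p y) else 1 := by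
  classical
  have key : ∀ a b : ZMod 2, sgn (a * b) = if a = 1 ∧ b = 1 then -1 else 1 := by decide
  rw [← Fintype.prod_prod_type', koszulSign, ← Finset.prod_const, prod_filter]
  refine prod_congr rfl fun xy _ => ?_
  simp only [key]
  split_ifs <;> tauto

theorem prod_rank_symm {M : Type*} [CommMonoid M] {u w : X → ℕ} (hu : u.Injective)
    (hw : w.Injective) (f : X → X → M) (hf : ∀ x y, f x y = f y x) :
    (∏ x, ∏ y, if u x < u y then f x y else 1) = ∏ x, ∏ y, if w x < w y then f x y else 1 := by
  have split : ∀ u w : X → ℕ, u.Injective → w.Injective →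
      (∏ x, ∏ y, if u x < u y then f x y else 1) =
      (∏ x, ∏ y, if u x < u y ∧ w x < w y then f x y else 1) *
      ∏ x, ∏ y, if u x < u y ∧ w y < w x then f x y else 1 := by
    intro u w hu hw
    simp only [← prod_mul_distrib]
    refine prod_congr rfl fun x _ => prod_congr rfl fun y _ => ?_
    rcases eq_or_ne x y with rfl | h
    · simp
    · have := hw.ne h
      by_cases h1 : u x < u y
      · rcases lt_or_gt_of_ne this with h2 | h2
        · simp [h1, h2, h2.le]
        · simp [h1, h2, h2.le]
      · simp [h1]
  rw [split u w hu hw, split w u hw hu]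
  congr 1
  · simp only [and_comm]
  · rw [Finset.prod_comm]
    refine prod_congr rfl fun x _ => prod_congr rfl fun y _ => ?_
    rw [hf]; simp only [and_comm]

theorem koszulSign_base (p : X → ZMod 2) {r s u : X → ℕ} (hr : r.Injective) (hs : s.Injective)
    (hu : u.Injective) :
    koszulSign p r s = ∏ x, ∏ y, if u x < u y then
      (if (r x < r y ↔ s x < s y) then 1 else sgn (p x * p y)) else 1 := by
  classical
  rw [prod_rank_symm hu hr, koszulSign_eq_prod]
  · refine prod_congr rfl fun x _ => prod_congr rfl fun y _ => ?_
    by_cases h : r x < r y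
    · have hxy : x ≠ y := fun e => by simp [e] at h
      have := hs.ne hxy
      by_cases h2 : s x < s y
      · simp [h, h2, h2.le]
      · have h3 : s y < s x := by omega
        simp [h, h2, h3]
    · simp [h]
  · intro x y
    rcases eq_or_ne x y with rfl | hxy
    · rfl
    · have h1 := hs.ne hxy
      have h2 := hr.ne hxy
      rw [mul_comm]
      congr 1
      apply propext
      omega

theorem koszulSign_mul (p : X → ZMod 2) {r s t : X → ℕ} (hr : r.Injective) (hs : s.Injective)
    (ht : t.Injective) : koszulSign p r s * koszulSign p s t = koszulSign p r t := by
  rw [koszulSign_base p hr hs hr, koszulSign_base p hs ht hr, koszulSign_base p hr ht hr]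
  simp only [← prod_mul_distrib]
  refine prod_congr rfl fun x _ => prod_congr rfl fun y _ => ?_
  have := sgn_mul_self (p x * p y)
  by_cases h1 : r x < r y <;> by_cases h2 : s x < s y <;> by_cases h3 : t x < t y <;>
    simp [h1, h2, h3, this]

theorem koszulSign_congr {p : X → ZMod 2} {r r' s s' : X → ℕ}
    (hr : ∀ x y, r x < r y ↔ r' x < r' y) (hs : ∀ x y, s x < s y ↔ s' x < s' y) :
    koszulSign p r s = koszulSign p r' s' := by
  simp only [koszulSign, hr, hs]

theorem koszulSign_comm (p : X → ZMod 2) (r s : X → ℕ) : koszulSign p r s = koszulSign p s r := by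
  rw [koszulSign_eq_prod, koszulSign_eq_prod, Finset.prod_comm]
  refine prod_congr rfl fun x _ => prod_congr rfl fun y _ => ?_
  rw [mul_comm]; simp only [and_comm]

theorem koszulSign_mul_self (p : X → ZMod 2) (r s : X → ℕ) :
    koszulSign p r s * koszulSign p r s = 1 := by
  rw [koszulSign, ← pow_add, ← two_mul, pow_mul]; simp

theorem koszulSign_comp_equiv (g : Y ≃ X) (p : X → ZMod 2) (r s : X → ℕ) :
    koszulSign (p ∘ g) (r ∘ g) (s ∘ g) = koszulSign p r s := by
  rw [koszulSign_eq_prod, koszulSign_eq_prod, ← g.prod_comp]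
  refine prod_congr rfl fun x _ => ?_
  rw [← g.prod_comp]
  rfl

theorem koszulSign_window {z : Y → X} (hz : z.Injective) (p : X → ZMod 2) {r s : X → ℕ}
    (h : ∀ x y, x ∉ range z ∨ y ∉ range z → r x < r y → ¬ s y < s x) :
    koszulSign p r s = koszulSign (p ∘ z) (r ∘ z) (s ∘ z) := by
  classical
  unfold koszulSign
  congr 1
  symm
  refine Finset.card_bij (fun xy _ => (z xy.1, z xy.2)) ?_ ?_ ?_
  · intro a ha; simpa using ha
  · intro a _ b _ hab
    simp only [Prod.mk.injEq] at hab
    exact Prod.ext (hz hab.1) (hz hab.2)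
  · rintro ⟨x, y⟩ hxy
    simp only [mem_filter, mem_univ, true_and] at hxy
    have h1 : x ∈ range z := by
      by_contra hc; exact h x y (Or.inl hc) hxy.1 hxy.2.1
    have h2 : y ∈ range z := by
      by_contra hc; exact h x y (Or.inr hc) hxy.1 hxy.2.1
    obtain ⟨a, rfl⟩ := h1
    obtain ⟨b, rfl⟩ := h2
    exact ⟨(a, b), by simpa using hxy, rfl⟩

theorem koszulSign_parity_change [DecidableEq X] {p p' : X → ZMod 2} {r s : X → ℕ}
    (hr : r.Injective) (hs : s.Injective) (f : X) (hf : p' f = p f + 1)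
    (hp : ∀ x, x ≠ f → p' x = p x) :
    koszulSign p' r s = koszulSign p r s * (sgn (∑ x ∈ univ.filter (fun x => r x < r f), p x) *
        sgn (∑ x ∈ univ.filter (fun x => s x < s f), p x)) := by
  classical
  have expand : ∀ p : X → ZMod 2, koszulSign p r s =
      (∏ x, ∏ y, if x ≠ f ∧ y ≠ f ∧ r x < r y ∧ s y < s x then sgn (p x * p y) else 1) *
      ∏ x, if (r x < r f ↔ s x < s f) then 1 else sgn (p x * p f) := by
    intro p
    rw [koszulSign_eq_prod]
    have e1 : ∀ x y, (if r x < r y ∧ s y < s x then sgn (p x * p y) else 1) =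
        (if x ≠ f ∧ y ≠ f ∧ r x < r y ∧ s y < s x then sgn (p x * p y) else 1) *
        ((if y = f then (if r x < r f ∧ s f < s x then sgn (p x * p f) else 1) else 1) *
        (if x = f then (if r f < r y ∧ s y < s f then sgn (p y * p f) else 1) else 1)) := by
      intro x y
      by_cases hx : x = f <;> by_cases hy : y = f
      · subst hx; subst hy; simp
      · subst hx; simp [hy, mul_comm]
      · subst hy; simp [hx]
      · simp [hx, hy]
    rw [prod_congr rfl fun x _ => prod_congr rfl fun y _ => e1 x y]
    simp_rw [prod_mul_distrib, Finset.prod_ite_eq', mem_univ, if_true]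
    congr 1
    have e2 : ∀ x, (∏ y, if x = f then (if r f < r y ∧ s y < s f then sgn (p y * p f) else 1)
        else 1) = if x = f then ∏ y, (if r f < r y ∧ s y < s f then sgn (p y * p f) else 1)
        else 1 := by
      intro x; split_ifs <;> simp
    simp_rw [e2, Finset.prod_ite_eq', mem_univ, if_true, ← prod_mul_distrib]
    refine prod_congr rfl fun x _ => ?_
    rcases eq_or_ne x f with rfl | hx
    · simp
    · have h1 := hr.ne hx
      have h2 := hs.ne hx
      rcases lt_or_gt_of_ne h1 with a | a <;> rcases lt_or_gt_of_ne h2 with b | b <;>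
        simp [a, b, not_lt.mpr a.le, not_lt.mpr b.le]
  rw [expand p', expand p, mul_assoc]
  congr 1
  · refine prod_congr rfl fun x _ => prod_congr rfl fun y _ => ?_
    by_cases hx : x = f
    · simp [hx]
    by_cases hy : y = f
    · simp [hy]
    rw [hp x hx, hp y hy]
  · rw [sgn_sum, sgn_sum, prod_filter, prod_filter, ← prod_mul_distrib, ← prod_mul_distrib]
    refine prod_congr rfl fun x _ => ?_
    rcases eq_or_ne x f with rfl | hx
    · simp
    · rw [hp x hx, hf, mul_add, mul_one, sgn_add]
      have := sgn_mul_self (p x)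
      by_cases a : r x < r f <;> by_cases b : s x < s f <;> simp [a, b, this]

/-- Two orders which differ by moving the letters of `A` past the letters of `B`. -/
theorem koszulSign_rectangle (p : X → ZMod 2) {r s : X → ℕ} (A B : Finset X)
    (h : ∀ x y, r x < r y ∧ s y < s x ↔ x ∈ A ∧ y ∈ B) :
    koszulSign p r s = sgn ((∑ x ∈ A, p x) * ∑ x ∈ B, p x) := by
  classical
  rw [koszulSign_eq_prod, sum_mul_sum, sgn_sum]
  simp_rw [sgn_sum, h]
  rw [← Finset.prod_subset (Finset.subset_univ A)]
  · refine prod_congr rfl fun x hx => ?_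
    rw [← Finset.prod_subset (Finset.subset_univ B)]
    · exact prod_congr rfl fun y hy => by simp [hx, hy]
    · intro y _ hy; simp [hy]
  · intro x _ hx; simp [hx]

theorem koszulSign_sumType (p : X ⊕ Y → ZMod 2) {r s : X ⊕ Y → ℕ}
    (hr : ∀ x y, r (.inl x) < r (.inr y)) (hs : ∀ x y, s (.inl x) < s (.inr y)) :
    koszulSign p r s = koszulSign (p ∘ Sum.inl) (r ∘ Sum.inl) (s ∘ Sum.inl) *
      koszulSign (p ∘ Sum.inr) (r ∘ Sum.inr) (s ∘ Sum.inr) := by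
  simp only [koszulSign_eq_prod, Fintype.prod_sum_type, prod_mul_distrib]
  have h1 : ∀ x y, ¬ (r (.inl x) < r (.inr y) ∧ s (.inr y) < s (.inl x)) := fun x y h =>
    absurd (hs x y) (not_lt.mpr h.2.le)
  have h2 : ∀ x y, ¬ (r (.inr y) < r (.inl x) ∧ s (.inl x) < s (.inr y)) := fun x y h =>
    absurd (hr x y) (not_lt.mpr h.1.le)
  simp [h1, h2]

end Koszul

/-! ### Return maps of permutations -/

/-- `σ` sends each label to the next label met on its cycle of `φ`. -/
def Returns {X Y : Type*} (φ : Perm Y) (j : X → Y) (σ : Perm X) : Prop :=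
  ∀ x, ∃ m : ℕ, 0 < m ∧ (φ ^ m) (j x) = j (σ x) ∧ ∀ l : ℕ, 0 < l → l < m → (φ ^ l) (j x) ∉ range j

section Returns

variable {X Y Z : Type*} {φ : Perm Y} {j : X → Y} {σ τ : Perm X}

theorem Induces.returns (h : Induces φ j σ) : Returns φ j σ := h.2

theorem exists_pow_mem_range_of_sameCycle [Finite Y] {y : Y} (h : ∃ x, φ.SameCycle y (j x)) :
    ∃ m : ℕ, (φ ^ m) y ∈ range j ∧ ∀ l < m, (φ ^ l) y ∉ range j := by
  classical
  have h1 : ∃ m : ℕ, (φ ^ m) y ∈ range j := by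
    obtain ⟨x, hx⟩ := h
    obtain ⟨m, hm⟩ := hx.exists_nat_pow_eq
    exact ⟨m, x, hm.symm⟩
  exact ⟨Nat.find h1, Nat.find_spec h1, fun l hl => Nat.find_min h1 hl⟩

theorem exists_returns [Finite X] [Finite Y] (φ : Perm Y) (hj : j.Injective) :
    ∃ σ, Returns φ j σ := by
  classical
  have h1 : ∀ x, ∃ m : ℕ, 0 < m ∧ (φ ^ m) (j x) ∈ range j := fun x =>
    ⟨orderOf φ, orderOf_pos φ, x, by simp [pow_orderOf_eq_one]⟩
  have h2 : ∀ x, ∃ y, (φ ^ Nat.find (h1 x)) (j x) = j y := fun x => by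
    obtain ⟨y, hy⟩ := (Nat.find_spec (h1 x)).2
    exact ⟨y, hy.symm⟩
  choose f hf using h2
  have hmin : ∀ x l, 0 < l → l < Nat.find (h1 x) → (φ ^ l) (j x) ∉ range j :=
    fun x l h0 hl hr => Nat.find_min (h1 x) hl ⟨h0, hr⟩
  have aux : ∀ x x', f x = f x' → Nat.find (h1 x) ≤ Nat.find (h1 x') → x = x' := by
    intro x x' he hle
    obtain ⟨d, hd⟩ := Nat.exists_eq_add_of_le hle
    have e : (φ ^ Nat.find (h1 x)) (j x) = (φ ^ Nat.find (h1 x)) ((φ ^ d) (j x')) := by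
      rw [← mul_apply, ← pow_add, ← hd, hf, hf, he]
    have e' := (φ ^ Nat.find (h1 x)).injective e
    rcases Nat.eq_zero_or_pos d with rfl | hd0
    · exact hj (by simpa using e')
    · exact absurd ⟨x, e'⟩ (hmin x' d hd0 (by have := (Nat.find_spec (h1 x)).1; omega))
  have finj : f.Injective := by
    intro x x' he
    rcases le_total (Nat.find (h1 x)) (Nat.find (h1 x')) with h | h
    · exact aux x x' he h
    · exact (aux x' x he.symm h).symm
  refine ⟨ofBijective f (Finite.injective_iff_bijective.mp finj), fun x => ?_⟩
  exact ⟨Nat.find (h1 x), (Nat.find_spec (h1 x)).1, hf x, hmin x⟩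

theorem Returns.unique (hj : j.Injective) (h : Returns φ j σ) (h' : Returns φ j τ) : σ = τ := by
  ext x
  obtain ⟨m, h0, h1, h2⟩ := h x
  obtain ⟨m', h0', h1', h2'⟩ := h' x
  rcases lt_trichotomy m m' with hlt | rfl | hlt
  · exact absurd ⟨_, h1.symm⟩ (h2' m h0 hlt)
  · exact hj (h1.symm.trans h1')
  · exact absurd ⟨_, h1'.symm⟩ (h2 m' h0' hlt)

theorem Returns.sameCycle_iff [Finite Y] (hj : j.Injective) (h : Returns φ j σ) {x y : X} :
    φ.SameCycle (j x) (j y) ↔ σ.SameCycle x y := by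
  constructor
  · intro hxy
    obtain ⟨N, hN⟩ := hxy.exists_nat_pow_eq
    induction N using Nat.strong_induction_on generalizing x with
    | _ N ih =>
      rcases Nat.eq_zero_or_pos N with rfl | hN0
      · rw [show x = y from hj (by simpa using hN)]
      · obtain ⟨m, h0, h1, h2⟩ := h x
        have hm : m ≤ N := by
          by_contra hc
          exact h2 N hN0 (by omega) ⟨y, hN.symm⟩
        obtain ⟨d, rfl⟩ := Nat.exists_eq_add_of_le hm
        have e : (φ ^ d) (j (σ x)) = j y := by
          rw [← h1, ← mul_apply, ← pow_add, add_comm, hN]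
        have := ih d (by omega) ⟨d, by simpa using e⟩ e
        exact Perm.sameCycle_apply_left.mp this
  · rintro ⟨i, rfl⟩
    have step : ∀ x, φ.SameCycle (j x) (j (σ x)) := fun x => by
      obtain ⟨m, _, h1, _⟩ := h x
      exact ⟨m, by simpa using h1⟩
    have nat : ∀ (n : ℕ) x, φ.SameCycle (j x) (j ((σ ^ n) x)) := by
      intro n
      induction n with
      | zero => intro x; exact Perm.SameCycle.rfl
      | succ n ih =>
        intro x
        rw [pow_succ', mul_apply]
        exact (ih x).trans (step _)
    rcases i.eq_nat_or_neg with ⟨n, rfl | rfl⟩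
    · simpa using nat n x
    · have := nat n ((σ ^ (-(n : ℤ))) x)
      rw [← zpow_natCast, ← mul_apply, ← zpow_add, add_neg_cancel, zpow_zero,
        Perm.one_apply] at this
      exact this.symm

theorem Returns.trans {i : Z → X} {ρ : Perm Z} (h : Returns φ j σ) (h' : Returns σ i ρ)
    (hj : j.Injective) : Returns φ (j ∘ i) ρ := by
  have key : ∀ M : ℕ, 0 < M → ∀ x : X, (∀ l, 0 < l → l < M → (σ ^ l) x ∉ range i) →
      ∃ m : ℕ, 0 < m ∧ (φ ^ m) (j x) = j ((σ ^ M) x) ∧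
        ∀ l : ℕ, 0 < l → l < m → (φ ^ l) (j x) ∉ range (j ∘ i) := by
    intro M
    induction M with
    | zero => intro h; omega
    | succ M ih =>
      intro _ x hx
      obtain ⟨m, h0, h1, h2⟩ := h x
      have h3 : ∀ l : ℕ, 0 < l → l < m → (φ ^ l) (j x) ∉ range (j ∘ i) := fun l a b hc => by
        obtain ⟨z, hz⟩ := hc
        exact h2 l a b ⟨i z, hz⟩
      rcases Nat.eq_zero_or_pos M with rfl | hM
      · exact ⟨m, h0, by simpa using h1, h3⟩
      · obtain ⟨m', h0', h1', h2'⟩ := ih hM (σ x) (fun l a b => by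
          have := hx (l + 1) (by omega) (by omega)
          rwa [pow_succ, mul_apply] at this)
        refine ⟨m' + m, by omega, ?_, ?_⟩
        · rw [pow_add, mul_apply, h1, h1', pow_succ, mul_apply]
        · intro l a b
          rcases lt_trichotomy l m with hlt | rfl | hlt
          · exact h3 l a hlt
          · rintro ⟨z, hz⟩
            rw [h1] at hz
            exact hx 1 one_pos (by omega) ⟨z, by simpa using hj hz⟩
          · obtain ⟨d, rfl⟩ := Nat.exists_eq_add_of_lt hlt
            have e : m + d + 1 = (d + 1) + m := by omega
            rw [e, pow_add, mul_apply, h1]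
            exact h2' (d + 1) (by omega) (by omega)
  intro z
  obtain ⟨M, h0, h1, h2⟩ := h' z
  obtain ⟨m, g0, g1, g2⟩ := key M h0 (i z) h2
  exact ⟨m, g0, by rw [comp_apply, g1, h1]; rfl, g2⟩

theorem Returns.mul_left {θ : Perm Y} {θ' : Perm X} (h : Returns φ j σ)
    (hθ : ∀ x, θ (j x) = j (θ' x)) (hθ' : ∀ y ∉ range j, θ y = y) :
    Returns (θ * φ) j (θ' * σ) := by
  intro x
  obtain ⟨m, h0, h1, h2⟩ := h x
  have key : ∀ l < m, ((θ * φ) ^ l) (j x) = (φ ^ l) (j x) := by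
    intro l
    induction l with
    | zero => intro _; rfl
    | succ l ih =>
      intro hl
      rw [pow_succ', mul_apply, ih (by omega), mul_apply, ← mul_apply φ,
        ← pow_succ', hθ' _ (h2 _ (by omega) hl)]
  refine ⟨m, h0, ?_, fun l a b => by rw [key l b]; exact h2 l a b⟩
  obtain ⟨m', rfl⟩ := Nat.exists_eq_add_of_lt h0
  simp only [zero_add] at *
  rw [pow_succ', mul_apply, key m' (by omega), mul_apply, ← mul_apply φ, ← pow_succ', h1, hθ]
  rfl

theorem exists_sameCycle_mul_left [Finite Y] {θ : Perm Y} {y : Y} (h : ∃ x, φ.SameCycle y (j x))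
    (hθ' : ∀ y ∉ range j, θ y = y) : ∃ x, (θ * φ).SameCycle y (j x) := by
  obtain ⟨m, hm, hlt⟩ := exists_pow_mem_range_of_sameCycle h
  have hr : ∀ z ∈ range j, θ z ∈ range j := by
    intro z hz
    by_contra hc
    have e := hθ' _ hc
    exact hc ((θ.injective e).symm ▸ hz)
  have key : ∀ l < m, ((θ * φ) ^ l) y = (φ ^ l) y := by
    intro l
    induction l with
    | zero => intro _; rfl
    | succ l ih =>
      intro hl
      rw [pow_succ', mul_apply, ih (by omega), mul_apply, ← mul_apply φ,
        ← pow_succ', hθ' _ (hlt _ hl)]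
  have hmem : ((θ * φ) ^ m) y ∈ range j := by
    cases m with
    | zero => exact hm
    | succ m =>
      rw [pow_succ', mul_apply, key m (by omega), mul_apply, ← mul_apply φ, ← pow_succ']
      exact hr _ hm
  obtain ⟨x, hx⟩ := hmem
  exact ⟨x, m, by simpa using hx.symm⟩

theorem Induces.mul_left [Finite Y] {θ : Perm Y} {θ' : Perm X} (h : Induces φ j σ)
    (hθ : ∀ x, θ (j x) = j (θ' x)) (hθ' : ∀ y ∉ range j, θ y = y) :
    Induces (θ * φ) j (θ' * σ) :=
  ⟨fun y => exists_sameCycle_mul_left (h.1 y) hθ', Returns.mul_left h.2 hθ hθ'⟩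

theorem swap_label [DecidableEq X] [DecidableEq Y] (hj : j.Injective) (p q : X) :
    (∀ x, swap (j p) (j q) (j x) = j (swap p q x)) ∧ ∀ y ∉ range j, swap (j p) (j q) y = y := by
  constructor
  · intro x
    rcases eq_or_ne x p with rfl | h1
    · simp
    rcases eq_or_ne x q with rfl | h2
    · simp
    rw [swap_apply_of_ne_of_ne h1 h2, swap_apply_of_ne_of_ne (hj.ne h1) (hj.ne h2)]
  · intro y hy
    exact swap_apply_of_ne_of_ne (fun e => hy ⟨p, e.symm⟩) fun e => hy ⟨q, e.symm⟩

theorem Induces.swap_mul [Finite Y] [DecidableEq X] [DecidableEq Y] (h : Induces φ j σ)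
    (hj : j.Injective) (p q : X) : Induces (swap (j p) (j q) * φ) j (swap p q * σ) :=
  h.mul_left (swap_label hj p q).1 (swap_label hj p q).2

theorem Induces.trans [Finite Y] {i : Z → X} {ρ : Perm Z} (h : Induces φ j σ)
    (h' : Induces σ i ρ) (hj : j.Injective) : Induces φ (j ∘ i) ρ := by
  refine ⟨fun y => ?_, Returns.trans h.2 h'.2 hj⟩
  obtain ⟨x, hx⟩ := h.1 y
  obtain ⟨z, hz⟩ := h'.1 x
  exact ⟨z, hx.trans ((h.returns.sameCycle_iff hj).mpr hz)⟩

theorem Induces.sameCycle_iff [Finite Y] (hj : j.Injective) (h : Induces φ j σ) {x y : X} :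
    φ.SameCycle (j x) (j y) ↔ σ.SameCycle x y :=
  h.returns.sameCycle_iff hj

theorem Induces.unique (hj : j.Injective) (h : Induces φ j σ) (h' : Induces φ j τ) : σ = τ :=
  h.returns.unique hj h'.returns

theorem exists_induces [Finite X] [Finite Y] (hj : j.Injective)
    (h : ∀ y, ∃ x, φ.SameCycle y (j x)) : ∃ σ, Induces φ j σ := by
  obtain ⟨σ, hσ⟩ := exists_returns φ hj
  exact ⟨σ, h, hσ⟩

theorem Induces.of_trans [Finite Y] [Finite X] [Finite Z] {i : Z → X} {ρ : Perm Z}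
    (h : Induces φ j σ) (h' : Induces φ (j ∘ i) ρ) (hj : j.Injective) (hi : i.Injective) :
    Induces σ i ρ := by
  obtain ⟨ρ', hρ'⟩ := exists_induces (φ := σ) hi (fun x => by
    obtain ⟨z, hz⟩ := h'.1 (j x)
    exact ⟨z, (h.sameCycle_iff hj).mp hz⟩)
  rwa [h'.unique (hj.comp hi) (h.trans hρ' hj)]

theorem induces_equiv (φ : Perm Y) (e : X ≃ Y) : Induces φ e (e.symm.permCongr φ) := by
  refine ⟨fun y => ⟨e.symm y, by simp [Perm.SameCycle.refl]⟩, fun x => ⟨1, one_pos, by simp [permCongr_apply], ?_⟩⟩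
  intro l h1 h2; omega

theorem induces_equiv' (φ : Perm X) (e : X ≃ Y) : Induces (e.permCongr φ) e φ := by
  convert induces_equiv (e.permCongr φ) e
  ext x; simp [permCongr_apply]

theorem Induces.sumCongr {X' Y' : Type*} [Finite Y] [Finite Y'] {φ' : Perm Y'} {j' : X' → Y'}
    {σ' : Perm X'} (h : Induces φ j σ) (h' : Induces φ' j' σ') :
    Induces (sumCongr φ φ') (Sum.map j j') (sumCongr σ σ') := by
  have e1 : ∀ (n : ℕ) y, ((Equiv.Perm.sumCongr φ φ') ^ n) (.inl y) = .inl ((φ ^ n) y) := by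
    intro n
    induction n with
    | zero => intro y; rfl
    | succ n ih => intro y; rw [pow_succ', mul_apply, ih, pow_succ', mul_apply]; rfl
  have e2 : ∀ (n : ℕ) y, ((Equiv.Perm.sumCongr φ φ') ^ n) (.inr y) = .inr ((φ' ^ n) y) := by
    intro n
    induction n with
    | zero => intro y; rfl
    | succ n ih => intro y; rw [pow_succ', mul_apply, ih, pow_succ', mul_apply]; rfl
  constructor
  · rintro (y | y)
    · obtain ⟨x, hx⟩ := h.1 y
      obtain ⟨n, hn⟩ := hx.exists_nat_pow_eq
      exact ⟨.inl x, n, by rw [zpow_natCast, e1, hn]; rfl⟩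
    · obtain ⟨x, hx⟩ := h'.1 y
      obtain ⟨n, hn⟩ := hx.exists_nat_pow_eq
      exact ⟨.inr x, n, by rw [zpow_natCast, e2, hn]; rfl⟩
  · rintro (x | x)
    · obtain ⟨m, h0, h1, h2⟩ := h.2 x
      refine ⟨m, h0, by simp [e1, h1], fun l a b => ?_⟩
      rintro ⟨z | z, hz⟩
      · simp only [map_inl, e1, Sum.inl.injEq] at hz
        exact h2 l a b ⟨z, hz⟩
      · simp [e1] at hz
    · obtain ⟨m, h0, h1, h2⟩ := h'.2 x
      refine ⟨m, h0, by simp [e2, h1], fun l a b => ?_⟩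
      rintro ⟨z | z, hz⟩
      · simp [e2] at hz
      · simp only [map_inr, e2, Sum.inr.injEq] at hz
        exact h2 l a b ⟨z, hz⟩

end Returns

/-! ### Cycles after composition with a transposition -/

theorem swap_mul_swap_mul {Y : Type*} [DecidableEq Y] {φ : Perm Y} {p q : Y} :
    swap p q * (swap p q * φ) = φ := by
  rw [← mul_assoc, Equiv.swap_mul_self, one_mul]

section SwapCycles

variable {Y : Type*} [Finite Y] [DecidableEq Y] {φ : Perm Y} {p q : Y}

theorem sameCycle_swap_mul_iff (hpq : p ≠ q) :
    (swap p q * φ).SameCycle p q ↔ ¬ φ.SameCycle p q := by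
  let j : Bool → Y := fun b => cond b p q
  have hj : j.Injective := by
    intro a b h
    cases a <;> cases b <;> simp_all [j, eq_comm]
  obtain ⟨σ, hσ⟩ := exists_returns φ hj
  have h2 : Returns (swap p q * φ) j (swap true false * σ) := by
    have := swap_label hj true false
    exact hσ.mul_left this.1 this.2
  have e1 := hσ.sameCycle_iff hj (x := true) (y := false)
  have e2 := h2.sameCycle_iff hj (x := true) (y := false)
  change φ.SameCycle p q ↔ _ at e1
  change (swap p q * φ).SameCycle p q ↔ _ at e2
  rw [e1, e2]
  have h3 : σ = 1 ∨ σ = swap true false := by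
    rcases hb : σ true with _ | _
    · right
      ext b
      cases b
      · have : σ false ≠ σ true := σ.injective.ne (by decide)
        rw [hb] at this
        simp; simpa using this
      · simp [hb]
    · left
      ext b
      cases b
      · have : σ false ≠ σ true := σ.injective.ne (by decide)
        rw [hb] at this
        simpa using this
      · simp [hb]
  have h4 : (swap true false : Perm Bool).SameCycle true false := ⟨1, by simp⟩
  have h5 : ¬ (1 : Perm Bool).SameCycle true false := by simp
  rcases h3 with rfl | rfl
  · simp [h4]
  · simp [h4]

theorem SameCycle.swap_mul_of_not {x y : Y} (h : φ.SameCycle x y) (hp : ¬ φ.SameCycle x p)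
    (hq : ¬ φ.SameCycle x q) : (swap p q * φ).SameCycle x y := by
  obtain ⟨n, rfl⟩ := h.exists_nat_pow_eq
  have : ∀ n : ℕ, ((swap p q * φ) ^ n) x = (φ ^ n) x := by
    intro n
    induction n with
    | zero => rfl
    | succ n ih =>
      rw [pow_succ', mul_apply, ih, mul_apply, ← mul_apply φ, ← pow_succ', swap_apply_of_ne_of_ne]
      · rintro h; exact hp ⟨n + 1, by exact_mod_cast h⟩
      · rintro h; exact hq ⟨n + 1, by exact_mod_cast h⟩
  exact ⟨n, by rw [zpow_natCast, this]⟩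

theorem SameCycle.swap_mul_or {x : Y} (h : φ.SameCycle x p ∨ φ.SameCycle x q) :
    (swap p q * φ).SameCycle x p ∨ (swap p q * φ).SameCycle x q := by
  let j : Bool → Y := fun b => cond b p q
  have h1 : ∃ b, φ.SameCycle x (j b) := by
    rcases h with h | h
    · exact ⟨true, h⟩
    · exact ⟨false, h⟩
  obtain ⟨b, hb⟩ := exists_sameCycle_mul_left (θ := swap p q) h1 (fun y hy =>
    swap_apply_of_ne_of_ne (fun e => hy ⟨true, e.symm⟩) fun e => hy ⟨false, e.symm⟩)
  cases b
  · exact Or.inr hb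
  · exact Or.inl hb

theorem sameCycle_swap_mul_join (hpq : p ≠ q) (h : ¬ φ.SameCycle p q) (x y : Y) :
    (swap p q * φ).SameCycle x y ↔ φ.SameCycle x y ∨
      ((φ.SameCycle x p ∨ φ.SameCycle x q) ∧ (φ.SameCycle y p ∨ φ.SameCycle y q)) := by
  have hs : (swap p q * φ).SameCycle p q := (sameCycle_swap_mul_iff hpq).mpr h
  have cl : ∀ x, (φ.SameCycle x p ∨ φ.SameCycle x q) ↔ (swap p q * φ).SameCycle x p := by
    intro x
    constructor
    · intro hx
      rcases SameCycle.swap_mul_or hx with h1 | h1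
      · exact h1
      · exact h1.trans hs.symm
    · intro hx
      have := SameCycle.swap_mul_or (φ := swap p q * φ) (p := p) (q := q) (Or.inl hx)
      rwa [swap_mul_swap_mul] at this
  rw [cl, cl]
  constructor
  · intro hxy
    by_cases hx : (swap p q * φ).SameCycle x p
    · exact Or.inr ⟨hx, hxy.symm.trans hx⟩
    · left
      have := SameCycle.swap_mul_of_not (p := p) (q := q) hxy hx (fun hc => hx (hc.trans hs.symm))
      rwa [swap_mul_swap_mul] at this
  · rintro (hxy | ⟨hx, hy⟩)
    · by_cases hx : (swap p q * φ).SameCycle x p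
      · refine hx.trans ?_
        have h2 := (cl x).mpr hx
        exact ((cl y).mp (h2.imp hxy.symm.trans hxy.symm.trans)).symm
      · have h2 := (cl x).not.mpr hx
        push Not at h2
        exact SameCycle.swap_mul_of_not hxy h2.1 h2.2
    · exact hx.trans hy.symm

end SwapCycles

/-! ### Lines spanned by the cycles of a permutation -/

/-- A list containing one element of each cycle. -/
def IsTransversal {Y : Type*} (φ : Perm Y) (l : List Y) : Prop :=
  l.Nodup ∧ ∀ y, ∃! x, x ∈ l ∧ φ.SameCycle x y

section Transversal

variable {Y : Type*} {φ : Perm Y}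

theorem IsTransversal.perm {l l' : List Y} (h : IsTransversal φ l) (hl : l.Perm l') :
    IsTransversal φ l' :=
  ⟨hl.nodup_iff.mp h.1, fun y => by simpa [hl.mem_iff] using h.2 y⟩

theorem IsTransversal.eq_of_sameCycle {l : List Y} (h : IsTransversal φ l) {x y : Y} (hx : x ∈ l)
    (hy : y ∈ l) (hxy : φ.SameCycle x y) : x = y :=
  (h.2 y).unique ⟨hx, hxy⟩ ⟨hy, Perm.SameCycle.rfl⟩

theorem exists_transversal_of_section [Finite Y]
    (f : Quotient (Perm.SameCycle.setoid φ) → Y) (hf : ∀ z, Quotient.mk _ (f z) = z) :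
    ∃ l, IsTransversal φ l ∧ (∀ x, x ∈ l ↔ x ∈ range f) := by
  classical
  have := Fintype.ofFinite (Quotient (Perm.SameCycle.setoid φ))
  have hinj : f.Injective := fun a b h => by rw [← hf a, h, hf]
  have hm : ∀ x, x ∈ (univ.toList.map f) ↔ x ∈ range f := fun x => by
    simp
  refine ⟨univ.toList.map f, ⟨(Finset.nodup_toList _).map hinj, fun y => ?_⟩, hm⟩
  refine ⟨f (Quotient.mk _ y), ⟨(hm _).mpr ⟨_, rfl⟩, Quotient.exact (hf _)⟩, ?_⟩
  rintro x ⟨hx, hxy⟩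
  obtain ⟨z, rfl⟩ := (hm x).mp hx
  congr 1
  rw [← hf z]
  exact Quotient.sound hxy

theorem exists_transversal [Finite Y] (φ : Perm Y) : ∃ l, IsTransversal φ l := by
  obtain ⟨l, hl, _⟩ := exists_transversal_of_section (φ := φ) Quotient.out Quotient.out_eq
  exact ⟨l, hl⟩

theorem exists_transversal_cons_cons [Finite Y] (φ : Perm Y) {p q : Y} (h : ¬ φ.SameCycle p q) :
    ∃ l, IsTransversal φ (p :: q :: l) := by
  classical
  have hqp : (Quotient.mk (Perm.SameCycle.setoid φ) q) ≠ Quotient.mk _ p := fun e =>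
    h (Quotient.exact e).symm
  obtain ⟨l, hl, hm⟩ := exists_transversal_of_section (φ := φ)
    (fun z => if z = Quotient.mk _ p then p else if z = Quotient.mk _ q then q else z.out)
    (fun z => by
      split_ifs with h h
      · exact h.symm
      · exact h.symm
      · exact Quotient.out_eq z)
  have hp : p ∈ l := (hm p).mpr ⟨Quotient.mk _ p, by simp⟩
  have hq : q ∈ l.erase p := by
    refine (List.mem_erase_of_ne ?_).mpr ((hm q).mpr ⟨Quotient.mk _ q, by simp [hqp]⟩)
    rintro rfl
    exact h Perm.SameCycle.rfl
  exact ⟨(l.erase p).erase q,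
    hl.perm ((List.perm_cons_erase hp).trans ((List.perm_cons_erase hq).cons p))⟩

end Transversal

section Line

variable {k : Type*} [Field k] {Y : Type*} {φ : Perm Y}

theorem cycleVector_congr {x y : Y} (h : φ.SameCycle x y) :
    cycleVector k φ x = cycleVector k φ y := by
  classical
  funext z
  unfold cycleVector
  have : φ.SameCycle x z ↔ φ.SameCycle y z := ⟨h.symm.trans, h.trans⟩
  simp only [this]

/-- The exterior product of the cycles of the members of a list. -/
def cycleProd (k : Type*) [Field k] {Y : Type*} (φ : Perm Y) (l : List Y) :
    ExteriorAlgebra k (Y → k) :=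
  (l.map fun y => ExteriorAlgebra.ι k (cycleVector k φ y)).prod

theorem cycleProd_cons (p : Y) (l : List Y) :
    cycleProd k φ (p :: l) = ExteriorAlgebra.ι k (cycleVector k φ p) * cycleProd k φ l := by
  simp [cycleProd]

theorem ι_mul_comm {M : Type*} [AddCommGroup M] [Module k M] (x y : M) :
    ExteriorAlgebra.ι k x * ExteriorAlgebra.ι k y =
      -(ExteriorAlgebra.ι k y * ExteriorAlgebra.ι k x) :=
  eq_neg_of_add_eq_zero_left (ExteriorAlgebra.ι_add_mul_swap x y)

theorem cycleProd_perm {l l' : List Y} (h : l.Perm l') :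
    cycleProd k φ l' = cycleProd k φ l ∨ cycleProd k φ l' = -cycleProd k φ l := by
  induction h with
  | nil => exact Or.inl rfl
  | cons x _ ih =>
    rw [cycleProd_cons, cycleProd_cons]
    rcases ih with h | h
    · exact Or.inl (by rw [h])
    · exact Or.inr (by rw [h, mul_neg])
  | swap x y l =>
    right
    simp only [cycleProd_cons, ← mul_assoc]
    rw [ι_mul_comm, neg_mul]
  | trans _ _ ih1 ih2 =>
    rcases ih1 with h1 | h1 <;> rcases ih2 with h2 | h2 <;> simp [h1, h2]

theorem cycleProd_mem {l : List Y} (hl : IsTransversal φ l) : cycleProd k φ l ∈ cycleLine k φ :=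
  Submodule.subset_span ⟨l, hl.1, hl.2, rfl⟩

theorem mem_cycleLine_iff {l : List Y} (hl : IsTransversal φ l)
    {x : ExteriorAlgebra k (Y → k)} : x ∈ cycleLine k φ ↔ ∃ a : k, x = a • cycleProd k φ l := by
  constructor
  · intro hx
    suffices h : cycleLine k φ ≤ Submodule.span k {cycleProd k φ l} by
      obtain ⟨a, ha⟩ := Submodule.mem_span_singleton.mp (h hx)
      exact ⟨a, ha.symm⟩
    refine Submodule.span_le.mpr ?_
    rintro D ⟨l', h1, h2, rfl⟩
    have hl' : IsTransversal φ l' := ⟨h1, h2⟩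
    choose f hf using fun y => (hl.2 y).exists
    have hp : (l'.map f).Perm l := by
      refine (List.perm_ext_iff_of_nodup ?_ hl.1).mpr fun x => ?_
      · refine List.Nodup.map_on (fun a ha b hb hab => ?_) h1
        exact hl'.eq_of_sameCycle ha hb ((hf a).2.symm.trans (hab ▸ (hf b).2))
      · constructor
        · intro hx
          obtain ⟨y, _, rfl⟩ := List.mem_map.mp hx
          exact (hf y).1
        · intro hx
          obtain ⟨y, ⟨hy, hyx⟩, _⟩ := hl'.2 x
          refine List.mem_map.mpr ⟨y, hy, ?_⟩
          exact hl.eq_of_sameCycle (hf y).1 hx ((hf y).2.trans hyx)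
    have e : (l'.map fun y => ExteriorAlgebra.ι k (cycleVector k φ y)).prod =
        cycleProd k φ (l'.map f) := by
      rw [cycleProd, map_map]
      congr 1
      refine List.map_congr_left fun y _ => ?_
      rw [comp_apply, cycleVector_congr (hf y).2]
    rw [e]
    have hm := Submodule.mem_span_singleton_self (R := k) (cycleProd k φ l)
    rcases cycleProd_perm (k := k) (φ := φ) hp.symm with h | h
    · rw [h]; exact hm
    · rw [h]; exact neg_mem hm
  · rintro ⟨a, rfl⟩
    exact smul_mem _ _ (cycleProd_mem hl)

theorem contractLeft_cycleProd_eq_zero {d : Module.Dual k (Y → k)} {l : List Y}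
    (h : ∀ y ∈ l, d (cycleVector k φ y) = 0) :
    CliffordAlgebra.contractLeft d (cycleProd k φ l) = 0 := by
  induction l with
  | nil => simp [cycleProd]
  | cons a l ih =>
    rw [cycleProd_cons, ExteriorAlgebra.ι, contractLeft_ι_mul,
      h a (by simp), ih (fun y hy => h y (by simp [hy]))]
    simp

theorem contractLeft_eq_zero_of_mem [Finite Y] {d : Module.Dual k (Y → k)}
    (h : ∀ y, d (cycleVector k φ y) = 0) {x : ExteriorAlgebra k (Y → k)}
    (hx : x ∈ cycleLine k φ) : CliffordAlgebra.contractLeft d x = 0 := by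
  obtain ⟨l, hl⟩ := exists_transversal φ
  obtain ⟨a, rfl⟩ := (mem_cycleLine_iff hl).mp hx
  rw [map_smul, contractLeft_cycleProd_eq_zero fun y _ => h y, smul_zero]

/-- The difference of two coordinates. -/
def diffDual (k : Type*) [Field k] {Y : Type*} (p q : Y) : Module.Dual k (Y → k) :=
  LinearMap.proj (R := k) (φ := fun _ : Y => k) p - LinearMap.proj q

theorem diffDual_apply (p q : Y) (v : Y → k) : diffDual k p q v = v p - v q := rfl

theorem cycleVector_apply (x y : Y) [Decidable (φ.SameCycle x y)] :
    cycleVector k φ x y = if φ.SameCycle x y then 1 else 0 := by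
  unfold cycleVector
  congr

theorem glueCycles_same [DecidableEq Y] {p q : Y} (h : φ.SameCycle p q)
    (x : ExteriorAlgebra k (Y → k)) :
    glueCycles φ p q x = ExteriorAlgebra.ι k (cycleVector k (swap p q * φ) p) * x := by
  unfold glueCycles
  rw [if_pos h, LinearMap.mulLeft_apply]
  congr!

theorem glueCycles_not_same {p q : Y} (h : ¬ φ.SameCycle p q) (x : ExteriorAlgebra k (Y → k)) :
    glueCycles φ p q x = CliffordAlgebra.contractLeft (diffDual k p q) x := by
  unfold glueCycles
  rw [if_neg h]
  rfl

theorem IsTransversal.not_sameCycle_cons {l : List Y} {a y : Y} (h : IsTransversal φ (a :: l))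
    (hy : y ∈ l) : ¬ φ.SameCycle y a := fun hc => by
  have := h.eq_of_sameCycle (by simp [hy]) (by simp) hc
  subst this
  exact (nodup_cons.mp h.1).1 hy

theorem contractLeft_join {p q : Y} (h : ¬ φ.SameCycle p q) {l : List Y}
    (hp : ∀ y ∈ l, ¬ φ.SameCycle y p) (hq : ∀ y ∈ l, ¬ φ.SameCycle y q) :
    CliffordAlgebra.contractLeft (diffDual k p q) (cycleProd k φ (p :: q :: l)) =
      ExteriorAlgebra.ι k (cycleVector k φ p + cycleVector k φ q) * cycleProd k φ l := by
  classical
  have h0 : CliffordAlgebra.contractLeft (diffDual k p q) (cycleProd k φ l) = 0 :=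
    contractLeft_cycleProd_eq_zero fun y hy => by
      simp [diffDual_apply, cycleVector_apply, hp y hy, hq y hy]
  have h' : ¬ φ.SameCycle q p := fun hc => h hc.symm
  rw [cycleProd_cons, cycleProd_cons, ExteriorAlgebra.ι, contractLeft_ι_mul,
    contractLeft_ι_mul, h0, diffDual_apply, diffDual_apply]
  simp only [cycleVector_apply, Perm.SameCycle.rfl, h, h', if_true, if_false]
  simp [add_mul, add_comm]

theorem diffDual_swap (p q : Y) : diffDual k q p = -diffDual k p q := by
  simp [diffDual]

variable [Finite Y] [DecidableEq Y] {p q : Y}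

theorem cycleVector_join (hpq : p ≠ q) (h : ¬ φ.SameCycle p q) :
    cycleVector k (swap p q * φ) p = cycleVector k φ p + cycleVector k φ q := by
  classical
  funext z
  simp only [cycleVector_apply, Pi.add_apply, sameCycle_swap_mul_join hpq h]
  have hh : ¬ (φ.SameCycle p z ∧ φ.SameCycle q z) := fun hc => h (hc.1.trans hc.2.symm)
  simp only [Perm.SameCycle.rfl, true_or, true_and]
  rw [Perm.sameCycle_comm (x := z) (y := p), Perm.sameCycle_comm (x := z) (y := q)]
  by_cases h1 : φ.SameCycle p z <;> by_cases h2 : φ.SameCycle q z <;> simp_all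

theorem cycleVector_swap_other (hpq : p ≠ q) (h : ¬ φ.SameCycle p q) {x : Y}
    (hp : ¬ φ.SameCycle x p) (hq : ¬ φ.SameCycle x q) :
    cycleVector k (swap p q * φ) x = cycleVector k φ x := by
  classical
  funext z
  simp [cycleVector_apply, sameCycle_swap_mul_join hpq h, hp, hq]

theorem cycleProd_swap_other (hpq : p ≠ q) (h : ¬ φ.SameCycle p q) {l : List Y}
    (hp : ∀ y ∈ l, ¬ φ.SameCycle y p) (hq : ∀ y ∈ l, ¬ φ.SameCycle y q) :
    cycleProd k (swap p q * φ) l = cycleProd k φ l := by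
  unfold cycleProd
  congr 1
  exact List.map_congr_left fun y hy => by rw [cycleVector_swap_other hpq h (hp y hy) (hq y hy)]

theorem IsTransversal.join (hpq : p ≠ q) (h : ¬ φ.SameCycle p q) {l : List Y}
    (hl : IsTransversal φ (p :: q :: l)) : IsTransversal (swap p q * φ) (p :: l) := by
  have hq : ∀ y ∈ l, ¬ φ.SameCycle y q := fun y hy hc => by
    have := hl.eq_of_sameCycle (by simp [hy]) (by simp) hc
    subst this
    exact (nodup_cons.mp (nodup_cons.mp hl.1).2).1 hy
  have hp : ∀ y ∈ l, ¬ φ.SameCycle y p := fun y hy => hl.not_sameCycle_cons (by simp [hy])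
  have hn := nodup_cons.mp hl.1
  refine ⟨nodup_cons.mpr ⟨fun hc => hn.1 (by simp [hc]), (nodup_cons.mp hn.2).2⟩, ?_⟩
  intro y
  by_cases hy : φ.SameCycle y p ∨ φ.SameCycle y q
  · refine ⟨p, ⟨by simp, (sameCycle_swap_mul_join hpq h p y).mpr
      (Or.inr ⟨Or.inl Perm.SameCycle.rfl, hy⟩)⟩, ?_⟩
    rintro x ⟨hx, hxy⟩
    rcases mem_cons.mp hx with rfl | hx
    · rfl
    · exfalso
      rcases (sameCycle_swap_mul_join hpq h x y).mp hxy with h1 | ⟨h1 | h1, _⟩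
      · rcases hy with h2 | h2
        · exact hp x hx (h1.trans h2)
        · exact hq x hx (h1.trans h2)
      · exact hp x hx h1
      · exact hq x hx h1
  · push Not at hy
    obtain ⟨x, ⟨hx, hxy⟩, hu⟩ := hl.2 y
    have hxl : x ∈ l := by
      simp only [mem_cons] at hx
      rcases hx with rfl | rfl | hx
      · exact absurd hxy.symm hy.1
      · exact absurd hxy.symm hy.2
      · exact hx
    refine ⟨x, ⟨by simp [hxl], (sameCycle_swap_mul_join hpq h x y).mpr (Or.inl hxy)⟩, ?_⟩
    rintro x' ⟨_, hx'⟩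
    rcases (sameCycle_swap_mul_join hpq h x' y).mp hx' with h1 | ⟨_, h1⟩
    · rcases mem_cons.mp ‹x' ∈ p :: l› with rfl | h2
      · exact absurd h1.symm hy.1
      · exact hu x' ⟨by simp [h2], h1⟩
    · exact absurd h1 (by tauto)

theorem glueCycles_join (hpq : p ≠ q) (h : ¬ φ.SameCycle p q) {x : ExteriorAlgebra k (Y → k)}
    (hx : x ∈ cycleLine k φ) : glueCycles φ p q x ∈ cycleLine k (swap p q * φ) ∧
      glueCycles (swap p q * φ) p q (glueCycles φ p q x) = x := by
  obtain ⟨l, hl⟩ := exists_transversal_cons_cons φ h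
  obtain ⟨a, rfl⟩ := (mem_cycleLine_iff hl).mp hx
  have hp : ∀ y ∈ l, ¬ φ.SameCycle y p := fun y hy => hl.not_sameCycle_cons (by simp [hy])
  have hl2 : IsTransversal φ (q :: p :: l) := hl.perm (List.Perm.swap _ _ _)
  have hq : ∀ y ∈ l, ¬ φ.SameCycle y q := fun y hy => hl2.not_sameCycle_cons (by simp [hy])
  have hs : (swap p q * φ).SameCycle p q := (sameCycle_swap_mul_iff hpq).mpr h
  have e : glueCycles φ p q (cycleProd k φ (p :: q :: l)) = cycleProd k (swap p q * φ) (p :: l) := by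
    rw [glueCycles_not_same h, contractLeft_join h hp hq, cycleProd_cons,
      cycleProd_swap_other hpq h hp hq, cycleVector_join hpq h]
  rw [map_smul, e]
  refine ⟨smul_mem _ _ (cycleProd_mem (hl.join hpq h)), ?_⟩
  rw [map_smul, glueCycles_same hs, swap_mul_swap_mul, cycleProd_cons, cycleVector_join hpq h,
    cycleProd_swap_other hpq h hp hq, map_add, add_mul, mul_add, ← mul_assoc,
    ExteriorAlgebra.ι_sq_zero, zero_mul, zero_add, cycleProd_cons, cycleProd_cons]

theorem glueCycles_cut (hpq : p ≠ q) (h : φ.SameCycle p q) {x : ExteriorAlgebra k (Y → k)}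
    (hx : x ∈ cycleLine k φ) : glueCycles φ p q x ∈ cycleLine k (swap p q * φ) ∧
      CliffordAlgebra.contractLeft (diffDual k p q) (glueCycles φ p q x) = x := by
  have h' : ¬ (swap p q * φ).SameCycle p q := fun hc => (sameCycle_swap_mul_iff hpq).mp hc h
  obtain ⟨l, hl⟩ := exists_transversal_cons_cons (swap p q * φ) h'
  have hl' := hl.join hpq h'
  rw [swap_mul_swap_mul] at hl'
  obtain ⟨a, rfl⟩ := (mem_cycleLine_iff hl').mp hx
  have hmem := glueCycles_join (k := k) hpq h' (cycleProd_mem hl)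
  rw [swap_mul_swap_mul] at hmem
  have hp : ∀ y ∈ l, ¬ (swap p q * φ).SameCycle y p :=
    fun y hy => hl.not_sameCycle_cons (by simp [hy])
  have hl2 : IsTransversal (swap p q * φ) (q :: p :: l) := hl.perm (List.Perm.swap _ _ _)
  have hq : ∀ y ∈ l, ¬ (swap p q * φ).SameCycle y q :=
    fun y hy => hl2.not_sameCycle_cons (by simp [hy])
  have e : glueCycles (swap p q * φ) p q (cycleProd k (swap p q * φ) (p :: q :: l)) =
      cycleProd k φ (p :: l) := by
    have e1 := cycleVector_join (k := k) hpq h'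
    have e2 := cycleProd_swap_other (k := k) hpq h' hp hq
    rw [swap_mul_swap_mul] at e1 e2
    rw [glueCycles_not_same h', contractLeft_join h' hp hq, ← e1, ← e2, cycleProd_cons]
  rw [e] at hmem
  rw [map_smul, hmem.2, map_smul]
  refine ⟨smul_mem _ _ (cycleProd_mem hl), ?_⟩
  rw [← glueCycles_not_same h', e]

theorem glueCycles_mem (hpq : p ≠ q) {x : ExteriorAlgebra k (Y → k)} (hx : x ∈ cycleLine k φ) :
    glueCycles φ p q x ∈ cycleLine k (swap p q * φ) := by
  by_cases h : φ.SameCycle p q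
  · exact (glueCycles_cut hpq h hx).1
  · exact (glueCycles_join hpq h hx).1

theorem glueCycles_glueCycles (hpq : p ≠ q) {x : ExteriorAlgebra k (Y → k)}
    (hx : x ∈ cycleLine k φ) : glueCycles (swap p q * φ) p q (glueCycles φ p q x) = x := by
  by_cases h : φ.SameCycle p q
  · have h' : ¬ (swap p q * φ).SameCycle p q := fun hc => (sameCycle_swap_mul_iff hpq).mp hc h
    rw [glueCycles_not_same h']
    exact (glueCycles_cut hpq h hx).2
  · exact (glueCycles_join hpq h hx).2

theorem contractLeft_injOn (hpq : p ≠ q) (h : ¬ φ.SameCycle p q)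
    {x : ExteriorAlgebra k (Y → k)} (hx : x ∈ cycleLine k φ)
    (h0 : CliffordAlgebra.contractLeft (diffDual k p q) x = 0) : x = 0 := by
  rw [← (glueCycles_join hpq h hx).2, glueCycles_not_same h, h0, map_zero]

theorem glueCycles_swap (hpq : p ≠ q) {x : ExteriorAlgebra k (Y → k)}
    (hx : x ∈ cycleLine k φ) : glueCycles φ q p x = -glueCycles φ p q x := by
  by_cases h : φ.SameCycle p q
  · have h' : ¬ (swap p q * φ).SameCycle p q := fun hc => (sameCycle_swap_mul_iff hpq).mp hc h
    have h1 := glueCycles_cut hpq h hx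
    have h2 := glueCycles_cut hpq.symm h.symm hx
    rw [Equiv.swap_comm] at h2
    rw [← sub_eq_zero, sub_neg_eq_add]
    refine contractLeft_injOn hpq h' (add_mem h2.1 h1.1) ?_
    have h3 := h2.2
    rw [diffDual_swap, map_neg, LinearMap.neg_apply] at h3
    rw [map_add, h1.2]
    exact eq_neg_iff_add_eq_zero.mp (neg_eq_iff_eq_neg.mp h3)
  · rw [glueCycles_not_same h, glueCycles_not_same (fun hc => h hc.symm), diffDual_swap, map_neg,
      LinearMap.neg_apply]

end Line

/-! ### Gluings along disjoint pairs anticommute -/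

section Anticommute

variable {k : Type*} [Field k] {Y : Type*} {φ : Perm Y} [DecidableEq Y] {p q r s : Y}

theorem swap_mul_swap_mul_comm (hd : [p, q, r, s].Nodup) (φ : Perm Y) :
    swap r s * (swap p q * φ) = swap p q * (swap r s * φ) := by
  rw [← mul_assoc, ← mul_assoc, (Perm.disjoint_swap_swap hd).commute.eq]

variable [Finite Y]

theorem sameCycle_interleaved (hd : [p, q, r, s].Nodup) (hpr : φ.SameCycle p r)
    (hqs : φ.SameCycle q s) (hpq : ¬ φ.SameCycle p q) :
    (swap p q * (swap r s * φ)).SameCycle p s ∧ (swap p q * (swap r s * φ)).SameCycle q r := by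
  let j : Fin 4 → Y := ![p, q, r, s]
  have hj : j.Injective := by
    have := List.nodup_iff_injective_get.mp hd
    intro a b h
    have h2 : [p, q, r, s].get a = [p, q, r, s].get b := by
      fin_cases a <;> fin_cases b <;> exact h
    exact this h2
  obtain ⟨σ, hσ⟩ := exists_returns φ hj
  have h1 := hσ.mul_left (swap_label hj 2 3).1 (swap_label hj 2 3).2
  have h2 := h1.mul_left (swap_label hj 0 1).1 (swap_label hj 0 1).2
  have key : ∀ σ : Perm (Fin 4), σ.SameCycle 0 2 → σ.SameCycle 1 3 → ¬ σ.SameCycle 0 1 →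
      (swap 0 1 * (swap 2 3 * σ)).SameCycle 0 3 ∧ (swap 0 1 * (swap 2 3 * σ)).SameCycle 1 2 := by
    set_option maxRecDepth 100000 in decide
  have e := fun a b => (hσ.sameCycle_iff hj (x := a) (y := b))
  have e2 := fun a b => (h2.sameCycle_iff hj (x := a) (y := b))
  have := key σ ((e 0 2).mp hpr) ((e 1 3).mp hqs) (fun hc => hpq ((e 0 1).mpr hc))
  exact ⟨(e2 0 3).mpr this.1, (e2 1 2).mpr this.2⟩

theorem glueCycles_comm_interleaved_aux (hd : [p, q, r, s].Nodup) (hpr : φ.SameCycle p r)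
    (hqs : φ.SameCycle q s) (hpq : ¬ φ.SameCycle p q) {x : ExteriorAlgebra k (Y → k)}
    (hx : x ∈ cycleLine k φ) :
    glueCycles (swap p q * φ) r s (glueCycles φ p q x) =
      -glueCycles (swap r s * φ) p q (glueCycles φ r s x) := by
  classical
  have npq : p ≠ q := by rintro rfl; simp at hd
  have nrs : r ≠ s := by rintro rfl; simp at hd
  have hrs : ¬ φ.SameCycle r s := fun hc => hpq (hpr.trans (hc.trans hqs.symm))
  have top := sameCycle_interleaved hd hpr hqs hpq
  have ha : (swap p q * φ).SameCycle r s := (sameCycle_swap_mul_join npq hpq r s).mpr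
    (Or.inr ⟨Or.inl hpr.symm, Or.inr hqs.symm⟩)
  have hb : (swap r s * φ).SameCycle p q := (sameCycle_swap_mul_join nrs hrs p q).mpr
    (Or.inr ⟨Or.inl hpr, Or.inr hqs⟩)
  have hxa := (glueCycles_join npq hpq hx).1
  have hxb := (glueCycles_join nrs hrs hx).1
  have y1 := glueCycles_cut nrs ha hxa
  have y2 := glueCycles_cut npq hb hxb
  rw [swap_mul_swap_mul_comm hd] at y1
  have nab : ¬ (swap p q * (swap r s * φ)).SameCycle r s := by
    intro hc
    have : (swap p q * (swap r s * φ)).SameCycle p q := top.1.trans (hc.symm.trans top.2.symm)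
    exact (sameCycle_swap_mul_iff npq).mp this hb
  rw [← sub_eq_zero, sub_neg_eq_add]
  refine contractLeft_injOn nrs nab (add_mem y1.1 y2.1) ?_
  have e1 : ∀ y, diffDual k p q (cycleVector k φ y) = diffDual k r s (cycleVector k φ y) := by
    intro y
    have h1 : φ.SameCycle y p ↔ φ.SameCycle y r := ⟨fun h => h.trans hpr, fun h => h.trans hpr.symm⟩
    have h2 : φ.SameCycle y q ↔ φ.SameCycle y s := ⟨fun h => h.trans hqs, fun h => h.trans hqs.symm⟩
    simp [diffDual_apply, cycleVector_apply, h1, h2]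
  set ψ := swap p q * (swap r s * φ)
  have e2 : ∀ y, (diffDual k p q + diffDual k r s) (cycleVector k ψ y) = 0 := by
    intro y
    have h1 : ψ.SameCycle y p ↔ ψ.SameCycle y s :=
      ⟨fun h => h.trans top.1, fun h => h.trans top.1.symm⟩
    have h2 : ψ.SameCycle y q ↔ ψ.SameCycle y r :=
      ⟨fun h => h.trans top.2, fun h => h.trans top.2.symm⟩
    simp [diffDual_apply, cycleVector_apply, h1, h2]
  have e3 := contractLeft_eq_zero_of_mem (k := k) (d := diffDual k p q - diffDual k r s)
    (fun y => by rw [LinearMap.sub_apply, e1, sub_self]) hx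
  have e4 := contractLeft_eq_zero_of_mem (k := k) (d := diffDual k p q + diffDual k r s) e2 y2.1
  rw [map_sub, LinearMap.sub_apply, sub_eq_zero] at e3
  rw [map_add, LinearMap.add_apply, y2.2, glueCycles_not_same hrs, ← e3] at e4
  rw [map_add, y1.2, glueCycles_not_same hrs, glueCycles_not_same hpq, ← e3]
  exact e4

theorem glueCycles_comm_interleaved (hd : [p, q, r, s].Nodup) (hpq : ¬ φ.SameCycle p q)
    (hrs : ¬ φ.SameCycle r s) (ha : (swap p q * φ).SameCycle r s)
    {x : ExteriorAlgebra k (Y → k)} (hx : x ∈ cycleLine k φ) :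
    glueCycles (swap p q * φ) r s (glueCycles φ p q x) =
      -glueCycles (swap r s * φ) p q (glueCycles φ r s x) := by
  have npq : p ≠ q := by rintro rfl; simp at hd
  have nrs : r ≠ s := by rintro rfl; simp at hd
  rcases (sameCycle_swap_mul_join npq hpq r s).mp ha with h | ⟨h1 | h1, h2 | h2⟩
  · exact absurd h hrs
  · exact absurd (h1.trans h2.symm) hrs
  · exact glueCycles_comm_interleaved_aux hd h1.symm h2.symm hpq hx
  · have hd' : [p, q, s, r].Nodup := by
      simp only [nodup_cons, mem_cons, List.not_mem_nil] at hd ⊢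
      simp only [eq_comm] at hd ⊢
      tauto
    have := glueCycles_comm_interleaved_aux hd' h2.symm h1.symm hpq hx
    rw [glueCycles_swap nrs (glueCycles_mem npq hx), glueCycles_swap nrs hx, map_neg,
      neg_inj, Equiv.swap_comm s r] at this
    exact this
  · exact absurd (h1.trans h2.symm) hrs

theorem sameCycle_swap_mul_symm (npq : p ≠ q) (nrs : r ≠ s) (A : ¬ φ.SameCycle p q)
    (B : ¬ φ.SameCycle r s) (h : (swap p q * φ).SameCycle r s) :
    (swap r s * φ).SameCycle p q := by
  refine (sameCycle_swap_mul_join nrs B p q).mpr (Or.inr ?_)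
  rcases (sameCycle_swap_mul_join npq A r s).mp h with h | ⟨h1 | h1, h2 | h2⟩
  · exact absurd h B
  · exact absurd (h1.trans h2.symm) B
  · exact ⟨Or.inl h1.symm, Or.inr h2.symm⟩
  · exact ⟨Or.inr h2.symm, Or.inl h1.symm⟩
  · exact absurd (h1.trans h2.symm) B

theorem sameCycle_two_swaps (hd : [p, q, r, s].Nodup) {A B A' B' : Prop}
    (hA : φ.SameCycle p q ↔ A) (hB : φ.SameCycle r s ↔ B)
    (hA' : (swap r s * φ).SameCycle p q ↔ A') (hB' : (swap p q * φ).SameCycle r s ↔ B') :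
    (A ∧ B ∧ A' ∧ B') ∨ (A ∧ B ∧ ¬ A' ∧ ¬ B') ∨ (A ∧ ¬ B ∧ A' ∧ ¬ B') ∨
      (¬ A ∧ B ∧ ¬ A' ∧ B') ∨ (¬ A ∧ ¬ B ∧ A' ∧ B') ∨ (¬ A ∧ ¬ B ∧ ¬ A' ∧ ¬ B') := by
  have npq : p ≠ q := by rintro rfl; simp at hd
  have nrs : r ≠ s := by rintro rfl; simp at hd
  have hcomm := swap_mul_swap_mul_comm hd φ
  have mono : ∀ {φ : Perm Y} {p q r s : Y}, p ≠ q → ¬ φ.SameCycle p q → φ.SameCycle r s →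
      (swap p q * φ).SameCycle r s := fun h1 h2 h3 =>
    (sameCycle_swap_mul_join h1 h2 _ _).mpr (Or.inl h3)
  have sab := sameCycle_swap_mul_iff (φ := swap r s * φ) npq
  have sba := sameCycle_swap_mul_iff (φ := swap p q * φ) nrs
  rw [hcomm, hB'] at sba
  rw [hA'] at sab
  have ea : swap r s * (swap p q * (swap r s * φ)) = swap p q * φ := by
    rw [← hcomm, swap_mul_swap_mul]
  have sa := sameCycle_swap_mul_iff (φ := φ) npq
  have sb := sameCycle_swap_mul_iff (φ := φ) nrs
  rw [hA] at sa
  rw [hB] at sb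
  have m1 : ¬ A → B → B' := fun h1 h2 => hB'.mp (mono npq (hA.not.mpr h1) (hB.mpr h2))
  have m2 : ¬ B → A → A' := fun h1 h2 => hA'.mp (mono nrs (hB.not.mpr h1) (hA.mpr h2))
  have m3 : A' → ¬ B' → ¬ B := fun h1 h2 => by
    have := mono npq (sab.not.mpr (not_not.mpr h1)) (sba.mpr h2)
    rw [swap_mul_swap_mul] at this
    exact sb.mp this
  have m4 : B' → ¬ A' → ¬ A := fun h1 h2 => by
    have := mono nrs (sba.not.mpr (not_not.mpr h1)) (sab.mpr h2)
    rw [ea] at this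
    exact sa.mp this
  have l1 : ¬ A → ¬ B → B' → A' := fun h1 h2 h3 => hA'.mp
    (sameCycle_swap_mul_symm npq nrs (hA.not.mpr h1) (hB.not.mpr h2) (hB'.mpr h3))
  have l2 : ¬ A → ¬ B → A' → B' := fun h1 h2 h3 => hB'.mp
    (sameCycle_swap_mul_symm nrs npq (hB.not.mpr h2) (hA.not.mpr h1) (hA'.mpr h3))
  have l3 : A' → B' → ¬ B → ¬ A := fun h1 h2 h3 => by
    have := sameCycle_swap_mul_symm npq nrs (sab.not.mpr (not_not.mpr h1))
      (sba.not.mpr (not_not.mpr h2)) (by rw [swap_mul_swap_mul]; exact sb.mpr h3)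
    rw [ea] at this
    exact sa.mp this
  have l4 : A' → B' → ¬ A → ¬ B := fun h1 h2 h3 => by
    have := sameCycle_swap_mul_symm nrs npq (sba.not.mpr (not_not.mpr h2))
      (sab.not.mpr (not_not.mpr h1)) (by rw [ea]; exact sa.mpr h3)
    rw [swap_mul_swap_mul] at this
    exact sb.mp this
  clear sa sb sab sba hA hB hA' hB' mono hcomm ea hd
  by_cases A <;> by_cases B <;> by_cases A' <;> by_cases B' <;> simp_all

theorem glueCycles_comm (hd : [p, q, r, s].Nodup) {x : ExteriorAlgebra k (Y → k)}
    (hx : x ∈ cycleLine k φ) :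
    glueCycles (swap p q * φ) r s (glueCycles φ p q x) =
      -glueCycles (swap r s * φ) p q (glueCycles φ r s x) := by
  have npq : p ≠ q := by rintro rfl; simp at hd
  have nrs : r ≠ s := by rintro rfl; simp at hd
  have hcomm := swap_mul_swap_mul_comm hd φ
  have hxa := glueCycles_mem npq hx
  have hxb := glueCycles_mem nrs hx
  have hy1 := glueCycles_mem nrs hxa
  have hy2 := glueCycles_mem npq hxb
  have sa := sameCycle_swap_mul_iff (φ := φ) npq
  have sab := sameCycle_swap_mul_iff (φ := swap r s * φ) npq
  have sba := sameCycle_swap_mul_iff (φ := swap p q * φ) nrs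
  rw [hcomm] at sba hy1
  rcases sameCycle_two_swaps hd (φ := φ) Iff.rfl Iff.rfl Iff.rfl Iff.rfl with
    ⟨A, B, A', B'⟩ | ⟨A, B, A', B'⟩ | ⟨A, B, A', B'⟩ | ⟨A, B, A', B'⟩ | ⟨A, B, A', B'⟩ |
    ⟨A, B, A', B'⟩
  · have na : ¬ (swap p q * φ).SameCycle p q := sa.not.mpr (not_not.mpr A)
    have nb : ¬ (swap p q * (swap r s * φ)).SameCycle r s := sba.not.mpr (not_not.mpr B')
    have y1 := (glueCycles_cut nrs B' hxa).2
    have y2 := (glueCycles_cut npq A' hxb).2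
    have z1 := (glueCycles_cut npq A hx).2
    have z2 := (glueCycles_cut nrs B hx).2
    rw [← sub_eq_zero, sub_neg_eq_add]
    refine contractLeft_injOn nrs nb (add_mem hy1 hy2) ?_
    have hm := (glueCycles_join nrs nb (add_mem hy1 hy2)).1
    rw [glueCycles_not_same nb, ← hcomm, swap_mul_swap_mul] at hm
    refine contractLeft_injOn npq na hm ?_
    rw [map_add, map_add, y1, z1, contractLeft_comm, y2, z2, add_neg_cancel]
  · have na : ¬ (swap p q * φ).SameCycle p q := sa.not.mpr (not_not.mpr A)
    have hb : (swap p q * (swap p q * φ)).SameCycle r s := by rwa [swap_mul_swap_mul]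
    have := glueCycles_comm_interleaved hd na B' hb hxa
    rw [swap_mul_swap_mul, glueCycles_glueCycles npq hx, hcomm] at this
    have e := congrArg (glueCycles (swap r s * φ) p q) this
    rw [map_neg] at e
    have e2 := glueCycles_glueCycles npq hy1
    rw [swap_mul_swap_mul] at e2
    rw [e2] at e
    rw [e, neg_neg]
  · have nA' : ¬ (swap p q * (swap r s * φ)).SameCycle p q := sab.not.mpr (not_not.mpr A')
    have z1 := (glueCycles_cut npq A hx).2
    have y2 := (glueCycles_cut npq A' hxb).2
    rw [← sub_eq_zero, sub_neg_eq_add]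
    refine contractLeft_injOn npq nA' (add_mem hy1 hy2) ?_
    rw [map_add, y2, glueCycles_not_same B', glueCycles_not_same B,
      contractLeft_comm, z1, neg_add_cancel]
  · have nb : ¬ (swap p q * (swap r s * φ)).SameCycle r s := sba.not.mpr (not_not.mpr B')
    have z2 := (glueCycles_cut nrs B hx).2
    have y1 := (glueCycles_cut nrs B' hxa).2
    rw [← sub_eq_zero, sub_neg_eq_add]
    refine contractLeft_injOn nrs nb (add_mem hy1 hy2) ?_
    rw [map_add, y1, glueCycles_not_same A', glueCycles_not_same A,
      contractLeft_comm (diffDual k r s), z2, add_neg_cancel]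
  · exact glueCycles_comm_interleaved hd A B B' hx
  · rw [glueCycles_not_same B', glueCycles_not_same A, glueCycles_not_same A',
      glueCycles_not_same B, contractLeft_comm]

end Anticommute

/-- The number of cycles, including fixed points. -/
def numCycles {Y : Type*} (φ : Perm Y) : ℕ := Nat.card (Quotient (Perm.SameCycle.setoid φ))

theorem IsTransversal.length_eq {Y : Type*} [Finite Y] {φ : Perm Y} {l : List Y}
    (hl : IsTransversal φ l) : l.length = numCycles φ := by
  classical
  rw [← List.toFinset_card_of_nodup hl.1, numCycles, ← Fintype.card_coe, ← Nat.card_eq_fintype_card]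
  refine Nat.card_congr (ofBijective (fun x => Quotient.mk _ x.1) ⟨?_, ?_⟩)
  · intro x y h
    exact Subtype.ext (hl.eq_of_sameCycle (List.mem_toFinset.mp x.2) (List.mem_toFinset.mp y.2)
      (Quotient.exact h))
  · intro z
    obtain ⟨y, rfl⟩ := Quotient.exists_rep z
    obtain ⟨x, ⟨hx, hxy⟩, _⟩ := hl.2 y
    exact ⟨⟨x, List.mem_toFinset.mpr hx⟩, Quotient.sound hxy⟩

theorem IsTransversal.map {X Y : Type*} [Finite Y] {φ : Perm Y} {j : X → Y} {σ : Perm X}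
    (h : Induces φ j σ) (hj : j.Injective) {l : List X} (hl : IsTransversal σ l) :
    IsTransversal φ (l.map j) := by
  refine ⟨hl.1.map hj, fun y => ?_⟩
  obtain ⟨x, hx⟩ := h.1 y
  obtain ⟨z, ⟨hz, hzx⟩, _⟩ := hl.2 x
  refine ⟨j z, ⟨List.mem_map_of_mem hz, ((h.sameCycle_iff hj).mpr hzx).trans hx.symm⟩, ?_⟩
  rintro w ⟨hw, hwy⟩
  obtain ⟨z', hz', rfl⟩ := List.mem_map.mp hw
  congr 1
  exact hl.eq_of_sameCycle hz' hz (((h.sameCycle_iff hj).mp (hwy.trans hx)).trans hzx.symm)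

theorem Induces.numCycles_eq {X Y : Type*} [Finite X] [Finite Y] {φ : Perm Y} {j : X → Y}
    {σ : Perm X} (h : Induces φ j σ) (hj : j.Injective) : numCycles σ = numCycles φ := by
  obtain ⟨l, hl⟩ := exists_transversal σ
  rw [← hl.length_eq, ← (hl.map h hj).length_eq, List.length_map]

section Sum

variable {X Y : Type*} {φ : Perm X} {ψ : Perm Y}

theorem sumCongr_zpow (n : ℤ) : (sumCongr φ ψ) ^ n = sumCongr (φ ^ n) (ψ ^ n) :=
  (map_zpow (Perm.sumCongrHom X Y) (φ, ψ) n).symm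

theorem sameCycle_sumCongr_inl {x y : X} :
    (sumCongr φ ψ).SameCycle (.inl x) (.inl y) ↔ φ.SameCycle x y := by
  simp [Perm.SameCycle, sumCongr_zpow]

theorem sameCycle_sumCongr_inr {x y : Y} :
    (sumCongr φ ψ).SameCycle (.inr x) (.inr y) ↔ ψ.SameCycle x y := by
  simp [Perm.SameCycle, sumCongr_zpow]

theorem not_sameCycle_sumCongr {x : X} {y : Y} : ¬ (sumCongr φ ψ).SameCycle (.inl x) (.inr y) := by
  simp [Perm.SameCycle, sumCongr_zpow]

theorem not_sameCycle_sumCongr' {x : X} {y : Y} : ¬ (sumCongr φ ψ).SameCycle (.inr y) (.inl x) := by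
  simp [Perm.SameCycle, sumCongr_zpow]

theorem swap_inl_mul_sumCongr [DecidableEq X] [DecidableEq Y] (p q : X) :
    swap (Sum.inl p) (Sum.inl q) * sumCongr φ ψ = sumCongr (swap p q * φ) ψ := by
  rw [← Perm.sumCongr_swap_one, Perm.sumCongr_mul, one_mul]

theorem swap_inr_mul_sumCongr [DecidableEq X] [DecidableEq Y] (p q : Y) :
    swap (Sum.inr p) (Sum.inr q) * sumCongr φ ψ = sumCongr φ (swap p q * ψ) := by
  rw [← Perm.sumCongr_one_swap, Perm.sumCongr_mul, one_mul]

end Sum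

/-! ### Restriction and extension of exterior products -/

section Ext

variable {k : Type*} [Field k]

theorem contractLeft_map_mul {M N : Type*} [AddCommGroup M] [Module k M] [AddCommGroup N]
    [Module k N] (f : M →ₗ[k] N) (d : Module.Dual k N) (x : ExteriorAlgebra k M)
    {y : ExteriorAlgebra k N} (hy : CliffordAlgebra.contractLeft d y = 0) :
    CliffordAlgebra.contractLeft d (ExteriorAlgebra.map f x * y) =
      ExteriorAlgebra.map f (CliffordAlgebra.contractLeft (d ∘ₗ f) x) * y := by
  induction x using CliffordAlgebra.left_induction with
  | algebraMap r =>
    rw [AlgHom.commutes, CliffordAlgebra.contractLeft_algebraMap_mul, hy,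
      CliffordAlgebra.contractLeft_algebraMap, map_zero, zero_mul, mul_zero]
  | add x z hx hz => simp only [map_add, add_mul, hx, hz]
  | ι_mul x m hx =>
    have e : ExteriorAlgebra.map f (CliffordAlgebra.ι 0 m) = CliffordAlgebra.ι 0 (f m) :=
      map_apply_ι f m
    rw [map_mul (ExteriorAlgebra.map f), e, mul_assoc, contractLeft_ι_mul, hx,
      contractLeft_ι_mul, map_sub, map_mul (ExteriorAlgebra.map f), e, sub_mul, mul_assoc, map_smul,
      smul_mul_assoc]
    rfl

theorem contractLeft_map {M N : Type*} [AddCommGroup M] [Module k M] [AddCommGroup N]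
    [Module k N] (f : M →ₗ[k] N) (d : Module.Dual k N) (x : ExteriorAlgebra k M) :
    CliffordAlgebra.contractLeft d (ExteriorAlgebra.map f x) =
      ExteriorAlgebra.map f (CliffordAlgebra.contractLeft (d ∘ₗ f) x) := by
  simpa using contractLeft_map_mul f d x (y := 1) (CliffordAlgebra.contractLeft_one _ d)

variable {X Y : Type*}

theorem restrictExt_ι (j : X → Y) (v : Y → k) :
    restrictExt k j (ExteriorAlgebra.ι k v) = ExteriorAlgebra.ι k (v ∘ j) :=
  map_apply_ι _ _

theorem extendExt_ι (j : X → Y) (v : X → k) :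
    extendExt k j (ExteriorAlgebra.ι k v) = ExteriorAlgebra.ι k (Function.extend j v 0) :=
  map_apply_ι _ _

theorem restrictExt_restrictExt {Z : Type*} (i : Z → X) (j : X → Y)
    (x : ExteriorAlgebra k (Y → k)) :
    restrictExt k i (restrictExt k j x) = restrictExt k (j ∘ i) x := by
  unfold restrictExt
  rw [← AlgHom.comp_apply, map_comp_map]
  rfl

theorem cycleVector_comp [Finite Y] {φ : Perm Y} {j : X → Y} {σ : Perm X} (h : Induces φ j σ)
    (hj : j.Injective) (x : X) : cycleVector k φ (j x) ∘ j = cycleVector k σ x := by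
  classical
  funext z
  simp [cycleVector_apply, h.sameCycle_iff hj]

theorem restrictExt_cycleProd [Finite Y] {φ : Perm Y} {j : X → Y} {σ : Perm X}
    (h : Induces φ j σ) (hj : j.Injective) (l : List X) :
    restrictExt k j (cycleProd k φ (l.map j)) = cycleProd k σ l := by
  unfold cycleProd
  rw [map_list_prod, map_map, map_map]
  congr 1
  refine List.map_congr_left fun x _ => ?_
  rw [comp_apply, comp_apply, restrictExt_ι, cycleVector_comp h hj]

theorem restrictExt_glueCycles [Finite Y] [DecidableEq X] [DecidableEq Y] {φ : Perm Y}
    {j : X → Y} {σ : Perm X} (h : Induces φ j σ) (hj : j.Injective) (p q : X)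
    (x : ExteriorAlgebra k (Y → k)) :
    restrictExt k j (glueCycles φ (j p) (j q) x) = glueCycles σ p q (restrictExt k j x) := by
  by_cases hs : σ.SameCycle p q
  · rw [glueCycles_same hs, glueCycles_same ((h.sameCycle_iff hj).mpr hs), map_mul,
      restrictExt_ι, cycleVector_comp (h.swap_mul hj p q) hj]
  · rw [glueCycles_not_same hs, glueCycles_not_same ((h.sameCycle_iff hj).not.mpr hs),
      restrictExt, contractLeft_map]
    rfl

theorem restrictExt_mem_cycleLine [Finite X] [Finite Y] {φ : Perm Y} {j : X → Y} {σ : Perm X}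
    (h : Induces φ j σ) (hj : j.Injective) {x : ExteriorAlgebra k (Y → k)}
    (hx : x ∈ cycleLine k φ) : restrictExt k j x ∈ cycleLine k σ := by
  obtain ⟨l, hl⟩ := exists_transversal σ
  obtain ⟨a, rfl⟩ := (mem_cycleLine_iff (hl.map h hj)).mp hx
  rw [map_smul, restrictExt_cycleProd h hj]
  exact smul_mem _ _ (cycleProd_mem hl)

theorem restrictExt_sum {X' Y' : Type*} (j : X → Y) (j' : X' → Y')
    (a : ExteriorAlgebra k (Y → k)) (b : ExteriorAlgebra k (Y' → k)) :
    restrictExt k (Sum.map j j') (extendExt k Sum.inl a * extendExt k Sum.inr b) =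
      extendExt k Sum.inl (restrictExt k j a) * extendExt k Sum.inr (restrictExt k j' b) := by
  rw [map_mul]
  unfold restrictExt extendExt
  congr 1
  · rw [← AlgHom.comp_apply, ← AlgHom.comp_apply, map_comp_map, map_comp_map]
    congr 2
    refine LinearMap.ext fun v => funext fun z => ?_
    rcases z with z | z
    · simp [LinearMap.funLeft_apply, inl_injective.extend_apply]
    · simp [LinearMap.funLeft_apply]
  · rw [← AlgHom.comp_apply, ← AlgHom.comp_apply, map_comp_map, map_comp_map]
    congr 2
    refine LinearMap.ext fun v => funext fun z => ?_
    rcases z with z | z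
    · simp [LinearMap.funLeft_apply]
    · simp [LinearMap.funLeft_apply, inr_injective.extend_apply]

variable {φ : Perm X} {ψ : Perm Y}

theorem cycleVector_sumCongr_inl (x : X) : cycleVector k (sumCongr φ ψ) (.inl x) =
    Function.extend Sum.inl (cycleVector k φ x) 0 := by
  classical
  funext z
  rcases z with z | z
  · simp [cycleVector_apply, sameCycle_sumCongr_inl, inl_injective.extend_apply]
  · simp [cycleVector_apply, not_sameCycle_sumCongr]

theorem cycleVector_sumCongr_inr (y : Y) : cycleVector k (sumCongr φ ψ) (.inr y) =
    Function.extend Sum.inr (cycleVector k ψ y) 0 := by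
  classical
  funext z
  rcases z with z | z
  · simp [cycleVector_apply, not_sameCycle_sumCongr']
  · simp [cycleVector_apply, sameCycle_sumCongr_inr, inr_injective.extend_apply]

theorem contractLeft_extendExt_eq_zero (j : X → Y) {p q : Y}
    (hp : p ∉ range j) (hq : q ∉ range j) (b : ExteriorAlgebra k (X → k)) :
    CliffordAlgebra.contractLeft (diffDual k p q) (extendExt k j b) = 0 := by
  have : diffDual k p q ∘ₗ Function.ExtendByZero.linearMap k j = 0 := by
    refine LinearMap.ext fun v => ?_
    have h1 : Function.extend j v 0 p = (0 : Y → k) p := Function.extend_apply' _ _ _ hp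
    have h2 : Function.extend j v 0 q = (0 : Y → k) q := Function.extend_apply' _ _ _ hq
    simp [diffDual_apply, h1, h2]
  rw [extendExt, contractLeft_map, this, map_zero, LinearMap.zero_apply, map_zero]

theorem glueCycles_sumCongr_inl [DecidableEq X] [DecidableEq Y] (p q : X)
    (a : ExteriorAlgebra k (X → k)) (b : ExteriorAlgebra k (Y → k)) :
    glueCycles (sumCongr φ ψ) (.inl p) (.inl q) (extendExt k Sum.inl a * extendExt k Sum.inr b) =
      extendExt k Sum.inl (glueCycles φ p q a) * extendExt k Sum.inr b := by
  by_cases hs : φ.SameCycle p q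
  · rw [glueCycles_same hs, glueCycles_same (sameCycle_sumCongr_inl.mpr hs),
      swap_inl_mul_sumCongr, cycleVector_sumCongr_inl, map_mul, extendExt_ι, mul_assoc]
  · rw [glueCycles_not_same hs, glueCycles_not_same (sameCycle_sumCongr_inl.not.mpr hs)]
    have h0 := contractLeft_extendExt_eq_zero (k := k) (Sum.inr : Y → X ⊕ Y)
      (p := .inl p) (q := .inl q) (by simp) (by simp) b
    rw [extendExt, contractLeft_map_mul _ _ _ h0]
    congr 3
    congr 1
    refine LinearMap.ext fun v => ?_
    simp [diffDual_apply, inl_injective.extend_apply]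

theorem extendExt_cycleProd (l : List X) :
    extendExt k Sum.inl (cycleProd k φ l) = cycleProd k (sumCongr φ ψ) (l.map Sum.inl) := by
  unfold cycleProd
  rw [map_list_prod, map_map, map_map]
  congr 1
  refine List.map_congr_left fun x _ => ?_
  rw [comp_apply, comp_apply, extendExt_ι, cycleVector_sumCongr_inl]

theorem ι_mul_cycleProd_mul (w : X → k) (l : List X) (z : ExteriorAlgebra k (X → k)) :
    ExteriorAlgebra.ι k w * (cycleProd k φ l * z) =
      (-1 : k) ^ l.length • (cycleProd k φ l * (ExteriorAlgebra.ι k w * z)) := by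
  induction l with
  | nil => simp [cycleProd]
  | cons a l ih =>
    rw [cycleProd_cons, mul_assoc, ← mul_assoc (ExteriorAlgebra.ι k w), ι_mul_comm, neg_mul,
      mul_assoc, ih, length_cons, pow_succ, mul_smul_comm, mul_assoc, mul_neg_one, neg_smul]

theorem contractLeft_cycleProd_mul (d : Module.Dual k (X → k)) (l : List X)
    (h : ∀ x ∈ l, d (cycleVector k φ x) = 0) (z : ExteriorAlgebra k (X → k)) :
    CliffordAlgebra.contractLeft d (cycleProd k φ l * z) =
      (-1 : k) ^ l.length • (cycleProd k φ l * CliffordAlgebra.contractLeft d z) := by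
  induction l with
  | nil => simp [cycleProd]
  | cons a l ih =>
    rw [cycleProd_cons, mul_assoc, ExteriorAlgebra.ι, contractLeft_ι_mul,
      h a (by simp), ih (fun x hx => h x (by simp [hx])), length_cons, pow_succ,
      mul_smul_comm, mul_assoc, mul_neg_one, neg_smul, zero_smul, zero_sub]

theorem glueCycles_sumCongr_inr [Finite X] [DecidableEq X] [DecidableEq Y] (p q : Y)
    {a : ExteriorAlgebra k (X → k)} (ha : a ∈ cycleLine k φ) (b : ExteriorAlgebra k (Y → k)) :
    glueCycles (sumCongr φ ψ) (.inr p) (.inr q) (extendExt k Sum.inl a * extendExt k Sum.inr b) =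
      (-1 : k) ^ numCycles φ •
        (extendExt k Sum.inl a * extendExt k Sum.inr (glueCycles ψ p q b)) := by
  obtain ⟨l, hl⟩ := exists_transversal φ
  obtain ⟨c, rfl⟩ := (mem_cycleLine_iff hl).mp ha
  rw [← hl.length_eq, map_smul, smul_mul_assoc, smul_mul_assoc, smul_comm _ c, map_smul]
  congr 1
  rw [extendExt_cycleProd (ψ := ψ), ← List.length_map (as := l) (Sum.inl : X → X ⊕ Y)]
  by_cases hs : ψ.SameCycle p q
  · rw [glueCycles_same hs, glueCycles_same (sameCycle_sumCongr_inr.mpr hs),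
      swap_inr_mul_sumCongr, cycleVector_sumCongr_inr, map_mul, extendExt_ι, ι_mul_cycleProd_mul]
  · rw [glueCycles_not_same hs, glueCycles_not_same (sameCycle_sumCongr_inr.not.mpr hs),
      contractLeft_cycleProd_mul]
    · congr 2
      rw [extendExt, contractLeft_map]
      congr 2
      congr 1
      refine LinearMap.ext fun v => ?_
      simp [diffDual_apply, inr_injective.extend_apply]
    · intro x hx
      obtain ⟨y, _, rfl⟩ := List.mem_map.mp hx
      classical
      simp [diffDual_apply, cycleVector_apply, not_sameCycle_sumCongr]

end Ext

/-! ### Coefficient systems -/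

/-- Coefficients for products of cycles of permutations, each cycle being of parity `c`: scalars for
`c = 0` and the exterior algebra for `c = 1`. -/
structure Coef (k : Type u) [Field k] where
  c : ZMod 2
  C : Type → Type u
  ring : ∀ Y, Ring (C Y)
  algebra : ∀ Y, Algebra k (C Y)
  vec : ∀ {Y : Type}, Perm Y → Y → C Y
  glue : ∀ {Y : Type}, Perm Y → Y → Y → C Y →ₗ[k] C Y
  res : ∀ {X Y : Type}, (X → Y) → C Y →ₐ[k] C X
  ext : ∀ {X Y : Type}, (X → Y) → C X →ₐ[k] C Y
  line : ∀ {Y : Type}, Perm Y → Submodule k (C Y)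
  vec_comm : ∀ {Y : Type} (φ : Perm Y) (x y : Y),
    vec φ x * vec φ y = (sgn c : k) • (vec φ y * vec φ x)
  vec_congr : ∀ {Y : Type} {φ : Perm Y} {x y : Y}, φ.SameCycle x y → vec φ x = vec φ y
  prod_mem_line : ∀ {Y : Type} {φ : Perm Y} {l : List Y}, IsTransversal φ l →
    (l.map (vec φ)).prod ∈ line φ
  glue_mem_line : ∀ {Y : Type} [Finite Y] [DecidableEq Y] {φ : Perm Y} {p q : Y} {x : C Y},
    p ≠ q → x ∈ line φ → glue φ p q x ∈ line (swap p q * φ)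
  glue_swap : ∀ {Y : Type} [Finite Y] [DecidableEq Y] {φ : Perm Y} {p q : Y} {x : C Y},
    p ≠ q → x ∈ line φ → glue φ q p x = (sgn c : k) • glue φ p q x
  glue_comm : ∀ {Y : Type} [Finite Y] [DecidableEq Y] {φ : Perm Y} {p q r s : Y} {x : C Y},
    [p, q, r, s].Nodup → x ∈ line φ → glue (swap p q * φ) r s (glue φ p q x) =
      (sgn c : k) • glue (swap r s * φ) p q (glue φ r s x)
  glue_join : ∀ {Y : Type} [Finite Y] [DecidableEq Y] {φ : Perm Y} {p q : Y} {l : List Y},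
    p ≠ q → ¬ φ.SameCycle p q → (∀ y ∈ l, ¬ φ.SameCycle y p) → (∀ y ∈ l, ¬ φ.SameCycle y q) →
    glue φ p q (((p :: q :: l).map (vec φ)).prod) = ((p :: l).map (vec (swap p q * φ))).prod
  res_vec : ∀ {X Y : Type} [Finite Y] {φ : Perm Y} {j : X → Y} {σ : Perm X}, Induces φ j σ →
    j.Injective → ∀ x, res j (vec φ (j x)) = vec σ x
  res_glue : ∀ {X Y : Type} [Finite Y] [DecidableEq X] [DecidableEq Y] {φ : Perm Y} {j : X → Y}
    {σ : Perm X}, Induces φ j σ → j.Injective → ∀ p q x,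
    res j (glue φ (j p) (j q) x) = glue σ p q (res j x)
  res_mem_line : ∀ {X Y : Type} [Finite X] [Finite Y] {φ : Perm Y} {j : X → Y} {σ : Perm X},
    Induces φ j σ → j.Injective → ∀ {x}, x ∈ line φ → res j x ∈ line σ
  res_res : ∀ {X Y Z : Type} (i : Z → X) (j : X → Y) (x : C Y), res i (res j x) = res (j ∘ i) x
  res_sum : ∀ {X Y X' Y' : Type} (j : X → Y) (j' : X' → Y') (a : C Y) (b : C Y'),
    res (Sum.map j j') (ext Sum.inl a * ext Sum.inr b) =
      ext Sum.inl (res j a) * ext Sum.inr (res j' b)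
  ext_vec_inl : ∀ {X Y : Type} (φ : Perm X) (ψ : Perm Y) (x : X),
    vec (sumCongr φ ψ) (.inl x) = ext Sum.inl (vec φ x)
  ext_vec_inr : ∀ {X Y : Type} (φ : Perm X) (ψ : Perm Y) (y : Y),
    vec (sumCongr φ ψ) (.inr y) = ext Sum.inr (vec ψ y)
  glue_inl : ∀ {X Y : Type} [DecidableEq X] [DecidableEq Y] (φ : Perm X) (ψ : Perm Y) (p q : X)
    (a : C X) (b : C Y), glue (sumCongr φ ψ) (.inl p) (.inl q)
      (ext Sum.inl a * ext Sum.inr b) = ext Sum.inl (glue φ p q a) * ext Sum.inr b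
  glue_inr : ∀ {X Y : Type} [Finite X] [DecidableEq X] [DecidableEq Y] (φ : Perm X) (ψ : Perm Y)
    (p q : Y) {a : C X} (b : C Y), a ∈ line φ →
    glue (sumCongr φ ψ) (.inr p) (.inr q) (ext Sum.inl a * ext Sum.inr b) =
      (sgn (c * (numCycles φ : ZMod 2)) : k) • (ext Sum.inl a * ext Sum.inr (glue ψ p q b))

instance {k : Type u} [Field k] (W : Coef k) (Y : Type) : Ring (W.C Y) := W.ring Y

instance {k : Type u} [Field k] (W : Coef k) (Y : Type) : Algebra k (W.C Y) := W.algebra Y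

theorem sgn_natCast (n : ℕ) : sgn (n : ZMod 2) = (-1) ^ n := by
  induction n with
  | zero => rfl
  | succ n ih => rw [Nat.cast_succ, sgn_add, ih, pow_succ]; rfl

/-- Scalar coefficients. -/
def scalarCoef (k : Type u) [Field k] : Coef k where
  c := 0
  C _ := k
  ring _ := inferInstance
  algebra _ := inferInstance
  vec _ _ := 1
  glue _ _ _ := LinearMap.id
  res _ := AlgHom.id k k
  ext _ := AlgHom.id k k
  line _ := ⊤
  vec_comm _ _ _ := by simp [sgn_zero]
  vec_congr _ := rfl
  prod_mem_line _ := trivial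
  glue_mem_line _ _ := trivial
  glue_swap _ _ := by simp [sgn_zero]
  glue_comm _ _ := by simp [sgn_zero]
  glue_join _ _ _ _ := by simp
  res_vec _ _ _ := rfl
  res_glue _ _ _ _ _ := rfl
  res_mem_line _ _ _ _ := trivial
  res_res _ _ _ := rfl
  res_sum _ _ _ _ := rfl
  ext_vec_inl _ _ _ := rfl
  ext_vec_inr _ _ _ := rfl
  glue_inl _ _ _ _ _ _ := rfl
  glue_inr _ _ _ _ _ _ _ := by simp [sgn_zero]

/-- Coefficients in exterior products of cycles. -/
def exteriorCoef (k : Type u) [Field k] : Coef k where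
  c := 1
  C Y := ExteriorAlgebra k (Y → k)
  ring _ := inferInstance
  algebra _ := inferInstance
  vec φ y := ExteriorAlgebra.ι k (cycleVector k φ y)
  glue := glueCycles
  res := restrictExt k
  ext := extendExt k
  line := cycleLine k
  vec_comm _ _ _ := by rw [ι_mul_comm]; simp [sgn_one]
  vec_congr h := by rw [cycleVector_congr h]
  prod_mem_line hl := cycleProd_mem hl
  glue_mem_line hpq hx := glueCycles_mem hpq hx
  glue_swap hpq hx := by rw [glueCycles_swap hpq hx]; simp [sgn_one]
  glue_comm hd hx := by rw [glueCycles_comm hd hx]; simp [sgn_one]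
  glue_join {Y _ _ φ p q l} hpq h hp hq := by
    have e1 := contractLeft_join (k := k) h hp hq
    rw [← glueCycles_not_same h, ← cycleVector_join hpq h, ← cycleProd_swap_other hpq h hp hq,
      ← cycleProd_cons] at e1
    exact e1
  res_vec h hj x := by rw [restrictExt_ι, cycleVector_comp h hj]
  res_glue h hj p q x := restrictExt_glueCycles h hj p q x
  res_mem_line h hj _ hx := restrictExt_mem_cycleLine h hj hx
  res_res := restrictExt_restrictExt
  res_sum := restrictExt_sum
  ext_vec_inl φ ψ x := by rw [extendExt_ι, cycleVector_sumCongr_inl]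
  ext_vec_inr φ ψ y := by rw [extendExt_ι, cycleVector_sumCongr_inr]
  glue_inl _ _ p q a b := glueCycles_sumCongr_inl p q a b
  glue_inr _ _ p q _ b ha := by
    rw [glueCycles_sumCongr_inr p q ha, one_mul, sgn_natCast]
    simp

/-! ### Ribbon graphs presented by their vertices and edges -/

/-- The flags of `V` trivalent vertices. -/
abbrev Flags (V : ℕ) := Fin V × Fin 3

/-- The flags of `E` edges and `n` legs. -/
abbrev Ends (E n : ℕ) := (Fin E × Fin 2) ⊕ Fin n

/-- The cyclic shift of the second coordinate. -/
def shift (V r : ℕ) [NeZero r] : Perm (Fin V × Fin r) :=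
  Equiv.prodCongr (.refl _) (Equiv.addRight 1)

theorem shift_apply {V r : ℕ} [NeZero r] (x : Fin V × Fin r) : shift V r x = (x.1, x.2 + 1) := rfl

/-- The involution exchanging the two flags of each edge. -/
def endInv (E n : ℕ) : Perm (Ends E n) := sumCongr (shift E 2) 1

def flagRank {V : ℕ} (f : Flags V) : ℕ := 3 * f.1 + f.2

def endRank {E n : ℕ} : Ends E n → ℕ := Sum.elim (fun e => 2 * e.1 + e.2) fun x => 2 * E + x

theorem flagRank_injective {V : ℕ} : (flagRank (V := V)).Injective := by
  rintro ⟨a, b⟩ ⟨c, d⟩ h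
  simp only [flagRank] at h
  ext <;> simp <;> omega

theorem endRank_injective {E n : ℕ} : (endRank (E := E) (n := n)).Injective := by
  rintro (⟨a, b⟩ | a) (⟨c, d⟩ | c) h <;> simp only [endRank, elim_inl, elim_inr] at h
  · congr 1; ext <;> simp <;> omega
  · omega
  · omega
  · congr 1; ext; omega

section Presentation

variable {k : Type u} [Field k] {K : Type*} {V E n : ℕ} {Y Z : Type}

/-- The rotation at the vertices. -/
def rotOf (α : Flags V ≃ Y) : Perm Y := α.permCongr (shift V 3)

/-- The involution of the edges. -/
def invOf (β : Ends E n ≃ Y) : Perm Y := β.permCongr (endInv E n)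

def legOf (β : Ends E n ≃ Y) (x : Fin n) : Y := β (.inr x)

theorem legOf_injective (β : Ends E n ≃ Y) : (legOf β).Injective := fun _ _ h =>
  inr_injective (β.injective h)

theorem rotOf_apply (α : Flags V ≃ Y) (x : Flags V) : rotOf α (α x) = α (x.1, x.2 + 1) := by
  simp [rotOf, permCongr_apply, shift_apply]

theorem invOf_inl (β : Ends E n ≃ Y) (e : Fin E) (b : Fin 2) :
    invOf β (β (.inl (e, b))) = β (.inl (e, b + 1)) := by
  simp [invOf, permCongr_apply, endInv, shift_apply]

theorem invOf_inr (β : Ends E n ≃ Y) (x : Fin n) : invOf β (β (.inr x)) = β (.inr x) := by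
  simp [invOf, permCongr_apply, endInv]

theorem rotOf_trans (α : Flags V ≃ Y) (h : Y ≃ Z) : rotOf (α.trans h) = h.permCongr (rotOf α) := by
  ext; simp [rotOf, permCongr_apply]

theorem invOf_trans (β : Ends E n ≃ Y) (h : Y ≃ Z) : invOf (β.trans h) = h.permCongr (invOf β) := by
  ext; simp [invOf, permCongr_apply]

/-- One term of the contraction: the letters are given on all flags. -/
def term (par : K → ZMod 2) (m : K → K → K → k) (τ : Fin E → K → K → k) [Fintype Y]
    (α : Flags V ≃ Y) (β : Ends E n ≃ Y) (a : Fin n → K → k) (φ : Y → K) : k :=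
  (koszulSign (par ∘ φ) (endRank ∘ β.symm) (flagRank ∘ α.symm) : k) *
    (∏ i, m (φ (α (i, 0))) (φ (α (i, 1))) (φ (α (i, 2)))) *
    (∏ e, τ e (φ (β (.inl (e, 0)))) (φ (β (.inl (e, 1))))) *
    ∏ x, a x (φ (β (.inr x)))

/-- The contraction of three-tensors at the vertices with two-tensors at the edges. -/
def contr [Fintype K] (par : K → ZMod 2) (m : K → K → K → k) (τ : Fin E → K → K → k) [Fintype Y]
    [DecidableEq Y] (α : Flags V ≃ Y) (β : Ends E n ≃ Y) (a : Fin n → K → k) : k :=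
  ∑ φ : Y → K, term par m τ α β a φ

theorem term_trans [Fintype Y] [Fintype Z] (par : K → ZMod 2) (m : K → K → K → k)
    (τ : Fin E → K → K → k) (α : Flags V ≃ Y) (β : Ends E n ≃ Y) (a : Fin n → K → k) (h : Y ≃ Z)
    (φ : Z → K) : term par m τ (α.trans h) (β.trans h) a φ = term par m τ α β a (φ ∘ h) := by
  unfold term
  rw [← koszulSign_comp_equiv h]
  have e1 : (endRank ∘ (β.trans h).symm) ∘ h = endRank ∘ β.symm := by ext; simp
  have e2 : (flagRank ∘ (α.trans h).symm) ∘ h = flagRank ∘ α.symm := by ext; simp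
  rw [e1, e2]
  rfl

theorem contr_trans [Fintype K] [Fintype Y] [Fintype Z] [DecidableEq Y] [DecidableEq Z] (par : K → ZMod 2)
    (m : K → K → K → k) (τ : Fin E → K → K → k) (α : Flags V ≃ Y) (β : Ends E n ≃ Y)
    (a : Fin n → K → k) (h : Y ≃ Z) :
    contr par m τ (α.trans h) (β.trans h) a = contr par m τ α β a := by
  unfold contr
  rw [← (Equiv.arrowCongr h (Equiv.refl K)).sum_comp]
  refine sum_congr rfl fun φ _ => ?_
  rw [term_trans]
  congr 1
  ext y
  simp

/-! Orientations -/

variable (W : Coef k)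

/-- Gluing along a list of pairs. -/
def glueList {Y : Type} [DecidableEq Y] (L : List (Y × Y)) (s : Perm Y × W.C Y) : Perm Y × W.C Y :=
  L.foldl (fun s p => (swap p.1 p.2 * s.1, W.glue s.1 p.1 p.2 s.2)) s

def vertProd (α : Flags V ≃ Y) : W.C Y := (ofFn fun i => W.vec (rotOf α) (α (i, 0))).prod

def edgeList (β : Ends E n ≃ Y) : List (Y × Y) := ofFn fun e => (β (.inl (e, 0)), β (.inl (e, 1)))

/-- The product of the vertices, glued along the edges. -/
def orient [DecidableEq Y] (α : Flags V ≃ Y) (β : Ends E n ≃ Y) : W.C Y :=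
  (glueList W (edgeList β) (rotOf α, vertProd W α)).2

/-- The contraction together with the orientation, restricted to the legs. -/
def weight [Fintype K] [Fintype Y] [DecidableEq Y] (par : K → ZMod 2) (m : K → K → K → k)
    (τ : Fin E → K → K → k) (α : Flags V ≃ Y) (β : Ends E n ≃ Y) (a : Fin n → K → k) :
    W.C (Fin n) :=
  contr par m τ α β a • W.res (legOf β) (orient W α β)

/-- One term of the contraction together with the orientation. -/
def oterm [Fintype Y] [DecidableEq Y] (par : K → ZMod 2) (m : K → K → K → k)
    (τ : Fin E → K → K → k) (α : Flags V ≃ Y) (β : Ends E n ≃ Y) (a : Fin n → K → k)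
    (φ : Y → K) : W.C Y :=
  term par m τ α β a φ • orient W α β

/-- The contraction together with the orientation. -/
def oweight [Fintype K] [Fintype Y] [DecidableEq Y] (par : K → ZMod 2) (m : K → K → K → k)
    (τ : Fin E → K → K → k) (α : Flags V ≃ Y) (β : Ends E n ≃ Y) (a : Fin n → K → k) :
    W.C Y :=
  contr par m τ α β a • orient W α β

theorem oweight_eq_sum [Fintype K] [Fintype Y] [DecidableEq Y] (par : K → ZMod 2)
    (m : K → K → K → k) (τ : Fin E → K → K → k) (α : Flags V ≃ Y) (β : Ends E n ≃ Y)
    (a : Fin n → K → k) : oweight W par m τ α β a = ∑ φ, oterm W par m τ α β a φ :=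
  sum_smul

theorem weight_eq_res [Fintype K] [Fintype Y] [DecidableEq Y] (par : K → ZMod 2)
    (m : K → K → K → k) (τ : Fin E → K → K → k) (α : Flags V ≃ Y) (β : Ends E n ≃ Y)
    (a : Fin n → K → k) :
    weight W par m τ α β a = W.res (legOf β) (oweight W par m τ α β a) :=
  (map_smul _ _ _).symm

variable {W}

theorem glueList_cons [DecidableEq Y] (p : Y × Y) (L : List (Y × Y)) (s : Perm Y × W.C Y) :
    glueList W (p :: L) s = glueList W L (swap p.1 p.2 * s.1, W.glue s.1 p.1 p.2 s.2) := rfl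

theorem glueList_append [DecidableEq Y] (L L' : List (Y × Y)) (s : Perm Y × W.C Y) :
    glueList W (L ++ L') s = glueList W L' (glueList W L s) := by
  simp [glueList, List.foldl_append]

theorem glueList_fst [DecidableEq Y] (L : List (Y × Y)) (φ : Perm Y) (x x' : W.C Y) :
    (glueList W L (φ, x)).1 = (glueList W L (φ, x')).1 := by
  induction L generalizing φ x x' with
  | nil => rfl
  | cons p L ih => exact ih _ _ _

theorem glueList_smul [DecidableEq Y] (L : List (Y × Y)) (φ : Perm Y) (r : k) (x : W.C Y) :
    (glueList W L (φ, r • x)).2 = r • (glueList W L (φ, x)).2 := by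
  induction L generalizing φ x with
  | nil => rfl
  | cons p L ih =>
    rw [glueList_cons, glueList_cons]
    simp only [map_smul]
    exact ih _ _

theorem glueList_mem_line [Finite Y] [DecidableEq Y] {L : List (Y × Y)}
    (hL : ∀ p ∈ L, p.1 ≠ p.2) {φ : Perm Y} {x : W.C Y} (hx : x ∈ W.line φ) :
    (glueList W L (φ, x)).2 ∈ W.line (glueList W L (φ, x)).1 := by
  induction L generalizing φ x with
  | nil => exact hx
  | cons p L ih =>
    exact ih (fun q hq => hL q (by simp [hq])) (W.glue_mem_line (hL p (by simp)) hx)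

theorem glueList_res [Finite Y] [DecidableEq Y] [DecidableEq Z] {j : Z → Y} (hj : j.Injective)
    (L : List (Z × Z)) {φ : Perm Y} {σ : Perm Z} (h : Induces φ j σ) (x : W.C Y) :
    Induces (glueList W (L.map (Prod.map j j)) (φ, x)).1 j (glueList W L (σ, W.res j x)).1 ∧
    W.res j (glueList W (L.map (Prod.map j j)) (φ, x)).2 = (glueList W L (σ, W.res j x)).2 := by
  induction L generalizing φ σ x with
  | nil => exact ⟨h, rfl⟩
  | cons p L ih =>
    rw [map_cons, glueList_cons, glueList_cons]
    simp only [Prod.map]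
    rw [← W.res_glue h hj]
    exact ih (h.swap_mul hj p.1 p.2) _

theorem rotOf_pow (α : Flags V ≃ Y) (b : ℕ) (x : Flags V) :
    ((rotOf α) ^ b) (α x) = α (x.1, x.2 + b • (1 : Fin 3)) := by
  induction b generalizing x with
  | zero => simp
  | succ b ih =>
    rw [pow_succ', mul_apply, ih, rotOf_apply, succ_nsmul, add_assoc]

theorem sameCycle_rotOf_iff (α : Flags V ≃ Y) (x y : Flags V) :
    (rotOf α).SameCycle (α x) (α y) ↔ x.1 = y.1 := by
  constructor
  · intro h
    have : Finite Y := Finite.of_equiv _ α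
    obtain ⟨b, hb⟩ := h.exists_nat_pow_eq
    rw [rotOf_pow] at hb
    rw [← α.injective hb]
  · intro h
    have key : ∀ b : Fin 3, (b : ℕ) • (1 : Fin 3) = b := by decide
    refine ⟨((y.2 - x.2 : Fin 3) : ℕ), ?_⟩
    rw [zpow_natCast, rotOf_pow, key]
    congr 1
    ext
    · simp [h]
    · simp

theorem isTransversal_vertices (α : Flags V ≃ Y) :
    IsTransversal (rotOf α) (ofFn fun i => α (i, 0)) := by
  refine ⟨List.nodup_ofFn.mpr fun i j h => by simpa using h, fun y => ?_⟩
  obtain ⟨x, rfl⟩ := α.surjective y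
  refine ⟨α (x.1, 0), ⟨by simp, (sameCycle_rotOf_iff α _ _).mpr rfl⟩, ?_⟩
  rintro z ⟨hz, hzx⟩
  obtain ⟨i, rfl⟩ := (mem_ofFn' _ _).mp hz
  have h : i = x.1 := (sameCycle_rotOf_iff α _ _).mp hzx
  rw [h]

theorem vertProd_mem_line (α : Flags V ≃ Y) : vertProd W α ∈ W.line (rotOf α) := by
  have := W.prod_mem_line (isTransversal_vertices α)
  rwa [map_ofFn] at this

theorem edgeList_ne (β : Ends E n ≃ Y) : ∀ p ∈ edgeList β, p.1 ≠ p.2 := by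
  intro p hp
  obtain ⟨e, rfl⟩ := (mem_ofFn' _ _).mp hp
  simp

theorem glueList_edgeList_fst [DecidableEq Y] (β : Ends E n ≃ Y) (φ : Perm Y) (x : W.C Y) :
    (glueList W (edgeList β) (φ, x)).1 = invOf β * φ := by
  have key : ∀ (L : List (Y × Y)) (φ : Perm Y) (x : W.C Y), (glueList W L (φ, x)).1 =
      (L.map fun p => swap p.1 p.2).reverse.prod * φ := by
    intro L
    induction L with
    | nil => intro φ x; simp [glueList]
    | cons p L ih => intro φ x; rw [glueList_cons, ih]; simp [mul_assoc]
  rw [key]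
  congr 1
  have fix : ∀ (L : List (Y × Y)) (y : Y), (∀ p ∈ L, y ≠ p.1 ∧ y ≠ p.2) →
      (L.map fun p => swap p.1 p.2).reverse.prod y = y := by
    intro L
    induction L with
    | nil => intro y _; rfl
    | cons p L ih =>
      intro y hy
      rw [map_cons, List.reverse_cons, List.prod_append, List.prod_singleton, mul_apply,
        swap_apply_of_ne_of_ne (hy p (by simp)).1 (hy p (by simp)).2,
        ih y fun q hq => hy q (by simp [hq])]
  have move : ∀ (L : List (Y × Y)) (p : Y × Y), p ∈ L →
      L.Pairwise (fun p q => p.1 ≠ q.1 ∧ p.1 ≠ q.2 ∧ p.2 ≠ q.1 ∧ p.2 ≠ q.2) →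
      (L.map fun p => swap p.1 p.2).reverse.prod p.1 = p.2 ∧
      (L.map fun p => swap p.1 p.2).reverse.prod p.2 = p.1 := by
    intro L
    induction L with
    | nil => intro p hp; simp at hp
    | cons q L ih =>
      intro p hp hL
      rw [List.pairwise_cons] at hL
      rw [map_cons, List.reverse_cons, List.prod_append, List.prod_singleton, mul_apply, mul_apply]
      rcases mem_cons.mp hp with rfl | hp
      · rw [swap_apply_left, Equiv.swap_apply_right]
        exact ⟨fix L _ fun q hq => ⟨(hL.1 q hq).2.2.1, (hL.1 q hq).2.2.2⟩,
          fix L _ fun q hq => ⟨(hL.1 q hq).1, (hL.1 q hq).2.1⟩⟩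
      · have h1 := hL.1 p hp
        rw [swap_apply_of_ne_of_ne h1.1.symm h1.2.2.1.symm,
          swap_apply_of_ne_of_ne h1.2.1.symm h1.2.2.2.symm]
        exact ih p hp hL.2
  have pw : (edgeList β).Pairwise (fun p q => p.1 ≠ q.1 ∧ p.1 ≠ q.2 ∧ p.2 ≠ q.1 ∧ p.2 ≠ q.2) := by
    refine List.pairwise_ofFn.mpr fun i j hij => ?_
    have := hij.ne
    simp [this]
  ext y
  obtain ⟨x, rfl⟩ := β.surjective y
  rcases x with ⟨e, b⟩ | x
  · have h := move _ (β (.inl (e, 0)), β (.inl (e, 1))) ((mem_ofFn' _ _).mpr ⟨e, rfl⟩) pw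
    rw [invOf_inl]
    fin_cases b
    · exact h.1
    · exact h.2
  · rw [invOf_inr, fix]
    intro p hp
    obtain ⟨e, rfl⟩ := (mem_ofFn' _ _).mp hp
    simp

theorem orient_mem_line [Finite Y] [DecidableEq Y] (α : Flags V ≃ Y) (β : Ends E n ≃ Y) :
    orient W α β ∈ W.line (invOf β * rotOf α) := by
  rw [← glueList_edgeList_fst (W := W) β _ (vertProd W α)]
  exact glueList_mem_line (edgeList_ne β) (vertProd_mem_line α)

theorem res_vertProd [Finite Z] (α : Flags V ≃ Y) (h : Y ≃ Z) :
    W.res h (vertProd W (α.trans h)) = vertProd W α := by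
  unfold vertProd
  rw [map_list_prod, map_ofFn, rotOf_trans]
  congr 2
  funext i
  exact W.res_vec (induces_equiv' (rotOf α) h) h.injective _

theorem res_orient [Finite Z] [DecidableEq Y] [DecidableEq Z] (α : Flags V ≃ Y)
    (β : Ends E n ≃ Y) (h : Y ≃ Z) :
    W.res h (orient W (α.trans h) (β.trans h)) = orient W α β := by
  have e : edgeList (β.trans h) = (edgeList β).map (Prod.map h h) := by
    simp [edgeList, map_ofFn, comp_def]
  unfold orient
  rw [e, rotOf_trans, (glueList_res h.injective (edgeList β) (induces_equiv' (rotOf α) h) _).2,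
    res_vertProd]

theorem weight_trans [Fintype K] [Fintype Y] [Fintype Z] [DecidableEq Y] [DecidableEq Z] (par : K → ZMod 2)
    (m : K → K → K → k) (τ : Fin E → K → K → k) (α : Flags V ≃ Y) (β : Ends E n ≃ Y)
    (a : Fin n → K → k) (h : Y ≃ Z) :
    weight W par m τ (α.trans h) (β.trans h) a = weight W par m τ α β a := by
  unfold weight
  rw [contr_trans, ← res_orient α β h, W.res_res]
  rfl

theorem res_oterm_trans [Fintype Y] [Fintype Z] [DecidableEq Y] [DecidableEq Z] (par : K → ZMod 2)
    (m : K → K → K → k) (τ : Fin E → K → K → k) (α : Flags V ≃ Y) (β : Ends E n ≃ Y)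
    (a : Fin n → K → k) (h : Y ≃ Z) (φ : Z → K) :
    W.res h (oterm W par m τ (α.trans h) (β.trans h) a φ) = oterm W par m τ α β a (φ ∘ h) := by
  unfold oterm
  rw [term_trans, map_smul, res_orient α β h]

end Presentation

/-! ### Symmetries of the weight -/

/-- Tensors of parity `c` with the cyclic symmetry given by the Koszul rule. -/
structure IsCyclicTensor {k : Type u} [Field k] {K : Type*} (par : K → ZMod 2) (c : ZMod 2)
    (m : K → K → K → k) : Prop where
  parity : ∀ x y z, m x y z ≠ 0 → par x + par y + par z = c
  cyclic : ∀ x y z, m x y z = (sgn (par x * (par y + par z)) : k) * m y z x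

/-- Two-tensors of parity `c`, symmetric for `c = 0` and antisymmetric for `c = 1`. -/
structure IsEdgeTensor {k : Type u} [Field k] {K : Type*} (par : K → ZMod 2) (c : ZMod 2)
    (t : K → K → k) : Prop where
  parity : ∀ x y, t x y ≠ 0 → par x + par y = c
  symm : ∀ x y, t x y = (sgn (par x * par y + c) : k) * t y x

section Fin

theorem val_swap_castSucc_succ {n : ℕ} (i : Fin n) (j : Fin (n + 1)) :
    ((swap i.castSucc i.succ j : Fin (n + 1)) : ℕ) =
      if (j : ℕ) = i then (i : ℕ) + 1 else if (j : ℕ) = (i : ℕ) + 1 then (i : ℕ) else (j : ℕ) := by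
  rw [swap_apply_def]
  simp only [ext_iff, Fin.val_castSucc, val_succ]
  split_ifs <;> simp

theorem swap_succ_succ {n : ℕ} (i : Fin n) (j : Fin (n + 1)) :
    swap i.succ.castSucc i.succ.succ j.succ = (swap i.castSucc i.succ j).succ := by
  ext
  rw [val_swap_castSucc_succ, val_succ (swap i.castSucc i.succ j), val_swap_castSucc_succ]
  simp only [val_succ]
  split_ifs <;> omega

theorem swap_succ_zero {n : ℕ} (i : Fin n) :
    swap i.succ.castSucc i.succ.succ (0 : Fin (n + 2)) = 0 := by
  ext
  rw [val_swap_castSucc_succ]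
  simp

theorem swap_zero_succ_succ {n : ℕ} (j : Fin n) :
    swap (0 : Fin (n + 1)).castSucc (0 : Fin (n + 1)).succ j.succ.succ = j.succ.succ := by
  ext
  rw [val_swap_castSucc_succ]
  simp

end Fin

section Lists

variable {k : Type u} [Field k]

theorem prod_ofFn_swap {A : Type*} [Ring A] [Algebra k A] {ε : k} {n : ℕ} (f : Fin (n + 1) → A)
    (hf : ∀ x y, f x * f y = ε • (f y * f x)) (i : Fin n) :
    (ofFn (f ∘ swap i.castSucc i.succ)).prod = ε • (ofFn f).prod := by
  induction n with
  | zero => exact i.elim0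
  | succ n ih =>
    refine Fin.cases ?_ (fun i => ?_) i
    · rw [ofFn_succ, ofFn_succ, ofFn_succ (f := f), ofFn_succ]
      simp only [comp_apply, swap_zero_succ_succ, List.prod_cons]
      rw [← mul_assoc, ← mul_assoc, ← smul_mul_assoc, ← hf]
      congr 2
    · have := ih (fun j => f j.succ) (fun _ _ => hf _ _) i
      rw [ofFn_succ, ofFn_succ (f := f), List.prod_cons, List.prod_cons, ← mul_smul_comm, ← this]
      simp only [comp_apply, swap_succ_zero, swap_succ_succ, comp_def]

variable {W : Coef k} {Y : Type} [Finite Y] [DecidableEq Y]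

theorem glueList_ofFn_swap {n : ℕ} (f : Fin (n + 1) → Y × Y)
    (hf : ∀ i j, i ≠ j → [(f i).1, (f i).2, (f j).1, (f j).2].Nodup)
    (hf' : ∀ i, (f i).1 ≠ (f i).2) (i : Fin n)
    {φ : Perm Y} {x : W.C Y} (hx : x ∈ W.line φ) :
    (glueList W (ofFn (f ∘ swap i.castSucc i.succ)) (φ, x)).2 =
      (sgn W.c : k) • (glueList W (ofFn f) (φ, x)).2 := by
  induction n generalizing φ x with
  | zero => exact i.elim0
  | succ n ih =>
    revert i
    refine Fin.cases ?_ (fun i => ?_)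
    · have e1 : (f ∘ swap (0 : Fin (n + 1)).castSucc (0 : Fin (n + 1)).succ) 0 = f 1 := by
        simp
      have e2 : (f ∘ swap (0 : Fin (n + 1)).castSucc (0 : Fin (n + 1)).succ) (Fin.succ 0) = f 0 := by
        simp
      rw [ofFn_succ, ofFn_succ, ofFn_succ (f := f), ofFn_succ, e1, e2]
      simp only [comp_apply, swap_zero_succ_succ, glueList_cons]
      rw [← glueList_smul, Fin.succ_zero_eq_one]
      have hd := hf 0 1 (by simp)
      rw [swap_mul_swap_mul_comm (hf 1 0 (by simp)), W.glue_comm (hf 1 0 (by simp)) hx]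
    · rw [ofFn_succ, ofFn_succ (f := f), glueList_cons, glueList_cons]
      have := ih (fun j => f j.succ) (fun a b h => hf _ _ (by simpa using h)) (fun _ => hf' _) i
        (W.glue_mem_line (hf' 0) hx)
      rw [← this]
      simp only [comp_apply, swap_succ_zero, swap_succ_succ, comp_def]

theorem glueList_ofFn_flip {n : ℕ} (f f' : Fin n → Y × Y) (hf : ∀ i, (f i).1 ≠ (f i).2)
    (e : Fin n) (he : f' e = (f e).swap) (hne : ∀ j, j ≠ e → f' j = f j) {φ : Perm Y} {x : W.C Y}
    (hx : x ∈ W.line φ) : (glueList W (ofFn f') (φ, x)).2 =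
      (sgn W.c : k) • (glueList W (ofFn f) (φ, x)).2 := by
  induction n generalizing φ x with
  | zero => exact e.elim0
  | succ n ih =>
    rw [ofFn_succ, ofFn_succ (f := f), glueList_cons, glueList_cons]
    rcases Fin.eq_zero_or_eq_succ e with rfl | ⟨e, rfl⟩
    · have e1 : (fun i : Fin n => f' i.succ) = fun i => f i.succ :=
        funext fun i => hne _ (Fin.succ_ne_zero i)
      rw [e1, he, ← glueList_smul, Prod.fst_swap, Prod.snd_swap, W.glue_swap (hf 0) hx,
        Equiv.swap_comm]
    · rw [hne 0 (Fin.succ_ne_zero e).symm]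
      exact ih (fun i => f i.succ) (fun i => f' i.succ) (fun _ => hf _) e he
        (fun j hj => hne _ (by simpa using hj)) (W.glue_mem_line (hf 0) hx)

end Lists

section Koszul

variable {V E n : ℕ} {Y : Type} [Fintype Y]

theorem koszulSign_vertex_change (p : Y → ZMod 2) (α : Flags V ≃ Y) (β : Ends E n ≃ Y)
    (g : Perm (Flags V)) :
    koszulSign p (endRank ∘ β.symm) (flagRank ∘ (g.trans α).symm) =
      koszulSign p (endRank ∘ β.symm) (flagRank ∘ α.symm) *
        koszulSign (p ∘ α) flagRank (flagRank ∘ g.symm) := by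
  rw [← koszulSign_mul p (endRank_injective.comp β.symm.injective)
    (flagRank_injective.comp α.symm.injective)
    (flagRank_injective.comp (g.trans α).symm.injective)]
  congr 1
  rw [← koszulSign_comp_equiv α]
  congr 1 <;> ext <;> simp

theorem koszulSign_edge_change (p : Y → ZMod 2) (α : Flags V ≃ Y) (β : Ends E n ≃ Y)
    (g : Perm (Ends E n)) :
    koszulSign p (endRank ∘ (g.trans β).symm) (flagRank ∘ α.symm) =
      koszulSign p (endRank ∘ β.symm) (flagRank ∘ α.symm) *
        koszulSign (p ∘ β) endRank (endRank ∘ g.symm) := by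
  rw [← koszulSign_mul p (endRank_injective.comp (g.trans β).symm.injective)
    (endRank_injective.comp β.symm.injective)
    (flagRank_injective.comp α.symm.injective), mul_comm]
  congr 1
  rw [koszulSign_comm, ← koszulSign_comp_equiv β]
  congr 1 <;> ext <;> simp

/-- Exchanging two neighbouring vertices. -/
def vertexSwap (i : Fin V) : Perm (Flags (V + 1)) :=
  Equiv.prodCongr (swap i.castSucc i.succ) (.refl _)

theorem koszulSign_vertexSwap (i : Fin V) (p : Flags (V + 1) → ZMod 2) :
    koszulSign p flagRank (flagRank ∘ (vertexSwap i).symm) =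
      sgn ((∑ b, p (i.castSucc, b)) * ∑ b, p (i.succ, b)) := by
  have h : ∀ j : Fin (V + 1), ∑ x ∈ univ.filter (fun x : Flags (V + 1) => x.1 = j), p x =
      ∑ b, p (j, b) := by
    intro j
    rw [sum_filter, sum_prod_type, sum_eq_single j]
    · simp
    · intro b _ hb; simp [hb]
    · simp
  rw [koszulSign_rectangle p (univ.filter fun x => x.1 = i.castSucc)
    (univ.filter fun x => x.1 = i.succ), h, h]
  rintro ⟨x, b⟩ ⟨y, c⟩
  simp only [flagRank, vertexSwap, comp_apply, Equiv.prodCongr_symm, Equiv.symm_swap,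
    Equiv.prodCongr_apply, Prod.map, val_swap_castSucc_succ, mem_filter, mem_univ,
    true_and, ext_iff, Fin.val_castSucc, val_succ, Equiv.refl_symm, Equiv.refl_apply]
  split_ifs <;> omega

/-- Exchanging two neighbouring edges. -/
def edgeSwap (i : Fin E) (n : ℕ) : Perm (Ends (E + 1) n) :=
  sumCongr (Equiv.prodCongr (swap i.castSucc i.succ) (.refl _)) 1

theorem koszulSign_edgeSwap (i : Fin E) (p : Ends (E + 1) n → ZMod 2) :
    koszulSign p endRank (endRank ∘ (edgeSwap i n).symm) =
      sgn ((p (.inl (i.castSucc, 0)) + p (.inl (i.castSucc, 1))) *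
        (p (.inl (i.succ, 0)) + p (.inl (i.succ, 1)))) := by
  rw [koszulSign_rectangle p {.inl (i.castSucc, 0), .inl (i.castSucc, 1)}
    {.inl (i.succ, 0), .inl (i.succ, 1)}, sum_pair (by simp), sum_pair (by simp)]
  have key : ∀ e : Fin (E + 1) × Fin 2, endRank ((edgeSwap i n).symm (.inl e)) =
      2 * (if (e.1 : ℕ) = i then (i : ℕ) + 1 else if (e.1 : ℕ) = i + 1 then i else e.1) + e.2 := by
    intro e
    rw [← val_swap_castSucc_succ i e.1]
    rfl
  have key2 : ∀ x : Fin n, endRank ((edgeSwap i n).symm (.inr x)) = 2 * (E + 1) + x := fun x => rfl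
  have k1 : ∀ e : Fin (E + 1) × Fin 2, endRank (n := n) (.inl e) = 2 * e.1 + e.2 := fun _ => rfl
  have k2 : ∀ x : Fin n, endRank (E := E + 1) (.inr x) = 2 * (E + 1) + x := fun _ => rfl
  rintro (⟨x, b⟩ | x) (⟨y, c⟩ | y) <;>
    simp only [comp_apply, key, key2, k1, k2, mem_insert, mem_singleton,
      Sum.inl.injEq, Prod.mk.injEq, ext_iff, Fin.val_castSucc, val_succ, reduceCtorEq,
      or_self, and_false, false_and, iff_false]
  · have hb := b.isLt
    have hc := c.isLt
    simp only [Fin.val_zero, Fin.val_one]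
    split_ifs <;> omega
  · split_ifs <;> omega
  · split_ifs <;> omega
  · omega

theorem koszulSign_edgeFlip (e : Fin E) (p : Ends E n → ZMod 2) :
    koszulSign p endRank (endRank ∘ (swap (.inl (e, 0)) (.inl (e, 1)) : Perm (Ends E n)).symm) =
      sgn (p (.inl (e, 0)) * p (.inl (e, 1))) := by
  rw [koszulSign_rectangle p {.inl (e, 0)} {.inl (e, 1)}, sum_singleton, sum_singleton]
  have key : ∀ x : Ends E n, endRank (swap (.inl (e, 0)) (.inl (e, 1)) x) =
      if x = .inl (e, 0) then endRank (.inl (e, 1) : Ends E n) else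
        if x = .inl (e, 1) then endRank (.inl (e, 0) : Ends E n) else endRank x := by
    intro x
    rw [swap_apply_def]
    split_ifs <;> rfl
  intro x y
  have hx := endRank_injective.eq_iff (a := x) (b := .inl (e, 0))
  have hx' := endRank_injective.eq_iff (a := x) (b := .inl (e, 1))
  have hy := endRank_injective.eq_iff (a := y) (b := .inl (e, 0))
  have hy' := endRank_injective.eq_iff (a := y) (b := .inl (e, 1))
  have r0 : endRank (.inl (e, 0) : Ends E n) = 2 * e := rfl
  have r1 : endRank (.inl (e, 1) : Ends E n) = 2 * e + 1 := rfl
  simp only [comp_apply, Equiv.symm_swap, key, mem_singleton, ← hx, ← hx', ← hy, ← hy', r0, r1]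
  split_ifs <;> omega

/-- Rotating one vertex. -/
def vertexRot (i : Fin V) : Perm (Flags V) where
  toFun x := (x.1, if x.1 = i then x.2 + 1 else x.2)
  invFun x := (x.1, if x.1 = i then x.2 - 1 else x.2)
  left_inv x := by
    by_cases h : x.1 = i
    · simp [h]; rw [← h]
    · simp [h]
  right_inv x := by
    by_cases h : x.1 = i
    · simp [h]; rw [← h]
    · simp [h]

theorem koszulSign_vertexRot (i : Fin V) (p : Flags V → ZMod 2) :
    koszulSign p flagRank (flagRank ∘ (vertexRot i).symm) =
      sgn (p (i, 0) * (p (i, 1) + p (i, 2))) := by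
  rw [koszulSign_rectangle p {(i, 0)} {(i, 1), (i, 2)}, sum_singleton, sum_pair (by simp)]
  have key : ∀ x, flagRank ((vertexRot i).symm x) =
      3 * (x.1 : ℕ) + if x.1 = i then ((x.2 - 1 : Fin 3) : ℕ) else x.2 := by
    intro x
    change 3 * (x.1 : ℕ) + ((if x.1 = i then x.2 - 1 else x.2 : Fin 3) : ℕ) = _
    split_ifs <;> rfl
  have sub : ∀ b : Fin 3, ((b - 1 : Fin 3) : ℕ) =
      if (b : ℕ) = 0 then 2 else (b : ℕ) - 1 := by decide
  rintro ⟨x, b⟩ ⟨y, c⟩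
  have hb := b.isLt
  have hc := c.isLt
  simp only [comp_apply, key]
  simp only [sub, flagRank, mem_insert, mem_singleton,
    Prod.mk.injEq, ext_iff, Fin.val_zero, Fin.val_one, Fin.val_two]
  split_ifs <;> omega

end Koszul

section Invariance

variable {k : Type u} [Field k] {K : Type*} {V E n : ℕ} {Y : Type}
  {W : Coef k} {par : K → ZMod 2} {m : K → K → K → k} {τ : Fin E → K → K → k}

theorem rotOf_conj (g : Perm (Flags V)) (hg : Commute g (shift V 3)) (α : Flags V ≃ Y) :
    rotOf (g.trans α) = rotOf α := by
  ext y
  obtain ⟨x, rfl⟩ := (g.trans α).surjective y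
  rw [rotOf_apply]
  have h2 : (g.trans α) (x.1, x.2 + 1) = α (shift V 3 (g x)) := by
    change α (g (shift V 3 x)) = _
    rw [← mul_apply, hg.eq]; rfl
  rw [h2]
  simp [rotOf, permCongr_apply]

theorem commute_vertexSwap (i : Fin V) : Commute (vertexSwap i) (shift (V + 1) 3) := by
  ext x <;> rfl

theorem commute_vertexRot (i : Fin V) : Commute (vertexRot i) (shift V 3) := by
  refine Equiv.ext fun x => ?_
  change (x.1, if x.1 = i then x.2 + 1 + 1 else x.2 + 1) =
    (x.1, (if x.1 = i then x.2 + 1 else x.2) + 1)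
  split_ifs <;> rfl

theorem vertProd_vertexSwap (i : Fin V) (α : Flags (V + 1) ≃ Y) :
    vertProd W ((vertexSwap i).trans α) = (sgn W.c : k) • vertProd W α := by
  unfold vertProd
  rw [rotOf_conj _ (commute_vertexSwap i),
    ← prod_ofFn_swap (fun i => W.vec (rotOf α) (α (i, 0))) (fun _ _ => W.vec_comm _ _ _)]
  rfl

theorem vertProd_vertexRot (i : Fin V) (α : Flags V ≃ Y) :
    vertProd W ((vertexRot i).trans α) = vertProd W α := by
  unfold vertProd
  rw [rotOf_conj _ (commute_vertexRot i)]
  congr 2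
  funext j
  exact W.vec_congr ((sameCycle_rotOf_iff α _ _).mpr rfl)

theorem sgn_mul_self_cast (a : ZMod 2) : (sgn a : k) * (sgn a : k) = 1 := by
  rw [← Int.cast_mul, sgn_mul_self, Int.cast_one]

theorem zmod_two_mul_self (a : ZMod 2) : a * a = a := by
  revert a; decide

theorem term_vertexSwap [Fintype Y] {c : ZMod 2} (hm : IsCyclicTensor par c m)
    (i : Fin V) (α : Flags (V + 1) ≃ Y) (β : Ends E n ≃ Y) (a : Fin n → K → k) (φ : Y → K) :
    term par m τ ((vertexSwap i).trans α) β a φ = (sgn c : k) * term par m τ α β a φ := by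
  unfold term
  rw [koszulSign_vertex_change, koszulSign_vertexSwap]
  have e1 : (∏ j, m (φ (((vertexSwap i).trans α) (j, 0))) (φ (((vertexSwap i).trans α) (j, 1)))
      (φ (((vertexSwap i).trans α) (j, 2)))) =
      ∏ j, m (φ (α (j, 0))) (φ (α (j, 1))) (φ (α (j, 2))) :=
    Equiv.prod_comp (swap i.castSucc i.succ) fun j => m (φ (α (j, 0))) (φ (α (j, 1))) (φ (α (j, 2)))
  rw [e1]
  by_cases h0 : (∏ j, m (φ (α (j, 0))) (φ (α (j, 1))) (φ (α (j, 2)))) = 0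
  · rw [h0]; ring
  · replace h0 := prod_ne_zero_iff.mp h0
    have hp : ∀ j, ∑ b, ((par ∘ φ) ∘ α) (j, b) = c := fun j => by
      rw [Fin.sum_univ_three]
      exact hm.parity _ _ _ (h0 j (mem_univ _))
    rw [hp, hp, zmod_two_mul_self]
    push_cast
    ring

theorem term_vertexRot [Fintype Y] {c : ZMod 2} (hm : IsCyclicTensor par c m)
    (i : Fin V) (α : Flags V ≃ Y) (β : Ends E n ≃ Y) (a : Fin n → K → k) (φ : Y → K) :
    term par m τ ((vertexRot i).trans α) β a φ = term par m τ α β a φ := by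
  unfold term
  rw [koszulSign_vertex_change, koszulSign_vertexRot]
  have e1 : ∀ j b, ((vertexRot i).trans α) (j, b) = α (j, if j = i then b + 1 else b) :=
    fun j b => rfl
  have e2 : (∏ j, m (φ (((vertexRot i).trans α) (j, 0))) (φ (((vertexRot i).trans α) (j, 1)))
      (φ (((vertexRot i).trans α) (j, 2)))) =
      (sgn (((par ∘ φ) ∘ α) (i, 0) * (((par ∘ φ) ∘ α) (i, 1) + ((par ∘ φ) ∘ α) (i, 2))) : k) *
      ∏ j, m (φ (α (j, 0))) (φ (α (j, 1))) (φ (α (j, 2))) := by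
    simp only [e1]
    rw [← mul_prod_erase _ _ (mem_univ i), ← mul_prod_erase _
      (fun j => m (φ (α (j, 0))) (φ (α (j, 1))) (φ (α (j, 2)))) (mem_univ i), ← mul_assoc]
    congr 1
    · simp only [if_true, zero_add]
      rw [hm.cyclic (φ (α (i, 0)))]
      simp only [comp_apply]
      rw [← mul_assoc, sgn_mul_self_cast, one_mul]
      rfl
    · refine prod_congr rfl fun j hj => ?_
      simp only [if_neg (ne_of_mem_erase hj)]
  rw [e2]
  push_cast
  linear_combination ((koszulSign (par ∘ φ) (endRank ∘ β.symm) (flagRank ∘ α.symm) : k) *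
    (∏ j, m (φ (α (j, 0))) (φ (α (j, 1))) (φ (α (j, 2)))) *
    (∏ e, τ e (φ (β (.inl (e, 0)))) (φ (β (.inl (e, 1))))) *
    ∏ x, a x (φ (β (.inr x)))) * sgn_mul_self_cast (k := k)
      (((par ∘ φ) ∘ α) (i, 0) * (((par ∘ φ) ∘ α) (i, 1) + ((par ∘ φ) ∘ α) (i, 2)))

theorem edgeList_pair_nodup (β : Ends E n ≃ Y) {i j : Fin E} (h : i ≠ j) :
    [β (.inl (i, 0)), β (.inl (i, 1)), β (.inl (j, 0)), β (.inl (j, 1))].Nodup := by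
  simp [h]

variable [Fintype Y] [DecidableEq Y]

theorem oterm_vertexSwap (hm : IsCyclicTensor par W.c m) (i : Fin V) (α : Flags (V + 1) ≃ Y)
    (β : Ends E n ≃ Y) (a : Fin n → K → k) (φ : Y → K) :
    oterm W par m τ ((vertexSwap i).trans α) β a φ = oterm W par m τ α β a φ := by
  unfold oterm orient
  rw [term_vertexSwap hm]
  rw [vertProd_vertexSwap, rotOf_conj _ (commute_vertexSwap i), glueList_smul, smul_smul,
    mul_comm, ← mul_assoc, sgn_mul_self_cast, one_mul]

theorem oterm_vertexRot (hm : IsCyclicTensor par W.c m) (i : Fin V) (α : Flags V ≃ Y)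
    (β : Ends E n ≃ Y) (a : Fin n → K → k) (φ : Y → K) :
    oterm W par m τ ((vertexRot i).trans α) β a φ = oterm W par m τ α β a φ := by
  unfold oterm orient
  rw [term_vertexRot hm, vertProd_vertexRot, rotOf_conj _ (commute_vertexRot i)]

theorem oterm_edgeSwap {τ : Fin (E + 1) → K → K → k} {P : Fin (E + 1) → ZMod 2}
    (hτ : ∀ e x y, τ e x y ≠ 0 → par x + par y = P e) (i : Fin E) (α : Flags V ≃ Y)
    (β : Ends (E + 1) n ≃ Y) (a : Fin n → K → k) (φ : Y → K) :
    oterm W par m (τ ∘ swap i.castSucc i.succ) α ((edgeSwap i n).trans β) a φ =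
      (sgn (P i.castSucc * P i.succ + W.c) : k) • oterm W par m τ α β a φ := by
  have ht : term par m (τ ∘ swap i.castSucc i.succ) α ((edgeSwap i n).trans β) a φ =
      (sgn (P i.castSucc * P i.succ) : k) * term par m τ α β a φ := by
    unfold term
    rw [koszulSign_edge_change, koszulSign_edgeSwap]
    have e1 : (∏ e, (τ ∘ swap i.castSucc i.succ) e (φ (((edgeSwap i n).trans β) (.inl (e, 0))))
        (φ (((edgeSwap i n).trans β) (.inl (e, 1))))) =
        ∏ e, τ e (φ (β (.inl (e, 0)))) (φ (β (.inl (e, 1)))) :=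
      Equiv.prod_comp (swap i.castSucc i.succ)
        fun e => τ e (φ (β (.inl (e, 0)))) (φ (β (.inl (e, 1))))
    have e2 : ∀ x, ((edgeSwap i n).trans β) (.inr x) = β (.inr x) := fun x => rfl
    simp only [e1, e2]
    by_cases h0 : (∏ e, τ e (φ (β (.inl (e, 0)))) (φ (β (.inl (e, 1))))) = 0
    · rw [h0]; ring
    · replace h0 := prod_ne_zero_iff.mp h0
      have hp := fun e => hτ e _ _ (h0 e (mem_univ _))
      simp only [comp_apply]
      rw [hp, hp]
      push_cast
      ring
  have ho : orient W α ((edgeSwap i n).trans β) = (sgn W.c : k) • orient W α β := by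
    unfold orient edgeList
    rw [← glueList_ofFn_swap _ (fun i j h => edgeList_pair_nodup β h) (by simp) i
      (vertProd_mem_line α)]
    rfl
  unfold oterm
  rw [ht, ho, smul_smul, smul_smul, sgn_add]
  congr 1
  push_cast
  ring

theorem weight_edgeSwap [Fintype K] {τ : Fin (E + 1) → K → K → k} {P : Fin (E + 1) → ZMod 2}
    (hτ : ∀ e x y, τ e x y ≠ 0 → par x + par y = P e) (i : Fin E) (α : Flags V ≃ Y)
    (β : Ends (E + 1) n ≃ Y) (a : Fin n → K → k) :
    weight W par m (τ ∘ swap i.castSucc i.succ) α ((edgeSwap i n).trans β) a =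
      (sgn (P i.castSucc * P i.succ + W.c) : k) • weight W par m τ α β a := by
  rw [weight_eq_res, weight_eq_res, oweight_eq_sum, oweight_eq_sum, ← map_smul, smul_sum]
  simp only [oterm_edgeSwap hτ]
  rfl

theorem oterm_edgeFlip (e : Fin E) (hτ : IsEdgeTensor par W.c (τ e)) (α : Flags V ≃ Y)
    (β : Ends E n ≃ Y) (a : Fin n → K → k) (φ : Y → K) :
    oterm W par m τ α ((swap (.inl (e, 0)) (.inl (e, 1)) : Perm (Ends E n)).trans β) a φ =
      oterm W par m τ α β a φ := by
  set g : Perm (Ends E n) := swap (.inl (e, 0)) (.inl (e, 1)) with hg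
  have g0 : g (.inl (e, 0)) = .inl (e, 1) := swap_apply_left _ _
  have g1 : g (.inl (e, 1)) = .inl (e, 0) := Equiv.swap_apply_right _ _
  have gne : ∀ j b, j ≠ e → g (.inl (j, b)) = .inl (j, b) := fun j b h =>
    swap_apply_of_ne_of_ne (by simp [h]) (by simp [h])
  have gr : ∀ x, g (.inr x) = .inr x := fun x => swap_apply_of_ne_of_ne (by simp) (by simp)
  have ht : term par m τ α (g.trans β) a φ = (sgn W.c : k) * term par m τ α β a φ := by
    unfold term
    rw [koszulSign_edge_change, hg, koszulSign_edgeFlip, ← hg]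
    have e1 : (∏ j, τ j (φ ((g.trans β) (.inl (j, 0)))) (φ ((g.trans β) (.inl (j, 1))))) =
        (sgn (((par ∘ φ) ∘ β) (.inl (e, 0)) * ((par ∘ φ) ∘ β) (.inl (e, 1)) + W.c) : k) *
        ∏ j, τ j (φ (β (.inl (j, 0)))) (φ (β (.inl (j, 1)))) := by
      rw [← mul_prod_erase _ _ (mem_univ e), ← mul_prod_erase _
        (fun j => τ j (φ (β (.inl (j, 0)))) (φ (β (.inl (j, 1))))) (mem_univ e), ← mul_assoc]
      congr 1
      · simp only [trans_apply, g0, g1]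
        rw [hτ.symm, mul_comm (par _)]
        rfl
      · refine prod_congr rfl fun j hj => ?_
        simp only [trans_apply, gne j _ (ne_of_mem_erase hj)]
    rw [e1, sgn_add]
    simp only [trans_apply, gr]
    push_cast
    linear_combination ((koszulSign (par ∘ φ) (endRank ∘ β.symm) (flagRank ∘ α.symm) : k) *
      (∏ j, m (φ (α (j, 0))) (φ (α (j, 1))) (φ (α (j, 2)))) *
      (∏ e, τ e (φ (β (.inl (e, 0)))) (φ (β (.inl (e, 1))))) *
      (∏ x, a x (φ (β (.inr x)))) * (sgn W.c : k)) * sgn_mul_self_cast (k := k)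
        (((par ∘ φ) ∘ β) (.inl (e, 0)) * ((par ∘ φ) ∘ β) (.inl (e, 1)))
  have ho : orient W α (g.trans β) = (sgn W.c : k) • orient W α β := by
    unfold orient edgeList
    rw [← glueList_ofFn_flip _ _ (by simp) e _ _ (vertProd_mem_line α)]
    · simp [g0, g1]
    · intro j hj; simp [gne j _ hj]
  unfold oterm
  rw [ht, ho, smul_smul, mul_right_comm, sgn_mul_self_cast, one_mul]

end Invariance

/-! ### The symmetry group of the vertices and the edges -/

section Wreath

variable {V r : ℕ} [NeZero r]

/-- Permuting the blocks by `π`, after a shift in each of them. -/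
def wreath (π : Perm (Fin V)) (s : Fin V → Fin r) : Perm (Fin V × Fin r) where
  toFun x := (π x.1, x.2 + s x.1)
  invFun x := (π.symm x.1, x.2 - s (π.symm x.1))
  left_inv x := by simp
  right_inv x := by simp

theorem wreath_apply (π : Perm (Fin V)) (s : Fin V → Fin r) (x : Fin V × Fin r) :
    wreath π s x = (π x.1, x.2 + s x.1) := rfl

theorem wreath_mul (π π' : Perm (Fin V)) (s s' : Fin V → Fin r) :
    wreath π s * wreath π' s' = wreath (π * π') (s' + s ∘ π') := by
  ext x
  · rfl
  · simp [wreath_apply, add_assoc]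

theorem wreath_one : wreath (1 : Perm (Fin V)) (0 : Fin V → Fin r) = 1 := by
  ext x <;> simp [wreath_apply]

theorem commute_wreath (π : Perm (Fin V)) (s : Fin V → Fin r) :
    Commute (wreath π s) (shift V r) := by
  refine Equiv.ext fun x => ?_
  simp [wreath_apply, shift_apply, add_right_comm]

theorem exists_wreath (hr : ∀ i : Fin r, (i : ℕ) • (1 : Fin r) = i) {g : Perm (Fin V × Fin r)}
    (hg : Commute g (shift V r)) : ∃ π s, g = wreath π s := by
  have key : ∀ (b : ℕ) (v : Fin V), g (v, b • (1 : Fin r)) =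
      ((g (v, 0)).1, b • (1 : Fin r) + (g (v, 0)).2) := by
    intro b v
    induction b with
    | zero => simp
    | succ b ih =>
      have := congrFun (congrArg DFunLike.coe hg.eq) (v, b • (1 : Fin r))
      rw [mul_apply, mul_apply, shift_apply, shift_apply, ih] at this
      rw [succ_nsmul, this]
      simp only [add_right_comm]
  have key' : ∀ x, g x = ((g (x.1, 0)).1, x.2 + (g (x.1, 0)).2) := fun x => by
    rw [← hr x.2, ← key, hr]
  have surj : Function.Surjective fun v => (g (v, 0)).1 := fun w => by
    obtain ⟨x, hx⟩ := g.surjective (w, 0)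
    rw [key'] at hx
    exact ⟨x.1, congrArg Prod.fst hx⟩
  exact ⟨ofBijective _ (Finite.surjective_iff_bijective.mp surj), fun v => (g (v, 0)).2,
    Equiv.ext key'⟩

theorem wreath_injective (hr : ∀ i : Fin r, (i : ℕ) • (1 : Fin r) = i) :
    Function.Bijective fun x : Perm (Fin V) × (Fin V → Fin r) =>
      (⟨wreath x.1 x.2, commute_wreath x.1 x.2⟩ : {g // Commute g (shift V r)}) := by
  constructor
  · rintro ⟨π, s⟩ ⟨π', s'⟩ h
    have h' : ∀ v, wreath π s (v, 0) = wreath π' s' (v, 0) := fun v =>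
      congrFun (congrArg DFunLike.coe (congrArg Subtype.val h)) _
    simp only [wreath_apply, Prod.mk.injEq, zero_add] at h'
    exact Prod.ext (Equiv.ext fun v => (h' v).1) (funext fun v => (h' v).2)
  · rintro ⟨g, hg⟩
    obtain ⟨π, s, rfl⟩ := exists_wreath hr hg
    exact ⟨(π, s), rfl⟩

theorem card_commute_shift (hr : ∀ i : Fin r, (i : ℕ) • (1 : Fin r) = i) :
    Nat.card {g : Perm (Fin V × Fin r) // Commute g (shift V r)} = V.factorial * r ^ V := by
  rw [← Nat.card_congr (ofBijective _ (wreath_injective hr)), Nat.card_prod, Nat.card_perm,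
    Nat.card_eq_fintype_card, card_fin, Nat.card_eq_fintype_card, Fintype.card_fun,
    card_fin, card_fin]

theorem perm_fin_induction {n : ℕ} {P : Perm (Fin (n + 1)) → Prop} (one : P 1)
    (mul : ∀ g h, P g → P h → P (g * h)) (hs : ∀ i : Fin n, P (swap i.castSucc i.succ))
    (π : Perm (Fin (n + 1))) : P π := by
  have hm : π ∈ Submonoid.closure (range fun i : Fin n => swap i.castSucc i.succ) := by
    rw [Perm.mclosure_swap_castSucc_succ]; trivial
  induction hm using Submonoid.closure_induction with
  | mem x hx => obtain ⟨i, rfl⟩ := hx; exact hs i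
  | one => exact one
  | mul x y _ _ hx hy => exact mul x y hx hy

theorem wreath_induction (hr : ∀ i : Fin r, (i : ℕ) • (1 : Fin r) = i)
    {P : Perm (Fin V × Fin r) → Prop} (one : P 1) (mul : ∀ g h, P g → P h → P (g * h))
    (hrot : ∀ i, P (wreath 1 (Pi.single i 1))) (hperm : ∀ π, P (wreath π 0))
    {g : Perm (Fin V × Fin r)} (hg : Commute g (shift V r)) : P g := by
  classical
  obtain ⟨π, s, rfl⟩ := exists_wreath hr hg
  have h1 : ∀ (n : ℕ) i, P (wreath 1 (n • Pi.single i 1)) := by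
    intro n i
    induction n with
    | zero => rw [zero_smul, wreath_one]; exact one
    | succ n ih =>
      have := mul _ _ ih (hrot i)
      rwa [wreath_mul, mul_one, Perm.coe_one, comp_id, add_comm, ← succ_nsmul] at this
  have h2 : ∀ t : Finset (Fin V), P (wreath 1 (∑ i ∈ t, (s i : ℕ) • Pi.single i 1)) := by
    intro t
    induction t using Finset.induction_on with
    | empty => rw [Finset.sum_empty, wreath_one]; exact one
    | insert a t ha ih =>
      have := mul _ _ ih (h1 (s a) a)
      rw [sum_insert ha]
      rwa [wreath_mul, mul_one, Perm.coe_one, comp_id] at this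
  have h3 := h2 univ
  have e : (∑ i, (s i : ℕ) • (Pi.single i 1 : Fin V → Fin r)) = s := by
    funext j
    rw [Finset.sum_apply, sum_eq_single j]
    · simp [hr]
    · intro b _ hb; simp [hb.symm]
    · simp
  rw [e] at h3
  have := mul _ _ (hperm π) h3
  rwa [wreath_mul, mul_one, Pi.zero_comp, add_zero] at this

end Wreath

theorem fin_two_nsmul_one (i : Fin 2) : (i : ℕ) • (1 : Fin 2) = i := by
  revert i; decide

theorem fin_three_nsmul_one (i : Fin 3) : (i : ℕ) • (1 : Fin 3) = i := by
  revert i; decide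

section Invariance

variable {k : Type u} [Field k] {K : Type*} {V E n : ℕ} {Y : Type}
  {W : Coef k} {par : K → ZMod 2} {m : K → K → K → k} {τ : Fin E → K → K → k} {t : K → K → k}

theorem vertexRot_eq_wreath (i : Fin V) : vertexRot i = wreath 1 (Pi.single i 1) := by
  refine Equiv.ext fun x => ?_
  change (x.1, if x.1 = i then x.2 + 1 else x.2) = (x.1, x.2 + (Pi.single i 1 : Fin V → Fin 3) x.1)
  by_cases h : x.1 = i
  · rw [h]; simp
  · simp [h]

theorem vertexSwap_eq_wreath (i : Fin V) : vertexSwap i = wreath (swap i.castSucc i.succ) 0 := by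
  refine Equiv.ext fun x => ?_
  change _ = (swap i.castSucc i.succ x.1, x.2 + 0)
  rw [add_zero]
  rfl

theorem exists_commute_of_rotOf_eq {α α' : Flags V ≃ Y} (h : rotOf α' = rotOf α) :
    ∃ g, Commute g (shift V 3) ∧ α' = g.trans α := by
  refine ⟨α'.trans α.symm, ?_, by ext; simp⟩
  refine Equiv.ext fun x => ?_
  apply α.injective
  have h1 : α (shift V 3 (α.symm (α' x))) = rotOf α (α' x) := by
    simp [rotOf, permCongr_apply]
  have h2 : α' (shift V 3 x) = rotOf α' (α' x) := by
    simp [rotOf, permCongr_apply]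
  simp only [mul_apply, trans_apply, apply_symm_apply]
  rw [h1, h2, h]

theorem exists_commute_of_invOf_eq {β β' : Ends E n ≃ Y} (h : invOf β' = invOf β)
    (hl : legOf β' = legOf β) :
    ∃ g, Commute g (shift E 2) ∧ β' = (sumCongr g 1 : Perm (Ends E n)).trans β := by
  set f : Perm (Ends E n) := β'.trans β.symm with hf
  have fr : ∀ x, f (.inr x) = .inr x := fun x => by
    have : β' (.inr x) = β (.inr x) := congrFun hl x
    simp [hf, this]
  have fm : Set.MapsTo f (range Sum.inl) (range Sum.inl) := by
    rintro _ ⟨x, rfl⟩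
    rcases hx : f (.inl x) with y | y
    · exact ⟨y, rfl⟩
    · have := f.injective (hx.trans (fr y).symm)
      simp at this
  obtain ⟨⟨g, g'⟩, hg⟩ := Perm.mem_sumCongrHom_range_of_perm_mapsTo_inl fm
  have hgf : f = sumCongr g g' := hg.symm
  have hg' : g' = 1 := by
    ext x
    have := fr x
    rw [hgf] at this
    simp at this
    simp [this]
  subst hg'
  refine ⟨g, ?_, ?_⟩
  · refine Equiv.ext fun x => ?_
    have h1 : ∀ y, β (Sum.inl (g y)) = β' (.inl y) := fun y => by
      have : f (.inl y) = .inl (g y) := by rw [hgf]; rfl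
      rw [← this, hf]; simp
    have h2 : ∀ (β : Ends E n ≃ Y) y, β (.inl (shift E 2 y)) = invOf β (β (.inl y)) := fun β y =>
      (invOf_inl β y.1 y.2).symm
    apply inl_injective
    apply β.injective
    rw [mul_apply, mul_apply, h1, h2, h2, h1, h]
  · rw [← hgf, hf]; ext; simp

variable [Fintype Y] [DecidableEq Y]

theorem oterm_vertex_symm (hm : IsCyclicTensor par W.c m) {α α' : Flags V ≃ Y}
    (h : rotOf α' = rotOf α) (β : Ends E n ≃ Y) (a : Fin n → K → k) (φ : Y → K) :
    oterm W par m τ α' β a φ = oterm W par m τ α β a φ := by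
  obtain ⟨g, hg, rfl⟩ := exists_commute_of_rotOf_eq h
  clear h
  have mul : ∀ g h : Perm (Flags V),
      (∀ α, oterm W par m τ (g.trans α) β a φ = oterm W par m τ α β a φ) →
      (∀ α, oterm W par m τ (h.trans α) β a φ = oterm W par m τ α β a φ) →
      ∀ α, oterm W par m τ ((g * h).trans α) β a φ = oterm W par m τ α β a φ :=
    fun g h hg hh α => by
      have : (g * h).trans α = h.trans (g.trans α) := rfl
      rw [this, hh, hg]
  suffices hh : ∀ α : Flags V ≃ Y, oterm W par m τ (g.trans α) β a φ = oterm W par m τ α β a φ from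
    hh _
  refine wreath_induction (P := fun g => ∀ α, oterm W par m τ (g.trans α) β a φ =
    oterm W par m τ α β a φ) fin_three_nsmul_one (fun α => rfl) mul ?_ ?_ hg
  · intro i α
    rw [← vertexRot_eq_wreath, oterm_vertexRot hm]
  · intro π
    cases V with
    | zero =>
      intro α
      congr 1
      exact Equiv.ext fun x => x.1.elim0
    | succ V =>
      refine perm_fin_induction (P := fun π => ∀ α, oterm W par m τ ((wreath π 0).trans α) β a φ =
        oterm W par m τ α β a φ) ?_ ?_ ?_ π
      · intro α; rw [wreath_one]; rfl
      · intro g h hg hh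
        have := mul _ _ hg hh
        rwa [wreath_mul, Pi.zero_comp, add_zero] at this
      · intro i α
        rw [← vertexSwap_eq_wreath, oterm_vertexSwap hm]

theorem oterm_edge_symm (ht : IsEdgeTensor par W.c t) (α : Flags V ≃ Y)
    {β β' : Ends E n ≃ Y} (h : invOf β' = invOf β) (hl : legOf β' = legOf β)
    (a : Fin n → K → k) (φ : Y → K) :
    oterm W par m (fun _ => t) α β' a φ = oterm W par m (fun _ => t) α β a φ := by
  obtain ⟨g, hg, rfl⟩ := exists_commute_of_invOf_eq h hl
  clear h hl
  set P : Perm (Fin E × Fin 2) → Prop := fun g => ∀ β : Ends E n ≃ Y,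
    oterm W par m (fun _ => t) α ((sumCongr g 1 : Perm (Ends E n)).trans β) a φ =
    oterm W par m (fun _ => t) α β a φ
  have one : P 1 := fun β => by rw [Perm.sumCongr_one]; rfl
  have mul : ∀ g h, P g → P h → P (g * h) := fun g h hg hh β => by
    have : (sumCongr (g * h) 1 : Perm (Ends E n)).trans β =
        (sumCongr h 1 : Perm (Ends E n)).trans ((sumCongr g 1 : Perm (Ends E n)).trans β) := by
      ext x; rcases x with x | x <;> rfl
    rw [this, hh, hg]
  suffices hh : P g from hh _
  refine wreath_induction (P := P) fin_two_nsmul_one one mul ?_ ?_ hg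
  · intro i β
    have e : (sumCongr (wreath 1 (Pi.single i 1)) 1 : Perm (Ends E n)) =
        swap (.inl (i, 0)) (.inl (i, 1)) := by
      refine Equiv.ext fun x => ?_
      rcases x with ⟨j, b⟩ | x
      · have e1 : (sumCongr (wreath 1 (Pi.single i 1)) 1 : Perm (Ends E n)) (.inl (j, b)) =
          .inl (j, b + (Pi.single i 1 : Fin E → Fin 2) j) := rfl
        rw [e1]
        by_cases hj : j = i
        · subst hj
          fin_cases b <;> simp
        · rw [swap_apply_of_ne_of_ne (by simp [hj]) (by simp [hj])]
          simp [hj]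
      · rw [swap_apply_of_ne_of_ne (by simp) (by simp)]; rfl
    rw [e, oterm_edgeFlip i ht]
  · intro π
    cases E with
    | zero =>
      intro β
      congr 1
      refine Equiv.ext fun x => ?_
      rcases x with x | x
      · exact x.1.elim0
      · rfl
    | succ E =>
      refine perm_fin_induction (P := fun π => P (wreath π 0)) ?_ ?_ ?_ π
      · rw [wreath_one]; exact one
      · intro g h hg hh
        have := mul _ _ hg hh
        rwa [wreath_mul, Pi.zero_comp, add_zero] at this
      · intro i β
        have e : (sumCongr (wreath (swap i.castSucc i.succ) 0) 1 : Perm (Ends (E + 1) n)) =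
            edgeSwap i n := by
          refine Equiv.ext fun x => ?_
          rcases x with x | x
          · simp [edgeSwap, wreath_apply, Prod.map]
          · rfl
        have := oterm_edgeSwap (W := W) (m := m) (τ := fun _ => t) (P := fun _ => W.c)
          (fun _ => ht.parity) i α β a φ
        rw [zmod_two_mul_self, CharTwo.add_self_eq_zero, sgn_zero, Int.cast_one, one_smul] at this
        rw [e]
        exact this

theorem oweight_vertex_symm [Fintype K] (hm : IsCyclicTensor par W.c m) {α α' : Flags V ≃ Y}
    (h : rotOf α' = rotOf α) (β : Ends E n ≃ Y) (a : Fin n → K → k) :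
    oweight W par m τ α' β a = oweight W par m τ α β a := by
  simp only [oweight_eq_sum, oterm_vertex_symm hm h]

theorem weight_vertex_symm [Fintype K] (hm : IsCyclicTensor par W.c m) {α α' : Flags V ≃ Y}
    (h : rotOf α' = rotOf α) (β : Ends E n ≃ Y) (a : Fin n → K → k) :
    weight W par m τ α' β a = weight W par m τ α β a := by
  rw [weight_eq_res, weight_eq_res, oweight_vertex_symm hm h]

theorem oweight_edge_symm [Fintype K] (ht : IsEdgeTensor par W.c t) (α : Flags V ≃ Y)
    {β β' : Ends E n ≃ Y} (h : invOf β' = invOf β) (hl : legOf β' = legOf β)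
    (a : Fin n → K → k) :
    oweight W par m (fun _ => t) α β' a = oweight W par m (fun _ => t) α β a := by
  simp only [oweight_eq_sum, oterm_edge_symm ht α h hl]

end Invariance

/-! ### Insertion of an odd operator at a flag -/

theorem sum_update_swap {Y K M : Type*} [Fintype Y] [DecidableEq Y] [Fintype K]
    [AddCommMonoid M] (f : Y) (G : (Y → K) → (Y → K) → M) :
    ∑ φ, ∑ y, G φ (update φ f y) = ∑ φ, ∑ y, G (update φ f y) φ := by
  classical
  rw [← sum_prod_type', ← sum_prod_type']
  refine Finset.sum_bij' (fun x _ => (update x.1 f x.2, x.1 f))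
    (fun x _ => (update x.1 f x.2, x.1 f)) ?_ ?_ ?_ ?_ ?_ <;> simp

theorem sum_filter_lt {Y Z : Type*} [Fintype Y] [Fintype Z] (g : Z ≃ Y) (r : Z → ℕ) (z : Z)
    (p : Y → ZMod 2) :
    ∑ y ∈ univ.filter (fun y => (r ∘ g.symm) y < (r ∘ g.symm) (g z)), p y =
      ∑ x, if r x < r z then p (g x) else 0 := by
  rw [sum_filter, ← g.sum_comp]
  simp

theorem flagRank_lt {V : ℕ} {i j : Fin V} {b d : Fin 3} :
    flagRank (i, b) < flagRank (j, d) ↔ i < j ∨ i = j ∧ b < d := by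
  simp only [flagRank, lt_def, ext_iff]
  omega

theorem endRank_inl_lt {E n : ℕ} {i j : Fin E} {b d : Fin 2} :
    endRank (.inl (i, b) : Ends E n) < endRank (.inl (j, d) : Ends E n) ↔
      i < j ∨ i = j ∧ b < d := by
  simp only [endRank, elim_inl, lt_def, ext_iff]
  omega

theorem endRank_inr_lt {E n : ℕ} {x y : Fin n} :
    endRank (.inr x : Ends E n) < endRank (.inr y : Ends E n) ↔ x < y := by
  simp only [endRank, elim_inr, lt_def]
  omega

theorem endRank_inl_lt_inr {E n : ℕ} (x : Fin E × Fin 2) (y : Fin n) :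
    endRank (.inl x : Ends E n) < endRank (.inr y : Ends E n) := by
  simp only [endRank, elim_inl, elim_inr]
  omega

section Insertion

variable {k : Type u} [Field k] {K : Type*} {V E n : ℕ} {Y : Type} [Fintype Y] [DecidableEq Y]
  [Fintype K]
  {par : K → ZMod 2} {m : K → K → K → k} {τ : Fin E → K → K → k} {t : K → K → k}
  {J : K → K → k} {α : Flags V ≃ Y} {β : Ends E n ≃ Y} {a : Fin n → K → k}

/-- The contraction with `J` inserted at the flag `f`, on the side of the vertex. -/
def vertexInsertion (par : K → ZMod 2) (m : K → K → K → k) (τ : Fin E → K → K → k)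
    (J : K → K → k) (α : Flags V ≃ Y) (β : Ends E n ≃ Y) (a : Fin n → K → k) (f : Y) (φ : Y → K) :
    k :=
  (koszulSign (par ∘ φ) (endRank ∘ β.symm) (flagRank ∘ α.symm) : k) *
    (sgn (∑ x ∈ univ.filter (fun x => (flagRank ∘ α.symm) x < (flagRank ∘ α.symm) f),
      par (φ x)) : k) *
    (∑ y, J y (φ f) * ∏ i, m (update φ f y (α (i, 0))) (update φ f y (α (i, 1)))
      (update φ f y (α (i, 2)))) *
    ((∏ e, τ e (φ (β (.inl (e, 0)))) (φ (β (.inl (e, 1))))) * ∏ x, a x (φ (β (.inr x))))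

/-- The contraction with `J` inserted at the flag `f`, on the side of the edge or leg. -/
def edgeInsertion (par : K → ZMod 2) (m : K → K → K → k) (τ : Fin E → K → K → k)
    (J : K → K → k) (α : Flags V ≃ Y) (β : Ends E n ≃ Y) (a : Fin n → K → k) (f : Y) (φ : Y → K) :
    k :=
  (koszulSign (par ∘ φ) (endRank ∘ β.symm) (flagRank ∘ α.symm) : k) *
    (sgn (∑ x ∈ univ.filter (fun x => (endRank ∘ β.symm) x < (endRank ∘ β.symm) f),
      par (φ x)) : k) *
    (∏ i, m (φ (α (i, 0))) (φ (α (i, 1))) (φ (α (i, 2)))) *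
    ∑ y, J (φ f) y * ((∏ e, τ e (update φ f y (β (.inl (e, 0))))
      (update φ f y (β (.inl (e, 1))))) * ∏ x, a x (update φ f y (β (.inr x))))

theorem sum_vertexInsertion (hJ : ∀ y x, J y x ≠ 0 → par y = par x + 1) (f : Y) :
    ∑ φ, vertexInsertion par m τ J α β a f φ = ∑ φ, edgeInsertion par m τ J α β a f φ := by
  set H : (Y → K) → (Y → K) → k := fun φ ψ =>
    (koszulSign (par ∘ φ) (endRank ∘ β.symm) (flagRank ∘ α.symm) : k) *
    (sgn (∑ x ∈ univ.filter (fun x => (flagRank ∘ α.symm) x < (flagRank ∘ α.symm) f),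
      par (φ x)) : k) *
    (J (ψ f) (φ f) * ∏ i, m (ψ (α (i, 0))) (ψ (α (i, 1))) (ψ (α (i, 2)))) *
    ((∏ e, τ e (φ (β (.inl (e, 0)))) (φ (β (.inl (e, 1))))) * ∏ x, a x (φ (β (.inr x)))) with hH
  have h1 : ∀ φ, vertexInsertion par m τ J α β a f φ = ∑ y, H φ (update φ f y) := by
    intro φ
    simp only [hH, vertexInsertion, update_self]
    rw [mul_sum, sum_mul]
  have h2 : ∀ φ, edgeInsertion par m τ J α β a f φ = ∑ y, H (update φ f y) φ := by
    intro φ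
    unfold edgeInsertion
    rw [mul_sum]
    refine sum_congr rfl fun y _ => ?_
    simp only [hH, update_self]
    by_cases h0 : J (φ f) y = 0
    · rw [h0]; ring
    · have hp := hJ _ _ h0
      have hq : par y = par (φ f) + 1 := by rw [hp, add_assoc, CharTwo.add_self_eq_zero, add_zero]
      rw [koszulSign_parity_change (p := par ∘ φ) (p' := par ∘ update φ f y)
        (endRank_injective.comp β.symm.injective) (flagRank_injective.comp α.symm.injective) f
        (by simp [hq]) (fun x hx => by simp [hx])]
      have e : ∑ x ∈ univ.filter (fun x => (flagRank ∘ α.symm) x < (flagRank ∘ α.symm) f),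
          par (update φ f y x) =
          ∑ x ∈ univ.filter (fun x => (flagRank ∘ α.symm) x < (flagRank ∘ α.symm) f),
          par (φ x) := by
        refine sum_congr rfl fun x hx => ?_
        rw [update_of_ne]
        rintro rfl
        simp at hx
      rw [e]
      have hs := sgn_mul_self_cast (k := k) (∑ x ∈ univ.filter
        (fun x => (flagRank ∘ α.symm) x < (flagRank ∘ α.symm) f), par (φ x))
      simp only [comp_apply] at hs ⊢
      push_cast
      linear_combination (-(koszulSign (par ∘ φ) (endRank ∘ β.symm) (flagRank ∘ α.symm) : k) *
        (sgn (∑ x ∈ univ.filter (fun x => endRank (β.symm x) < endRank (β.symm f)),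
          par (φ x)) : k) * (J (φ f) y * ∏ i, m (φ (α (i, 0))) (φ (α (i, 1))) (φ (α (i, 2)))) *
        ((∏ e, τ e (update φ f y (β (.inl (e, 0)))) (update φ f y (β (.inl (e, 1))))) *
          ∏ x, a x (update φ f y (β (.inr x))))) * hs
  simp only [h1, h2]
  exact sum_update_swap f H

theorem sum_vertexInsertion_vertex
    (hinv : ∀ x y z, ∑ w, J w x * m w y z + (sgn (par x) : k) * ∑ w, J w y * m x w z +
      (sgn (par x + par y) : k) * ∑ w, J w z * m x y w = 0) (i : Fin V) (φ : Y → K) :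
    ∑ b, vertexInsertion par m τ J α β a (α (i, b)) φ = 0 := by
  set x := φ (α (i, 0)) with hx
  set y := φ (α (i, 1)) with hy
  set z := φ (α (i, 2)) with hz
  set R := ∏ j ∈ univ.erase i, m (φ (α (j, 0))) (φ (α (j, 1))) (φ (α (j, 2)))
  have hprod : ∀ b w, ∏ j, m (update φ (α (i, b)) w (α (j, 0)))
      (update φ (α (i, b)) w (α (j, 1))) (update φ (α (i, b)) w (α (j, 2))) =
      m (update φ (α (i, b)) w (α (i, 0))) (update φ (α (i, b)) w (α (i, 1)))
        (update φ (α (i, b)) w (α (i, 2))) * R := by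
    intro b w
    rw [← mul_prod_erase _ _ (mem_univ i)]
    congr 1
    refine prod_congr rfl fun j hj => ?_
    have hj' := ne_of_mem_erase hj
    rw [update_of_ne (by simp [hj']), update_of_ne (by simp [hj']), update_of_ne (by simp [hj'])]
  set S := ∑ u : Flags V, if flagRank u < flagRank (i, (0 : Fin 3)) then par (φ (α u)) else 0 with hS
  have hsum : ∀ b, ∑ y ∈ univ.filter (fun y => (flagRank ∘ α.symm) y <
      (flagRank ∘ α.symm) (α (i, b))), par (φ y) =
      S + ∑ b', if b' < b then par (φ (α (i, b'))) else 0 := by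
    intro b
    have e2 : (∑ b', if b' < b then par (φ (α (i, b'))) else 0) =
        ∑ u : Flags V, if u.1 = i then (if u.2 < b then par (φ (α u)) else 0) else 0 := by
      rw [sum_prod_type, sum_eq_single i]
      · simp
      · intro j _ hj; simp [hj]
      · simp
    rw [sum_filter_lt α flagRank (i, b) (fun y => par (φ y)), e2, hS, ← sum_add_distrib]
    refine sum_congr rfl fun u _ => ?_
    obtain ⟨j, b'⟩ := u
    simp only [flagRank_lt, Fin.not_lt_zero, and_false, or_false]
    by_cases h1 : j < i
    · rw [if_pos (.inl h1), if_pos h1, if_neg h1.ne, add_zero]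
    · rw [if_neg h1, zero_add]
      by_cases h2 : j = i
      · simp [h2]
      · simp [h1, h2]
  have hi := hinv x y z
  rw [Fin.sum_univ_three]
  unfold vertexInsertion
  simp only [hsum, hprod, ← mul_assoc, ← sum_mul]
  have n01 : α (i, (0 : Fin 3)) ≠ α (i, 1) := by simp
  have n02 : α (i, (0 : Fin 3)) ≠ α (i, 2) := by simp
  have n12 : α (i, (1 : Fin 3)) ≠ α (i, 2) := by simp
  simp only [update_self, update_of_ne n01, update_of_ne n01.symm,
    update_of_ne n02, update_of_ne n02.symm, update_of_ne n12,
    update_of_ne n12.symm, ← hx, ← hy, ← hz, Fin.sum_univ_three]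
  simp +decide only [if_true, if_false, add_zero]
  rw [sgn_add S, sgn_add S]
  push_cast
  linear_combination ((koszulSign (par ∘ φ) (endRank ∘ β.symm) (flagRank ∘ α.symm) : k) *
    (sgn S : k) * R * (∏ e, τ e (φ (β (.inl (e, 0)))) (φ (β (.inl (e, 1))))) *
    ∏ x, a x (φ (β (.inr x)))) * hi

theorem sum_ends_lt_edge (e : Fin E) (b : Fin 2) (p : Ends E n → ZMod 2) :
    (∑ u, if endRank u < endRank (.inl (e, b) : Ends E n) then p u else 0) =
      ∑ e' ∈ univ.filter (· < e), (p (.inl (e', 0)) + p (.inl (e', 1))) +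
        if b = 1 then p (.inl (e, 0)) else 0 := by
  rw [sum_sum_type, sum_prod_type, sum_filter]
  have h1 : (∑ x : Fin n, if endRank (.inr x : Ends E n) < endRank (.inl (e, b) : Ends E n)
      then p (.inr x) else 0) = 0 := by
    exact sum_eq_zero fun x _ => if_neg (endRank_inl_lt_inr _ _).not_gt
  have h2 : (if b = 1 then p (.inl (e, 0)) else 0) =
      ∑ e', if e' = e then (if b = 1 then p (.inl (e', 0)) else 0) else 0 := by simp
  rw [h1, add_zero, h2, ← sum_add_distrib]
  refine sum_congr rfl fun e' _ => ?_
  simp only [Fin.sum_univ_two, endRank_inl_lt]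
  by_cases h3 : e' < e
  · rw [if_pos (.inl h3), if_pos (.inl h3), if_pos h3, if_neg h3.ne, add_zero]
  · rw [if_neg h3, zero_add]
    by_cases h4 : e' = e
    · subst h4
      fin_cases b <;> simp
    · simp [h3, h4]

theorem sum_ends_lt_leg (x : Fin n) (p : Ends E n → ZMod 2) :
    (∑ u, if endRank u < endRank (.inr x : Ends E n) then p u else 0) =
      ∑ e, (p (.inl (e, 0)) + p (.inl (e, 1))) + ∑ l ∈ univ.filter (· < x), p (.inr l) := by
  rw [sum_sum_type, sum_prod_type, sum_filter]
  congr 1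
  · refine sum_congr rfl fun e _ => ?_
    rw [Fin.sum_univ_two, if_pos (endRank_inl_lt_inr _ _), if_pos (endRank_inl_lt_inr _ _)]
  · simp only [endRank_inr_lt]

theorem sum_edgeInsertion_edge {c : ZMod 2} {D : K → K → k}
    (hvar : ∀ y z, ∑ x, J y x * t x z + (sgn (par y) : k) * ∑ x, J z x * t y x = D y z)
    (ht : ∀ x y, t x y ≠ 0 → par x + par y = c) (e : Fin E) (φ : Y → K) :
    ∑ b, edgeInsertion par m (fun _ => t) J α β a (β (.inl (e, b))) φ =
      (sgn (c * (e : ℕ)) : k) * term par m (update (fun _ => t) e D) α β a φ := by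
  set y := φ (β (.inl (e, 0))) with hy
  set z := φ (β (.inl (e, 1))) with hz
  set R := ∏ j ∈ univ.erase e, t (φ (β (.inl (j, 0)))) (φ (β (.inl (j, 1))))
  set A := ∏ x, a x (φ (β (.inr x)))
  have hprod : ∀ b w, (∏ j, t (update φ (β (.inl (e, b))) w (β (.inl (j, 0))))
      (update φ (β (.inl (e, b))) w (β (.inl (j, 1))))) *
      ∏ x, a x (update φ (β (.inl (e, b))) w (β (.inr x))) =
      t (update φ (β (.inl (e, b))) w (β (.inl (e, 0))))
        (update φ (β (.inl (e, b))) w (β (.inl (e, 1)))) * (R * A) := by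
    intro b w
    rw [← mul_prod_erase _ _ (mem_univ e), mul_assoc]
    congr 2
    · refine prod_congr rfl fun j hj => ?_
      have hj' := ne_of_mem_erase hj
      rw [update_of_ne (by simp [hj']), update_of_ne (by simp [hj'])]
    · refine prod_congr rfl fun x _ => ?_
      rw [update_of_ne (by simp)]
  have hterm : term par m (update (fun _ => t) e D) α β a φ =
      (koszulSign (par ∘ φ) (endRank ∘ β.symm) (flagRank ∘ α.symm) : k) *
      (∏ i, m (φ (α (i, 0))) (φ (α (i, 1))) (φ (α (i, 2)))) * (D y z * R) * A := by
    unfold term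
    rw [← mul_prod_erase _ _ (mem_univ e), update_self]
    congr 3
    refine prod_congr rfl fun j hj => ?_
    rw [update_of_ne (ne_of_mem_erase hj)]
  rw [hterm]
  by_cases hR0 : R = 0
  · rw [hR0]
    unfold edgeInsertion
    simp only [hprod, hR0]
    simp
  have hpar : ∑ e' ∈ univ.filter (· < e), (par (φ (β (.inl (e', 0)))) +
      par (φ (β (.inl (e', 1))))) = c * (e : ℕ) := by
    rw [sum_congr rfl (g := fun _ => c)]
    · have : (univ.filter (· < e)).card = e := by
        rw [show univ.filter (· < e) = Finset.Iio e by ext; simp, Fin.card_Iio]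
      rw [Finset.sum_const, this, nsmul_eq_mul, mul_comm]
    · intro j hj
      have := (mem_filter.mp hj).2.ne
      exact ht _ _ (prod_ne_zero_iff.mp hR0 j (Finset.mem_erase.mpr ⟨this, mem_univ _⟩))
  have hv := hvar y z
  rw [Fin.sum_univ_two]
  unfold edgeInsertion
  have n01 : β (.inl (e, (0 : Fin 2))) ≠ β (.inl (e, 1)) := by simp
  have hs : ∀ b, ∑ x ∈ univ.filter (fun x => (endRank ∘ β.symm) x <
      (endRank ∘ β.symm) (β (.inl (e, b)))), par (φ x) =
      c * (e : ℕ) + if b = 1 then par y else 0 := by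
    intro b
    rw [sum_filter_lt β endRank (.inl (e, b)) (fun y => par (φ y)),
      sum_ends_lt_edge e b fun u => par (φ (β u)), hpar]
  simp only [hs, hprod, ← mul_assoc, ← sum_mul, update_self,
    update_of_ne n01, update_of_ne n01.symm, ← hy, ← hz,
    show ¬ ((0 : Fin 2) = 1) by decide, if_true, if_false, add_zero, sgn_add]
  push_cast
  linear_combination ((koszulSign (par ∘ φ) (endRank ∘ β.symm) (flagRank ∘ α.symm) : k) *
    (sgn (c * (e : ℕ)) : k) * (∏ i, m (φ (α (i, 0))) (φ (α (i, 1))) (φ (α (i, 2)))) * R * A) * hv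

theorem edgeInsertion_leg {c : ZMod 2} {pv : Fin n → ZMod 2}
    (ht : ∀ x y, t x y ≠ 0 → par x + par y = c) (ha : ∀ x y, a x y ≠ 0 → par y = pv x)
    (x : Fin n) (φ : Y → K) :
    edgeInsertion par m (fun _ => t) J α β a (β (.inr x)) φ =
      (sgn (c * E) : k) * (sgn (∑ l ∈ univ.filter (· < x), pv l) : k) *
        term par m (fun _ => t) α β (update a x fun z => ∑ y, J z y * a x y) φ := by
  set R := ∏ j ∈ univ.erase x, a j (φ (β (.inr j)))
  set T := ∏ e : Fin E, t (φ (β (.inl (e, 0)))) (φ (β (.inl (e, 1))))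
  have hprod : ∀ w, (∏ j : Fin E, t (update φ (β (.inr x)) w (β (.inl (j, 0))))
      (update φ (β (.inr x)) w (β (.inl (j, 1))))) *
      ∏ l, a l (update φ (β (.inr x)) w (β (.inr l))) = T * (a x w * R) := by
    intro w
    rw [← mul_prod_erase _ (fun l => a l (update φ (β (.inr x)) w (β (.inr l))))
      (mem_univ x), update_self]
    refine congrArg₂ _ (prod_congr rfl fun j _ => ?_) (congrArg _ (prod_congr rfl fun l hl => ?_))
    · rw [update_of_ne (by simp), update_of_ne (by simp)]
    · have hl' := ne_of_mem_erase hl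
      rw [update_of_ne (by simp [hl'])]
  have hterm : term par m (fun _ => t) α β (update a x fun z => ∑ y, J z y * a x y) φ =
      (koszulSign (par ∘ φ) (endRank ∘ β.symm) (flagRank ∘ α.symm) : k) *
      (∏ i, m (φ (α (i, 0))) (φ (α (i, 1))) (φ (α (i, 2)))) * T *
      ((∑ y, J (φ (β (.inr x))) y * a x y) * R) := by
    unfold term
    rw [← mul_prod_erase _ _ (mem_univ x), update_self]
    congr 2
    refine prod_congr rfl fun j hj => ?_
    rw [update_of_ne (ne_of_mem_erase hj)]
  rw [hterm]
  unfold edgeInsertion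
  simp only [hprod]
  by_cases hR0 : R = 0
  · rw [hR0]; simp
  by_cases hT0 : T = 0
  · rw [hT0]; simp
  have hpar : ∑ e : Fin E, (par (φ (β (.inl (e, 0)))) + par (φ (β (.inl (e, 1))))) = c * E := by
    rw [sum_congr rfl (g := fun _ => c)]
    · simp [mul_comm]
    · intro j hj
      exact ht _ _ (prod_ne_zero_iff.mp hT0 j (mem_univ _))
  have hpar' : ∑ l ∈ univ.filter (· < x), par (φ (β (.inr l))) =
      ∑ l ∈ univ.filter (· < x), pv l := by
    refine sum_congr rfl fun l hl => ?_
    have := (mem_filter.mp hl).2.ne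
    exact ha _ _ (prod_ne_zero_iff.mp hR0 l (Finset.mem_erase.mpr ⟨this, mem_univ _⟩))
  rw [sum_filter_lt β endRank (.inr x) (fun y => par (φ y)),
    sum_ends_lt_leg x fun u => par (φ (β u)), hpar, hpar', sgn_add, sum_mul, mul_sum,
    mul_sum, mul_sum]
  refine sum_congr rfl fun y _ => ?_
  push_cast
  ring

/-- The operator `J`, applied in turn to all edges and legs, annihilates the contraction. -/
theorem sum_contr_insertion {c : ZMod 2} {D : K → K → k} {pv : Fin n → ZMod 2}
    (hJ : ∀ y x, J y x ≠ 0 → par y = par x + 1)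
    (hinv : ∀ x y z, ∑ w, J w x * m w y z + (sgn (par x) : k) * ∑ w, J w y * m x w z +
      (sgn (par x + par y) : k) * ∑ w, J w z * m x y w = 0)
    (hvar : ∀ y z, ∑ x, J y x * t x z + (sgn (par y) : k) * ∑ x, J z x * t y x = D y z)
    (ht : ∀ x y, t x y ≠ 0 → par x + par y = c) (ha : ∀ x y, a x y ≠ 0 → par y = pv x) :
    ∑ e : Fin E, (sgn (c * (e : ℕ)) : k) * contr par m (update (fun _ => t) e D) α β a +
      ∑ x, (sgn (c * E) : k) * (sgn (∑ l ∈ univ.filter (· < x), pv l) : k) *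
        contr par m (fun _ : Fin E => t) α β (update a x fun z => ∑ y, J z y * a x y) = 0 := by
  have h0 : ∑ f, ∑ φ, vertexInsertion par m (fun _ => t) J α β a f φ = 0 := by
    rw [← α.sum_comp, sum_prod_type]
    refine sum_eq_zero fun i _ => ?_
    rw [sum_comm]
    exact sum_eq_zero fun φ _ => sum_vertexInsertion_vertex hinv i φ
  rw [← h0]
  simp only [sum_vertexInsertion hJ]
  rw [← β.sum_comp, sum_sum_type, sum_prod_type]
  congr 1
  · refine sum_congr rfl fun e _ => ?_
    rw [sum_comm, contr, mul_sum]
    exact sum_congr rfl fun φ _ => (sum_edgeInsertion_edge hvar ht e φ).symm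
  · refine sum_congr rfl fun x _ => ?_
    rw [contr, mul_sum]
    exact sum_congr rfl fun φ _ => (edgeInsertion_leg ht ha x φ).symm

end Insertion

/-! ### Sums over connected graphs -/

/-- The vertices and the edges form a non-empty connected graph. -/
def Conn {Y : Type} (ρ i : Perm Y) : Prop :=
  Nonempty Y ∧ ∀ f g, Relation.ReflTransGen (fun a b => b = ρ a ∨ b = i a) f g

theorem Conn.permCongr {Y Z : Type} {ρ i : Perm Y} (h : Conn ρ i) (e : Y ≃ Z) :
    Conn (e.permCongr ρ) (e.permCongr i) := by
  refine ⟨h.1.map e, fun f g => ?_⟩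
  have := (h.2 (e.symm f) (e.symm g)).lift e
    (p := fun a b => b = e.permCongr ρ a ∨ b = e.permCongr i a) (by
      rintro a b (rfl | rfl)
      · exact .inl (by simp [permCongr_apply])
      · exact .inr (by simp [permCongr_apply]))
  simpa [Function.onFun] using this

/-- The graph is connected, and its boundary components, each of which carries legs, are the cycles
of `σ`. -/
def Adm {V E n : ℕ} {Y : Type} (α : Flags V ≃ Y) (β : Ends E n ≃ Y) (σ : Perm (Fin n)) : Prop :=
  Conn (rotOf α) (invOf β) ∧ Induces (invOf β * rotOf α) (legOf β) σ

theorem Adm.trans {V E n : ℕ} {Y Z : Type} [Finite Z] {α : Flags V ≃ Y} {β : Ends E n ≃ Y}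
    {σ : Perm (Fin n)} (h : Adm α β σ) (e : Y ≃ Z) : Adm (α.trans e) (β.trans e) σ := by
  refine ⟨?_, ?_⟩
  · rw [rotOf_trans, invOf_trans]
    exact h.1.permCongr e
  · have h1 : invOf (β.trans e) * rotOf (α.trans e) = e.permCongr (invOf β * rotOf α) := by
      rw [rotOf_trans, invOf_trans]; ext; simp [permCongr_apply]
    rw [h1]
    exact (induces_equiv' _ e).trans h.2 e.injective

theorem adm_trans {V E n : ℕ} {Y Z : Type} [Finite Z] {α : Flags V ≃ Y} {β : Ends E n ≃ Y}
    {σ : Perm (Fin n)} (e : Y ≃ Z) : Adm (α.trans e) (β.trans e) σ ↔ Adm α β σ := by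
  have : Finite Y := Finite.of_equiv Z e.symm
  refine ⟨fun h => ?_, fun h => h.trans e⟩
  have := h.trans e.symm
  rwa [Equiv.trans_assoc, Equiv.trans_assoc, Equiv.self_trans_symm, Equiv.trans_refl,
    Equiv.trans_refl] at this

theorem adm_congr {V E n : ℕ} {Y : Type} {α α' : Flags V ≃ Y} {β β' : Ends E n ≃ Y}
    {σ : Perm (Fin n)} (hα : rotOf α' = rotOf α) (hβ : invOf β' = invOf β)
    (hl : legOf β' = legOf β) : Adm α' β' σ ↔ Adm α β σ := by
  unfold Adm
  rw [hα, hβ, hl]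

theorem invOf_edgeSwap {E n : ℕ} {Y : Type} (i : Fin E) (β : Ends (E + 1) n ≃ Y) :
    invOf ((edgeSwap i n).trans β) = invOf β := by
  refine Equiv.ext fun y => ?_
  obtain ⟨x, rfl⟩ := ((edgeSwap i n).trans β).surjective y
  rcases x with ⟨e, b⟩ | x
  · rw [invOf_inl]
    exact (invOf_inl β _ _).symm
  · rw [invOf_inr]
    exact (invOf_inr β x).symm

section Total

variable {k : Type u} [Field k] {K : Type*} [Fintype K] {V E n : ℕ}
  (W : Coef k) (par : K → ZMod 2) (m : K → K → K → k) (τ : Fin E → K → K → k)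

open Classical in
/-- The sum of the weights of all connected graphs with numbered vertices and edges. -/
def total (V n : ℕ) (σ : Perm (Fin n)) (a : Fin n → K → k) : W.C (Fin n) :=
  ∑ β : Ends E n ≃ Flags V, if Adm (.refl _) β σ then weight W par m τ (.refl _) β a else 0

variable {W} {par} {m} {t D : K → K → k} {a : Fin n → K → k} {σ : Perm (Fin n)}

theorem total_edgeSwap {τ : Fin (E + 1) → K → K → k} {P : Fin (E + 1) → ZMod 2}
    (hτ : ∀ e x y, τ e x y ≠ 0 → par x + par y = P e) (i : Fin E) :
    total W par m (τ ∘ swap i.castSucc i.succ) V n σ a =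
      (sgn (P i.castSucc * P i.succ + W.c) : k) • total W par m τ V n σ a := by
  unfold total
  rw [smul_sum, ← (Equiv.equivCongr (edgeSwap i n) (Equiv.refl (Flags V))).sum_comp]
  refine sum_congr rfl fun β _ => ?_
  have e : (Equiv.equivCongr (edgeSwap i n) (Equiv.refl (Flags V))) β = (edgeSwap i n).trans β := by
    have : (edgeSwap i n).symm = edgeSwap i n := by
      refine Equiv.ext fun x => ?_
      rcases x with x | x
      · simp [edgeSwap, Equiv.prodCongr_symm]
      · rfl
    rw [← this]
    rfl
  rw [e, weight_edgeSwap hτ i, smul_ite, smul_zero]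
  congr 1
  exact propext (adm_congr rfl (invOf_edgeSwap i β) rfl)

theorem total_update (ht : ∀ x y, t x y ≠ 0 → par x + par y = W.c)
    (hD : ∀ x y, D x y ≠ 0 → par x + par y = W.c + 1) (e : Fin (E + 1)) :
    (sgn (W.c * (e : ℕ)) : k) • total W par m (update (fun _ => t) e D) V n σ a =
      (sgn (W.c * E) : k) • total W par m (update (fun _ => t) (last E) D) V n σ a := by
  induction e using Fin.reverseInduction with
  | last => simp
  | cast i ih =>
    rw [← ih]
    have h : ∀ e x y, update (fun _ => t) i.succ D e x y ≠ 0 → par x + par y =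
        update (fun _ => W.c) i.succ (W.c + 1) e := by
      intro e x y h
      by_cases he : e = i.succ
      · subst he
        rw [update_self] at h ⊢
        exact hD _ _ h
      · rw [update_of_ne he] at h ⊢
        exact ht _ _ h
    have h1 := total_edgeSwap (W := W) (m := m) (V := V) (σ := σ) (a := a) h i
    have h2 : update (fun _ => t) i.succ D ∘ swap i.castSucc i.succ =
        update (fun _ => t) i.castSucc D := by
      funext e
      by_cases he : e = i.castSucc
      · subst he; simp
      · rw [update_of_ne he, comp_apply, update_of_ne]
        rw [Ne, Equiv.swap_apply_eq_iff]
        simpa using he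
    have h3 : ∀ c : ZMod 2, c * (c + 1) + c = c := by decide
    rw [h2, update_self, update_of_ne Fin.castSucc_lt_succ.ne, h3] at h1
    rw [h1, smul_smul]
    congr 1
    simp only [Fin.val_castSucc, val_succ]
    push_cast
    rw [mul_add, mul_one, sgn_add]
    push_cast
    ring

theorem sum_total_update_leg {J : K → K → k} {pv : Fin n → ZMod 2}
    (hJ : ∀ y x, J y x ≠ 0 → par y = par x + 1)
    (hinv : ∀ x y z, ∑ w, J w x * m w y z + (sgn (par x) : k) * ∑ w, J w y * m x w z +
      (sgn (par x + par y) : k) * ∑ w, J w z * m x y w = 0)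
    (hvar : ∀ y z, ∑ x, J y x * t x z + (sgn (par y) : k) * ∑ x, J z x * t y x = D y z)
    (ht : ∀ x y, t x y ≠ 0 → par x + par y = W.c)
    (hD : ∀ x y, D x y ≠ 0 → par x + par y = W.c + 1)
    (ha : ∀ x y, a x y ≠ 0 → par y = pv x) :
    ∑ x, (sgn (∑ l ∈ univ.filter (· < x), pv l) : k) •
      total W par m (fun _ : Fin (E + 1) => t) V n σ (update a x fun z => ∑ y, J z y * a x y) =
      -(((E + 1 : ℕ) : k) * (sgn W.c : k)) •
        total W par m (update (fun _ => t) (last E) D) V n σ a := by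
  have h1 : ∑ x, ((sgn (W.c * (E + 1 : ℕ)) : k) * (sgn (∑ l ∈ univ.filter (· < x), pv l) : k)) •
      total W par m (fun _ : Fin (E + 1) => t) V n σ (update a x fun z => ∑ y, J z y * a x y) =
      - ∑ e : Fin (E + 1), (sgn (W.c * (e : ℕ)) : k) •
        total W par m (update (fun _ => t) e D) V n σ a := by
    rw [eq_neg_iff_add_eq_zero]
    unfold total
    simp only [smul_sum]
    rw [sum_comm, sum_comm (s := (univ : Finset (Fin (E + 1)))), ← sum_add_distrib]
    refine sum_eq_zero fun β _ => ?_
    by_cases hA : Adm (.refl _) β σ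
    · simp only [if_pos hA]
      unfold weight
      simp only [smul_smul]
      rw [← sum_smul, ← sum_smul, ← add_smul, add_comm,
        sum_contr_insertion hJ hinv hvar ht ha, zero_smul]
    · simp [if_neg hA]
  simp only [total_update ht hD, Finset.sum_const, Finset.card_univ, card_fin,
    ← smul_smul, ← smul_sum] at h1
  have h2 := congrArg (fun x => (sgn (W.c * (E + 1 : ℕ)) : k) • x) h1
  simp only [smul_smul, sgn_mul_self_cast, one_smul, smul_neg] at h2
  rw [h2, neg_smul, smul_comm, ← Nat.cast_smul_eq_nsmul k, smul_smul, smul_smul]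
  congr 2
  push_cast
  rw [mul_add, mul_one, sgn_add]
  push_cast
  linear_combination ((E : k) + 1) * (sgn W.c : k) * sgn_mul_self_cast (k := k) (W.c * (E : ZMod 2))

end Total

/-! ### Contracting an edge: the associativity relation -/

theorem sum_eq_zero_of_update {k : Type*} [Field k] [CharZero k] {Y K : Type*} [Fintype Y]
    [DecidableEq Y] [Fintype K] (p q : Y) (F : (Y → K) → k)
    (h : ∀ φ, ∑ x, ∑ y, F (update (update φ p x) q y) = 0) : ∑ φ, F φ = 0 := by
  have key : ∀ (G : (Y → K) → k) (f : Y),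
      ∑ φ, ∑ x, G (update φ f x) = (Fintype.card K : k) * ∑ φ, G φ := by
    intro G f
    rw [sum_update_swap f fun _ ψ => G ψ]
    simp [mul_sum]
  have h1 := key (fun φ => ∑ y, F (update φ q y)) p
  rw [key F q] at h1
  simp only [h, sum_const_zero] at h1
  rcases isEmpty_or_nonempty K with hK | hK
  · have : IsEmpty (Y → K) := ⟨fun φ => hK.elim (φ p)⟩
    simp
  · have : (Fintype.card K : k) ≠ 0 := Nat.cast_ne_zero.mpr Fintype.card_ne_zero
    simpa [this] using h1.symm

section Window

variable {V : ℕ}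

/-- The order of the flags in which the first two vertices come first, their flags being ordered
by `w`. -/
def headRank (w : Fin 2 × Fin 3 → ℕ) (f : Flags (V + 2)) : ℕ :=
  if h : (f.1 : ℕ) < 2 then w (⟨f.1, h⟩, f.2) else flagRank f

def headFlag (u : Fin 2 × Fin 3) : Flags (V + 2) := (⟨u.1, by omega⟩, u.2)

theorem headFlag_injective : (headFlag (V := V)).Injective := by
  rintro ⟨a, b⟩ ⟨c, d⟩ h
  simp only [headFlag, Prod.mk.injEq, Fin.mk.injEq] at h
  exact Prod.ext (Fin.ext h.1) h.2

theorem headRank_headFlag (w : Fin 2 × Fin 3 → ℕ) : headRank w ∘ headFlag (V := V) = w := by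
  funext u
  rw [comp_apply, headRank, dif_pos (show ((headFlag u : Flags (V + 2)).1 : ℕ) < 2 from u.1.2)]
  rfl

theorem mem_range_headFlag {f : Flags (V + 2)} : f ∈ range (headFlag (V := V)) ↔ (f.1 : ℕ) < 2 := by
  constructor
  · rintro ⟨u, rfl⟩
    exact u.1.2
  · intro h
    exact ⟨(⟨f.1, h⟩, f.2), rfl⟩

theorem headRank_lt {w : Fin 2 × Fin 3 → ℕ} (hw : ∀ u, w u < 6) {f : Flags (V + 2)}
    (h : f ∈ range (headFlag (V := V))) : headRank w f < 6 := by
  rw [headRank, dif_pos (mem_range_headFlag.mp h)]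
  exact hw _

theorem headRank_of_not_mem {w : Fin 2 × Fin 3 → ℕ} {f : Flags (V + 2)}
    (h : f ∉ range (headFlag (V := V))) : headRank w f = flagRank f := by
  rw [headRank, dif_neg (mem_range_headFlag.not.mp h)]

theorem six_le_flagRank {f : Flags (V + 2)} (h : f ∉ range (headFlag (V := V))) :
    6 ≤ flagRank f := by
  have := mem_range_headFlag.not.mp h
  simp only [flagRank]
  omega

theorem headRank_injective {w : Fin 2 × Fin 3 → ℕ} (hw : ∀ u, w u < 6) (hi : w.Injective) :
    (headRank (V := V) w).Injective := by
  intro f g h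
  by_cases hf : f ∈ range (headFlag (V := V)) <;> by_cases hg : g ∈ range (headFlag (V := V))
  · obtain ⟨u, rfl⟩ := hf
    obtain ⟨v, rfl⟩ := hg
    have e := congrFun (headRank_headFlag (V := V) w)
    rw [hi ((e u).symm.trans (h.trans (e v)))]
  · have h1 := headRank_lt hw hf
    have h2 := six_le_flagRank hg
    rw [← headRank_of_not_mem (w := w) hg] at h2
    omega
  · have h1 := headRank_lt hw hg
    have h2 := six_le_flagRank hf
    rw [← headRank_of_not_mem (w := w) hf] at h2
    omega
  · rw [headRank_of_not_mem hf, headRank_of_not_mem hg] at h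
    exact flagRank_injective h

theorem koszulSign_headRank (p : Flags (V + 2) → ZMod 2) {w w' : Fin 2 × Fin 3 → ℕ}
    (hw : ∀ u, w u < 6) (hw' : ∀ u, w' u < 6) :
    koszulSign p (headRank w) (headRank w') = koszulSign (p ∘ headFlag) w w' := by
  rw [koszulSign_window headFlag_injective, headRank_headFlag, headRank_headFlag]
  intro x y hxy h1 h2
  by_cases hx : x ∈ range (headFlag (V := V)) <;> by_cases hy : y ∈ range (headFlag (V := V))
  · rcases hxy with h | h
    exacts [h hx, h hy]
  · have h3 := headRank_lt hw' hx
    have h4 := six_le_flagRank hy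
    rw [← headRank_of_not_mem (w := w') hy] at h4
    omega
  · have h3 := headRank_lt hw hy
    have h4 := six_le_flagRank hx
    rw [← headRank_of_not_mem (w := w) hx] at h4
    omega
  · rw [headRank_of_not_mem hx, headRank_of_not_mem hy] at h1 h2
    omega

/-- The permutation of the flags of the first two vertices passing from the vertices `(p a b)`,
`(q c d)` to the vertices `(p b c)`, `(q d a)`. -/
def headRot : Perm (Flags (V + 2)) := swap (0, 1) (0, 2) * swap (0, 2) (1, 1) * swap (1, 1) (1, 2)

theorem headRot_apply (f : Flags (V + 2)) : headRot f =
    swap (0, 1) (0, 2) (swap (0, 2) (1, 1) (swap (1, 1) (1, 2) f)) := rfl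

theorem flags_cases {P : Flags (V + 2) → Prop} (h00 : P (0, 0)) (h01 : P (0, 1)) (h02 : P (0, 2))
    (h10 : P (1, 0)) (h11 : P (1, 1)) (h12 : P (1, 2))
    (h : ∀ (i : Fin V) b, P (i.succ.succ, b)) (f : Flags (V + 2)) : P f := by
  obtain ⟨i, b⟩ := f
  refine Fin.cases ?_ (fun i => Fin.cases ?_ (fun i => h i b) i) i
  · fin_cases b <;> assumption
  · fin_cases b <;> assumption

theorem headRot_values : headRot (V := V) (0, 0) = (0, 0) ∧ headRot (V := V) (0, 1) = (0, 2) ∧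
    headRot (V := V) (0, 2) = (1, 1) ∧ headRot (V := V) (1, 0) = (1, 0) ∧
    headRot (V := V) (1, 1) = (1, 2) ∧ headRot (V := V) (1, 2) = (0, 1) ∧
    ∀ (i : Fin V) b, headRot (i.succ.succ, b) = (i.succ.succ, b) := by
  simp [headRot_apply, swap_apply_def, Fin.succ_succ_ne_one]

theorem flagRank_eq_headRank : flagRank (V := V + 2) = headRank fun u => ![![0, 1, 2], ![3, 4, 5]] u.1 u.2 := by
  funext f
  induction f using flags_cases with
  | h i b => simp [headRank]
  | _ => simp [headRank, flagRank]

theorem flagRank_headRot : flagRank (V := V + 2) ∘ headRot.symm =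
    headRank fun u => ![![0, 5, 1], ![3, 2, 4]] u.1 u.2 := by
  obtain ⟨h1, h2, h3, h4, h5, h6, h7⟩ := headRot_values (V := V)
  have key : ∀ f g : Flags (V + 2), headRot f = g → headRot.symm g = f := fun f g h => by
    rw [← h, symm_apply_apply]
  funext f
  rw [comp_apply]
  induction f using flags_cases with
  | h i b => rw [key _ _ (h7 i b)]; simp [headRank]
  | h00 => rw [key _ _ h1]; simp [headRank, flagRank]
  | h01 => rw [key _ _ h6]; simp [headRank, flagRank]
  | h02 => rw [key _ _ h2]; simp [headRank, flagRank]
  | h10 => rw [key _ _ h4]; simp [headRank, flagRank]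
  | h11 => rw [key _ _ h3]; simp [headRank, flagRank]
  | h12 => rw [key _ _ h5]; simp [headRank, flagRank]

theorem koszulSign_head (p : Flags (V + 2) → ZMod 2) :
    koszulSign p (headRank fun u => ![![0, 2, 3], ![1, 4, 5]] u.1 u.2) flagRank =
      sgn (p (1, 0) * (p (0, 1) + p (0, 2))) := by
  rw [flagRank_eq_headRank, koszulSign_headRank _ (by decide) (by decide),
    koszulSign_rectangle _ {(1, 0)} {(0, 1), (0, 2)} (by decide), sum_singleton,
    sum_pair (by decide)]
  rfl

theorem koszulSign_head' (p : Flags (V + 2) → ZMod 2) :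
    koszulSign p (headRank fun u => ![![0, 2, 3], ![1, 4, 5]] u.1 u.2) (flagRank ∘ headRot.symm) =
      sgn (p (0, 1) * (p (0, 2) + p (1, 1) + p (1, 2))) * sgn (p (1, 0) * (p (0, 2) + p (1, 1))) := by
  rw [flagRank_headRot, koszulSign_headRank _ (by decide) (by decide),
    ← koszulSign_mul _ (s := fun u => ![![0, 5, 2], ![1, 3, 4]] u.1 u.2)
      (by decide) (by decide) (by decide),
    koszulSign_rectangle _ {(0, 1)} {(0, 2), (1, 1), (1, 2)} (by decide),
    koszulSign_rectangle _ {(1, 0)} {(0, 2), (1, 1)} (by decide), sum_singleton,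
    sum_singleton, sum_pair (by decide), sum_insert (by decide),
    sum_pair (by decide), add_assoc (p (0, 2))]
  rfl

end Window

section Assoc

variable {k : Type u} [Field k] {K : Type*} [Fintype K] {V E n : ℕ}
  {W : Coef k} {par : K → ZMod 2} {m : K → K → K → k} {t T : K → K → k} {a : Fin n → K → k}
  {σ : Perm (Fin n)}

theorem koszulSign_pair {X : Type*} [Fintype X] [DecidableEq X] {p p' : X → ZMod 2} {r s : X → ℕ}
    (hr : r.Injective) (hs : s.Injective) {x y : X} (hxy : x ≠ y) (hrxy : r y = r x + 1)
    (hsxy : s y = s x + 1) (hsum : p' x + p' y = p x + p y)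
    (h : ∀ z, z ≠ x → z ≠ y → p' z = p z) : koszulSign p' r s = koszulSign p r s := by
  have z2 : ∀ u v : ZMod 2, u = v ∨ u = v + 1 := by decide
  rcases z2 (p' x) (p x) with hx | hx
  · have hy : p' y = p y := by rw [hx] at hsum; exact add_left_cancel hsum
    have : p' = p := funext fun z => by
      by_cases h1 : z = x
      · rw [h1, hx]
      · by_cases h2 : z = y
        · rw [h2, hy]
        · exact h z h1 h2
    rw [this]
  · have hy : p' y = p y + 1 := by
      have e : ∀ a b d : ZMod 2, a + 1 + b = a + d → b = d + 1 := by decide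
      rw [hx] at hsum
      exact e _ _ _ hsum
    set p1 := update p x (p x + 1) with hp1
    have e1 := koszulSign_parity_change (p := p) (p' := p1) hr hs x (by simp [hp1])
      (fun z hz => by simp [hp1, hz])
    have e2 := koszulSign_parity_change (p := p1) (p' := p') hr hs y
      (by rw [hy, hp1, update_of_ne hxy.symm]) (fun z hz => by
        by_cases hzx : z = x
        · subst hzx; simp [hp1, hx]
        · rw [h z hzx hz, hp1, update_of_ne hzx])
    have key : ∀ {w : X → ℕ}, w.Injective → w y = w x + 1 →
        ∑ z ∈ univ.filter (fun z => w z < w y), p1 z =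
        ∑ z ∈ univ.filter (fun z => w z < w x), p z + (p x + 1) := by
      intro w hw hwxy
      have : univ.filter (fun z => w z < w y) = insert x (univ.filter (fun z => w z < w x)) := by
        ext z
        simp only [mem_filter, mem_univ, true_and, mem_insert]
        rw [hwxy, Nat.lt_succ_iff_lt_or_eq, or_comm, hw.eq_iff]
      rw [this, sum_insert (by simp), add_comm]
      congr 1
      · refine sum_congr rfl fun z hz => ?_
        rw [hp1, update_of_ne]
        rintro rfl
        simp at hz
      · simp [hp1]
    rw [e2, e1, key hr hrxy, key hs hsxy]
    simp only [sgn_add]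
    have q := fun a => sgn_mul_self a
    linear_combination koszulSign p r s * (sgn (p x) * sgn (p x) * (sgn 1 * sgn 1)) *
      (sgn (∑ z ∈ univ.filter (fun z => s z < s x), p z) *
        sgn (∑ z ∈ univ.filter (fun z => s z < s x), p z)) *
      (q (∑ z ∈ univ.filter (fun z => r z < r x), p z)) +
      koszulSign p r s * (sgn (p x) * sgn (p x) * (sgn 1 * sgn 1)) *
        (q (∑ z ∈ univ.filter (fun z => s z < s x), p z)) +
      koszulSign p r s * (sgn 1 * sgn 1) * q (p x) + koszulSign p r s * q 1

/-- The associativity of the vertices, contracted with the two-tensor `T`. -/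
def IsAssociative (par : K → ZMod 2) (m : K → K → K → k) (T : K → K → k) : Prop :=
  ∀ a b d e, ∑ x, ∑ y, T x y * (sgn (par y * (par a + par b)) : k) * m x a b * m y d e =
    -((sgn (par a * (par b + par d + par e)) : k) *
      ∑ x, ∑ y, T x y * (sgn (par y * (par b + par d)) : k) * m x b d * m y e a)

theorem contr_headRot [CharZero k] {c : ZMod 2} (hT : ∀ x y, T x y ≠ 0 → par x + par y = c)
    (hass : IsAssociative par m T) (β : Ends (E + 1) n ≃ Flags (V + 2))
    (h0 : β (.inl (last E, 0)) = (0, 0)) (h1 : β (.inl (last E, 1)) = (1, 0)) :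
    contr par m (update (fun _ => t) (last E) T) headRot β a =
      -contr par m (update (fun _ => t) (last E) T) (.refl _) β a := by
  rw [eq_neg_iff_add_eq_zero, contr, contr, ← sum_add_distrib]
  refine sum_eq_zero_of_update (0, 0) (1, 0) _ fun φ => ?_
  obtain ⟨k1, k2, k3, k4, k5, k6, k7⟩ := headRot_values (V := V)
  set s0 : Flags (V + 2) → ℕ := headRank fun u => ![![0, 2, 3], ![1, 4, 5]] u.1 u.2 with hs0
  have s0i : s0.Injective := headRank_injective (by decide) (by decide)
  set r : Flags (V + 2) → ℕ := endRank ∘ β.symm with hr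
  have ri : r.Injective := endRank_injective.comp β.symm.injective
  have n01 : ((0 : Fin (V + 2)), (0 : Fin 3)) ≠ (1, 0) := by simp
  have hr1 : r (1, 0) = r (0, 0) + 1 := by
    rw [hr, ← h0, ← h1]
    simp [endRank]
  have hs1 : s0 (1, 0) = s0 (0, 0) + 1 := by simp [hs0, headRank]
  set φ' : K → K → Flags (V + 2) → K := fun x y => update (update φ (0, 0) x) (1, 0) y with hφ'
  have v0 : ∀ x y, φ' x y (0, 0) = x := fun x y => by simp [hφ']
  have v1 : ∀ x y, φ' x y (1, 0) = y := fun x y => by simp [hφ']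
  have v : ∀ x y f, f ≠ (0, 0) → f ≠ (1, 0) → φ' x y f = φ f := fun x y f h h' => by
    simp [hφ', h, h']
  set p0 : Flags (V + 2) → ZMod 2 := update (update (par ∘ φ) (0, 0) c) (1, 0) 0 with hp0
  have hK : ∀ x y, T x y * (koszulSign (par ∘ φ' x y) r s0 : k) =
      T x y * (koszulSign p0 r s0 : k) := by
    intro x y
    by_cases hxy : T x y = 0
    · rw [hxy, zero_mul, zero_mul]
    · rw [koszulSign_pair ri s0i n01 hr1 hs1 (p := p0) (p' := par ∘ φ' x y)]
      · simp [hp0, v0, v1, hT _ _ hxy]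
      · intro z hz hz'
        rw [comp_apply, v _ _ _ hz hz', hp0, update_of_ne hz', update_of_ne hz, comp_apply]
  set R := ∏ i : Fin V, m (φ (i.succ.succ, 0)) (φ (i.succ.succ, 1)) (φ (i.succ.succ, 2))
  set Q := ∏ e : Fin E, t (φ (β (.inl (e.castSucc, 0)))) (φ (β (.inl (e.castSucc, 1))))
  set A := ∏ x, a x (φ (β (.inr x)))
  set b1 := φ (0, 1)
  set b2 := φ (0, 2)
  set b3 := φ (1, 1)
  set b4 := φ (1, 2)
  have w1 : ∀ x y, φ' x y (0, 1) = b1 := fun x y => v _ _ _ (by simp) (by simp)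
  have w2 : ∀ x y, φ' x y (0, 2) = b2 := fun x y => v _ _ _ (by simp) (by simp)
  have w3 : ∀ x y, φ' x y (1, 1) = b3 := fun x y => v _ _ _ (by simp) (by simp)
  have w4 : ∀ x y, φ' x y (1, 2) = b4 := fun x y => v _ _ _ (by simp) (by simp)
  have w : ∀ x y (i : Fin V) b, φ' x y (i.succ.succ, b) = φ (i.succ.succ, b) := fun x y i b =>
    v _ _ _ (by simp) (by simp [Fin.succ_succ_ne_one])
  have hβ : ∀ x y u, u ≠ .inl (last E, 0) → u ≠ .inl (last E, 1) →
      φ' x y (β u) = φ (β u) := fun x y u hu hu' =>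
    v _ _ _ (by rw [← h0]; simpa using hu) (by rw [← h1]; simpa using hu')
  have hQ' : ∀ x y, (∏ e, update (fun _ => t) (last E) T e
      (φ' x y (β (.inl (e, 0)))) (φ' x y (β (.inl (e, 1))))) = Q * T x y := by
    intro x y
    rw [Fin.prod_univ_castSucc, update_self, h0, h1, v0, v1]
    congr 1
    refine prod_congr rfl fun e _ => ?_
    rw [update_of_ne (castSucc_lt_last e).ne, hβ _ _ _ (by simp [(castSucc_lt_last e).ne])
      (by simp), hβ _ _ _ (by simp) (by simp [(castSucc_lt_last e).ne])]
  have hA' : ∀ x y, (∏ l, a l (φ' x y (β (.inr l)))) = A := fun x y =>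
    prod_congr rfl fun l _ => by rw [hβ _ _ _ (by simp) (by simp)]
  have t1 : ∀ x y, term par m (update (fun _ => t) (last E) T) (.refl _) β a
      (φ' x y) = (koszulSign p0 r s0 : k) * R * Q * A *
        (T x y * (sgn (par y * (par b1 + par b2)) : k) * m x b1 b2 * m y b3 b4) := by
    intro x y
    unfold term
    have e1 : flagRank ∘ (Equiv.refl (Flags (V + 2))).symm = flagRank := rfl
    rw [hQ', hA', e1, ← koszulSign_mul _ ri s0i flagRank_injective, hs0, koszulSign_head,
      Fin.prod_univ_succ, Fin.prod_univ_succ, ← hs0]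
    simp only [Equiv.refl_apply, comp_apply, Fin.succ_zero_eq_one, v0, v1, w1, w2, w3, w4, w]
    push_cast
    linear_combination ((sgn (par y * (par b1 + par b2)) : k) * m x b1 b2 * m y b3 b4 *
      R * Q * A) * hK x y
  have t2 : ∀ x y, term par m (update (fun _ => t) (last E) T) headRot β a
      (φ' x y) = (koszulSign p0 r s0 : k) * R * Q * A *
        ((sgn (par b1 * (par b2 + par b3 + par b4)) : k) *
          (T x y * (sgn (par y * (par b2 + par b3)) : k) * m x b2 b3 * m y b4 b1)) := by
    intro x y
    unfold term
    rw [hQ', hA', ← koszulSign_mul _ ri s0i (flagRank_injective.comp headRot.symm.injective), hs0,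
      koszulSign_head', Fin.prod_univ_succ, Fin.prod_univ_succ, ← hs0]
    simp only [comp_apply, Fin.succ_zero_eq_one, k1, k2, k3, k4, k5, k6, k7, v0, v1, w1,
      w2, w3, w4, w]
    push_cast
    linear_combination ((sgn (par b1 * (par b2 + par b3 + par b4)) : k) *
      (sgn (par y * (par b2 + par b3)) : k) * m x b2 b3 * m y b4 b1 * R * Q * A) * hK x y
  simp only [hφ'] at t1 t2
  simp only [t1, t2, ← mul_sum, sum_add_distrib]
  have := hass b1 b2 b3 b4
  linear_combination ((koszulSign p0 r s0 : k) * R * Q * A) * this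

end Assoc

section CutTwo

variable {Y : Type*} {φ ψ : Perm Y} {p q : Y}

theorem induces_cut_two (hp : ψ p = p) (hq : ψ q = q) (hφp : φ p ≠ p ∧ φ p ≠ q)
    (hφq : φ q ≠ p ∧ φ q ≠ q)
    (h : ∀ y, y ≠ p → y ≠ q → ψ y = φ y ∨ ((φ y = p ∨ φ y = q) ∧ ψ y = φ (φ y)))
    (hψ : ∀ y, (y ≠ p ∧ y ≠ q) ↔ (ψ y ≠ p ∧ ψ y ≠ q)) :
    Induces φ (Subtype.val : {y // y ≠ p ∧ y ≠ q} → Y) (ψ.subtypePerm (fun y => (hψ y).symm)) := by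
  refine ⟨fun y => ?_, fun x => ?_⟩
  · by_cases h1 : y = p
    · subst h1
      exact ⟨⟨φ y, hφp⟩, Perm.sameCycle_apply_right.mpr (Perm.SameCycle.refl _ _)⟩
    · by_cases h2 : y = q
      · subst h2
        exact ⟨⟨φ y, hφq⟩, Perm.sameCycle_apply_right.mpr (Perm.SameCycle.refl _ _)⟩
      · exact ⟨⟨y, h1, h2⟩, Perm.SameCycle.refl _ _⟩
  · rcases h x.1 x.2.1 x.2.2 with h1 | ⟨h1, h2⟩
    · exact ⟨1, one_pos, by simpa using h1.symm, fun l h0 hl => by omega⟩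
    · refine ⟨2, two_pos, by simpa [pow_two] using h2.symm, fun l h0 hl => ?_⟩
      obtain rfl : l = 1 := by omega
      rw [pow_one]
      rintro ⟨z, hz⟩
      rcases h1 with h1 | h1
      · exact z.2.1 (hz.trans h1)
      · exact z.2.2 (hz.trans h1)

end CutTwo

section GlueMove

variable {k : Type u} [Field k] {W : Coef k} {Y : Type} [Finite Y] [DecidableEq Y]

theorem glueList_concat {L : List (Y × Y)} {p q : Y}
    (hL : ∀ e ∈ L, [p, q, e.1, e.2].Nodup) {φ : Perm Y} {x : W.C Y} (hx : x ∈ W.line φ) :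
    (glueList W (L ++ [(p, q)]) (φ, x)).2 =
      (sgn W.c : k) ^ L.length • (glueList W L (swap p q * φ, W.glue φ p q x)).2 := by
  induction L generalizing φ x with
  | nil => simp [glueList]
  | cons e L ih =>
    have he := hL e (by simp)
    have hne : e.1 ≠ e.2 := by simp at he; tauto
    rw [List.cons_append, glueList_cons, ih (fun e' h => hL e' (by simp [h]))
      (W.glue_mem_line hne hx), glueList_cons, W.glue_comm he hx, glueList_smul,
      swap_mul_swap_mul_comm he, length_cons, pow_succ, smul_smul, mul_assoc, sgn_mul_self_cast,
      mul_one]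

end GlueMove

section AssocOrient

variable {k : Type u} [Field k] {V E n : ℕ} {W : Coef k}

/-- The boundary of the tetravalent vertex obtained by gluing the first flags of the first two
vertices. -/
def headCut (V : ℕ) : Perm (Flags (V + 2)) :=
  swap (1, 0) (1, 1) * (swap (0, 0) (0, 1) * (swap (0, 0) (1, 0) * shift (V + 2) 3))

theorem fin_three_one_add_one : (1 : Fin 3) + 1 = 2 := rfl

theorem fin_three_two_add_one : (2 : Fin 3) + 1 = 0 := rfl

theorem headCut_values : headCut V (0, 0) = (0, 0) ∧ headCut V (0, 1) = (0, 2) ∧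
    headCut V (0, 2) = (1, 1) ∧ headCut V (1, 0) = (1, 0) ∧ headCut V (1, 1) = (1, 2) ∧
    headCut V (1, 2) = (0, 1) ∧ ∀ (i : Fin V) b, headCut V (i.succ.succ, b) = (i.succ.succ, b + 1) := by
  simp [headCut, shift_apply, swap_apply_def, Fin.succ_succ_ne_one, fin_three_one_add_one,
    fin_three_two_add_one]

/-- Gluing the first flags of the first two vertices. -/
def headGlue (φ : Perm (Flags (V + 2))) : Perm (Flags (V + 2)) := swap (0, 0) (1, 0) * φ

theorem headGlue_values : headGlue (shift (V + 2) 3) (0, 0) = (0, 1) ∧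
    headGlue (shift (V + 2) 3) (0, 1) = (0, 2) ∧
    headGlue (shift (V + 2) 3) (0, 2) = (1, 0) ∧
    headGlue (shift (V + 2) 3) (1, 0) = (1, 1) ∧
    headGlue (shift (V + 2) 3) (1, 1) = (1, 2) ∧
    headGlue (shift (V + 2) 3) (1, 2) = (0, 0) ∧
    ∀ (i : Fin V) b, headGlue (shift (V + 2) 3) (i.succ.succ, b) = (i.succ.succ, b + 1) := by
  simp [headGlue, shift_apply, swap_apply_def, Fin.succ_succ_ne_one, fin_three_one_add_one,
    fin_three_two_add_one]

theorem rotOf_headRot_values : rotOf (headRot (V := V)) (0, 0) = (0, 2) ∧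
    rotOf (headRot (V := V)) (0, 1) = (1, 0) ∧ rotOf (headRot (V := V)) (0, 2) = (1, 1) ∧
    rotOf (headRot (V := V)) (1, 0) = (1, 2) ∧ rotOf (headRot (V := V)) (1, 1) = (0, 0) ∧
    rotOf (headRot (V := V)) (1, 2) = (0, 1) ∧
    ∀ (i : Fin V) b, rotOf (headRot (V := V)) (i.succ.succ, b) = (i.succ.succ, b + 1) := by
  obtain ⟨h1, h2, h3, h4, h5, h6, h7⟩ := headRot_values (V := V)
  have key := rotOf_apply (headRot (V := V))
  refine ⟨?_, ?_, ?_, ?_, ?_, ?_, fun i b => ?_⟩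
  · rw [← h1, key]; exact h2
  · rw [← h6, key]; exact h4
  · rw [← h2, key]; exact h3
  · rw [← h4, key]; exact h5
  · rw [← h3, key]; exact h1
  · rw [← h5, key]; exact h6
  · rw [← h7, key]; exact h7 _ _

theorem headGlue_values' : headGlue (rotOf (headRot (V := V))) (0, 0) = (0, 2) ∧
    headGlue (rotOf (headRot (V := V))) (0, 1) = (0, 0) ∧
    headGlue (rotOf (headRot (V := V))) (0, 2) = (1, 1) ∧
    headGlue (rotOf (headRot (V := V))) (1, 0) = (1, 2) ∧
    headGlue (rotOf (headRot (V := V))) (1, 1) = (1, 0) ∧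
    headGlue (rotOf (headRot (V := V))) (1, 2) = (0, 1) ∧
    ∀ (i : Fin V) b, headGlue (rotOf (headRot (V := V))) (i.succ.succ, b) =
      (i.succ.succ, b + 1) := by
  obtain ⟨h1, h2, h3, h4, h5, h6, h7⟩ := rotOf_headRot_values (V := V)
  simp [headGlue, h1, h2, h3, h4, h5, h6, h7, swap_apply_def, Fin.succ_succ_ne_one]

/-- The flags other than the first flags of the first two vertices. -/
abbrev Tail (V : ℕ) := {y : Flags (V + 2) // y ≠ (0, 0) ∧ y ≠ (1, 0)}

theorem headCut_iff (y : Flags (V + 2)) :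
    (headCut V y ≠ (0, 0) ∧ headCut V y ≠ (1, 0)) ↔ (y ≠ (0, 0) ∧ y ≠ (1, 0)) := by
  obtain ⟨h1, -, -, h4, -⟩ := headCut_values (V := V)
  refine and_congr (not_congr ?_) (not_congr ?_)
  · nth_rw 1 [← h1]; exact (headCut V).injective.eq_iff
  · nth_rw 1 [← h4]; exact (headCut V).injective.eq_iff

def tailCut (V : ℕ) : Perm (Tail V) := (headCut V).subtypePerm headCut_iff

theorem induces_tailCut : Induces (headGlue (shift (V + 2) 3))
    (Subtype.val : Tail V → Flags (V + 2)) (tailCut V) := by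
  obtain ⟨h1, h2, h3, h4, h5, h6, h7⟩ := headCut_values (V := V)
  obtain ⟨k1, k2, k3, k4, k5, k6, k7⟩ := headGlue_values (V := V)
  refine induces_cut_two h1 h4 (by rw [k1]; simp) (by rw [k4]; simp) (fun y => ?_)
    fun y => (headCut_iff y).symm
  induction y using flags_cases with
  | h i b => intro _ _; rw [h7, k7]; exact .inl rfl
  | h00 => intro h; exact absurd rfl h
  | h10 => intro _ h; exact absurd rfl h
  | h01 => intro _ _; rw [h2, k2]; exact .inl rfl
  | h02 => intro _ _; rw [h3, k3, k4]; exact .inr ⟨.inr rfl, rfl⟩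
  | h11 => intro _ _; rw [h5, k5]; exact .inl rfl
  | h12 => intro _ _; rw [h6, k6, k1]; exact .inr ⟨.inl rfl, rfl⟩

theorem induces_tailCut' : Induces (headGlue (rotOf (headRot (V := V))))
    (Subtype.val : Tail V → Flags (V + 2)) (tailCut V) := by
  obtain ⟨h1, h2, h3, h4, h5, h6, h7⟩ := headCut_values (V := V)
  obtain ⟨k1, k2, k3, k4, k5, k6, k7⟩ := headGlue_values' (V := V)
  refine induces_cut_two h1 h4 (by rw [k1]; simp) (by rw [k4]; simp) (fun y => ?_)
    fun y => (headCut_iff y).symm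
  induction y using flags_cases with
  | h i b => intro _ _; rw [h7, k7]; exact .inl rfl
  | h00 => intro h; exact absurd rfl h
  | h10 => intro _ h; exact absurd rfl h
  | h01 => intro _ _; rw [h2, k2, k1]; exact .inr ⟨.inl rfl, rfl⟩
  | h02 => intro _ _; rw [h3, k3]; exact .inl rfl
  | h11 => intro _ _; rw [h5, k5, k4]; exact .inr ⟨.inr rfl, rfl⟩
  | h12 => intro _ _; rw [h6, k6]; exact .inl rfl

theorem vertProd_succ_succ {Y : Type} (α : Flags (V + 2) ≃ Y) : vertProd W α =
    ((α (0, 0) :: α (1, 0) :: ofFn fun i : Fin V => α (i.succ.succ, 0)).map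
      (W.vec (rotOf α))).prod := by
  rw [vertProd, ofFn_succ, ofFn_succ, map_cons, map_cons, map_ofFn]
  rfl

theorem glue_vertProd {Y : Type} [Finite Y] [DecidableEq Y] (α : Flags (V + 2) ≃ Y) :
    W.glue (rotOf α) (α (0, 0)) (α (1, 0)) (vertProd W α) =
    ((α (0, 0) :: ofFn fun i : Fin V => α (i.succ.succ, 0)).map
      (W.vec (swap (α (0, 0)) (α (1, 0)) * rotOf α))).prod := by
  rw [vertProd_succ_succ]
  refine W.glue_join (by simp) ?_ ?_ ?_
  · rw [sameCycle_rotOf_iff]; simp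
  · intro y hy
    obtain ⟨i, rfl⟩ := (mem_ofFn' _ _).mp hy
    rw [sameCycle_rotOf_iff]
    simp
  · intro y hy
    obtain ⟨i, rfl⟩ := (mem_ofFn' _ _).mp hy
    rw [sameCycle_rotOf_iff]
    simp [Fin.succ_succ_ne_one]

theorem rotOf_refl : rotOf (.refl (Flags V)) = shift V 3 := by
  ext <;> simp [rotOf]

theorem res_glue_vertProd : W.res (Subtype.val : Tail V → Flags (V + 2))
    (W.glue (rotOf (headRot (V := V))) (0, 0) (1, 0) (vertProd W headRot)) =
    W.res Subtype.val (W.glue (shift (V + 2) 3) (0, 0) (1, 0) (vertProd W (.refl _))) := by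
  have h1 := glue_vertProd (W := W) (headRot (V := V))
  have h2 := glue_vertProd (W := W) (Equiv.refl (Flags (V + 2)))
  obtain ⟨v1, -, -, v4, -, -, v7⟩ := headRot_values (V := V)
  simp only [v1, v4, v7] at h1
  simp only [rotOf_refl, Equiv.refl_apply] at h2
  rw [h1, h2, map_list_prod, map_list_prod]
  change (List.map _ (List.map (W.vec (headGlue _)) _)).prod =
    (List.map _ (List.map (W.vec (headGlue _)) _)).prod
  obtain ⟨k1, -⟩ := headGlue_values (V := V)
  obtain ⟨l1, l2, -⟩ := headGlue_values' (V := V)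
  have c1 : (headGlue (shift (V + 2) 3)).SameCycle (0, 0) (0, 1) := by
    rw [← k1]; exact Perm.sameCycle_apply_right.mpr (Perm.SameCycle.refl _ _)
  have c2 : (headGlue (rotOf (headRot (V := V)))).SameCycle (0, 0) (0, 1) := by
    have := Perm.sameCycle_apply_left.mpr
      (Perm.SameCycle.refl (headGlue (rotOf (headRot (V := V)))) (0, 1))
    rwa [l2] at this
  have key : ∀ {φ : Perm (Flags (V + 2))}, φ.SameCycle (0, 0) (0, 1) →
      Induces φ (Subtype.val : Tail V → Flags (V + 2)) (tailCut V) →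
      ((((0, 0) :: ofFn fun i : Fin V => (i.succ.succ, 0)).map (W.vec φ)).map
        (W.res (Subtype.val : Tail V → Flags (V + 2)))) =
      ((⟨(0, 1), by simp⟩ :: ofFn fun i : Fin V => ⟨(i.succ.succ, 0), by
        simp [Fin.succ_succ_ne_one]⟩ : List (Tail V)).map (W.vec (tailCut V))) := by
    intro φ hc hi
    rw [map_map, map_cons, map_cons, map_ofFn, map_ofFn, comp_apply, W.vec_congr hc]
    congr 1
    · exact W.res_vec hi Subtype.val_injective ⟨(0, 1), by simp⟩
    · congr 1
      funext i
      exact W.res_vec hi Subtype.val_injective ⟨(i.succ.succ, 0), by simp [Fin.succ_succ_ne_one]⟩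
  rw [key c1 induces_tailCut, key c2 induces_tailCut']

end AssocOrient

section AssocTotal

variable {k : Type u} [Field k] {V E n : ℕ} {W : Coef k}

theorem ends_ne_head {β : Ends (E + 1) n ≃ Flags (V + 2)}
    (h0 : β (.inl (last E, 0)) = (0, 0)) (h1 : β (.inl (last E, 1)) = (1, 0))
    {u : Ends (E + 1) n} (hu : u ≠ .inl (last E, 0)) (hu' : u ≠ .inl (last E, 1)) :
    β u ≠ (0, 0) ∧ β u ≠ (1, 0) :=
  ⟨by rw [← h0]; simpa using hu, by rw [← h1]; simpa using hu'⟩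

theorem exists_tailEdges {β : Ends (E + 1) n ≃ Flags (V + 2)}
    (h0 : β (.inl (last E, 0)) = (0, 0)) (h1 : β (.inl (last E, 1)) = (1, 0)) :
    ∃ L : List (Tail V × Tail V), L.length = E ∧
      edgeList β = L.map (Prod.map Subtype.val Subtype.val) ++ [((0, 0), (1, 0))] ∧
      ∀ e ∈ L.map (Prod.map Subtype.val Subtype.val), [(0, 0), (1, 0), e.1, e.2].Nodup := by
  have hb : ∀ (e : Fin E) (b : Fin 2), β (.inl (e.castSucc, b)) ≠ (0, 0) ∧
      β (.inl (e.castSucc, b)) ≠ (1, 0) := fun e b =>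
    ends_ne_head h0 h1 (by simp [(castSucc_lt_last e).ne]) (by simp [(castSucc_lt_last e).ne])
  refine ⟨ofFn fun e => (⟨_, hb e 0⟩, ⟨_, hb e 1⟩), by simp, ?_, ?_⟩
  · rw [edgeList, List.ofFn_succ', List.concat_eq_append, map_ofFn, h0, h1]
    rfl
  · intro e he
    rw [map_ofFn] at he
    obtain ⟨i, rfl⟩ := (mem_ofFn' _ _).mp he
    have b0 := hb i 0
    have b1 := hb i 1
    simp [b0.1.symm, b0.2.symm, b1.1.symm, b1.2.symm]

theorem exists_tailLeg {β : Ends (E + 1) n ≃ Flags (V + 2)}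
    (h0 : β (.inl (last E, 0)) = (0, 0)) (h1 : β (.inl (last E, 1)) = (1, 0)) :
    ∃ l : Fin n → Tail V, l.Injective ∧ legOf β = Subtype.val ∘ l :=
  ⟨fun x => ⟨β (.inr x), ends_ne_head h0 h1 (by simp) (by simp)⟩, fun x y h =>
    legOf_injective β (congrArg Subtype.val h), rfl⟩

theorem glueList_concat_fst {Y : Type} [DecidableEq Y] {L : List (Y × Y)} {p q : Y}
    (hL : ∀ e ∈ L, [p, q, e.1, e.2].Nodup) (φ : Perm Y) (x y : W.C Y) :
    (glueList W (L ++ [(p, q)]) (φ, x)).1 = (glueList W L (swap p q * φ, y)).1 := by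
  induction L generalizing φ x y with
  | nil => rfl
  | cons e L ih =>
    rw [List.cons_append, glueList_cons,
      ih (fun e' h => hL e' (by simp [h])) _ _ (W.glue (swap p q * φ) e.1 e.2 y), glueList_cons,
      swap_mul_swap_mul_comm (hL e (by simp))]

theorem res_orient_head {α : Flags (V + 2) ≃ Flags (V + 2)}
    (hα : Induces (headGlue (rotOf α)) Subtype.val (tailCut V))
    {β : Ends (E + 1) n ≃ Flags (V + 2)} {L : List (Tail V × Tail V)}
    (hL : edgeList β = L.map (Prod.map Subtype.val Subtype.val) ++ [((0, 0), (1, 0))])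
    (hL' : ∀ e ∈ L.map (Prod.map Subtype.val Subtype.val), [(0, 0), (1, 0), e.1, e.2].Nodup) :
    W.res (Subtype.val : Tail V → _) (orient W α β) = (sgn W.c : k) ^ L.length •
      (glueList W L (tailCut V, W.res Subtype.val
        (W.glue (rotOf α) (0, 0) (1, 0) (vertProd W α)))).2 ∧
    Induces (invOf β * rotOf α) (Subtype.val : Tail V → _) (glueList W L (tailCut V, 0)).1 := by
  have h := glueList_res (W := W) Subtype.val_injective L hα
    (W.glue (rotOf α) (0, 0) (1, 0) (vertProd W α))
  constructor
  · rw [orient, hL, glueList_concat hL' (vertProd_mem_line α), map_smul, List.length_map, ← h.2]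
    rfl
  · rw [← glueList_edgeList_fst (W := W) β (rotOf α) (vertProd W α), hL,
      glueList_concat_fst hL' (rotOf α) _ (W.glue (rotOf α) (0, 0) (1, 0) (vertProd W α)),
      glueList_fst L _ 0 (W.res Subtype.val (W.glue (rotOf α) (0, 0) (1, 0) (vertProd W α)))]
    exact h.1

theorem res_orient_headRot {β : Ends (E + 1) n ≃ Flags (V + 2)}
    (h0 : β (.inl (last E, 0)) = (0, 0)) (h1 : β (.inl (last E, 1)) = (1, 0)) :
    W.res (legOf β) (orient W headRot β) = W.res (legOf β) (orient W (.refl _) β) := by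
  obtain ⟨L, -, hL, hL'⟩ := exists_tailEdges h0 h1
  obtain ⟨l, -, hl⟩ := exists_tailLeg h0 h1
  rw [hl, ← W.res_res, ← W.res_res, (res_orient_head induces_tailCut' hL hL').1,
    (res_orient_head (α := Equiv.refl _) (by rw [rotOf_refl]; exact induces_tailCut) hL hL').1,
    res_glue_vertProd, rotOf_refl]

theorem induces_headRot_iff {β : Ends (E + 1) n ≃ Flags (V + 2)} {σ : Perm (Fin n)}
    (h0 : β (.inl (last E, 0)) = (0, 0)) (h1 : β (.inl (last E, 1)) = (1, 0)) :
    Induces (invOf β * rotOf (headRot (V := V))) (legOf β) σ ↔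
      Induces (invOf β * rotOf (.refl _)) (legOf β) σ := by
  obtain ⟨L, -, hL, hL'⟩ := exists_tailEdges h0 h1
  obtain ⟨l, li, hl⟩ := exists_tailLeg h0 h1
  have i1 := (res_orient_head (W := scalarCoef ℚ) induces_tailCut' hL hL').2
  have i2 := (res_orient_head (W := scalarCoef ℚ) (α := Equiv.refl _)
    (by rw [rotOf_refl]; exact induces_tailCut) hL hL').2
  rw [hl]
  constructor
  · intro h
    exact i2.trans (i1.of_trans h Subtype.val_injective li) Subtype.val_injective
  · intro h
    exact i1.trans (i2.of_trans h Subtype.val_injective li) Subtype.val_injective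

theorem Conn.of_step {Y : Type} {ρ ρ' i : Perm Y} (h : Conn ρ i)
    (hs : ∀ f, Relation.ReflTransGen (fun a b => b = ρ' a ∨ b = i a) f (ρ f)) : Conn ρ' i := by
  refine ⟨h.1, fun f g => ?_⟩
  have hr := h.2 f g
  induction hr with
  | refl => exact .refl
  | tail _ hbc ih =>
    rcases hbc with rfl | rfl
    · exact ih.trans (hs _)
    · exact ih.tail (.inr rfl)

theorem conn_headRot_iff {i : Perm (Flags (V + 2))} (h0 : i (0, 0) = (1, 0))
    (h1 : i (1, 0) = (0, 0)) : Conn (rotOf (headRot (V := V))) i ↔ Conn (shift (V + 2) 3) i := by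
  obtain ⟨k1, k2, k3, k4, k5, k6, k7⟩ := rotOf_headRot_values (V := V)
  have s : ∀ (j : Fin (V + 2)) b, shift (V + 2) 3 (j, b) = (j, b + 1) := fun _ _ => rfl
  constructor
  · intro h
    refine h.of_step fun f => ?_
    set R : Flags (V + 2) → Flags (V + 2) → Prop := Relation.ReflTransGen
      (fun a b => b = shift (V + 2) 3 a ∨ b = i a) with hR
    have st : ∀ a, R a (shift (V + 2) 3 a) := fun a => .single (.inl rfl)
    have a1 : R (0, 0) (0, 1) := st _
    have a2 : R (0, 1) (0, 2) := st _
    have a3 : R (0, 2) (0, 0) := st _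
    have b1 : R (1, 0) (1, 1) := st _
    have b2 : R (1, 1) (1, 2) := st _
    have b3 : R (1, 2) (1, 0) := st _
    have c1 : R (0, 0) (1, 0) := .single (.inr h0.symm)
    have c2 : R (1, 0) (0, 0) := .single (.inr h1.symm)
    induction f using flags_cases with
    | h j b => rw [k7, ← s]; exact st _
    | h00 => rw [k1]; exact a1.trans a2
    | h01 => rw [k2]; exact a2.trans (a3.trans c1)
    | h02 => rw [k3]; exact a3.trans (c1.trans b1)
    | h10 => rw [k4]; exact b1.trans b2
    | h11 => rw [k5]; exact b2.trans (b3.trans c2)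
    | h12 => rw [k6]; exact b3.trans (c2.trans a1)
  · intro h
    refine h.of_step fun f => ?_
    set R : Flags (V + 2) → Flags (V + 2) → Prop := Relation.ReflTransGen
      (fun a b => b = rotOf (headRot (V := V)) a ∨ b = i a) with hR
    have st : ∀ a, R a (rotOf (headRot (V := V)) a) := fun a => .single (.inl rfl)
    have a1 : R (0, 0) (0, 2) := by rw [← k1]; exact st _
    have a2 : R (0, 2) (1, 1) := by rw [← k3]; exact st _
    have a3 : R (1, 1) (0, 0) := by rw [← k5]; exact st _
    have b1 : R (1, 0) (1, 2) := by rw [← k4]; exact st _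
    have b2 : R (1, 2) (0, 1) := by rw [← k6]; exact st _
    have b3 : R (0, 1) (1, 0) := by rw [← k2]; exact st _
    have c1 : R (0, 0) (1, 0) := .single (.inr h0.symm)
    have c2 : R (1, 0) (0, 0) := .single (.inr h1.symm)
    induction f using flags_cases with
    | h j b => rw [s, ← k7]; exact st _
    | h00 => exact c1.trans (b1.trans b2)
    | h01 => exact b3.trans (c2.trans a1)
    | h02 => exact a2.trans a3
    | h10 => exact c2.trans (a1.trans a2)
    | h11 => exact a3.trans (c1.trans b1)
    | h12 => exact b2.trans b3

theorem adm_headRot_iff {β : Ends (E + 1) n ≃ Flags (V + 2)} {σ : Perm (Fin n)}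
    (h0 : β (.inl (last E, 0)) = (0, 0)) (h1 : β (.inl (last E, 1)) = (1, 0)) :
    Adm headRot β σ ↔ Adm (.refl _) β σ := by
  refine and_congr ?_ (induces_headRot_iff h0 h1)
  rw [rotOf_refl]
  refine conn_headRot_iff ?_ ?_
  · rw [← h0, invOf_inl, ← h1]; rfl
  · rw [← h1, invOf_inl, ← h0]; rfl

variable {K : Type*} [Fintype K] {par : K → ZMod 2} {m : K → K → K → k} {t T : K → K → k}
  {a : Fin n → K → k} {σ : Perm (Fin n)}

theorem weight_headRot [CharZero k] {c : ZMod 2} (hT : ∀ x y, T x y ≠ 0 → par x + par y = c)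
    (hass : IsAssociative par m T) {Y : Type} [Fintype Y] [DecidableEq Y]
    (α : Flags (V + 2) ≃ Y) (β : Ends (E + 1) n ≃ Y)
    (h0 : β (.inl (last E, 0)) = α (0, 0)) (h1 : β (.inl (last E, 1)) = α (1, 0)) :
    weight W par m (update (fun _ => t) (last E) T) (headRot.trans α) β a =
      -weight W par m (update (fun _ => t) (last E) T) α β a ∧
    (Adm (headRot.trans α) β σ ↔ Adm α β σ) := by
  obtain ⟨γ, rfl⟩ : ∃ γ : Ends (E + 1) n ≃ Flags (V + 2), β = γ.trans α :=
    ⟨β.trans α.symm, by ext; simp⟩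
  have g0 : γ (.inl (last E, 0)) = (0, 0) := α.injective h0
  have g1 : γ (.inl (last E, 1)) = (1, 0) := α.injective h1
  have e1 : weight W par m (update (fun _ => t) (last E) T) α (γ.trans α) a =
      weight W par m (update (fun _ => t) (last E) T) (.refl _) γ a :=
    weight_trans par m _ (.refl _) γ a α
  have e2 : Adm α (γ.trans α) σ ↔ Adm (.refl _) γ σ := adm_trans (α := Equiv.refl _) α
  constructor
  · rw [weight_trans, e1, weight, contr_headRot hT hass γ g0 g1, res_orient_headRot g0 g1, neg_smul]
    rfl
  · rw [adm_trans, e2, adm_headRot_iff g0 g1]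

theorem exists_commute_shift {p q : Flags (V + 2)} (h : p.1 ≠ q.1) :
    ∃ g : Perm (Flags (V + 2)), Commute g (shift (V + 2) 3) ∧ g (0, 0) = p ∧ g (1, 0) = q := by
  set π1 : Perm (Fin (V + 2)) := swap 0 p.1
  have hp : π1 0 = p.1 := swap_apply_left _ _
  refine ⟨wreath (swap (π1 1) q.1 * π1) fun i => if i = 0 then p.2 else q.2,
    commute_wreath _ _, ?_, ?_⟩
  · rw [wreath_apply, mul_apply, hp, swap_apply_of_ne_of_ne _ h]
    · simp
    · rw [← hp]; simp
  · rw [wreath_apply, mul_apply, swap_apply_left]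
    simp

/-- An edge joining two flags of one vertex leaves a boundary component without legs. -/
theorem not_induces_of_loop {Y : Type} {α : Flags V ≃ Y} {β : Ends E n ≃ Y} {e : Fin E} {b : Fin 2}
    (h : (rotOf α) (β (.inl (e, b))) = β (.inl (e, b + 1))) :
    ¬ Induces (invOf β * rotOf α) (legOf β) σ := by
  intro hi
  obtain ⟨x, hx⟩ := hi.1 (β (.inl (e, b)))
  have hf : (invOf β * rotOf α) (β (.inl (e, b))) = β (.inl (e, b)) := by
    rw [mul_apply, h, invOf_inl, add_assoc, show (1 : Fin 2) + 1 = 0 from rfl, add_zero]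
  have := hx.eq_of_left hf
  simp [legOf] at this

theorem sum_fiber_eq_zero [CharZero k] {c : ZMod 2} (hT : ∀ x y, T x y ≠ 0 → par x + par y = c)
    (hm : IsCyclicTensor par W.c m) (hass : IsAssociative par m T) (p q : Flags V)
    [DecidablePred fun β : Ends (E + 1) n ≃ Flags V => Adm (.refl _) β σ] :
    (∑ β : Ends (E + 1) n ≃ Flags V with
        (β (.inl (last E, 0)), β (.inl (last E, 1))) = (p, q),
      if Adm (.refl _) β σ then
        weight W par m (update (fun _ => t) (last E) T) (.refl _) β a else 0) = 0 := by
  by_cases hpq : p.1 = q.1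
  · refine sum_eq_zero fun β hβ => if_neg fun hA => ?_
    obtain ⟨h0, h1⟩ := Prod.mk.inj (mem_filter.mp hβ).2
    have hne : β (.inl (last E, 0)) ≠ β (.inl (last E, 1)) := by simp
    rw [h0, h1] at hne
    have hne2 : p.2 ≠ q.2 := fun h => hne (Prod.ext hpq h)
    have h3 : ∀ x y : Fin 3, x ≠ y → y = x + 1 ∨ x = y + 1 := by decide
    rcases h3 _ _ hne2 with h | h
    · refine not_induces_of_loop (e := last E) (b := 0) ?_ hA.2
      rw [zero_add, h0, h1, rotOf_refl, shift_apply, hpq, ← h]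
    · refine not_induces_of_loop (e := last E) (b := 1) ?_ hA.2
      rw [show (1 : Fin 2) + 1 = 0 from rfl, h0, h1, rotOf_refl, shift_apply, ← hpq, ← h]
  · obtain ⟨V, rfl⟩ : ∃ W', V = W' + 2 := ⟨V - 2, by
      have h1 := p.1.2
      have h2 := q.1.2
      have h3 : (p.1 : ℕ) ≠ q.1 := fun h => hpq (Fin.ext h)
      omega⟩
    obtain ⟨α, hα, rfl, rfl⟩ := exists_commute_shift hpq
    set S := ∑ β : Ends (E + 1) n ≃ Flags (V + 2) with
        (β (.inl (last E, 0)), β (.inl (last E, 1))) = (α (0, 0), α (1, 0)),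
      if Adm (.refl _) β σ then
        weight W par m (update (fun _ => t) (last E) T) (.refl _) β a else 0 with hS
    obtain ⟨v1, -, -, v4, -⟩ := headRot_values (V := V)
    set g : Perm (Flags (V + 2)) := α.symm.trans (headRot.trans α) with hg
    have g0 : g (α (0, 0)) = α (0, 0) := by simp [hg, v1]
    have g1 : g (α (1, 0)) = α (1, 0) := by simp [hg, v4]
    have hαs : Commute α.symm (shift (V + 2) 3) := hα.inv_left
    have r1 : rotOf g = rotOf (headRot.trans α) := rotOf_conj _ hαs _
    have r2 : rotOf (.refl (Flags (V + 2))) = rotOf α := (rotOf_conj α hα (.refl _)).symm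
    have key : S = -S := by
      rw [hS, ← Finset.sum_neg_distrib]
      refine Finset.sum_bij' (fun β _ => β.trans g) (fun β _ => β.trans g.symm) ?_ ?_ ?_ ?_ ?_
      · intro β hβ
        obtain ⟨h0, h1⟩ := Prod.mk.inj (mem_filter.mp hβ).2
        refine mem_filter.mpr ⟨mem_univ _, ?_⟩
        change (g (β _), g (β _)) = _
        rw [h0, h1, g0, g1]
      · intro β hβ
        obtain ⟨h0, h1⟩ := Prod.mk.inj (mem_filter.mp hβ).2
        refine mem_filter.mpr ⟨mem_univ _, ?_⟩
        change (g.symm (β _), g.symm (β _)) = _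
        rw [h0, h1, g.symm_apply_eq.mpr g0.symm, g.symm_apply_eq.mpr g1.symm]
      · intro β _; ext x <;> simp
      · intro β _; ext x <;> simp
      · intro β hβ
        obtain ⟨h0, h1⟩ := Prod.mk.inj (mem_filter.mp hβ).2
        have e1 : weight W par m (update (fun _ => t) (last E) T) (.refl _) β a =
            weight W par m (update (fun _ => t) (last E) T) g (β.trans g) a :=
          (weight_trans par m _ (.refl _) β a g).symm
        have e2 : Adm (.refl _) β σ ↔ Adm g (β.trans g) σ := (adm_trans (α := Equiv.refl _) g).symm
        have k0 : (β.trans g) (.inl (last E, 0)) = α (0, 0) := by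
          rw [trans_apply, h0, g0]
        have k1 : (β.trans g) (.inl (last E, 1)) = α (1, 0) := by
          rw [trans_apply, h1, g1]
        have hw := weight_headRot (W := W) (m := m) (t := t) (a := a) (σ := σ) hT hass α _ k0 k1
        rw [e1, weight_vertex_symm hm r1, hw.1, weight_vertex_symm hm r2]
        have : Adm (.refl _) β σ ↔ Adm (.refl _) (β.trans g) σ := by
          rw [e2, adm_congr r1 rfl rfl, hw.2, adm_congr r2 rfl rfl]
        by_cases hA : Adm (.refl _) β σ
        · rw [if_pos hA, if_pos (this.mp hA)]
        · rw [if_neg hA, if_neg (this.not.mp hA), neg_zero]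
    have h2 : (2 : k) • S = 0 := by rw [two_smul]; nth_rw 2 [key]; rw [add_neg_cancel]
    exact (smul_eq_zero.mp h2).resolve_left two_ne_zero

/-- The full inverse tensor inserted in an edge contributes nothing. -/
theorem total_associative [CharZero k] {c : ZMod 2} (hT : ∀ x y, T x y ≠ 0 → par x + par y = c)
    (hm : IsCyclicTensor par W.c m) (hass : IsAssociative par m T) :
    total W par m (update (fun _ => t) (last E) T) V n σ a = 0 := by
  classical
  unfold total
  rw [← Finset.sum_fiberwise univ fun β : Ends (E + 1) n ≃ Flags V =>
    (β (.inl (last E, 0)), β (.inl (last E, 1)))]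
  exact sum_eq_zero fun pq _ => sum_fiber_eq_zero hT hm hass pq.1 pq.2

end AssocTotal

/-! ### Disjoint unions of graphs -/

theorem numCycles_swap_mul {Y : Type*} [Finite Y] [DecidableEq Y] {φ : Perm Y} {p q : Y}
    (hpq : p ≠ q) : (numCycles (swap p q * φ) : ZMod 2) = numCycles φ + 1 := by
  have key : ∀ φ : Perm Y, ¬ φ.SameCycle p q → numCycles φ = numCycles (swap p q * φ) + 1 := by
    intro φ h
    obtain ⟨l, hl⟩ := exists_transversal_cons_cons φ h
    rw [← hl.length_eq, ← (hl.join hpq h).length_eq]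
    rfl
  by_cases h : φ.SameCycle p q
  · have h1 := key (swap p q * φ) (by rw [sameCycle_swap_mul_iff hpq]; exact not_not.mpr h)
    rw [swap_mul_swap_mul] at h1
    rw [h1]
    push_cast
    rfl
  · rw [key φ h]
    push_cast
    rw [add_assoc, show (1 + 1 : ZMod 2) = 0 from rfl, add_zero]

section Sum

variable {k : Type u} [Field k] {K : Type*} {W : Coef k} {V E n : ℕ} {Y : Type} [Fintype Y]
  [DecidableEq Y]

theorem numCycles_glueList {L : List (Y × Y)} (hL : ∀ p ∈ L, p.1 ≠ p.2) (φ : Perm Y) (x : W.C Y) :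
    (numCycles (glueList W L (φ, x)).1 : ZMod 2) = numCycles φ + L.length := by
  induction L generalizing φ x with
  | nil => simp [glueList]
  | cons p L ih =>
    rw [glueList_cons, ih (fun q hq => hL q (by simp [hq])), numCycles_swap_mul (hL p (by simp)),
      length_cons]
    push_cast
    ring

theorem numCycles_boundary (α : Flags V ≃ Y) (β : Ends E n ≃ Y) :
    (numCycles (invOf β * rotOf α) : ZMod 2) = V + E := by
  rw [← glueList_edgeList_fst (W := scalarCoef ℚ) β _ 1, numCycles_glueList (edgeList_ne β),
    ← (isTransversal_vertices α).length_eq]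
  simp [edgeList]

theorem sum_par_vertices {q : Y → ZMod 2} {c : ZMod 2} (α : Flags V ≃ Y)
    (h : ∀ i, q (α (i, 0)) + q (α (i, 1)) + q (α (i, 2)) = c) : ∑ y, q y = c * V := by
  rw [← α.sum_comp, sum_prod_type]
  simp only [Fin.sum_univ_three, h]
  simp [mul_comm]

theorem sum_par_ends {q : Y → ZMod 2} {c : ZMod 2} (β : Ends E n ≃ Y)
    (h : ∀ e, q (β (.inl (e, 0))) + q (β (.inl (e, 1))) = c) :
    ∑ y, q y = c * E + ∑ x, q (legOf β x) := by
  rw [← β.sum_comp, sum_sum_type, sum_prod_type]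
  simp only [Fin.sum_univ_two, h]
  simp [mul_comm, legOf]

variable {par : K → ZMod 2} {m : K → K → K → k} {t : K → K → k} {a : Fin n → K → k}
  {pa : Fin n → ZMod 2}

theorem sum_par_legs {c : ZMod 2} (hm : IsCyclicTensor par c m) (ht : IsEdgeTensor par c t)
    (ha : ∀ x y, a x y ≠ 0 → par y = pa x) {α : Flags V ≃ Y} {β : Ends E n ≃ Y} {φ : Y → K}
    (h : term par m (fun _ => t) α β a φ ≠ 0) : ∑ x, pa x = c * (V + E) := by
  unfold term at h
  have h3 := right_ne_zero_of_mul h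
  have h2 := right_ne_zero_of_mul (left_ne_zero_of_mul h)
  have h1 := right_ne_zero_of_mul (left_ne_zero_of_mul (left_ne_zero_of_mul h))
  rw [prod_ne_zero_iff] at h1 h2 h3
  have e1 := sum_par_vertices (q := par ∘ φ) α fun i => hm.parity _ _ _ (h1 i (mem_univ _))
  have e2 := sum_par_ends (q := par ∘ φ) β fun e => ht.parity _ _ (h2 e (mem_univ _))
  have e3 : ∑ x, pa x = ∑ x, (par ∘ φ) (legOf β x) :=
    sum_congr rfl fun x _ => (ha x _ (h3 x (mem_univ _))).symm
  rw [e3, mul_add, ← e1, e2, add_comm, ← add_assoc, CharTwo.add_self_eq_zero, zero_add]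

end Sum

section Block

variable {k : Type u} [Field k] {K : Type*} {W : Coef k} {V V1 V2 E E1 E2 n n1 n2 : ℕ}
  {Y1 Y2 : Type}

/-- The flags of a disjoint union. -/
def sumFlags (ε : Fin V ≃ Fin V1 ⊕ Fin V2) (α1 : Flags V1 ≃ Y1) (α2 : Flags V2 ≃ Y2) :
    Flags V ≃ Y1 ⊕ Y2 :=
  ((ε.prodCongr (.refl _)).trans (Equiv.sumProdDistrib _ _ _)).trans (Equiv.sumCongr α1 α2)

/-- The edges and legs of a disjoint union. -/
def sumEnds (ε : Fin E ≃ Fin E1 ⊕ Fin E2) (εX : Fin n ≃ Fin n1 ⊕ Fin n2) (β1 : Ends E1 n1 ≃ Y1)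
    (β2 : Ends E2 n2 ≃ Y2) : Ends E n ≃ Y1 ⊕ Y2 :=
  ((Equiv.sumCongr ((ε.prodCongr (.refl _)).trans (Equiv.sumProdDistrib _ _ _)) εX).trans
    (Equiv.sumSumSumComm _ _ _ _)).trans (Equiv.sumCongr β1 β2)

section Values

variable (ε : Fin V ≃ Fin V1 ⊕ Fin V2) (α1 : Flags V1 ≃ Y1) (α2 : Flags V2 ≃ Y2)
  (εE : Fin E ≃ Fin E1 ⊕ Fin E2) (εX : Fin n ≃ Fin n1 ⊕ Fin n2) (β1 : Ends E1 n1 ≃ Y1)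
  (β2 : Ends E2 n2 ≃ Y2)

theorem sumFlags_inl (i : Fin V1) (b : Fin 3) :
    sumFlags ε α1 α2 (ε.symm (.inl i), b) = .inl (α1 (i, b)) := by
  simp [sumFlags]

theorem sumFlags_inr (i : Fin V2) (b : Fin 3) :
    sumFlags ε α1 α2 (ε.symm (.inr i), b) = .inr (α2 (i, b)) := by
  simp [sumFlags]

theorem sumEnds_inl_inl (i : Fin E1) (b : Fin 2) :
    sumEnds εE εX β1 β2 (.inl (εE.symm (.inl i), b)) = .inl (β1 (.inl (i, b))) := by
  simp [sumEnds]

theorem sumEnds_inl_inr (i : Fin E2) (b : Fin 2) :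
    sumEnds εE εX β1 β2 (.inl (εE.symm (.inr i), b)) = .inr (β2 (.inl (i, b))) := by
  simp [sumEnds]

theorem sumEnds_inr_inl (x : Fin n1) :
    sumEnds εE εX β1 β2 (.inr (εX.symm (.inl x))) = .inl (β1 (.inr x)) := by
  simp [sumEnds]

theorem sumEnds_inr_inr (x : Fin n2) :
    sumEnds εE εX β1 β2 (.inr (εX.symm (.inr x))) = .inr (β2 (.inr x)) := by
  simp [sumEnds]

theorem rotOf_sumFlags : rotOf (sumFlags ε α1 α2) = sumCongr (rotOf α1) (rotOf α2) := by
  refine Equiv.ext fun y => ?_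
  rcases y with y | y
  · obtain ⟨⟨i, b⟩, rfl⟩ := α1.surjective y
    rw [← sumFlags_inl ε α1 α2, rotOf_apply, sumFlags_inl, sumFlags_inl, sumCongr_apply,
      map_inl, rotOf_apply]
  · obtain ⟨⟨i, b⟩, rfl⟩ := α2.surjective y
    rw [← sumFlags_inr ε α1 α2, rotOf_apply, sumFlags_inr, sumFlags_inr, sumCongr_apply,
      map_inr, rotOf_apply]

theorem invOf_sumEnds : invOf (sumEnds εE εX β1 β2) = sumCongr (invOf β1) (invOf β2) := by
  refine Equiv.ext fun y => ?_
  rcases y with y | y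
  · obtain ⟨⟨i, b⟩ | x, rfl⟩ := β1.surjective y
    · rw [← sumEnds_inl_inl εE εX β1 β2, invOf_inl, sumEnds_inl_inl, sumEnds_inl_inl,
        sumCongr_apply, map_inl, invOf_inl]
    · rw [← sumEnds_inr_inl εE εX β1 β2, invOf_inr, sumEnds_inr_inl, sumCongr_apply,
        map_inl, invOf_inr]
  · obtain ⟨⟨i, b⟩ | x, rfl⟩ := β2.surjective y
    · rw [← sumEnds_inl_inr εE εX β1 β2, invOf_inl, sumEnds_inl_inr, sumEnds_inl_inr,
        sumCongr_apply, map_inr, invOf_inl]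
    · rw [← sumEnds_inr_inr εE εX β1 β2, invOf_inr, sumEnds_inr_inr, sumCongr_apply,
        map_inr, invOf_inr]

theorem legOf_sumEnds : legOf (sumEnds εE εX β1 β2) = Sum.map (legOf β1) (legOf β2) ∘ εX := by
  funext x
  obtain ⟨x | x, rfl⟩ := εX.symm.surjective x
  · simp [legOf, sumEnds_inr_inl]
  · simp [legOf, sumEnds_inr_inr]

end Values

section Orient

variable (α1 : Flags V1 ≃ Y1) (α2 : Flags V2 ≃ Y2) (εX : Fin n ≃ Fin n1 ⊕ Fin n2)
  (β1 : Ends E1 n1 ≃ Y1) (β2 : Ends E2 n2 ≃ Y2)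

theorem sumFlags_castAdd (i : Fin V1) (b : Fin 3) :
    sumFlags finSumFinEquiv.symm α1 α2 (castAdd V2 i, b) = .inl (α1 (i, b)) :=
  sumFlags_inl finSumFinEquiv.symm α1 α2 i b

theorem sumFlags_natAdd (i : Fin V2) (b : Fin 3) :
    sumFlags finSumFinEquiv.symm α1 α2 (natAdd V1 i, b) = .inr (α2 (i, b)) :=
  sumFlags_inr finSumFinEquiv.symm α1 α2 i b

theorem sumEnds_castAdd (i : Fin E1) (b : Fin 2) :
    sumEnds finSumFinEquiv.symm εX β1 β2 (.inl (castAdd E2 i, b)) = .inl (β1 (.inl (i, b))) :=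
  sumEnds_inl_inl finSumFinEquiv.symm εX β1 β2 i b

theorem sumEnds_natAdd (i : Fin E2) (b : Fin 2) :
    sumEnds finSumFinEquiv.symm εX β1 β2 (.inl (natAdd E1 i, b)) = .inr (β2 (.inl (i, b))) :=
  sumEnds_inl_inr finSumFinEquiv.symm εX β1 β2 i b

theorem list_ofFn_add {M : Type*} (f : Fin (V1 + V2) → M) :
    ofFn f = (ofFn fun i => f (castAdd V2 i)) ++ ofFn fun i => f (natAdd V1 i) := by
  rw [List.ofFn_add]
  rfl

theorem vertProd_sum : vertProd W (sumFlags finSumFinEquiv.symm α1 α2) =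
    W.ext Sum.inl (vertProd W α1) * W.ext Sum.inr (vertProd W α2) := by
  unfold vertProd
  rw [list_ofFn_add, List.prod_append, map_list_prod, map_list_prod, map_ofFn, map_ofFn,
    rotOf_sumFlags]
  simp only [sumFlags_castAdd, sumFlags_natAdd, W.ext_vec_inl, W.ext_vec_inr]
  rfl

theorem edgeList_sum : edgeList (sumEnds finSumFinEquiv.symm εX β1 β2) =
    (edgeList β1).map (Prod.map Sum.inl Sum.inl) ++
      (edgeList β2).map (Prod.map Sum.inr Sum.inr) := by
  unfold edgeList
  rw [list_ofFn_add, map_ofFn, map_ofFn]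
  simp only [sumEnds_castAdd, sumEnds_natAdd]
  rfl

variable [Fintype Y1] [Fintype Y2] [DecidableEq Y1] [DecidableEq Y2]

theorem glueList_inl (L : List (Y1 × Y1)) (φ : Perm Y1) (ψ : Perm Y2) (x : W.C Y1) (y : W.C Y2) :
    glueList W (L.map (Prod.map Sum.inl Sum.inl))
        (sumCongr φ ψ, W.ext Sum.inl x * W.ext Sum.inr y) =
      (sumCongr (glueList W L (φ, x)).1 ψ,
        W.ext Sum.inl (glueList W L (φ, x)).2 * W.ext Sum.inr y) := by
  induction L generalizing φ x with
  | nil => rfl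
  | cons p L ih =>
    rw [map_cons, glueList_cons, glueList_cons]
    simp only [Prod.map]
    rw [W.glue_inl, swap_inl_mul_sumCongr]
    exact ih _ _

theorem glueList_inr (L : List (Y2 × Y2)) (φ : Perm Y1) (ψ : Perm Y2) {x : W.C Y1} (y : W.C Y2)
    (hx : x ∈ W.line φ) :
    (glueList W (L.map (Prod.map Sum.inr Sum.inr))
        (sumCongr φ ψ, W.ext Sum.inl x * W.ext Sum.inr y)).2 =
      (sgn (W.c * (numCycles φ * L.length)) : k) •
        (W.ext Sum.inl x * W.ext Sum.inr (glueList W L (ψ, y)).2) := by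
  induction L generalizing ψ y with
  | nil => simp [glueList, sgn_zero]
  | cons p L ih =>
    rw [map_cons, glueList_cons, glueList_cons]
    simp only [Prod.map]
    rw [W.glue_inr _ _ _ _ _ hx, swap_inr_mul_sumCongr, glueList_smul, ih, smul_smul, length_cons]
    congr 1
    push_cast
    rw [mul_add, mul_add, mul_one, sgn_add]
    push_cast
    ring

theorem orient_sum : orient W (sumFlags finSumFinEquiv.symm α1 α2)
      (sumEnds finSumFinEquiv.symm εX β1 β2) =
    (sgn (W.c * ((V1 + E1) * E2)) : k) •
      (W.ext Sum.inl (orient W α1 β1) * W.ext Sum.inr (orient W α2 β2)) := by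
  have h1 := orient_mem_line (W := W) α1 β1
  unfold orient at h1 ⊢
  rw [edgeList_sum, glueList_append, vertProd_sum, rotOf_sumFlags, glueList_inl,
    glueList_edgeList_fst, glueList_inr _ _ _ _ h1, numCycles_boundary]
  simp only [edgeList, List.length_ofFn]

end Orient

section Contr

variable {p : Ends (E1 + E2) n → ZMod 2} (εX : Fin n ≃ Fin n1 ⊕ Fin n2)

/-- The order of the edges and legs of a disjoint union, component by component. -/
def sumRank : Ends (E1 + E2) n → ℕ := Sum.elim endRank (fun x => 2 * E1 + n1 + endRank x) ∘
    sumEnds finSumFinEquiv.symm εX (Equiv.refl (Ends E1 n1)) (Equiv.refl (Ends E2 n2))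

theorem sumRank_injective : (sumRank εX : Ends (E1 + E2) n → ℕ).Injective := by
  refine Function.Injective.comp ?_ (Equiv.injective _)
  have hb : ∀ x : Ends E1 n1, endRank x < 2 * E1 + n1 := by
    rintro (⟨e, b⟩ | x) <;> simp only [endRank, elim_inl, elim_inr] <;> omega
  rintro (x | x) (y | y) h <;> simp only [elim_inl, elim_inr] at h
  · rw [endRank_injective h]
  · have := hb x; omega
  · have := hb y; omega
  · rw [endRank_injective (Nat.add_left_cancel h)]

/-- The order in which the legs are listed component by component. -/
def legRank (x : Fin n) : ℕ := Sum.elim (fun y : Fin n1 => (y : ℕ)) (fun y : Fin n2 => n1 + y) (εX x)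

theorem legRank_injective : (legRank εX).Injective := by
  refine Function.Injective.comp (g := Sum.elim (fun y : Fin n1 => (y : ℕ)) (fun y : Fin n2 => n1 + y))
    ?_ εX.injective
  rintro (x | x) (y | y) h <;> simp only [elim_inl, elim_inr] at h
  · rw [Fin.ext h]
  · omega
  · omega
  · rw [Fin.ext (Nat.add_left_cancel h)]

theorem sumRank_castAdd (i : Fin E1) (b : Fin 2) :
    sumRank εX (.inl (castAdd E2 i, b)) = 2 * i + b := by
  simp [sumRank, sumEnds_castAdd, endRank]

theorem sumRank_natAdd (i : Fin E2) (b : Fin 2) :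
    sumRank εX (.inl (natAdd E1 i, b)) = 2 * E1 + n1 + (2 * i + b) := by
  simp [sumRank, sumEnds_natAdd, endRank]

theorem sumRank_inl (x : Fin n1) :
    sumRank (E1 := E1) (E2 := E2) εX (.inr (εX.symm (.inl x))) = 2 * E1 + x := by
  simp [sumRank, sumEnds_inr_inl, endRank]

theorem sumRank_inr (x : Fin n2) :
    sumRank (E1 := E1) (E2 := E2) εX (.inr (εX.symm (.inr x))) = 2 * E1 + n1 + (2 * E2 + x) := by
  simp [sumRank, sumEnds_inr_inr, endRank]

theorem legRank_inl (x : Fin n1) : legRank εX (εX.symm (.inl x)) = x := by simp [legRank]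

theorem legRank_inr (x : Fin n2) : legRank εX (εX.symm (.inr x)) = n1 + x := by simp [legRank]

theorem koszulSign_sumRank {c : ZMod 2} (h : ∀ e, p (.inl (natAdd E1 e, 0)) +
    p (.inl (natAdd E1 e, 1)) = c) :
    koszulSign p endRank (sumRank εX) = koszulSign (p ∘ Sum.inr) (fun x => (x : ℕ)) (legRank εX) *
        sgn (c * E2 * ∑ x, p (.inr (εX.symm (.inl x)))) := by
  classical
  set s : Ends (E1 + E2) n → ℕ := Sum.elim (fun e => 2 * e.1 + e.2)
    fun x => 2 * (E1 + E2) + legRank εX x with hs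
  have hsi : s.Injective := by
    rintro (⟨a, b⟩ | a) (⟨c, d⟩ | c) h <;> simp only [hs, elim_inl, elim_inr] at h
    · congr 1; ext <;> simp <;> omega
    · omega
    · omega
    · rw [legRank_injective εX (Nat.add_left_cancel h)]
  rw [← koszulSign_mul p endRank_injective hsi (sumRank_injective εX)]
  congr 1
  · rw [koszulSign_window (z := Sum.inr) inr_injective]
    · refine koszulSign_congr ?_ ?_ <;> intro x y <;> simp [hs, endRank]
    · rintro (⟨a, b⟩ | a) (⟨c, d⟩ | c) h <;> simp [hs, endRank] at h ⊢ <;> omega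
  · let fA : Fin E2 × Fin 2 ↪ Ends (E1 + E2) n :=
      ⟨fun e => .inl (natAdd E1 e.1, e.2), fun e e' h => by
        simpa [Prod.ext_iff] using h⟩
    let fB : Fin n1 ↪ Ends (E1 + E2) n :=
      ⟨fun x => .inr (εX.symm (.inl x)), fun e e' h => by simpa using h⟩
    rw [koszulSign_rectangle p (univ.map fA) (univ.map fB)]
    · rw [sum_map, sum_map]
      congr 2
      rw [sum_prod_type]
      simp only [Fin.sum_univ_two]
      change ∑ e, (p (.inl (natAdd E1 e, 0)) + p (.inl (natAdd E1 e, 1))) = _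
      simp [h, mul_comm]
    · have case : ∀ x : Ends (E1 + E2) n, (∃ i b, x = .inl (castAdd E2 i, b)) ∨
          (∃ i b, x = .inl (natAdd E1 i, b)) ∨ (∃ y, x = .inr (εX.symm (.inl y))) ∨
          ∃ y, x = .inr (εX.symm (.inr y)) := by
        rintro (⟨i, b⟩ | x)
        · refine Fin.addCases (fun i => ?_) (fun i => ?_) i
          · exact .inl ⟨i, b, rfl⟩
          · exact .inr (.inl ⟨i, b, rfl⟩)
        · obtain ⟨y | y, rfl⟩ := εX.symm.surjective x
          · exact .inr (.inr (.inl ⟨y, rfl⟩))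
          · exact .inr (.inr (.inr ⟨y, rfl⟩))
      have hA : ∀ x, x ∈ univ.map fA ↔ ∃ i b, x = .inl (natAdd E1 i, b) := by
        intro x
        simp only [Finset.mem_map, mem_univ, true_and, Prod.exists, eq_comm]
        rfl
      have hB : ∀ x, x ∈ univ.map fB ↔ ∃ y, x = .inr (εX.symm (.inl y)) := by
        intro x
        simp only [Finset.mem_map, mem_univ, true_and, eq_comm]
        rfl
      have ne : ∀ (i : Fin E1) (j : Fin E2), castAdd E2 i ≠ natAdd E1 j := by
        intro i j h
        have := congrArg Fin.val h
        simp at this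
        omega
      intro x y
      rw [hA, hB]
      rcases case x with ⟨i, b, rfl⟩ | ⟨i, b, rfl⟩ | ⟨i, rfl⟩ | ⟨i, rfl⟩ <;>
      rcases case y with ⟨j, d, rfl⟩ | ⟨j, d, rfl⟩ | ⟨j, rfl⟩ | ⟨j, rfl⟩ <;>
      simp [hs, sumRank_castAdd, sumRank_natAdd, sumRank_inl, sumRank_inr, legRank_inl,
        legRank_inr, ne] <;> omega

end Contr

section Ranks

variable (α1 : Flags V1 ≃ Y1) (α2 : Flags V2 ≃ Y2) (εX : Fin n ≃ Fin n1 ⊕ Fin n2)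
  (β1 : Ends E1 n1 ≃ Y1) (β2 : Ends E2 n2 ≃ Y2)

theorem sumRank_symm_inl (y : Y1) :
    sumRank εX ((sumEnds finSumFinEquiv.symm εX β1 β2).symm (.inl y)) = endRank (β1.symm y) := by
  obtain ⟨⟨e, b⟩ | x, rfl⟩ := β1.surjective y
  · rw [← sumEnds_castAdd (E2 := E2) εX β1 β2, symm_apply_apply, symm_apply_apply, sumRank_castAdd]
    rfl
  · rw [← sumEnds_inr_inl finSumFinEquiv.symm εX β1 β2, symm_apply_apply,
      symm_apply_apply, sumRank_inl]
    rfl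

theorem sumRank_symm_inr (y : Y2) :
    sumRank εX ((sumEnds finSumFinEquiv.symm εX β1 β2).symm (.inr y)) =
      2 * E1 + n1 + endRank (β2.symm y) := by
  obtain ⟨⟨e, b⟩ | x, rfl⟩ := β2.surjective y
  · rw [← sumEnds_natAdd (E1 := E1) εX β1 β2, symm_apply_apply, symm_apply_apply, sumRank_natAdd]
    rfl
  · rw [← sumEnds_inr_inr finSumFinEquiv.symm εX β1 β2, symm_apply_apply,
      symm_apply_apply, sumRank_inr]
    rfl

theorem flagRank_symm_inl (y : Y1) :
    flagRank ((sumFlags finSumFinEquiv.symm α1 α2).symm (.inl y)) = flagRank (α1.symm y) := by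
  obtain ⟨⟨e, b⟩, rfl⟩ := α1.surjective y
  rw [← sumFlags_castAdd (V2 := V2) α1 α2, symm_apply_apply, symm_apply_apply]
  rfl

theorem flagRank_symm_inr (y : Y2) : flagRank ((sumFlags finSumFinEquiv.symm α1 α2).symm (.inr y)) =
      3 * V1 + flagRank (α2.symm y) := by
  obtain ⟨⟨e, b⟩, rfl⟩ := α2.surjective y
  rw [← sumFlags_natAdd (V1 := V1) α1 α2, symm_apply_apply, symm_apply_apply]
  simp only [flagRank, Fin.val_natAdd]
  ring

theorem endRank_lt (x : Ends E n) : endRank x < 2 * E + n := by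
  rcases x with ⟨e, b⟩ | x <;> simp only [endRank, elim_inl, elim_inr] <;> omega

theorem flagRank_lt' (x : Flags V) : flagRank x < 3 * V := by
  obtain ⟨i, b⟩ := x
  simp only [flagRank]
  omega

variable [Fintype Y1] [Fintype Y2] {par : K → ZMod 2} {m : K → K → K → k} {t : K → K → k}
  {a : Fin n → K → k} {pa : Fin n → ZMod 2}

theorem term_sum (hm : IsCyclicTensor par W.c m) (ht : IsEdgeTensor par W.c t)
    (ha : ∀ x y, a x y ≠ 0 → par y = pa x) (φ : Y1 ⊕ Y2 → K) :
    term par m (fun _ => t) (sumFlags finSumFinEquiv.symm α1 α2)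
        (sumEnds finSumFinEquiv.symm εX β1 β2) a φ =
      (sgn (W.c * ((V1 + E1) * E2)) * koszulSign pa (fun x => (x : ℕ)) (legRank εX) : k) *
        (term par m (fun _ => t) α1 β1 (fun x => a (εX.symm (.inl x))) (φ ∘ Sum.inl) *
          term par m (fun _ => t) α2 β2 (fun x => a (εX.symm (.inr x))) (φ ∘ Sum.inr)) := by
  classical
  unfold term
  rw [Fin.prod_univ_add, Fin.prod_univ_add, ← εX.symm.prod_comp, Fintype.prod_sum_type]
  simp only [sumFlags_castAdd, sumFlags_natAdd, sumEnds_castAdd, sumEnds_natAdd, sumEnds_inr_inl,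
    sumEnds_inr_inr, comp_apply]
  set A1 := ∏ i, m (φ (.inl (α1 (i, 0)))) (φ (.inl (α1 (i, 1)))) (φ (.inl (α1 (i, 2))))
  set A2 := ∏ i, m (φ (.inr (α2 (i, 0)))) (φ (.inr (α2 (i, 1)))) (φ (.inr (α2 (i, 2))))
  set B1 := ∏ i, t (φ (.inl (β1 (.inl (i, 0))))) (φ (.inl (β1 (.inl (i, 1)))))
  set B2 := ∏ i, t (φ (.inr (β2 (.inl (i, 0))))) (φ (.inr (β2 (.inl (i, 1)))))
  set C1 := ∏ x, a (εX.symm (.inl x)) (φ (.inl (β1 (.inr x))))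
  set C2 := ∏ x, a (εX.symm (.inr x)) (φ (.inr (β2 (.inr x))))
  set κ1 := koszulSign (par ∘ φ ∘ Sum.inl) (endRank ∘ β1.symm) (flagRank ∘ α1.symm) with hκ1
  set κ2 := koszulSign (par ∘ φ ∘ Sum.inr) (endRank ∘ β2.symm) (flagRank ∘ α2.symm)
  by_cases hQ : A1 * B1 * C1 * (A2 * B2 * C2) = 0
  · linear_combination ((koszulSign (par ∘ φ)
      (endRank ∘ (sumEnds finSumFinEquiv.symm εX β1 β2).symm)
      (flagRank ∘ (sumFlags finSumFinEquiv.symm α1 α2).symm) : k) -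
      (sgn (W.c * ((V1 + E1) * E2)) * koszulSign pa (fun x => (x : ℕ)) (legRank εX) : k) *
      (κ1 * κ2)) * hQ
  have hQ1 := left_ne_zero_of_mul hQ
  have hQ2 := right_ne_zero_of_mul hQ
  have hC1' := prod_ne_zero_iff.mp (right_ne_zero_of_mul hQ1)
  have hC2' := prod_ne_zero_iff.mp (right_ne_zero_of_mul hQ2)
  have hB2' := prod_ne_zero_iff.mp (right_ne_zero_of_mul (left_ne_zero_of_mul hQ2))
  have hterm : term par m (fun _ => t) α1 β1 (fun x => a (εX.symm (.inl x))) (φ ∘ Sum.inl) ≠ 0 := by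
    unfold term
    have : ((κ1 : ℤ) : k) ≠ 0 := by
      intro h0
      have h1 := koszulSign_mul_self (par ∘ φ ∘ Sum.inl) (endRank ∘ β1.symm) (flagRank ∘ α1.symm)
      have h2 := congrArg (Int.cast : ℤ → k) h1
      rw [Int.cast_mul, ← hκ1, h0] at h2
      simp at h2
    have h3 := mul_ne_zero this hQ1
    simpa only [mul_assoc, comp_apply] using h3
  have hlegs := sum_par_legs (pa := fun x => pa (εX.symm (.inl x))) hm ht (fun x y => ha _ y) hterm
  have sign : koszulSign (par ∘ φ) (endRank ∘ (sumEnds finSumFinEquiv.symm εX β1 β2).symm)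
      (flagRank ∘ (sumFlags finSumFinEquiv.symm α1 α2).symm) =
      (sgn (W.c * ((V1 + E1) * E2)) * koszulSign pa (fun x => (x : ℕ)) (legRank εX)) *
        (κ1 * κ2) := by
    set β₀ := sumEnds (finSumFinEquiv (m := E1) (n := E2)).symm εX β1 β2 with hβ₀
    rw [← koszulSign_mul (par ∘ φ) (endRank_injective.comp β₀.symm.injective)
      ((sumRank_injective εX).comp β₀.symm.injective)
      (flagRank_injective.comp (Equiv.injective _))]
    congr 1
    · rw [← koszulSign_comp_equiv β₀]
      have e1 : (endRank ∘ β₀.symm) ∘ β₀ = endRank := by ext; simp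
      have e2 : (sumRank εX ∘ β₀.symm) ∘ β₀ = sumRank εX := by ext; simp
      have hp : ((par ∘ φ) ∘ β₀) ∘ Sum.inr = pa := by
        funext x
        obtain ⟨x | x, rfl⟩ := εX.symm.surjective x
        · simp only [comp_apply, hβ₀, sumEnds_inr_inl]
          exact ha _ _ (hC1' x (mem_univ _))
        · simp only [comp_apply, hβ₀, sumEnds_inr_inr]
          exact ha _ _ (hC2' x (mem_univ _))
      rw [e1, e2, koszulSign_sumRank (c := W.c) εX, hp, mul_comm]
      · congr 2
        have : ∀ x : Fin n1, ((par ∘ φ) ∘ β₀) (.inr (εX.symm (.inl x))) = pa (εX.symm (.inl x)) :=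
          fun x => congrFun hp _
        simp only [this, hlegs]
        rw [show ∀ c e w : ZMod 2, c * e * (c * w) = (c * c) * (w * e) from fun _ _ _ => by ring,
          zmod_two_mul_self]
      · intro e
        simp only [comp_apply, hβ₀, sumEnds_natAdd]
        exact ht.parity _ _ (hB2' e (mem_univ _))
    · rw [koszulSign_sumType]
      · congr 1
        · refine koszulSign_congr ?_ ?_ <;> intro x y <;>
            simp [hβ₀, sumRank_symm_inl, flagRank_symm_inl]
        · refine koszulSign_congr ?_ ?_ <;> intro x y <;>
            simp [hβ₀, sumRank_symm_inr, flagRank_symm_inr]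
      · intro x y
        simp only [comp_apply, hβ₀, sumRank_symm_inl, sumRank_symm_inr]
        have := endRank_lt (β1.symm x)
        omega
      · intro x y
        simp only [comp_apply, flagRank_symm_inl, flagRank_symm_inr]
        have := flagRank_lt' (α1.symm x)
        omega
  rw [sign]
  push_cast
  ring

variable [Fintype K] [DecidableEq Y1] [DecidableEq Y2]

theorem oweight_sum (hm : IsCyclicTensor par W.c m) (ht : IsEdgeTensor par W.c t)
    (ha : ∀ x y, a x y ≠ 0 → par y = pa x) :
    oweight W par m (fun _ => t) (sumFlags finSumFinEquiv.symm α1 α2)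
        (sumEnds finSumFinEquiv.symm εX β1 β2) a =
      (koszulSign pa (fun x => (x : ℕ)) (legRank εX) : k) •
        (W.ext Sum.inl (oweight W par m (fun _ => t) α1 β1 fun x => a (εX.symm (.inl x))) *
          W.ext Sum.inr (oweight W par m (fun _ => t) α2 β2 fun x => a (εX.symm (.inr x)))) := by
  unfold oweight
  have h : contr par m (fun _ => t) (sumFlags finSumFinEquiv.symm α1 α2)
        (sumEnds finSumFinEquiv.symm εX β1 β2) a =
      (sgn (W.c * ((V1 + E1) * E2)) * koszulSign pa (fun x => (x : ℕ)) (legRank εX) : k) *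
        (contr par m (fun _ => t) α1 β1 (fun x => a (εX.symm (.inl x))) *
          contr par m (fun _ => t) α2 β2 (fun x => a (εX.symm (.inr x)))) := by
    unfold contr
    rw [sum_mul_sum, ← sum_prod_type', mul_sum, ← (Equiv.sumArrowEquivProdArrow Y1 Y2 K).sum_comp]
    exact sum_congr rfl fun φ _ => term_sum α1 α2 εX β1 β2 hm ht ha φ
  rw [h, orient_sum, map_smul, map_smul, smul_mul_smul_comm, smul_smul, smul_smul]
  congr 1
  linear_combination (koszulSign pa (fun x => (x : ℕ)) (legRank εX) : k) *
    (contr par m (fun _ => t) α1 β1 (fun x => a (εX.symm (.inl x))) *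
          contr par m (fun _ => t) α2 β2 (fun x => a (εX.symm (.inr x)))) *
    sgn_mul_self_cast (k := k) (W.c * ((V1 + E1) * E2))

theorem weight_sum (hm : IsCyclicTensor par W.c m) (ht : IsEdgeTensor par W.c t)
    (ha : ∀ x y, a x y ≠ 0 → par y = pa x) (εV : Fin V ≃ Fin V1 ⊕ Fin V2)
    (εE : Fin E ≃ Fin E1 ⊕ Fin E2) :
    weight W par m (fun _ => t) (sumFlags εV α1 α2) (sumEnds εE εX β1 β2) a =
      (koszulSign pa (fun x => (x : ℕ)) (legRank εX) : k) • W.res εX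
        (W.ext Sum.inl (weight W par m (fun _ => t) α1 β1 fun x => a (εX.symm (.inl x))) *
          W.ext Sum.inr (weight W par m (fun _ => t) α2 β2 fun x => a (εX.symm (.inr x)))) := by
  obtain rfl : V = V1 + V2 := by simpa using card_congr εV
  obtain rfl : E = E1 + E2 := by simpa using card_congr εE
  rw [weight_eq_res, oweight_vertex_symm (α := sumFlags finSumFinEquiv.symm α1 α2) hm
    (by rw [rotOf_sumFlags, rotOf_sumFlags]),
    oweight_edge_symm (β := sumEnds finSumFinEquiv.symm εX β1 β2) ht _
    (by rw [invOf_sumEnds, invOf_sumEnds]) (by rw [legOf_sumEnds, legOf_sumEnds]), legOf_sumEnds,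
    oweight_sum α1 α2 εX β1 β2 hm ht ha, map_smul, ← W.res_res, W.res_sum, weight_eq_res,
    weight_eq_res]

end Ranks

end Block

/-! ### Components of a graph -/

section Reach

variable {Y : Type} {ρ i : Perm Y}

/-- `f` and `g` lie on one component. -/
def Reach (ρ i : Perm Y) : Y → Y → Prop := Relation.ReflTransGen fun a b => b = ρ a ∨ b = i a

theorem Reach.left (y : Y) : Reach ρ i y (ρ y) := .single (.inl rfl)

theorem Reach.right (y : Y) : Reach ρ i y (i y) := .single (.inr rfl)

theorem Reach.symm [Finite Y] {x y : Y} (h : Reach ρ i x y) : Reach ρ i y x := by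
  have pow : ∀ (l : ℕ) x, Reach ρ i x ((ρ ^ l) x) ∧ Reach ρ i x ((i ^ l) x) := by
    intro l x
    induction l with
    | zero => exact ⟨.refl, .refl⟩
    | succ l ih =>
      rw [pow_succ', pow_succ', mul_apply, mul_apply]
      exact ⟨ih.1.trans (Reach.left _), ih.2.trans (Reach.right _)⟩
  have inv : ∀ (θ : Perm Y) x, (θ ^ (orderOf θ - 1)) (θ x) = x := by
    intro θ x
    rw [← mul_apply, ← pow_succ, Nat.sub_add_cancel (orderOf_pos θ), pow_orderOf_eq_one]
    rfl
  induction h with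
  | refl => exact .refl
  | @tail b _ _ hbc ih =>
    refine Relation.ReflTransGen.trans ?_ ih
    rcases hbc with rfl | rfl
    · have := (pow (orderOf ρ - 1) (ρ b)).1
      rwa [inv] at this
    · have := (pow (orderOf i - 1) (i b)).2
      rwa [inv] at this

theorem conn_of_reach [Finite Y] (y : Y) (h : ∀ z, Reach ρ i y z) : Conn ρ i :=
  ⟨⟨y⟩, fun f g => (h f).symm.trans (h g)⟩

variable {Y2 : Type} {ρ₂ i₂ : Perm Y2}

theorem reach_sumCongr_inl {x : Y} {z : Y ⊕ Y2} :
    Reach (sumCongr ρ ρ₂) (sumCongr i i₂) (.inl x) z ↔ ∃ y, z = .inl y ∧ Reach ρ i x y := by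
  constructor
  · intro h
    induction h with
    | refl => exact ⟨x, rfl, .refl⟩
    | tail _ hbc ih =>
      obtain ⟨y, rfl, hy⟩ := ih
      rcases hbc with rfl | rfl
      · exact ⟨_, rfl, hy.trans (Reach.left _)⟩
      · exact ⟨_, rfl, hy.trans (Reach.right _)⟩
  · rintro ⟨y, rfl, hy⟩
    exact hy.lift Sum.inl (by rintro a b (rfl | rfl); exacts [.inl rfl, .inr rfl])

theorem reach_sumCongr_inr {x : Y2} {z : Y ⊕ Y2} :
    Reach (sumCongr ρ ρ₂) (sumCongr i i₂) (.inr x) z ↔ ∃ y, z = .inr y ∧ Reach ρ₂ i₂ x y := by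
  constructor
  · intro h
    induction h with
    | refl => exact ⟨x, rfl, .refl⟩
    | tail _ hbc ih =>
      obtain ⟨y, rfl, hy⟩ := ih
      rcases hbc with rfl | rfl
      · exact ⟨_, rfl, hy.trans (Reach.left _)⟩
      · exact ⟨_, rfl, hy.trans (Reach.right _)⟩
  · rintro ⟨y, rfl, hy⟩
    exact hy.lift Sum.inr (by rintro a b (rfl | rfl); exacts [.inl rfl, .inr rfl])

variable [DecidableEq Y] {p q : Y}

theorem reach_or_reach (h : Conn ρ (swap p q * i)) (y : Y) : Reach ρ i p y ∨ Reach ρ i q y := by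
  have := h.2 p y
  induction this with
  | refl => exact .inl .refl
  | @tail b c _ hbc ih =>
    rcases hbc with rfl | rfl
    · exact ih.imp (·.trans (Reach.left _)) (·.trans (Reach.left _))
    · rcases eq_or_ne (i b) p with hb | hb
      · rw [mul_apply, hb, swap_apply_left]
        exact .inr .refl
      · rcases eq_or_ne (i b) q with hb' | hb'
        · rw [mul_apply, hb', Equiv.swap_apply_right]
          exact .inl .refl
        · rw [mul_apply, swap_apply_of_ne_of_ne hb hb']
          exact ih.imp (·.trans (Reach.right _)) (·.trans (Reach.right _))

theorem Reach.swap_mul (hp : i p = p) (hq : i q = q) {x y : Y} (h : Reach ρ i x y) :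
    Reach ρ (swap p q * i) x y := by
  induction h with
  | refl => exact .refl
  | @tail b c _ hbc ih =>
    rcases hbc with rfl | rfl
    · exact ih.tail (.inl rfl)
    · rcases eq_or_ne b p with rfl | hb
      · rwa [hp]
      · rcases eq_or_ne b q with rfl | hb'
        · rwa [hq]
        · refine ih.tail (.inr ?_)
          have h1 : i b ≠ p := fun e => hb (i.injective (e.trans hp.symm))
          have h2 : i b ≠ q := fun e => hb' (i.injective (e.trans hq.symm))
          rw [mul_apply, swap_apply_of_ne_of_ne h1 h2]

theorem Conn.swap_mul (hp : i p = p) (hq : i q = q) (h : Conn ρ i) : Conn ρ (swap p q * i) :=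
  ⟨h.1, fun f g => Reach.swap_mul hp hq (h.2 f g)⟩

theorem conn_swap_mul [Finite Y] (hp : i p = p) (hq : i q = q)
    (h : ∀ y, Reach ρ i p y ∨ Reach ρ i q y) : Conn ρ (swap p q * i) := by
  refine conn_of_reach p fun z => ?_
  rcases h z with h | h
  · exact h.swap_mul hp hq
  · refine Relation.ReflTransGen.trans (.single (.inr ?_)) (h.swap_mul hp hq)
    rw [mul_apply, hp, swap_apply_left]

end Reach

theorem exists_sumCongr {A B C D : Type*} (f : A ⊕ B ≃ C ⊕ D)
    (h : ∀ x, (f x).isLeft = x.isLeft) : ∃ (f₁ : A ≃ C) (f₂ : B ≃ D), f = Equiv.sumCongr f₁ f₂ := by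
  have h' : ∀ y, (f.symm y).isLeft = y.isLeft := fun y => by
    rw [← h, apply_symm_apply]
  have k1 : ∀ a, ∃ c, f (.inl a) = .inl c := fun a => by
    have := h (.inl a); rcases hf : f (.inl a) with c | c
    · exact ⟨c, rfl⟩
    · rw [hf] at this; simp at this
  have k2 : ∀ a, ∃ c, f (.inr a) = .inr c := fun a => by
    have := h (.inr a); rcases hf : f (.inr a) with c | c
    · rw [hf] at this; simp at this
    · exact ⟨c, rfl⟩
  have k3 : ∀ c, ∃ a, f (.inl a) = .inl c := fun c => by
    have := h' (.inl c); rcases hf : f.symm (.inl c) with a | a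
    · exact ⟨a, by rw [← hf, apply_symm_apply]⟩
    · rw [hf] at this; simp at this
  have k4 : ∀ c, ∃ a, f (.inr a) = .inr c := fun c => by
    have := h' (.inr c); rcases hf : f.symm (.inr c) with a | a
    · rw [hf] at this; simp at this
    · exact ⟨a, by rw [← hf, apply_symm_apply]⟩
  choose g₁ hg1 using k1
  choose g₂ hg2 using k2
  refine ⟨ofBijective g₁ ⟨fun a b hab => ?_, fun c => ?_⟩,
    ofBijective g₂ ⟨fun a b hab => ?_, fun c => ?_⟩, ?_⟩
  · exact inl_injective (f.injective (by rw [hg1, hg1, hab]))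
  · obtain ⟨a, ha⟩ := k3 c
    exact ⟨a, inl_injective ((hg1 a).symm.trans ha)⟩
  · exact inr_injective (f.injective (by rw [hg2, hg2, hab]))
  · obtain ⟨a, ha⟩ := k4 c
    exact ⟨a, inr_injective ((hg2 a).symm.trans ha)⟩
  · refine Equiv.ext fun x => ?_
    rcases x with x | x
    · exact hg1 x
    · exact hg2 x

/-! ### Splitting index sets -/

section Split

variable {V n : ℕ}

/-- A finite set and its complement, enumerated separately. -/
def subsetEquiv (S : Finset (Fin V)) : Fin V ≃ Fin S.card ⊕ Fin Sᶜ.card :=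
  (finSumEquivOfFinset rfl rfl).symm

theorem subsetEquiv_symm_inl (S : Finset (Fin V)) (i : Fin S.card) :
    (subsetEquiv S).symm (.inl i) = S.orderEmbOfFin rfl i :=
  finSumEquivOfFinset_inl _ _ _

theorem subsetEquiv_symm_inr (S : Finset (Fin V)) (i : Fin Sᶜ.card) :
    (subsetEquiv S).symm (.inr i) = Sᶜ.orderEmbOfFin rfl i :=
  finSumEquivOfFinset_inr _ _ _

theorem isLeft_subsetEquiv (S : Finset (Fin V)) (i : Fin V) :
    (subsetEquiv S i).isLeft = true ↔ i ∈ S := by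
  obtain ⟨x, rfl⟩ := (subsetEquiv S).symm.surjective i
  rw [apply_symm_apply]
  rcases x with x | x
  · simp [subsetEquiv_symm_inl]
  · have : Sᶜ.orderEmbOfFin rfl x ∈ Sᶜ := orderEmbOfFin_mem _ _ _
    simpa [subsetEquiv_symm_inr] using mem_compl.mp this

theorem splitLabel_orderEmb (X : Finset (Fin n)) (i : Fin X.card) :
    splitLabel X (X.orderEmbOfFin rfl i) = .inl i.succ := by
  have h : X.orderEmbOfFin rfl i ∈ X := orderEmbOfFin_mem _ _ _
  rw [splitLabel, dif_pos h]
  congr 2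
  rw [OrderIso.symm_apply_eq]
  exact Subtype.ext (by simp)

theorem splitLabel_orderEmb_compl (X : Finset (Fin n)) (i : Fin Xᶜ.card) :
    splitLabel X (Xᶜ.orderEmbOfFin rfl i) = .inr i.succ := by
  have h : Xᶜ.orderEmbOfFin rfl i ∈ Xᶜ := orderEmbOfFin_mem _ _ _
  rw [splitLabel, dif_neg (mem_compl.mp h)]
  congr 2
  rw [OrderIso.symm_apply_eq]
  exact Subtype.ext (by simp)

theorem splitLabel_eq (X : Finset (Fin n)) (i : Fin n) :
    splitLabel X i = Sum.map Fin.succ Fin.succ (subsetEquiv X i) := by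
  obtain ⟨x, rfl⟩ := (subsetEquiv X).symm.surjective i
  rcases x with x | x
  · rw [apply_symm_apply]
    rw [subsetEquiv_symm_inl, splitLabel_orderEmb, map_inl]
  · rw [apply_symm_apply]
    rw [subsetEquiv_symm_inr, splitLabel_orderEmb_compl, map_inr]

/-- Two letters, put in front of the letters in `X` and in front of those outside of `X`. -/
def splitFun (X : Finset (Fin n)) : Fin (n + 2) → Fin (X.card + 1) ⊕ Fin (Xᶜ.card + 1) :=
  cons (.inl 0) (cons (.inr 0) (splitLabel X))

theorem splitFun_bijective (X : Finset (Fin n)) : (splitFun X).Bijective := by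
  rw [Fintype.bijective_iff_injective_and_card]
  constructor
  · unfold splitFun
    rw [Fin.cons_injective_iff, Fin.cons_injective_iff]
    refine ⟨?_, ?_, ?_⟩
    · rintro ⟨x, hx⟩
      refine Fin.cases (fun h => ?_) (fun x h => ?_) x hx
      · simp at h
      · rw [Fin.cons_succ, splitLabel_eq] at h
        rcases hy : subsetEquiv X x with y | y <;> rw [hy] at h <;> simp [Fin.succ_ne_zero] at h
    · rintro ⟨x, hx⟩
      rw [splitLabel_eq] at hx
      rcases hy : subsetEquiv X x with y | y <;> rw [hy] at hx <;> simp [Fin.succ_ne_zero] at hx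
    · have : splitLabel X = Sum.map Fin.succ Fin.succ ∘ subsetEquiv X := funext (splitLabel_eq X)
      rw [this]
      exact ((succ_injective _).sumMap (succ_injective _)).comp (subsetEquiv X).injective
  · have := X.card_add_card_compl
    rw [card_fin] at this
    simp
    omega

def splitEquiv (X : Finset (Fin n)) : Fin (n + 2) ≃ Fin (X.card + 1) ⊕ Fin (Xᶜ.card + 1) :=
  ofBijective _ (splitFun_bijective X)

theorem splitEquiv_zero (X : Finset (Fin n)) : splitEquiv X 0 = .inl 0 := rfl

theorem splitEquiv_one (X : Finset (Fin n)) : splitEquiv X 1 = .inr 0 := rfl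

theorem splitEquiv_succ (X : Finset (Fin n)) (x : Fin n) :
    splitEquiv X x.succ.succ = splitLabel X x := rfl

end Split

/-! ### Graphs cut in two components -/

section Cut

variable {V E n : ℕ} {Y Z : Type}

theorem boundary_trans (α : Flags V ≃ Y) (β : Ends E n ≃ Y) (e : Y ≃ Z) :
    invOf (β.trans e) * rotOf (α.trans e) = e.permCongr (invOf β * rotOf α) := by
  rw [rotOf_trans, invOf_trans]; ext; simp [permCongr_apply]

theorem induces_boundary_trans [Finite Y] [Finite Z] (α : Flags V ≃ Y) (β : Ends E n ≃ Y) (e : Y ≃ Z)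
    {σ : Perm (Fin n)} : Induces (invOf (β.trans e) * rotOf (α.trans e)) (legOf (β.trans e)) σ ↔
      Induces (invOf β * rotOf α) (legOf β) σ := by
  rw [boundary_trans]
  refine ⟨fun h => (induces_equiv' _ e).of_trans h e.injective (legOf_injective β),
    fun h => (induces_equiv' _ e).trans h e.injective⟩

/-- The graph becomes connected when the legs `0` and `1` are joined to an edge. -/
def JoinConn [DecidableEq Y] (α : Flags V ≃ Y) (β : Ends E (n + 2) ≃ Y) : Prop :=
  Conn (rotOf α) (swap (legOf β 0) (legOf β 1) * invOf β)

/-- A graph with two components, one of which carries the leg `0` and the other one the leg `1`. -/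
def assembly (VS : Finset (Fin V)) (ES : Finset (Fin E)) (X : Finset (Fin n))
    (β1 : Ends ES.card (X.card + 1) ≃ Flags VS.card)
    (β2 : Ends ESᶜ.card (Xᶜ.card + 1) ≃ Flags VSᶜ.card) : Ends E (n + 2) ≃ Flags V :=
  (sumEnds (subsetEquiv ES) (splitEquiv X) β1 β2).trans
    (sumFlags (subsetEquiv VS) (.refl _) (.refl _)).symm

variable {VS : Finset (Fin V)} {ES : Finset (Fin E)} {X : Finset (Fin n)}
  {β1 : Ends ES.card (X.card + 1) ≃ Flags VS.card}
  {β2 : Ends ESᶜ.card (Xᶜ.card + 1) ≃ Flags VSᶜ.card}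

theorem assembly_trans : (assembly VS ES X β1 β2).trans
    (sumFlags (subsetEquiv VS) (.refl _) (.refl _)) =
      sumEnds (subsetEquiv ES) (splitEquiv X) β1 β2 := by
  ext x; simp [assembly]

theorem assembly_aux : (Equiv.refl (Flags V)).trans
    (sumFlags (subsetEquiv VS) (.refl _) (.refl _)) =
      sumFlags (subsetEquiv VS) (Equiv.refl (Flags VS.card)) (Equiv.refl (Flags VSᶜ.card)) := rfl

theorem induces_assembly {σ : Perm (Fin (n + 2))} :
    Induces (invOf (assembly VS ES X β1 β2) * rotOf (.refl (Flags V)))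
        (legOf (assembly VS ES X β1 β2)) σ ↔
      Induces (sumCongr (invOf β1 * rotOf (.refl (Flags VS.card)))
        (invOf β2 * rotOf (.refl (Flags VSᶜ.card))))
        (Sum.map (legOf β1) (legOf β2) ∘ splitEquiv X) σ := by
  rw [← induces_boundary_trans _ _ (sumFlags (subsetEquiv VS) (Equiv.refl (Flags VS.card))
    (Equiv.refl (Flags VSᶜ.card))), assembly_trans, assembly_aux, invOf_sumEnds, rotOf_sumFlags,
    legOf_sumEnds, Perm.sumCongr_mul]

theorem reach_assembly {y z : Flags V} :
    Reach (rotOf (.refl (Flags V))) (invOf (assembly VS ES X β1 β2)) y z ↔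
      Reach (sumCongr (rotOf (.refl (Flags VS.card))) (rotOf (.refl (Flags VSᶜ.card))))
        (sumCongr (invOf β1) (invOf β2))
        (sumFlags (subsetEquiv VS) (.refl _) (.refl _) y)
        (sumFlags (subsetEquiv VS) (.refl _) (.refl _) z) := by
  have key : ∀ {A B : Type} (e : A ≃ B) (ρ i : Perm A) (y z : A), Reach ρ i y z →
      Reach (e.permCongr ρ) (e.permCongr i) (e y) (e z) := by
    intro A B e ρ i y z h
    exact h.lift e (by rintro a b (rfl | rfl) <;> simp [permCongr_apply, Function.onFun])
  have h1 := rotOf_sumFlags (subsetEquiv VS) (Equiv.refl (Flags VS.card))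
    (Equiv.refl (Flags VSᶜ.card))
  have h2 := invOf_sumEnds (subsetEquiv ES) (splitEquiv X) β1 β2
  rw [← assembly_trans, invOf_trans] at h2
  rw [← assembly_aux, rotOf_trans] at h1
  rw [← h1, ← h2]
  constructor
  · exact key _ _ _ y z
  · intro h
    have := key (sumFlags (subsetEquiv VS) (Equiv.refl (Flags VS.card))
      (Equiv.refl (Flags VSᶜ.card))).symm _ _ _ _ h
    have hr : ∀ {A B : Type} (e : A ≃ B) (φ : Perm A), e.symm.permCongr (e.permCongr φ) = φ :=
      fun e φ => by ext; simp [permCongr_apply]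
    rwa [hr, hr, symm_apply_apply, symm_apply_apply] at this

theorem legOf_assembly (x : Fin (n + 2)) :
    sumFlags (subsetEquiv VS) (.refl _) (.refl _) (legOf (assembly VS ES X β1 β2) x) =
      Sum.map (legOf β1) (legOf β2) (splitEquiv X x) := by
  have := congrFun (legOf_sumEnds (subsetEquiv ES) (splitEquiv X) β1 β2) x
  rw [← assembly_trans] at this
  exact this

theorem reach_leg_zero (h₁ : Conn (rotOf (.refl _)) (invOf β1)) (z : Flags V) :
    Reach (rotOf (.refl _)) (invOf (assembly VS ES X β1 β2)) (legOf (assembly VS ES X β1 β2) 0) z ↔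
    (sumFlags (subsetEquiv VS) (Equiv.refl (Flags VS.card)) (Equiv.refl (Flags VSᶜ.card)) z).isLeft := by
  rw [reach_assembly, legOf_assembly, splitEquiv_zero, map_inl, reach_sumCongr_inl, Sum.isLeft_iff]
  exact exists_congr fun y => ⟨fun h => h.1, fun h => ⟨h, h₁.2 _ _⟩⟩

theorem reach_leg_one (h₂ : Conn (rotOf (.refl _)) (invOf β2)) (z : Flags V) :
    Reach (rotOf (.refl _)) (invOf (assembly VS ES X β1 β2)) (legOf (assembly VS ES X β1 β2) 1) z ↔
    (sumFlags (subsetEquiv VS) (Equiv.refl (Flags VS.card)) (Equiv.refl (Flags VSᶜ.card)) z).isRight := by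
  rw [reach_assembly, legOf_assembly, splitEquiv_one, map_inr, reach_sumCongr_inr, Sum.isRight_iff]
  exact exists_congr fun y => ⟨fun h => h.1, fun h => ⟨h, h₂.2 _ _⟩⟩

theorem conn_assembly (h₁ : Conn (rotOf (.refl _)) (invOf β1))
    (h₂ : Conn (rotOf (.refl _)) (invOf β2)) :
    ¬ Conn (rotOf (.refl _)) (invOf (assembly VS ES X β1 β2)) ∧
      JoinConn (.refl _) (assembly VS ES X β1 β2) := by
  constructor
  · intro h
    have := (reach_leg_zero h₁ _).mp (h.2 _ (legOf (assembly VS ES X β1 β2) 1))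
    rw [legOf_assembly, splitEquiv_one] at this
    simp at this
  · refine conn_swap_mul (invOf_inr _ _) (invOf_inr _ _) fun y => ?_
    rw [reach_leg_zero h₁, reach_leg_one h₂]
    cases (sumFlags (subsetEquiv VS) (Equiv.refl (Flags VS.card)) (Equiv.refl (Flags VSᶜ.card)) y) <;>
      simp

theorem isLeft_sumFlags {V1 V2 : ℕ} {Y1 Y2 : Type} (ε : Fin V ≃ Fin V1 ⊕ Fin V2)
    (α1 : Flags V1 ≃ Y1) (α2 : Flags V2 ≃ Y2) (i : Fin V) (b : Fin 3) :
    (sumFlags ε α1 α2 (i, b)).isLeft = (ε i).isLeft := by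
  obtain ⟨i | i, rfl⟩ := ε.symm.surjective i
  · rw [sumFlags_inl]; simp
  · rw [sumFlags_inr]; simp

theorem isLeft_sumEnds_inl {E1 E2 n1 n2 : ℕ} {Y1 Y2 : Type} (ε : Fin E ≃ Fin E1 ⊕ Fin E2)
    (εX : Fin n ≃ Fin n1 ⊕ Fin n2) (β1 : Ends E1 n1 ≃ Y1) (β2 : Ends E2 n2 ≃ Y2) (i : Fin E)
    (b : Fin 2) : (sumEnds ε εX β1 β2 (.inl (i, b))).isLeft = (ε i).isLeft := by
  obtain ⟨i | i, rfl⟩ := ε.symm.surjective i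
  · rw [sumEnds_inl_inl]; simp
  · rw [sumEnds_inl_inr]; simp

theorem isLeft_sumEnds_inr {E1 E2 n1 n2 : ℕ} {Y1 Y2 : Type} (ε : Fin E ≃ Fin E1 ⊕ Fin E2)
    (εX : Fin n ≃ Fin n1 ⊕ Fin n2) (β1 : Ends E1 n1 ≃ Y1) (β2 : Ends E2 n2 ≃ Y2) (x : Fin n) :
    (sumEnds ε εX β1 β2 (.inr x)).isLeft = (εX x).isLeft := by
  obtain ⟨i | i, rfl⟩ := εX.symm.surjective x
  · rw [sumEnds_inr_inl]; simp
  · rw [sumEnds_inr_inr]; simp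

/-- Two connected graphs, on complementary sets of vertices, edges and legs. -/
abbrev Pieces (V E n : ℕ) := Σ S : Finset (Fin V) × Finset (Fin E) × Finset (Fin n),
  (Ends S.2.1.card (S.2.2.card + 1) ≃ Flags S.1.card) ×
    (Ends S.2.1ᶜ.card (S.2.2ᶜ.card + 1) ≃ Flags S.1ᶜ.card)

def Pieces.assembly (S : Pieces V E n) : Ends E (n + 2) ≃ Flags V :=
  NCBV.assembly S.1.1 S.1.2.1 S.1.2.2 S.2.1 S.2.2

def Pieces.IsConn (S : Pieces V E n) : Prop :=
  Conn (rotOf (.refl _)) (invOf S.2.1) ∧ Conn (rotOf (.refl _)) (invOf S.2.2)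

theorem isLeft_splitEquiv (X : Finset (Fin n)) (x : Fin n) :
    (splitEquiv X x.succ.succ).isLeft = true ↔ x ∈ X := by
  rw [splitEquiv_succ, splitLabel_eq, Sum.isLeft_map, isLeft_subsetEquiv]

theorem assembly_mem (β : Ends E (n + 2) ≃ Flags V) (h₁ : Conn (rotOf (.refl _)) (invOf β1))
    (hβ : assembly VS ES X β1 β2 = β) :
    (∀ i, i ∈ VS ↔ Reach (rotOf (.refl _)) (invOf β) (legOf β 0) (i, 0)) ∧
    (∀ e, e ∈ ES ↔ Reach (rotOf (.refl _)) (invOf β) (legOf β 0) (β (.inl (e, 0)))) ∧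
    ∀ x, x ∈ X ↔ Reach (rotOf (.refl _)) (invOf β) (legOf β 0) (legOf β x.succ.succ) := by
  subst hβ
  have key : ∀ x, sumFlags (subsetEquiv VS) (.refl _) (.refl _)
      (assembly VS ES X β1 β2 x) = sumEnds (subsetEquiv ES) (splitEquiv X) β1 β2 x := fun x =>
    congrArg (fun e : Ends E (n + 2) ≃ _ => e x) assembly_trans
  refine ⟨fun i => ?_, fun e => ?_, fun x => ?_⟩
  · rw [reach_leg_zero h₁, isLeft_sumFlags, isLeft_subsetEquiv]
  · rw [reach_leg_zero h₁, key, isLeft_sumEnds_inl, isLeft_subsetEquiv]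
  · rw [reach_leg_zero h₁, legOf, key, isLeft_sumEnds_inr, isLeft_splitEquiv]

theorem Pieces.assembly_injOn : Set.InjOn (Pieces.assembly (V := V) (E := E) (n := n)) {S | S.IsConn} := by
  rintro ⟨⟨VS, ES, X⟩, β1, β2⟩ h ⟨⟨VS', ES', X'⟩, β1', β2'⟩ h' heq
  have k := assembly_mem (β1 := β1) (β2 := β2) (NCBV.assembly VS ES X β1 β2) h.1 rfl
  have k' := assembly_mem (β1 := β1') (β2 := β2') (NCBV.assembly VS ES X β1 β2) h'.1 heq.symm
  obtain rfl : VS = VS' := Finset.ext fun i => (k.1 i).trans (k'.1 i).symm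
  obtain rfl : ES = ES' := Finset.ext fun i => (k.2.1 i).trans (k'.2.1 i).symm
  obtain rfl : X = X' := Finset.ext fun i => (k.2.2 i).trans (k'.2.2 i).symm
  have e : sumEnds (subsetEquiv ES) (splitEquiv X) β1 β2 =
      sumEnds (subsetEquiv ES) (splitEquiv X) β1' β2' := by
    rw [← assembly_trans, ← assembly_trans]
    exact congrArg (fun e : Ends E (n + 2) ≃ Flags V => e.trans (sumFlags (subsetEquiv VS)
      (Equiv.refl (Flags VS.card)) (Equiv.refl (Flags VSᶜ.card)))) heq
  have e1 : β1 = β1' := by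
    refine Equiv.ext fun x => inl_injective (β := Flags VSᶜ.card) ?_
    rcases x with ⟨i, b⟩ | x
    · rw [← sumEnds_inl_inl (subsetEquiv ES) (splitEquiv X) β1 β2, e, sumEnds_inl_inl]
    · rw [← sumEnds_inr_inl (subsetEquiv ES) (splitEquiv X) β1 β2, e, sumEnds_inr_inl]
  have e2 : β2 = β2' := by
    refine Equiv.ext fun x => inr_injective (α := Flags VS.card) ?_
    rcases x with ⟨i, b⟩ | x
    · rw [← sumEnds_inl_inr (subsetEquiv ES) (splitEquiv X) β1 β2, e, sumEnds_inl_inr]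
    · rw [← sumEnds_inr_inr (subsetEquiv ES) (splitEquiv X) β1 β2, e, sumEnds_inr_inr]
  rw [e1, e2]

theorem exists_pieces (β : Ends E (n + 2) ≃ Flags V)
    (hn : ¬ Conn (rotOf (.refl _)) (invOf β)) (hj : JoinConn (.refl _) β) :
    ∃ S : Pieces V E n, S.IsConn ∧ S.assembly = β := by
  classical
  set R := Reach (rotOf (.refl (Flags V))) (invOf β) with hR
  have h01 : ¬ R (legOf β 0) (legOf β 1) := by
    intro h
    refine hn (conn_of_reach (legOf β 0) fun z => ?_)
    rcases reach_or_reach hj z with hz | hz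
    · exact hz
    · exact h.trans hz
  have hcl : ∀ {y z}, R y z → (R (legOf β 0) y ↔ R (legOf β 0) z) := fun hyz =>
    ⟨fun h => h.trans hyz, fun h => h.trans hyz.symm⟩
  set VS : Finset (Fin V) := univ.filter fun i => R (legOf β 0) (i, 0) with hVS
  set ES : Finset (Fin E) := univ.filter fun e => R (legOf β 0) (β (.inl (e, 0))) with hES
  set X : Finset (Fin n) := univ.filter fun x => R (legOf β 0) (legOf β x.succ.succ) with hX
  set h := sumFlags (subsetEquiv VS) (Equiv.refl (Flags VS.card)) (Equiv.refl (Flags VSᶜ.card)) with hh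
  set g := sumEnds (subsetEquiv ES) (splitEquiv X) (Equiv.refl (Ends ES.card (X.card + 1)))
    (Equiv.refl (Ends ESᶜ.card (Xᶜ.card + 1))) with hg
  have hleft : ∀ y, (h y).isLeft = true ↔ R (legOf β 0) y := by
    rintro ⟨i, b⟩
    rw [hh, isLeft_sumFlags, isLeft_subsetEquiv, hVS, mem_filter]
    simp only [mem_univ, true_and]
    refine hcl ?_
    have h1 : ∀ b : Fin 3, R (i, b) (i, b + 1) := fun b => by
      have := Reach.left (ρ := rotOf (.refl (Flags V))) (i := invOf β) (i, b)
      rwa [show rotOf (.refl (Flags V)) (i, b) = (i, b + 1) from rotOf_apply (.refl _) (i, b)] at this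
    fin_cases b
    · exact .refl
    · exact h1 0
    · exact (h1 0).trans (h1 1)
  have gleft : ∀ x, (g x).isLeft = true ↔ R (legOf β 0) (β x) := by
    rintro (⟨e, b⟩ | x)
    · rw [hg, isLeft_sumEnds_inl, isLeft_subsetEquiv, hES, mem_filter]
      simp only [mem_univ, true_and]
      refine hcl ?_
      fin_cases b
      · exact .refl
      · have := Reach.right (ρ := rotOf (.refl (Flags V))) (i := invOf β) (β (.inl (e, 0)))
        rwa [invOf_inl] at this
    · rw [hg, isLeft_sumEnds_inr]
      refine Fin.cases ?_ (fun x => Fin.cases ?_ (fun x => ?_) x) x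
      · rw [splitEquiv_zero]
        exact ⟨fun _ => .refl, fun _ => rfl⟩
      · rw [show (0 : Fin (n + 1)).succ = 1 from rfl, splitEquiv_one]
        exact ⟨fun h => by simp at h, fun h => absurd h h01⟩
      · rw [isLeft_splitEquiv, hX, mem_filter]
        simp only [mem_univ, true_and]
        rfl
  obtain ⟨β1, β2, hβ⟩ := exists_sumCongr ((g.symm.trans β).trans h) (by
    intro x
    rw [Bool.eq_iff_iff]
    obtain ⟨x, rfl⟩ := g.surjective x
    rw [trans_apply, trans_apply, symm_apply_apply, hleft, gleft])
  have hasm : assembly VS ES X β1 β2 = β := by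
    have h1 : sumEnds (subsetEquiv ES) (splitEquiv X) β1 β2 = g.trans (Equiv.sumCongr β1 β2) := by
      ext x <;> simp [hg, sumEnds]
    rw [assembly, h1, ← hβ]
    ext x <;> simp [← hh]
  have ha0 : h (legOf β 0) = .inl (legOf β1 0) := by
    have := legOf_assembly (VS := VS) (β1 := β1) (β2 := β2) 0
    rwa [hasm] at this
  have ha1 : h (legOf β 1) = .inr (legOf β2 0) := by
    have := legOf_assembly (VS := VS) (β1 := β1) (β2 := β2) 1
    rwa [hasm] at this
  refine ⟨⟨(VS, ES, X), β1, β2⟩, ⟨?_, ?_⟩, hasm⟩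
  · refine conn_of_reach (legOf β1 0) fun z => ?_
    have h1 : R (legOf β 0) (h.symm (.inl z)) := by
      rw [← hleft, apply_symm_apply]; rfl
    rw [hR, ← hasm, reach_assembly, hasm, ← hh, ha0, apply_symm_apply, reach_sumCongr_inl] at h1
    obtain ⟨y, hy, h1⟩ := h1
    rwa [inl_injective hy]
  · refine conn_of_reach (legOf β2 0) fun z => ?_
    have h1 : R (legOf β 1) (h.symm (.inr z)) := by
      rcases reach_or_reach hj (h.symm (.inr z)) with hz | hz
      · have := (hleft _).mpr hz
        rw [apply_symm_apply] at this
        simp at this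
      · exact hz
    rw [hR, ← hasm, reach_assembly, hasm, ← hh, ha1, apply_symm_apply, reach_sumCongr_inr] at h1
    obtain ⟨y, hy, h1⟩ := h1
    rwa [inr_injective hy]

end Cut

/-! ### Gluing two legs -/

theorem induces_join_iff {X Y Z : Type*} [Finite X] [Finite Y] [Finite Z] [DecidableEq X]
    [DecidableEq Y] {φ : Perm Y} {j : X → Y} (hj : j.Injective) {i : Z → X} (hi : i.Injective)
    {p q : X} {σ : Perm Z} : Induces (swap (j p) (j q) * φ) (j ∘ i) σ ↔
      ∃ σ', Induces φ j σ' ∧ Induces (swap p q * σ') i σ := by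
  constructor
  · intro h
    obtain ⟨σ', hσ'⟩ := exists_induces (φ := φ) hj (fun y => by
      obtain ⟨z, hz⟩ := h.1 y
      have := exists_sameCycle_mul_left (θ := swap (j p) (j q)) (j := j) ⟨i z, hz⟩
        (swap_label hj p q).2
      rwa [swap_mul_swap_mul] at this)
    exact ⟨σ', hσ', (hσ'.swap_mul hj p q).of_trans h hj hi⟩
  · rintro ⟨σ', h1, h2⟩
    exact (h1.swap_mul hj p q).trans h2 hj

section CutTotal

variable {k : Type u} [Field k] {K : Type*} [Fintype K] {V E n : ℕ} {Y : Type} [Fintype Y]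
  [DecidableEq Y] (W : Coef k) (par : K → ZMod 2) (m : K → K → K → k) (t : K → K → k)

/-- The weight of a graph with the legs `0` and `1` cut out and glued. -/
def cutWeight (α : Flags V ≃ Y) (β : Ends E (n + 2) ≃ Y) (u : Fin (n + 2) → K → k) : W.C (Fin n) :=
  W.res (fun x => legOf β x.succ.succ) (W.glue (invOf β * rotOf α) (legOf β 0) (legOf β 1)
    (oweight W par m (fun _ => t) α β u))

/-- The graph with the legs `0` and `1` glued has the boundary words `σ`. -/
def JoinInduces (α : Flags V ≃ Y) (β : Ends E (n + 2) ≃ Y) (σ : Perm (Fin n)) : Prop :=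
  ∃ σ', Induces (invOf β * rotOf α) (legOf β) σ' ∧
    Induces (swap 0 1 * σ') (fun x : Fin n => x.succ.succ) σ

variable {W par m t}

theorem cutWeight_eq {α : Flags V ≃ Y} {β : Ends E (n + 2) ≃ Y} {σ' : Perm (Fin (n + 2))}
    (h : Induces (invOf β * rotOf α) (legOf β) σ') (u : Fin (n + 2) → K → k) :
    cutWeight W par m t α β u = W.res (fun x : Fin n => x.succ.succ)
      (W.glue σ' 0 1 (weight W par m (fun _ => t) α β u)) := by
  rw [weight_eq_res, ← W.res_glue h (legOf_injective β), W.res_res]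
  rfl

open Classical in
theorem sum_cutWeight_conn (σ : Perm (Fin n)) (u : Fin (n + 2) → K → k) :
    (∑ β : Ends E (n + 2) ≃ Flags V,
      if Conn (rotOf (.refl (Flags V))) (invOf β) ∧ JoinInduces (.refl _) β σ then
        cutWeight W par m t (.refl _) β u else 0) =
    ∑ σ' ∈ univ.filter fun σ' : Perm (Fin (n + 2)) =>
        Induces (swap 0 1 * σ') (fun i : Fin n => i.succ.succ) σ,
      W.res (fun x : Fin n => x.succ.succ)
        (W.glue σ' 0 1 (total W par m (fun _ : Fin E => t) V (n + 2) σ' u)) := by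
  simp only [total, map_sum]
  rw [sum_comm]
  refine sum_congr rfl fun β _ => ?_
  by_cases h : Conn (rotOf (.refl (Flags V))) (invOf β) ∧ JoinInduces (.refl _) β σ
  · rw [if_pos h]
    obtain ⟨hc, σ', h1, h2⟩ := h
    rw [sum_eq_single σ', if_pos ⟨hc, h1⟩, cutWeight_eq h1]
    · intro σ'' _ hne
      rw [if_neg, map_zero, map_zero]
      exact fun hA => hne (Induces.unique (legOf_injective β) hA.2 h1)
    · intro hn
      exact absurd (by simpa using h2) hn
  · rw [if_neg h]
    symm
    refine sum_eq_zero fun σ' hσ' => ?_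
    rw [if_neg, map_zero, map_zero]
    exact fun hA => h ⟨hA.1, σ', hA.2, (mem_filter.mp hσ').2⟩

theorem induces_sumCongr_iff {Y1 Y2 X : Type} [Finite X] [Finite Y1] [Finite Y2] {n1 n2 : ℕ}
    {φ1 : Perm Y1} {φ2 : Perm Y2} {j1 : Fin n1 → Y1} {j2 : Fin n2 → Y2} (hj1 : j1.Injective)
    (hj2 : j2.Injective) (ε : X ≃ Fin n1 ⊕ Fin n2) {σ : Perm X} :
    Induces (sumCongr φ1 φ2) (Sum.map j1 j2 ∘ ε) σ ↔
      ∃ σ1 σ2, Induces φ1 j1 σ1 ∧ Induces φ2 j2 σ2 ∧ Induces (sumCongr σ1 σ2) ε σ := by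
  constructor
  · intro h
    obtain ⟨σ1, h1⟩ := exists_induces (φ := φ1) hj1 (fun y => by
      obtain ⟨z, hz⟩ := h.1 (.inl y)
      rw [comp_apply] at hz
      generalize ε z = w at hz
      rcases w with x | x
      · exact ⟨x, sameCycle_sumCongr_inl.mp hz⟩
      · exact absurd hz not_sameCycle_sumCongr)
    obtain ⟨σ2, h2⟩ := exists_induces (φ := φ2) hj2 (fun y => by
      obtain ⟨z, hz⟩ := h.1 (.inr y)
      rw [comp_apply] at hz
      generalize ε z = w at hz
      rcases w with x | x
      · exact absurd hz not_sameCycle_sumCongr'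
      · exact ⟨x, sameCycle_sumCongr_inr.mp hz⟩)
    exact ⟨σ1, σ2, h1, h2, (h1.sumCongr h2).of_trans h (hj1.sumMap hj2) ε.injective⟩
  · rintro ⟨σ1, σ2, h1, h2, h⟩
    exact (h1.sumCongr h2).trans h (hj1.sumMap hj2)

theorem joinInduces_assembly {VS : Finset (Fin V)} {ES : Finset (Fin E)} {X : Finset (Fin n)}
    {β1 : Ends ES.card (X.card + 1) ≃ Flags VS.card}
    {β2 : Ends ESᶜ.card (Xᶜ.card + 1) ≃ Flags VSᶜ.card} {σ : Perm (Fin n)} :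
    JoinInduces (.refl _) (assembly VS ES X β1 β2) σ ↔ ∃ σ1 σ2,
      Induces (invOf β1 * rotOf (.refl _)) (legOf β1) σ1 ∧
      Induces (invOf β2 * rotOf (.refl _)) (legOf β2) σ2 ∧
      Induces (swap (.inl 0) (.inr 0) * sumCongr σ1 σ2) (splitLabel X) σ := by
  unfold JoinInduces
  simp only [induces_assembly, induces_sumCongr_iff (legOf_injective β1) (legOf_injective β2)]
  have key : ∀ σ1 σ2, (∃ σ', Induces (sumCongr σ1 σ2) (splitEquiv X) σ' ∧
      Induces (swap 0 1 * σ') (fun x : Fin n => x.succ.succ) σ) ↔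
      Induces (swap (.inl 0) (.inr 0) * sumCongr σ1 σ2) (splitLabel X) σ := fun σ1 σ2 =>
    (induces_join_iff (splitEquiv X).injective (i := fun x : Fin n => x.succ.succ)
      ((succ_injective _).comp (succ_injective _))).symm
  simp only [← key]
  constructor
  · rintro ⟨σ', ⟨σ1, σ2, h1, h2, h3⟩, h4⟩
    exact ⟨σ1, σ2, h1, h2, σ', h3, h4⟩
  · rintro ⟨σ1, σ2, h1, h2, σ', h3, h4⟩
    exact ⟨σ', ⟨σ1, σ2, h1, h2, h3⟩, h4⟩

variable {u : Fin (n + 2) → K → k} {pu : Fin (n + 2) → ZMod 2}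

theorem cutWeight_assembly (hm : IsCyclicTensor par W.c m) (ht : IsEdgeTensor par W.c t)
    (hu : ∀ x y, u x y ≠ 0 → par y = pu x) {VS : Finset (Fin V)} {ES : Finset (Fin E)}
    {X : Finset (Fin n)} {β1 : Ends ES.card (X.card + 1) ≃ Flags VS.card}
    {β2 : Ends ESᶜ.card (Xᶜ.card + 1) ≃ Flags VSᶜ.card} {σ1 : Perm (Fin (X.card + 1))}
    {σ2 : Perm (Fin (Xᶜ.card + 1))} (h₁ : Induces (invOf β1 * rotOf (.refl _)) (legOf β1) σ1)
    (h₂ : Induces (invOf β2 * rotOf (.refl _)) (legOf β2) σ2) :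
    cutWeight W par m t (.refl _) (assembly VS ES X β1 β2) u =
      (koszulSign pu (fun x => (x : ℕ)) (legRank (splitEquiv X)) : k) • W.res (splitLabel X)
        (W.glue (sumCongr σ1 σ2) (.inl 0) (.inr 0)
          (W.ext Sum.inl (weight W par m (fun _ => t) (.refl _) β1
              fun x => u ((splitEquiv X).symm (.inl x))) *
            W.ext Sum.inr (weight W par m (fun _ => t) (.refl _) β2
              fun x => u ((splitEquiv X).symm (.inr x))))) := by
  have h3 := induces_equiv (sumCongr σ1 σ2) (splitEquiv X)
  rw [cutWeight_eq (induces_assembly.mpr ((induces_sumCongr_iff (legOf_injective β1)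
    (legOf_injective β2) (splitEquiv X)).mpr ⟨σ1, σ2, h₁, h₂, h3⟩)),
    ← weight_trans par m _ _ _ u (sumFlags (subsetEquiv VS) (Equiv.refl (Flags VS.card))
    (Equiv.refl (Flags VSᶜ.card))), assembly_trans, assembly_aux,
    weight_sum _ _ _ _ _ hm ht hu, map_smul, map_smul,
    ← splitEquiv_zero X, ← splitEquiv_one X, ← W.res_glue h3 (splitEquiv X).injective, W.res_res]
  rfl

open Classical in
theorem sum_cutWeight_not_conn (hm : IsCyclicTensor par W.c m) (ht : IsEdgeTensor par W.c t)
    (hu : ∀ x y, u x y ≠ 0 → par y = pu x) (σ : Perm (Fin n)) :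
    (∑ β : Ends E (n + 2) ≃ Flags V,
      if (¬ Conn (rotOf (.refl (Flags V))) (invOf β) ∧ JoinConn (.refl _) β) ∧
        JoinInduces (.refl _) β σ then
        cutWeight W par m t (.refl _) β u else 0) =
    ∑ S : Finset (Fin V) × Finset (Fin E) × Finset (Fin n),
      ∑ σ' ∈ univ.filter fun σ' : Perm (Fin (S.2.2.card + 1)) × Perm (Fin (S.2.2ᶜ.card + 1)) =>
        Induces (swap (.inl 0) (.inr 0) * Equiv.Perm.sumCongr σ'.1 σ'.2) (splitLabel S.2.2) σ,
      (koszulSign pu (fun x => (x : ℕ)) (legRank (splitEquiv S.2.2)) : k) • W.res (splitLabel S.2.2)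
        (W.glue (sumCongr σ'.1 σ'.2) (.inl 0) (.inr 0)
          (W.ext Sum.inl (total W par m (fun _ : Fin S.2.1.card => t) S.1.card _ σ'.1
              fun x => u ((splitEquiv S.2.2).symm (.inl x))) *
            W.ext Sum.inr (total W par m (fun _ : Fin S.2.1ᶜ.card => t) S.1ᶜ.card _ σ'.2
              fun x => u ((splitEquiv S.2.2).symm (.inr x))))) := by
  have h1 : (∑ β : Ends E (n + 2) ≃ Flags V,
      if (¬ Conn (rotOf (.refl (Flags V))) (invOf β) ∧ JoinConn (.refl _) β) ∧
        JoinInduces (.refl _) β σ then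
        cutWeight W par m t (.refl _) β u else 0) =
      ∑ S : Pieces V E n, if S.IsConn ∧ JoinInduces (.refl _) S.assembly σ then
        cutWeight W par m t (.refl _) S.assembly u else 0 := by
    rw [← sum_filter, ← sum_filter]
    symm
    refine Finset.sum_nbij Pieces.assembly ?_ ?_ ?_ fun _ _ => rfl
    · intro S hS
      rw [mem_filter] at hS ⊢
      exact ⟨mem_univ _, conn_assembly hS.2.1.1 hS.2.1.2, hS.2.2⟩
    · intro S hS S' hS' h
      rw [mem_coe, mem_filter] at hS hS'
      exact Pieces.assembly_injOn hS.2.1 hS'.2.1 h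
    · intro β hβ
      rw [mem_coe, mem_filter] at hβ
      obtain ⟨S, hS, rfl⟩ := exists_pieces β hβ.2.1.1 hβ.2.1.2
      exact ⟨S, by simpa using ⟨hS, hβ.2.2⟩, rfl⟩
  rw [h1, Fintype.sum_sigma]
  refine sum_congr rfl fun S _ => ?_
  simp only [total, map_sum, sum_mul_sum, smul_sum, sum_prod_type]
  simp only [← sum_prod_type']
  rw [sum_comm]
  refine sum_congr rfl fun β _ => ?_
  by_cases h : Pieces.IsConn ⟨S, (β.1, β.2)⟩ ∧
      JoinInduces (.refl (Flags V)) (Pieces.assembly ⟨S, (β.1, β.2)⟩) σ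
  · rw [if_pos h]
    obtain ⟨⟨hc1, hc2⟩, h⟩ := h
    obtain ⟨σ1, σ2, e1, e2, e3⟩ := joinInduces_assembly.mp h
    rw [sum_eq_single (σ1, σ2), if_pos ⟨hc1, e1⟩, if_pos ⟨hc2, e2⟩]
    · exact cutWeight_assembly hm ht hu e1 e2
    · rintro ⟨σ1', σ2'⟩ _ hne
      by_cases hA1 : Adm (.refl (Flags S.1.card)) β.1 σ1'
      · by_cases hA2 : Adm (.refl (Flags S.1ᶜ.card)) β.2 σ2'
        · obtain rfl := Induces.unique (legOf_injective β.1) hA1.2 e1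
          obtain rfl := Induces.unique (legOf_injective β.2) hA2.2 e2
          exact absurd rfl hne
        · simp [if_neg hA2]
      · simp [if_neg hA1]
    · intro hn
      exact absurd (by simpa using e3) hn
  · rw [if_neg h]
    symm
    refine sum_eq_zero ?_
    rintro ⟨σ1, σ2⟩ hσ
    by_cases hA1 : Adm (.refl (Flags S.1.card)) β.1 σ1
    · by_cases hA2 : Adm (.refl (Flags S.1ᶜ.card)) β.2 σ2
      · exact absurd ⟨⟨hA1.1, hA2.1⟩, joinInduces_assembly.mpr
          ⟨σ1, σ2, hA1.2, hA2.2, (mem_filter.mp hσ).2⟩⟩ h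
      · simp [if_neg hA2]
    · simp [if_neg hA1]

end CutTotal

/-! ### Cutting the last edge -/

theorem succ_succ_ne_one {n : ℕ} (x : Fin n) : x.succ.succ ≠ 1 := fun h => by
  have := congrArg Fin.val h
  simp at this

section LastEdge

variable {V E n : ℕ} {Y : Type}

/-- The last edge is cut in two legs. -/
def lastEdgeFun : Ends E (n + 2) → Ends (E + 1) n := Sum.elim (fun e => .inl (e.1.castSucc, e.2))
    (cons (.inl (last E, 0)) (cons (.inl (last E, 1)) Sum.inr))

theorem endRank_lastEdgeFun (x : Ends E (n + 2)) : endRank (lastEdgeFun x) = endRank x := by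
  rcases x with ⟨e, b⟩ | x
  · simp [lastEdgeFun, endRank]
  · refine Fin.cases ?_ (fun x => Fin.cases ?_ (fun x => ?_) x) x <;>
      simp [lastEdgeFun, endRank] <;> ring

theorem lastEdgeFun_bijective : (lastEdgeFun (E := E) (n := n)).Bijective := by
  rw [Fintype.bijective_iff_injective_and_card]
  refine ⟨fun x y h => endRank_injective ?_, ?_⟩
  · rw [← endRank_lastEdgeFun, h, endRank_lastEdgeFun]
  · simp; ring

def lastEdge (E n : ℕ) : Ends E (n + 2) ≃ Ends (E + 1) n := ofBijective _ lastEdgeFun_bijective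

theorem lastEdge_inl (e : Fin E) (b : Fin 2) :
    lastEdge E n (.inl (e, b)) = .inl (e.castSucc, b) := rfl

theorem lastEdge_succ (x : Fin n) : lastEdge E n (.inr x.succ.succ) = .inr x := rfl

variable (β : Ends (E + 1) n ≃ Y)

theorem invOf_lastEdge [DecidableEq Y] : invOf β =
    swap (legOf ((lastEdge E n).trans β) 0) (legOf ((lastEdge E n).trans β) 1) *
      invOf ((lastEdge E n).trans β) := by
  set β' := (lastEdge E n).trans β
  have e1 : ∀ (e : Fin E) b, β' (.inl (e, b)) = β (.inl (e.castSucc, b)) := fun _ _ => rfl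
  have e2 : β' (.inr 0) = β (.inl (last E, 0)) := rfl
  have e3 : β' (.inr 1) = β (.inl (last E, 1)) := rfl
  have e4 : ∀ x : Fin n, β' (.inr x.succ.succ) = β (.inr x) := fun _ => rfl
  refine Equiv.ext fun y => ?_
  obtain ⟨⟨e, b⟩ | x, rfl⟩ := β'.surjective y
  · rw [mul_apply, invOf_inl, e1, invOf_inl, e1, legOf, legOf, e2, e3, swap_apply_of_ne_of_ne]
    · intro h; simpa [e.castSucc_lt_last.ne] using β.injective h
    · intro h; simpa [e.castSucc_lt_last.ne] using β.injective h
  · rw [mul_apply, invOf_inr, legOf, legOf]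
    refine Fin.cases ?_ (fun x => Fin.cases ?_ (fun x => ?_) x) x
    · rw [swap_apply_left, e2, invOf_inl, e3]
      rfl
    · rw [show (0 : Fin (n + 1)).succ = 1 from rfl, Equiv.swap_apply_right, e3, invOf_inl, e2]
      rfl
    · rw [swap_apply_of_ne_of_ne, e4, invOf_inr]
      · intro h; simpa [Fin.succ_ne_zero] using β'.injective h
      · intro h
        exact succ_succ_ne_one x (inr_injective (β'.injective h))

theorem adm_lastEdge [Finite Y] [DecidableEq Y] (α : Flags V ≃ Y) {σ : Perm (Fin n)} : Adm α β σ ↔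
    JoinConn α ((lastEdge E n).trans β) ∧ JoinInduces α ((lastEdge E n).trans β) σ := by
  unfold Adm JoinConn JoinInduces
  rw [invOf_lastEdge β, ← induces_join_iff (legOf_injective _) (i := fun x : Fin n => x.succ.succ)
    ((succ_injective _).comp (succ_injective _)), mul_assoc]
  rfl

variable {k : Type u} [Field k] {K : Type*} {W : Coef k}

theorem orient_lastEdge [DecidableEq Y] (α : Flags V ≃ Y) : orient W α β =
    W.glue (invOf ((lastEdge E n).trans β) * rotOf α) (legOf ((lastEdge E n).trans β) 0)
      (legOf ((lastEdge E n).trans β) 1) (orient W α ((lastEdge E n).trans β)) := by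
  have h : edgeList β = edgeList ((lastEdge E n).trans β) ++
      [(legOf ((lastEdge E n).trans β) 0, legOf ((lastEdge E n).trans β) 1)] := by
    unfold edgeList
    rw [List.ofFn_succ_last]
    rfl
  unfold orient
  rw [h, glueList_append, glueList_cons, glueList_edgeList_fst]
  rfl

variable [Fintype K] {K' : Type*} [Fintype K'] {par : K → ZMod 2} {m : K → K → K → k}
  {t D : K → K → k} {g : K' → K' → k} {e : K' → K → k} {a : Fin n → K → k}

theorem contr_lastEdge [Fintype Y] [DecidableEq Y] (hD : ∀ x y, D x y = ∑ μ, ∑ ν, g μ ν * (e μ x * e ν y))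
    (α : Flags V ≃ Y) : contr par m (update (fun _ => t) (last E) D) α β a =
      ∑ μ, ∑ ν, g μ ν * contr par m (fun _ => t) α ((lastEdge E n).trans β)
        (cons (e μ) (cons (e ν) a)) := by
  unfold contr
  simp only [mul_sum]
  rw [sum_congr rfl fun μ _ => sum_comm, sum_comm]
  refine sum_congr rfl fun φ _ => ?_
  unfold term
  rw [Fin.prod_univ_castSucc]
  simp only [Fin.prod_univ_succ, Fin.cons_zero, Fin.cons_succ, update_self,
    update_of_ne (castSucc_lt_last _).ne, hD]
  have hr : endRank ∘ ((lastEdge E n).trans β).symm = endRank ∘ β.symm := by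
    funext y
    obtain ⟨x, rfl⟩ := ((lastEdge E n).trans β).surjective y
    have : endRank (lastEdge E n x) = endRank x := endRank_lastEdgeFun x
    rw [comp_apply, symm_apply_apply, comp_apply, trans_apply, symm_apply_apply, this]
  rw [hr]
  simp only [mul_sum, sum_mul]
  refine sum_congr rfl fun μ _ => sum_congr rfl fun ν _ => ?_
  simp only [trans_apply, lastEdge_inl, lastEdge_succ]
  rw [← Fin.succ_zero_eq_one'] 
  change _ = g μ ν * (_ * _ * _ * (e μ (φ (β (.inl (last E, 0)))) *
    (e ν (φ (β (.inl (last E, 1)))) * _)))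
  ring

theorem weight_lastEdge [Fintype Y] [DecidableEq Y]
    (hD : ∀ x y, D x y = ∑ μ, ∑ ν, g μ ν * (e μ x * e ν y)) (α : Flags V ≃ Y) :
    weight W par m (update (fun _ => t) (last E) D) α β a =
      ∑ μ, ∑ ν, g μ ν • cutWeight W par m t α ((lastEdge E n).trans β)
        (cons (e μ) (cons (e ν) a)) := by
  unfold weight cutWeight oweight
  rw [contr_lastEdge β hD, sum_smul]
  refine sum_congr rfl fun μ _ => ?_
  rw [sum_smul]
  refine sum_congr rfl fun ν _ => ?_
  rw [map_smul, map_smul, smul_smul, orient_lastEdge]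
  rfl

end LastEdge

section Sign

variable {n : ℕ}

theorem koszulSign_splitEquiv (pu : Fin (n + 2) → ZMod 2) (X : Finset (Fin n)) :
    koszulSign pu (fun x => (x : ℕ)) (legRank (splitEquiv X)) =
      sgn (pu 1 * ∑ i ∈ X, pu i.succ.succ) *
        koszulSign (fun i : Fin n => pu i.succ.succ) (fun i => (i : ℕ))
          (fun i => if i ∈ X then (i : ℕ) else n + i) := by
  classical
  set s : Fin (n + 2) → ℕ := cons 0 (cons 1 fun i : Fin n =>
    2 + if i ∈ X then (i : ℕ) else n + i) with hs
  have s0 : s 0 = 0 := rfl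
  have s1 : s 1 = 1 := rfl
  have s2 : ∀ i : Fin n, s i.succ.succ = 2 + if i ∈ X then (i : ℕ) else n + i := fun _ => rfl
  have l0 : legRank (splitEquiv X) 0 = 0 := rfl
  have l1 : legRank (splitEquiv X) 1 = X.card + 1 := rfl
  have l2 : ∀ i, legRank (splitEquiv X) (X.orderEmbOfFin rfl i).succ.succ = i + 1 := fun i => by
    rw [legRank, splitEquiv_succ, splitLabel_orderEmb]; simp
  have l3 : ∀ i, legRank (splitEquiv X) (Xᶜ.orderEmbOfFin rfl i).succ.succ =
      X.card + 1 + (i + 1) := fun i => by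
    rw [legRank, splitEquiv_succ, splitLabel_orderEmb_compl]; simp
  have s3 : ∀ i, s (X.orderEmbOfFin rfl i).succ.succ = 2 + X.orderEmbOfFin rfl i := fun i => by
    rw [s2, if_pos (orderEmbOfFin_mem _ _ _)]
  have s4 : ∀ i, s (Xᶜ.orderEmbOfFin rfl i).succ.succ = 2 + (n + Xᶜ.orderEmbOfFin rfl i) := fun i => by
    rw [s2, if_neg (mem_compl.mp (orderEmbOfFin_mem _ _ _))]
  have case : ∀ x : Fin (n + 2), x = 0 ∨ x = 1 ∨ (∃ i, x = (X.orderEmbOfFin rfl i).succ.succ) ∨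
      ∃ i, x = (Xᶜ.orderEmbOfFin rfl i).succ.succ := by
    intro x
    refine Fin.cases (.inl rfl) (fun x => Fin.cases (.inr (.inl rfl)) (fun x => .inr (.inr ?_)) x) x
    obtain ⟨y | y, rfl⟩ := (subsetEquiv X).symm.surjective x
    · exact .inl ⟨y, by rw [subsetEquiv_symm_inl]⟩
    · exact .inr ⟨y, by rw [subsetEquiv_symm_inr]⟩
  have mo : ∀ (Z : Finset (Fin n)) (i j : Fin Z.card), ((Z.orderEmbOfFin rfl i : Fin n) : ℕ) <
      Z.orderEmbOfFin rfl j ↔ (i : ℕ) < j := fun Z i j => by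
    rw [← lt_def, OrderEmbedding.lt_iff_lt, lt_def]
  have hsi : s.Injective := by
    rw [hs, Fin.cons_injective_iff, Fin.cons_injective_iff]
    refine ⟨?_, ?_, ?_⟩
    · rintro ⟨x, hx⟩
      refine Fin.cases (fun h => ?_) (fun x h => ?_) x hx
      · simp at h
      · rw [Fin.cons_succ] at h; omega
    · rintro ⟨x, hx⟩
      dsimp only at hx
      omega
    · intro x y h
      dsimp only at h
      ext
      split_ifs at h <;> omega
  rw [← koszulSign_mul pu Fin.val_injective hsi (legRank_injective _), mul_comm]
  congr 1
  · rw [koszulSign_rectangle pu {1} (X.map ((Fin.succEmb n).trans (Fin.succEmb (n + 1))))]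
    · rw [sum_singleton, sum_map]
      rfl
    · have hB : ∀ x : Fin n, x.succ.succ ∈ X.map ((Fin.succEmb n).trans (Fin.succEmb (n + 1))) ↔ x ∈ X := by
        intro x
        simp
      have hB0 : (0 : Fin (n + 2)) ∉ X.map ((Fin.succEmb n).trans (Fin.succEmb (n + 1))) := by
        simp [Fin.succ_ne_zero]
      have hB1 : (1 : Fin (n + 2)) ∉ X.map ((Fin.succEmb n).trans (Fin.succEmb (n + 1))) := by
        simp only [Finset.mem_map, not_exists, not_and]
        exact fun x _ => succ_succ_ne_one x
      have m1 : ∀ i, X.orderEmbOfFin rfl i ∈ X := orderEmbOfFin_mem _ _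
      have m2 : ∀ i, Xᶜ.orderEmbOfFin rfl i ∉ X := fun i => mem_compl.mp (orderEmbOfFin_mem _ _ _)
      intro x y
      rw [mem_singleton]
      rcases case x with rfl | rfl | ⟨i, rfl⟩ | ⟨i, rfl⟩ <;>
      rcases case y with rfl | rfl | ⟨j, rfl⟩ | ⟨j, rfl⟩ <;>
      simp only [s0, s1, s3, s4, l0, l1, l2, l3, hB, hB0, hB1, succ_succ_ne_one, m1, m2, and_true,
        and_false, true_and, false_and, iff_false, iff_true, zero_ne_one, add_lt_add_iff_left,
        add_lt_add_iff_right, mo] <;> omega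
  · rw [koszulSign_window (z := fun i : Fin n => i.succ.succ)
      ((succ_injective _).comp (succ_injective _))]
    · refine koszulSign_congr ?_ ?_ <;> intro x y <;> simp [s2]
    · intro x y h hxy
      refine Fin.cases (fun h hxy => ?_) (fun x => Fin.cases (fun h hxy => ?_) (fun x h hxy => ?_) x) x h hxy
      · simp [s0]
      · rw [show (0 : Fin (n + 1)).succ = 1 from rfl] at hxy ⊢
        rw [s1]
        refine Fin.cases (fun hxy => ?_) (fun y => Fin.cases (fun hxy => ?_) (fun y hxy => ?_) y) y hxy
        · simp at hxy
        · simp at hxy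
        · rw [s2]; omega
      · refine Fin.cases (fun h hxy => ?_)
          (fun y => Fin.cases (fun h hxy => ?_) (fun y h hxy => ?_) y) y h hxy
        · simp at hxy
        · simp at hxy
        · simp at h

end Sign

/-! ### The Euler characteristic of a connected graph -/

theorem flags_card {V E n : ℕ} (β : Ends E n ≃ Flags V) : 3 * V = 2 * E + n := by
  have := card_congr β
  simp at this
  omega

theorem Conn.vertices_le {V E n : ℕ} {β : Ends E n ≃ Flags V}
    (h : Conn (rotOf (.refl (Flags V))) (invOf β)) : 0 < V ∧ V ≤ E + 1 := by
  classical
  obtain ⟨⟨v₀⟩, hc⟩ := h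
  refine ⟨Fin.pos v₀.1, ?_⟩
  let G : SimpleGraph (Fin V) := SimpleGraph.fromRel fun i j =>
    ∃ e, (β (.inl (e, 0))).1 = i ∧ (β (.inl (e, 1))).1 = j
  have hstep : ∀ y : Flags V, G.Reachable y.1 (invOf β y).1 := by
    intro y
    obtain ⟨⟨e, b⟩ | x, rfl⟩ := β.surjective y
    · rw [invOf_inl]
      have h01 : G.Reachable (β (.inl (e, 0))).1 (β (.inl (e, 1))).1 := by
        by_cases heq : (β (.inl (e, 0))).1 = (β (.inl (e, 1))).1
        · rw [heq]
        · exact SimpleGraph.Adj.reachable ((SimpleGraph.fromRel_adj _ _ _).mpr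
            ⟨heq, .inl ⟨e, rfl, rfl⟩⟩)
      fin_cases b
      · exact h01
      · exact h01.symm
    · rw [invOf_inr]
  have hreach : ∀ y z : Flags V, G.Reachable y.1 z.1 := by
    intro y z
    have := hc y z
    induction this with
    | refl => exact .refl _
    | @tail b c _ hbc ih =>
      rcases hbc with rfl | rfl
      · have : (rotOf (.refl (Flags V)) b).1 = b.1 := by rw [rotOf_refl]; rfl
        rwa [this]
      · exact ih.trans (hstep _)
  have hG : G.Connected := by
    have : Nonempty (Fin V) := ⟨v₀.1⟩
    exact ⟨fun i j => hreach (i, 0) (j, 0)⟩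
  have h1 := hG.card_vert_le_card_edgeSet_add_one
  rw [Nat.card_eq_fintype_card, card_fin] at h1
  refine h1.trans (Nat.add_le_add_right ?_ 1)
  have h2 : G.edgeSet ⊆ range fun e : Fin E => s((β (.inl (e, 0))).1, (β (.inl (e, 1))).1) := by
    intro s hs
    induction s using Sym2.ind with
    | _ i j =>
      rw [SimpleGraph.mem_edgeSet, SimpleGraph.fromRel_adj] at hs
      rcases hs.2 with ⟨e, rfl, rfl⟩ | ⟨e, rfl, rfl⟩
      · exact ⟨e, rfl⟩
      · exact ⟨e, Sym2.eq_swap⟩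
  calc Nat.card G.edgeSet ≤ Nat.card (range fun e : Fin E =>
        s((β (.inl (e, 0))).1, (β (.inl (e, 1))).1)) := Nat.card_mono (Set.toFinite _) h2
    _ ≤ Nat.card (Fin E) := Finite.card_range_le _
    _ = E := by simp

section Total

variable {k : Type u} [Field k] {K : Type*} [Fintype K] {K' : Type*} [Fintype K']
  (W : Coef k) (par : K → ZMod 2) (m : K → K → K → k) (t : K → K → k) (e : K' → K → k)

/-- The sum of the weights of all connected graphs with numbered vertices and edges, as a functional
on words. -/
def wordTotal (V E n : ℕ) (σ : Perm (Fin n)) (v : Fin n → K') : W.C (Fin n) :=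
  total W par m (fun _ : Fin E => t) V n σ fun x => e (v x)

variable {W par m t e}

theorem wordTotal_ne_zero {V E n : ℕ} {σ : Perm (Fin n)} {v : Fin n → K'}
    (h : wordTotal W par m t e V E n σ v ≠ 0) : 3 * V = 2 * E + n ∧ 0 < V ∧ V ≤ E + 1 := by
  classical
  unfold wordTotal total at h
  obtain ⟨β, _, hβ⟩ := Finset.exists_ne_zero_of_sum_ne_zero h
  have hA : Adm (.refl _) β σ := by
    by_contra hA
    exact hβ (if_neg hA)
  exact ⟨flags_card β, hA.1.vertices_le⟩

end Total

/-! ### The Batalin-Vilkovisky operations with coefficients -/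

section Operations

variable {k : Type u} [Field k] {K : Type*} [Fintype K] (W : Coef k)

open Classical in
/-- The Batalin-Vilkovisky operator, without the factor `1/2`. -/
def coefBv (g : K → K → k) (F : ∀ n, Perm (Fin n) → (Fin n → K) → W.C (Fin n)) (n : ℕ)
    (σ : Perm (Fin n)) (v : Fin n → K) : W.C (Fin n) :=
  ∑ σ' ∈ univ.filter fun σ' : Perm (Fin (n + 2)) =>
      Induces (swap 0 1 * σ') (fun i : Fin n => i.succ.succ) σ,
    ∑ μ, ∑ ν, g μ ν • W.res (fun i : Fin n => i.succ.succ)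
      (W.glue σ' 0 1 (F (n + 2) σ' (cons μ (cons ν v))))

open Classical in
/-- One summand of the bracket. -/
def coefBracketAt (par : K → ZMod 2) (g : K → K → k)
    (F G : ∀ n, Perm (Fin n) → (Fin n → K) → W.C (Fin n)) (n : ℕ)
    (σ : Perm (Fin n)) (v : Fin n → K) (X : Finset (Fin n)) : W.C (Fin n) :=
  ∑ σ' ∈ univ.filter fun σ' : Perm (Fin (X.card + 1)) × Perm (Fin (Xᶜ.card + 1)) =>
      Induces (swap (.inl 0) (.inr 0) * Equiv.Perm.sumCongr σ'.1 σ'.2) (splitLabel X) σ,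
    ∑ μ, ∑ ν, ((splitSign par v X ν : k) * g μ ν) • W.res (splitLabel X)
      (W.glue (Equiv.Perm.sumCongr σ'.1 σ'.2) (.inl 0) (.inr 0)
        (W.ext Sum.inl (F _ σ'.1 (cons μ (v ∘ X.orderEmbOfFin rfl))) *
          W.ext Sum.inr (G _ σ'.2 (cons ν (v ∘ Xᶜ.orderEmbOfFin rfl)))))

/-- The contragredient action of an odd operator. -/
def coefDual (par : K → ZMod 2) (J : K → K → k)
    (F : ∀ n, Perm (Fin n) → (Fin n → K) → W.C (Fin n)) (n : ℕ) (σ : Perm (Fin n))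
    (v : Fin n → K) : W.C (Fin n) :=
  -∑ i : Fin n, ∑ y, ((sgn (∑ l ∈ univ.filter (· < i), par (v l)) : k) * J y (v i)) •
      F n σ (update v i y)

/-- The coefficient at `ħ^c` of `ħ Δ S + ½ {S, S} + I^∨ S`. -/
def masterExpression (par : K → ZMod 2) (g J : K → K → k)
    (S : ℕ → ∀ n, Perm (Fin n) → (Fin n → K) → W.C (Fin n)) (c n : ℕ) (σ : Perm (Fin n))
    (v : Fin n → K) : W.C (Fin n) :=
  (match c with
    | 0 => 0
    | c' + 1 => (1 / 2 : k) • coefBv W g (S c') n σ v) +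
  (1 / 2 : k) • ∑ ab ∈ antidiagonal c, ∑ X : Finset (Fin n),
    coefBracketAt W par g (S ab.1) (S ab.2) n σ v X +
  coefDual W par J (S c) n σ v

end Operations

section TotalLast

variable {k : Type u} [Field k] {K : Type*} [Fintype K] {K' : Type*} [Fintype K']
  {W : Coef k} {par : K → ZMod 2} {m : K → K → K → k} {t D : K → K → k} {e : K' → K → k}
  {g : K' → K' → k} {pK : K' → ZMod 2} {V E n : ℕ}

theorem splitEquiv_legs_inl (X : Finset (Fin n)) (μ ν : K') (v : Fin n → K') (x : Fin (X.card + 1)) :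
    (cons (e μ) (cons (e ν) fun x => e (v x)) : Fin (n + 2) → K → k)
      ((splitEquiv X).symm (.inl x)) =
    e ((cons μ (v ∘ X.orderEmbOfFin rfl) : Fin (X.card + 1) → K') x) := by
  refine Fin.cases ?_ (fun x => ?_) x
  · rw [← splitEquiv_zero X, symm_apply_apply]; rfl
  · rw [← splitLabel_orderEmb X, ← splitEquiv_succ, symm_apply_apply]; rfl

theorem splitEquiv_legs_inr (X : Finset (Fin n)) (μ ν : K') (v : Fin n → K')
    (x : Fin (Xᶜ.card + 1)) :
    (cons (e μ) (cons (e ν) fun x => e (v x)) : Fin (n + 2) → K → k)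
      ((splitEquiv X).symm (.inr x)) =
    e ((cons ν (v ∘ Xᶜ.orderEmbOfFin rfl) : Fin (Xᶜ.card + 1) → K') x) := by
  refine Fin.cases ?_ (fun x => ?_) x
  · rw [← splitEquiv_one X, symm_apply_apply]; rfl
  · rw [← splitLabel_orderEmb_compl X, ← splitEquiv_succ, symm_apply_apply]; rfl

open Classical in
theorem total_last (hm : IsCyclicTensor par W.c m) (ht : IsEdgeTensor par W.c t)
    (he : ∀ u x, e u x ≠ 0 → par x = pK u)
    (hD : ∀ x y, D x y = ∑ μ, ∑ ν, g μ ν * (e μ x * e ν y)) (σ : Perm (Fin n)) (v : Fin n → K') :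
    total W par m (update (fun _ => t) (last E) D) V n σ (fun x => e (v x)) =
      coefBv W g (wordTotal W par m t e V E) n σ v +
      ∑ S : Finset (Fin V) × Finset (Fin E), ∑ X : Finset (Fin n),
        coefBracketAt W pK g (wordTotal W par m t e S.1.card S.2.card)
          (wordTotal W par m t e S.1ᶜ.card S.2ᶜ.card) n σ v X := by
  have h1 : total W par m (update (fun _ => t) (last E) D) V n σ (fun x => e (v x)) =
      ∑ μ, ∑ ν, g μ ν • ∑ β : Ends E (n + 2) ≃ Flags V,
        if JoinConn (.refl _) β ∧ JoinInduces (.refl _) β σ then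
          cutWeight W par m t (.refl _) β (cons (e μ) (cons (e ν) fun x => e (v x)))
        else 0 := by
    simp only [smul_sum]
    rw [sum_congr rfl fun μ _ => sum_comm, sum_comm]
    unfold total
    rw [← (Equiv.equivCongr (lastEdge E n) (Equiv.refl (Flags V))).sum_comp]
    refine sum_congr rfl fun β _ => ?_
    have hβ : (lastEdge E n).trans ((Equiv.equivCongr (lastEdge E n) (Equiv.refl (Flags V))) β) = β := by
      ext x <;> simp
    rw [weight_lastEdge _ hD, hβ]
    simp only [adm_lastEdge, hβ]
    split_ifs
    · rfl
    · simp
  have h2 : ∀ u : Fin (n + 2) → K → k, (∑ β : Ends E (n + 2) ≃ Flags V,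
        if JoinConn (.refl _) β ∧ JoinInduces (.refl _) β σ then
          cutWeight W par m t (.refl _) β u else 0) =
      (∑ β : Ends E (n + 2) ≃ Flags V,
        if Conn (rotOf (.refl (Flags V))) (invOf β) ∧ JoinInduces (.refl _) β σ then
          cutWeight W par m t (.refl _) β u else 0) +
      ∑ β : Ends E (n + 2) ≃ Flags V,
        if (¬ Conn (rotOf (.refl (Flags V))) (invOf β) ∧ JoinConn (.refl _) β) ∧
          JoinInduces (.refl _) β σ then cutWeight W par m t (.refl _) β u else 0 := by
    intro u
    rw [← sum_add_distrib]
    refine sum_congr rfl fun β _ => ?_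
    by_cases hc : Conn (rotOf (.refl (Flags V))) (invOf β)
    · have : JoinConn (.refl _) β := hc.swap_mul (invOf_inr _ _) (invOf_inr _ _)
      simp [hc, this]
    · simp [hc]
  have hu : ∀ μ ν x y, (cons (e μ) (cons (e ν) fun x => e (v x)) : Fin (n + 2) → K → k) x y ≠ 0 →
      par y = (cons (pK μ) (cons (pK ν) fun x => pK (v x)) : Fin (n + 2) → ZMod 2) x := by
    intro μ ν x y
    refine Fin.cases ?_ (fun x => Fin.cases ?_ (fun x => ?_) x) x <;> exact he _ _
  have hs : ∀ μ ν (X : Finset (Fin n)), koszulSign (cons (pK μ) (cons (pK ν) fun x => pK (v x)) :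
      Fin (n + 2) → ZMod 2) (fun x => (x : ℕ)) (legRank (splitEquiv X)) = splitSign pK v X ν := by
    intro μ ν X
    rw [koszulSign_splitEquiv]
    rfl
  simp only [h1, h2, smul_add, sum_add_distrib]
  congr 1
  · unfold coefBv wordTotal
    simp only [sum_cutWeight_conn, smul_sum]
    rw [sum_congr rfl fun μ _ => sum_comm, sum_comm]
    refine sum_congr rfl fun σ' _ => sum_congr rfl fun μ _ => sum_congr rfl fun ν _ => ?_
    have hl : (cons (e μ) (cons (e ν) fun x => e (v x)) : Fin (n + 2) → K → k) =
        fun x => e ((cons μ (cons ν v) : Fin (n + 2) → K') x) := by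
      funext x
      refine Fin.cases ?_ (fun x => Fin.cases ?_ (fun x => ?_) x) x <;> rfl
    rw [hl]
  · simp only [fun μ ν => sum_cutWeight_not_conn (V := V) (E := E) hm ht (hu μ ν) σ,
      smul_sum, smul_smul, hs, splitEquiv_legs_inl, splitEquiv_legs_inr]
    rw [sum_congr rfl fun μ _ => sum_comm, sum_comm, sum_prod_type, sum_prod_type]
    refine sum_congr rfl fun VS _ => ?_
    rw [sum_prod_type]
    refine sum_congr rfl fun ES _ => sum_congr rfl fun X _ => ?_
    unfold coefBracketAt
    rw [sum_congr rfl fun μ _ => sum_comm, sum_comm]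
    refine sum_congr rfl fun σ' _ => sum_congr rfl fun μ _ => sum_congr rfl fun ν _ => ?_
    rw [mul_comm]
    rfl

end TotalLast

/-! ### Counting numberings -/

section Counting

theorem sum_finset_card_compl {M : Type*} [AddCommMonoid M] (V : ℕ) (f : ℕ → ℕ → M) :
    ∑ S : Finset (Fin V), f S.card Sᶜ.card = ∑ p ∈ antidiagonal V, V.choose p.1 • f p.1 p.2 := by
  rw [Finset.Nat.sum_antidiagonal_eq_sum_range_succ fun i j => V.choose i • f i j]
  have h := Finset.sum_powerset_apply_card (fun i => f i (V - i)) (x := (univ : Finset (Fin V)))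
  rw [Finset.powerset_univ, Finset.card_univ, card_fin] at h
  rw [← h]
  exact sum_congr rfl fun S _ => by rw [Finset.card_compl, card_fin]

/-- The number of ways to number the vertices, edges and flags of a graph. -/
def numbering (k : Type*) [Field k] (V E : ℕ) : k :=
  (V.factorial * 3 ^ V : ℕ) * (E.factorial * 2 ^ E : ℕ)

variable {k : Type*} [Field k] [CharZero k]

theorem numbering_ne_zero (V E : ℕ) : numbering k V E ≠ 0 := by
  unfold numbering
  have h1 := V.factorial_ne_zero
  have h2 := E.factorial_ne_zero
  rw [← Nat.cast_mul, Nat.cast_ne_zero]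
  positivity

theorem numbering_succ (V E : ℕ) : numbering k V (E + 1) = numbering k V E * (2 * (E + 1 : ℕ)) := by
  unfold numbering
  rw [Nat.factorial_succ, pow_succ]
  push_cast
  ring

theorem choose_mul_numbering {V V1 V2 E E1 E2 : ℕ} (hV : V1 + V2 = V) (hE : E1 + E2 = E) :
    (V.choose V1 : k) * E.choose E1 * (numbering k V E)⁻¹ =
      (numbering k V1 E1)⁻¹ * (numbering k V2 E2)⁻¹ := by
  subst hV hE
  have h1 : ((V1 + V2).choose V1 : k) * V1.factorial * V2.factorial = (V1 + V2).factorial := by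
    rw [Nat.choose_symm_add]
    exact_mod_cast Nat.add_choose_mul_factorial_mul_factorial V1 V2
  have h2 : ((E1 + E2).choose E1 : k) * E1.factorial * E2.factorial = (E1 + E2).factorial := by
    rw [Nat.choose_symm_add]
    exact_mod_cast Nat.add_choose_mul_factorial_mul_factorial E1 E2
  have n1 := numbering_ne_zero (k := k) V1 E1
  have n2 := numbering_ne_zero (k := k) V2 E2
  have n3 := numbering_ne_zero (k := k) (V1 + V2) (E1 + E2)
  field_simp
  unfold numbering
  push_cast
  rw [← h1, ← h2, pow_add, pow_add]
  ring

end Counting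

section Linear

variable {k : Type u} [Field k] {K : Type*} [Fintype K] {V E n : ℕ} {W : Coef k}
  {par : K → ZMod 2} {m : K → K → K → k} {a : Fin n → K → k} {σ : Perm (Fin n)}

theorem total_update_leg_sum {K' : Type*} [Fintype K'] {τ : Fin E → K → K → k} (i : Fin n)
    (c : K' → k) (f : K' → K → k) :
    total W par m τ V n σ (update a i fun z => ∑ y, c y * f y z) =
      ∑ y, c y • total W par m τ V n σ (update a i (f y)) := by
  classical
  have hprod : ∀ (F : K → k) (q : Fin n → K), ∏ x, update a i F x (q x) =
      F (q i) * ∏ x ∈ univ.erase i, a x (q x) := by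
    intro F q
    rw [← mul_prod_erase univ _ (mem_univ i), update_self]
    congr 1
    refine prod_congr rfl fun x hx => ?_
    rw [update_of_ne (ne_of_mem_erase hx)]
  unfold total
  simp only [smul_sum]
  rw [sum_comm]
  refine sum_congr rfl fun β _ => ?_
  simp only [smul_ite, smul_zero]
  split_ifs
  · unfold weight
    simp only [smul_smul]
    rw [← sum_smul]
    congr 1
    unfold contr term
    simp only [hprod, mul_sum, sum_mul]
    rw [sum_comm]
    refine sum_congr rfl fun y _ => sum_congr rfl fun φ _ => ?_
    ring
  · simp

theorem total_last_sub {t D1 D2 : K → K → k} (s : k) :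
    total W par m (update (fun _ => t) (last E) fun x y => s * (D1 x y - D2 x y)) V n σ a =
      s • (total W par m (update (fun _ => t) (last E) D1) V n σ a -
        total W par m (update (fun _ => t) (last E) D2) V n σ a) := by
  unfold total
  rw [← Finset.sum_sub_distrib, smul_sum]
  refine sum_congr rfl fun β _ => ?_
  split_ifs
  · unfold weight
    rw [← sub_smul, smul_smul]
    congr 1
    unfold contr term
    simp only [Fin.prod_univ_castSucc, update_self, update_of_ne (castSucc_lt_last _).ne]
    rw [← Finset.sum_sub_distrib, mul_sum]
    refine sum_congr rfl fun φ _ => ?_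
    ring
  · simp

variable {K' : Type*} [Fintype K'] {g : K' → K' → k} {pK : K' → ZMod 2}
  {F F' G G' : ∀ n, Perm (Fin n) → (Fin n → K') → W.C (Fin n)} {v : Fin n → K'}

theorem coefBv_smul (r : k) : coefBv W g (fun n σ v => r • F n σ v) n σ v = r • coefBv W g F n σ v := by
  unfold coefBv
  simp only [map_smul, smul_sum, smul_comm _ r]

theorem coefBv_congr (h : ∀ σ v, F (n + 2) σ v = F' (n + 2) σ v) :
    coefBv W g F n σ v = coefBv W g F' n σ v := by
  unfold coefBv
  simp only [h]

theorem coefBv_eq_zero (h : ∀ σ v, F (n + 2) σ v = 0) : coefBv W g F n σ v = 0 := by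
  unfold coefBv
  simp [h]

theorem coefBracketAt_smul (r s : k) (X : Finset (Fin n)) :
    coefBracketAt W pK g (fun n σ v => r • F n σ v) (fun n σ v => s • G n σ v) n σ v X =
      (r * s) • coefBracketAt W pK g F G n σ v X := by
  unfold coefBracketAt
  simp only [map_smul, smul_mul_smul_comm, smul_sum, smul_comm _ (r * s)]

theorem coefBracketAt_congr {X : Finset (Fin n)} (h : ∀ σ v, F (X.card + 1) σ v = F' (X.card + 1) σ v)
    (h' : ∀ σ v, G (Xᶜ.card + 1) σ v = G' (Xᶜ.card + 1) σ v) :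
    coefBracketAt W pK g F G n σ v X = coefBracketAt W pK g F' G' n σ v X := by
  unfold coefBracketAt
  simp only [h, h']

theorem coefBracketAt_ne_zero {X : Finset (Fin n)} (h : coefBracketAt W pK g F G n σ v X ≠ 0) :
    (∃ σ v, F (X.card + 1) σ v ≠ 0) ∧ ∃ σ v, G (Xᶜ.card + 1) σ v ≠ 0 := by
  constructor
  · by_contra hc
    push Not at hc
    exact h (by unfold coefBracketAt; simp [hc])
  · by_contra hc
    push Not at hc
    exact h (by unfold coefBracketAt; simp [hc])

theorem coefDual_smul (par : K' → ZMod 2) (J : K' → K' → k) (r : k) :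
    coefDual W par J (fun n σ v => r • F n σ v) n σ v = r • coefDual W par J F n σ v := by
  unfold coefDual
  simp only [smul_neg, smul_sum, smul_comm _ r]

end Linear

/-! ### The master equation -/

section Master

variable {k : Type u} [Field k] {K : Type*} [Fintype K] {K' : Type*} [Fintype K']

/-- The coefficient at `ħ^c` of the sum over graphs. -/
def solution (W : Coef k) (par : K → ZMod 2) (m : K → K → K → k) (t : K → K → k) (e : K' → K → k)
    (V E n : ℕ) (σ : Perm (Fin n)) (v : Fin n → K') : W.C (Fin n) :=
  (numbering k V E)⁻¹ • wordTotal W par m t e V E n σ v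

/-- Tensors for which the sum over graphs solves the master equation. -/
structure IsMasterData (par : K → ZMod 2) (c : ZMod 2) (m : K → K → K → k) (t T TP : K → K → k)
    (J : K → K → k) (pK : K' → ZMod 2) (g J' : K' → K' → k) (e : K' → K → k) : Prop where
  cyclic : IsCyclicTensor par c m
  edge : IsEdgeTensor par c t
  parity : ∀ x y, T x y ≠ 0 → par x + par y = c + 1
  parity' : ∀ x y, TP x y ≠ 0 → par x + par y = c + 1
  assoc : IsAssociative par m T
  odd : ∀ y x, J y x ≠ 0 → par y = par x + 1
  invariant : ∀ x y z, ∑ w, J w x * m w y z + (sgn (par x) : k) * ∑ w, J w y * m x w z +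
      (sgn (par x + par y) : k) * ∑ w, J w z * m x y w = 0
  variation : ∀ y z, ∑ x, J y x * t x z + (sgn (par y) : k) * ∑ x, J z x * t y x =
    (sgn c : k) * (T y z - TP y z)
  factor : ∀ x y, TP x y = ∑ μ, ∑ ν, g μ ν * (e μ x * e ν y)
  even : ∀ u x, e u x ≠ 0 → par x = pK u
  intertwine : ∀ u z, ∑ y, J' y u * e y z = ∑ w, J z w * e u w

variable {W : Coef k} {par : K → ZMod 2} {m : K → K → K → k} {t T TP : K → K → k}
    {J : K → K → k} {pK : K' → ZMod 2} {g J' : K' → K' → k} {e : K' → K → k}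

theorem coefDual_wordTotal (h : IsMasterData par W.c m t T TP J pK g J' e) (V E n : ℕ)
    (σ : Perm (Fin n)) (v : Fin n → K') :
    coefDual W pK J' (wordTotal W par m t e V E) n σ v =
      -∑ i, (sgn (∑ l ∈ univ.filter (· < i), pK (v l)) : k) •
        total W par m (fun _ : Fin E => t) V n σ
          (update (fun x => e (v x)) i fun z => ∑ w, J z w * e (v i) w) := by
  unfold coefDual
  congr 1
  refine sum_congr rfl fun i _ => ?_
  have h1 : (fun z => ∑ w, J z w * e (v i) w) = fun z => ∑ y, J' y (v i) * e y z :=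
    funext fun z => (h.intertwine _ z).symm
  rw [h1, total_update_leg_sum, smul_sum]
  refine sum_congr rfl fun y _ => ?_
  rw [smul_smul]
  congr 1
  unfold wordTotal
  congr 1
  funext x
  by_cases hx : x = i
  · subst hx; simp
  · simp [update_of_ne hx]

theorem coefDual_succ [CharZero k] (h : IsMasterData par W.c m t T TP J pK g J' e) (V E n : ℕ)
    (σ : Perm (Fin n)) (v : Fin n → K') :
    coefDual W pK J' (wordTotal W par m t e V (E + 1)) n σ v = -((E + 1 : ℕ) : k) •
      total W par m (update (fun _ => t) (last E) TP) V n σ (fun x => e (v x)) := by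
  have hD : ∀ x y, (sgn W.c : k) * (T x y - TP x y) ≠ 0 → par x + par y = W.c + 1 := by
    intro x y hne
    by_cases hT : T x y = 0
    · refine h.parity' x y fun hTP => hne ?_
      rw [hT, hTP]; simp
    · exact h.parity x y hT
  rw [coefDual_wordTotal h, sum_total_update_leg (a := fun x => e (v x)) (pv := fun x => pK (v x))
    h.odd h.invariant h.variation h.edge.parity hD (fun x => h.even _), total_last_sub,
    total_associative h.parity h.cyclic h.assoc, zero_sub, smul_neg, smul_neg, neg_smul, neg_neg,
    smul_smul, neg_smul, mul_assoc, sgn_mul_self_cast, mul_one]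

theorem coefDual_zero (h : IsMasterData par W.c m t T TP J pK g J' e) (V n : ℕ)
    (σ : Perm (Fin n)) (v : Fin n → K') :
    coefDual W pK J' (wordTotal W par m t e V 0) n σ v = 0 := by
  rw [coefDual_wordTotal h, neg_eq_zero]
  unfold total
  simp only [smul_sum]
  rw [sum_comm]
  refine sum_eq_zero fun β _ => ?_
  by_cases hA : Adm (.refl _) β σ
  · simp only [if_pos hA]
    unfold weight
    simp only [smul_smul]
    rw [← sum_smul]
    have := sum_contr_insertion (α := Equiv.refl (Flags V)) (β := β) (a := fun x => e (v x))
      (pv := fun x => pK (v x)) h.odd h.invariant h.variation h.edge.parity (fun x => h.even _)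
    simp [sgn_zero] at this
    rw [this, zero_smul]
  · simp [if_neg hA]

end Master

section MasterEquation

variable {k : Type u} [Field k] {K : Type*} [Fintype K] {K' : Type*} [Fintype K']
  {W : Coef k} {par : K → ZMod 2} {m : K → K → K → k} {t T TP : K → K → k}
    {J : K → K → k} {pK : K' → ZMod 2} {g J' : K' → K' → k} {e : K' → K → k}

theorem sum_coefBracketAt_numbering [CharZero k] (V E n : ℕ) (σ : Perm (Fin n)) (v : Fin n → K')
    (X : Finset (Fin n)) : (numbering k V E)⁻¹ • ∑ S : Finset (Fin V) × Finset (Fin E),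
        coefBracketAt W pK g (wordTotal W par m t e S.1.card S.2.card)
          (wordTotal W par m t e S.1ᶜ.card S.2ᶜ.card) n σ v X =
      ∑ p ∈ antidiagonal V, ∑ q ∈ antidiagonal E,
        coefBracketAt W pK g (solution W par m t e p.1 q.1) (solution W par m t e p.2 q.2) n σ v X := by
  rw [sum_prod_type]
  dsimp only
  rw [sum_congr rfl fun S _ => sum_finset_card_compl E fun i j =>
    coefBracketAt W pK g (wordTotal W par m t e S.card i) (wordTotal W par m t e Sᶜ.card j) n σ v X,
    sum_finset_card_compl V fun i j => ∑ q ∈ antidiagonal E, E.choose q.1 •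
      coefBracketAt W pK g (wordTotal W par m t e i q.1) (wordTotal W par m t e j q.2) n σ v X,
    smul_sum]
  refine sum_congr rfl fun p hp => ?_
  rw [smul_sum, smul_sum]
  refine sum_congr rfl fun q hq => ?_
  have h1 : coefBracketAt W pK g (solution W par m t e p.1 q.1) (solution W par m t e p.2 q.2) n σ v X =
      ((numbering k p.1 q.1)⁻¹ * (numbering k p.2 q.2)⁻¹) • coefBracketAt W pK g
        (wordTotal W par m t e p.1 q.1) (wordTotal W par m t e p.2 q.2) n σ v X :=
    coefBracketAt_smul _ _ X
  rw [h1, ← choose_mul_numbering (mem_antidiagonal.mp hp) (mem_antidiagonal.mp hq),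
    ← Nat.cast_smul_eq_nsmul k, ← Nat.cast_smul_eq_nsmul k, smul_smul, smul_smul]
  congr 1
  ring

theorem coefDual_solution [CharZero k] (h : IsMasterData par W.c m t T TP J pK g J' e) (V E n : ℕ)
    (σ : Perm (Fin n)) (v : Fin n → K') :
    coefDual W pK J' (solution W par m t e V (E + 1)) n σ v = -(1 / 2 : k) •
      (coefBv W g (solution W par m t e V E) n σ v + ∑ X : Finset (Fin n),
        ∑ p ∈ antidiagonal V, ∑ q ∈ antidiagonal E,
          coefBracketAt W pK g (solution W par m t e p.1 q.1) (solution W par m t e p.2 q.2) n σ v X) := by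
  have h1 : coefDual W pK J' (solution W par m t e V (E + 1)) n σ v =
      (numbering k V (E + 1))⁻¹ • coefDual W pK J' (wordTotal W par m t e V (E + 1)) n σ v :=
    coefDual_smul pK J' _
  have h2 : coefBv W g (solution W par m t e V E) n σ v =
      (numbering k V E)⁻¹ • coefBv W g (wordTotal W par m t e V E) n σ v := coefBv_smul _
  rw [h1, coefDual_succ h, total_last h.cyclic h.edge h.even h.factor, h2, sum_comm]
  simp only [← sum_coefBracketAt_numbering]
  rw [← smul_sum, ← smul_add, smul_smul, smul_smul]
  congr 1
  have n1 := numbering_ne_zero (k := k) V E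
  have n2 : ((E + 1 : ℕ) : k) ≠ 0 := Nat.cast_ne_zero.mpr (Nat.succ_ne_zero E)
  rw [numbering_succ]
  field_simp

/-- The numbers of vertices and edges of a connected trivalent graph with `n` legs and
`1 - χ = c`. -/
def solutionOfOrder (W : Coef k) (par : K → ZMod 2) (m : K → K → K → k) (t : K → K → k)
    (e : K' → K → k) (c n : ℕ) (σ : Perm (Fin n)) (v : Fin n → K') : W.C (Fin n) :=
  solution W par m t e (n + 2 * c - 2) (n + 3 * c - 3) n σ v

theorem solution_ne_zero {V E n : ℕ} {σ : Perm (Fin n)} {v : Fin n → K'}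
    (h : solution W par m t e V E n σ v ≠ 0) : 3 * V = 2 * E + n ∧ 0 < V ∧ V ≤ E + 1 :=
  wordTotal_ne_zero fun h0 => h (by rw [solution, h0, smul_zero])

theorem sum_antidiagonal_order {n c V E : ℕ} (hV : V = n + 2 * c - 2) (hE : E + 1 = n + 3 * c - 3)
    (σ : Perm (Fin n)) (v : Fin n → K') (X : Finset (Fin n)) :
    ∑ p ∈ antidiagonal V, ∑ q ∈ antidiagonal E,
        coefBracketAt W pK g (solution W par m t e p.1 q.1) (solution W par m t e p.2 q.2) n σ v X =
      ∑ ab ∈ antidiagonal c, coefBracketAt W pK g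
        (solutionOfOrder W par m t e ab.1) (solutionOfOrder W par m t e ab.2) n σ v X := by
  have hX : X.card + Xᶜ.card = n := by
    have := X.card_add_card_compl
    rwa [card_fin] at this
  have key : ∀ {V1 V2 E1 E2 : ℕ}, coefBracketAt W pK g (solution W par m t e V1 E1)
      (solution W par m t e V2 E2) n σ v X ≠ 0 →
      (3 * V1 = 2 * E1 + (X.card + 1) ∧ 0 < V1 ∧ V1 ≤ E1 + 1) ∧
      (3 * V2 = 2 * E2 + (Xᶜ.card + 1) ∧ 0 < V2 ∧ V2 ≤ E2 + 1) := by
    intro V1 V2 E1 E2 h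
    obtain ⟨⟨σ1, v₁, h1⟩, σ2, v₂, h2⟩ := coefBracketAt_ne_zero h
    exact ⟨solution_ne_zero h1, solution_ne_zero h2⟩
  rw [← Finset.sum_product']
  refine Finset.sum_bij_ne_zero (fun x _ _ => (x.2.1 + 1 - x.1.1, x.2.2 + 1 - x.1.2)) ?_ ?_ ?_ ?_
  · rintro ⟨⟨V1, V2⟩, E1, E2⟩ hx hne
    have := key hne
    simp only [Finset.mem_product, mem_antidiagonal] at hx ⊢
    dsimp only at this
    omega
  · rintro ⟨⟨V1, V2⟩, E1, E2⟩ hx hne ⟨⟨V1', V2'⟩, E1', E2'⟩ hx' hne' heq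
    have h1 := key hne
    have h2 := key hne'
    simp only [Prod.mk.injEq] at heq ⊢
    dsimp only at h1 h2
    omega
  · rintro ⟨a, b⟩ hab hne
    have h0 : coefBracketAt W pK g
        (solution W par m t e (X.card + 1 + 2 * a - 2) (X.card + 1 + 3 * a - 3))
        (solution W par m t e (Xᶜ.card + 1 + 2 * b - 2) (Xᶜ.card + 1 + 3 * b - 3)) n σ v X ≠ 0 := by
      exact fun h0 => hne h0
    have h1 := key h0
    rw [mem_antidiagonal] at hab
    dsimp only at hab
    refine ⟨((X.card + 1 + 2 * a - 2, Xᶜ.card + 1 + 2 * b - 2),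
      (X.card + 1 + 3 * a - 3, Xᶜ.card + 1 + 3 * b - 3)), ?_, h0, ?_⟩
    · simp only [Finset.mem_product, mem_antidiagonal]
      omega
    · simp only [Prod.mk.injEq]
      omega
  · rintro ⟨⟨V1, V2⟩, E1, E2⟩ hx hne
    have h1 := key hne
    dsimp only at h1 ⊢
    refine coefBracketAt_congr (fun σ v => ?_) fun σ v => ?_
    · unfold solutionOfOrder
      congr 1 <;> omega
    · unfold solutionOfOrder
      congr 1 <;> omega

/-- The sum over graphs solves the master equation. -/
theorem master_equation [CharZero k] (h : IsMasterData par W.c m t T TP J pK g J' e) (c n : ℕ)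
    (σ : Perm (Fin n)) (v : Fin n → K') :
    masterExpression W pK g J' (solutionOfOrder W par m t e) c n σ v = 0 := by
  unfold masterExpression
  have hd : coefDual W pK J' (solutionOfOrder W par m t e c) n σ v =
      coefDual W pK J' (solution W par m t e (n + 2 * c - 2) (n + 3 * c - 3)) n σ v := rfl
  rw [sum_comm]
  rcases Nat.eq_zero_or_pos (n + 3 * c - 3) with h0 | h0
  · have hd0 : coefDual W pK J' (solution W par m t e (n + 2 * c - 2) 0) n σ v = 0 := by
      have h1 : coefDual W pK J' (solution W par m t e (n + 2 * c - 2) 0) n σ v =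
        (numbering k (n + 2 * c - 2) 0)⁻¹ • coefDual W pK J'
          (wordTotal W par m t e (n + 2 * c - 2) 0) n σ v := coefDual_smul pK J' _
      rw [h1, coefDual_zero h, smul_zero]
    rw [hd, h0, hd0, add_zero]
    have hb : ∑ X : Finset (Fin n), ∑ ab ∈ antidiagonal c,
        coefBracketAt W pK g (solutionOfOrder W par m t e ab.1) (solutionOfOrder W par m t e ab.2)
          n σ v X = 0 := by
      refine sum_eq_zero fun X _ => sum_eq_zero fun ab hab => ?_
      by_contra hne
      obtain ⟨⟨σ1, v₁, h1⟩, σ2, v₂, h2⟩ := coefBracketAt_ne_zero hne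
      have e1 := solution_ne_zero h1
      have e2 := solution_ne_zero h2
      have hX : X.card + Xᶜ.card = n := by
        have := X.card_add_card_compl
        rwa [card_fin] at this
      rw [mem_antidiagonal] at hab
      omega
    rw [hb, smul_zero, add_zero]
    rcases c with _ | c
    · rfl
    · dsimp only
      rw [coefBv_eq_zero, smul_zero]
      intro σ v
      by_contra hne
      have := solution_ne_zero hne
      omega
  · obtain ⟨E, hE⟩ : ∃ E, n + 3 * c - 3 = E + 1 := ⟨n + 3 * c - 3 - 1, by omega⟩
    rw [hd, hE, coefDual_solution h]
    simp only [sum_antidiagonal_order rfl hE.symm]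
    refine (congrArg₂ (· + ·) (congrArg₂ (· + ·) (?_ : _ = (1 / 2 : k) •
      coefBv W g (solution W par m t e (n + 2 * c - 2) E) n σ v) rfl) rfl).trans ?_
    · rcases c with _ | c
      · dsimp only
        rw [coefBv_eq_zero, smul_zero]
        intro σ v
        by_contra hne
        have := solution_ne_zero hne
        omega
      · dsimp only
        congr 1
        refine coefBv_congr fun σ v => ?_
        unfold solutionOfOrder
        congr 1
        · omega
        · omega
    · rw [neg_smul, smul_add, add_neg_cancel]

end MasterEquation

/-! ### Symmetry of the sum over graphs -/

section Symmetry

variable {k : Type u} [Field k] {K : Type*} [Fintype K] {K' : Type*} [Fintype K']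
  {W : Coef k} {par : K → ZMod 2} {m : K → K → K → k} {t : K → K → k} {pK : K' → ZMod 2}
  {e : K' → K → k} {V E n : ℕ}

theorem wordTotal_mem_line (σ : Perm (Fin n)) (v : Fin n → K') :
    wordTotal W par m t e V E n σ v ∈ W.line σ := by
  classical
  refine Submodule.sum_mem _ fun β _ => ?_
  split_ifs with hA
  · exact smul_mem _ _ (W.res_mem_line hA.2 (legOf_injective β) (orient_mem_line _ β))
  · exact Submodule.zero_mem _

theorem wordTotal_even (hm : IsCyclicTensor par W.c m) (ht : IsEdgeTensor par W.c t)
    (he : ∀ u x, e u x ≠ 0 → par x = pK u) {σ : Perm (Fin n)} {v : Fin n → K'}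
    (h : wordTotal W par m t e V E n σ v ≠ 0) : ∑ i, pK (v i) = W.c * numCycles σ := by
  classical
  unfold wordTotal total at h
  obtain ⟨β, _, hβ⟩ := Finset.exists_ne_zero_of_sum_ne_zero h
  by_cases hA : Adm (.refl (Flags V)) β σ
  · rw [if_pos hA, weight] at hβ
    have hc : contr par m (fun _ => t) (Equiv.refl (Flags V)) β (fun x => e (v x)) ≠ 0 :=
      fun h0 => hβ (by rw [h0, zero_smul])
    obtain ⟨φ, _, hφ⟩ := Finset.exists_ne_zero_of_sum_ne_zero hc
    rw [sum_par_legs (pa := fun i => pK (v i)) hm ht (fun x => he _) hφ,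
      hA.2.numCycles_eq (legOf_injective β), numCycles_boundary]
  · exact absurd (if_neg hA) hβ

/-- Renumbering of the legs. -/
def legPerm (E : ℕ) (τ : Perm (Fin n)) : Perm (Ends E n) := Equiv.sumCongr (.refl _) τ.symm

theorem legOf_legPerm {Y : Type} (τ : Perm (Fin n)) (β : Ends E n ≃ Y) :
    legOf ((legPerm E τ).trans β) = legOf β ∘ τ.symm := rfl

theorem invOf_legPerm {Y : Type} (τ : Perm (Fin n)) (β : Ends E n ≃ Y) :
    invOf ((legPerm E τ).trans β) = invOf β := by
  refine Equiv.ext fun y => ?_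
  obtain ⟨⟨i, b⟩ | x, rfl⟩ := ((legPerm E τ).trans β).surjective y
  · rw [invOf_inl]
    exact (invOf_inl β i b).symm
  · rw [invOf_inr]
    exact (invOf_inr β (τ.symm x)).symm

theorem adm_legPerm {Y : Type} [Finite Y] (τ σ : Perm (Fin n)) (α : Flags V ≃ Y) (β : Ends E n ≃ Y) :
    Adm α ((legPerm E τ).trans β) (τ * σ * τ⁻¹) ↔ Adm α β σ := by
  unfold Adm
  rw [invOf_legPerm, legOf_legPerm]
  refine and_congr_right fun _ => ?_
  have h1 : Induces σ τ.symm (τ * σ * τ⁻¹) := by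
    convert induces_equiv σ τ.symm using 1
    ext; simp [permCongr_apply]
  have h2 : Induces (τ * σ * τ⁻¹) τ σ := by
    convert induces_equiv (τ * σ * τ⁻¹) τ using 1
    ext; simp [permCongr_apply]
  constructor
  · intro h
    have := h.trans h2 ((legOf_injective β).comp τ.symm.injective)
    have e : (legOf β ∘ τ.symm) ∘ τ = legOf β := by ext; simp
    rwa [e] at this
  · intro h
    exact h.trans h1 (legOf_injective β)

theorem term_legPerm {Y : Type} [Fintype Y] {a : Fin n → K → k} {pa : Fin n → ZMod 2}
    (ha : ∀ x y, a x y ≠ 0 → par y = pa x) (τ : Perm (Fin n)) (α : Flags V ≃ Y) (β : Ends E n ≃ Y)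
    (φ : Y → K) : term par m (fun _ => t) α ((legPerm E τ).trans β) (a ∘ τ.symm) φ =
      (koszulSign pa (fun i => (i : ℕ)) (fun i => (τ i : ℕ)) : k) *
        term par m (fun _ => t) α β a φ := by
  unfold term
  have hl : ∏ x, (a ∘ τ.symm) x (φ (((legPerm E τ).trans β) (.inr x))) =
      ∏ x, a x (φ (β (.inr x))) := by
    rw [← τ.symm.prod_comp fun x => a x (φ (β (.inr x)))]
    rfl
  have hi : ∀ i b, ((legPerm E τ).trans β) (.inl (i, b)) = β (.inl (i, b)) := fun _ _ => rfl
  rw [hl]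
  simp only [hi]
  by_cases h0 : ∏ x, a x (φ (β (.inr x))) = 0
  · rw [h0]; ring
  replace h0 := prod_ne_zero_iff.mp h0
  have hs : koszulSign (par ∘ φ) (endRank ∘ ((legPerm E τ).trans β).symm) (flagRank ∘ α.symm) =
      koszulSign pa (fun i => (i : ℕ)) (fun i => (τ i : ℕ)) *
      koszulSign (par ∘ φ) (endRank ∘ β.symm) (flagRank ∘ α.symm) := by
    rw [← koszulSign_mul (par ∘ φ) (endRank_injective.comp (Equiv.injective _))
      (endRank_injective.comp β.symm.injective) (flagRank_injective.comp α.symm.injective)]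
    congr 1
    rw [← koszulSign_comp_equiv β, koszulSign_comm]
    have e1 : (endRank ∘ β.symm) ∘ β = endRank := by ext; simp
    have e2 : (endRank ∘ ((legPerm E τ).trans β).symm) ∘ β = endRank ∘ (legPerm E τ).symm := by
      ext; simp
    rw [e1, e2, koszulSign_window (z := Sum.inr) inr_injective]
    · have hp : ((par ∘ φ) ∘ β) ∘ Sum.inr = pa := funext fun x => ha _ _ (h0 x (mem_univ _))
      rw [hp]
      refine koszulSign_congr ?_ ?_ <;> intro x y <;> simp [endRank, legPerm]
    · rintro (⟨a, b⟩ | a) (⟨c, d⟩ | c) h <;> simp [endRank, legPerm] at h ⊢ <;> omega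
  rw [hs]
  push_cast
  ring

theorem weight_legPerm {Y : Type} [Fintype Y] [DecidableEq Y] {a : Fin n → K → k}
    {pa : Fin n → ZMod 2} (ha : ∀ x y, a x y ≠ 0 → par y = pa x) (τ : Perm (Fin n))
    (α : Flags V ≃ Y) (β : Ends E n ≃ Y) :
    weight W par m (fun _ => t) α ((legPerm E τ).trans β) (a ∘ τ.symm) =
      (koszulSign pa (fun i => (i : ℕ)) (fun i => (τ i : ℕ)) : k) •
        W.res τ.symm (weight W par m (fun _ => t) α β a) := by
  unfold weight contr
  simp only [term_legPerm ha]
  rw [← mul_sum, map_smul, smul_smul, W.res_res]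
  rfl

theorem wordTotal_equivariant (he : ∀ u x, e u x ≠ 0 → par x = pK u) (σ τ : Perm (Fin n))
    (v : Fin n → K') : wordTotal W par m t e V E n (τ * σ * τ⁻¹) (v ∘ τ.symm) =
      (koszulSign (pK ∘ v) (fun i => (i : ℕ)) (fun i => (τ i : ℕ)) : k) •
        W.res τ.symm (wordTotal W par m t e V E n σ v) := by
  unfold wordTotal total
  rw [map_sum, smul_sum, ← (Equiv.equivCongr (legPerm E τ).symm (Equiv.refl (Flags V))).sum_comp]
  refine sum_congr rfl fun β _ => ?_
  have hβ : (Equiv.equivCongr (legPerm E τ).symm (Equiv.refl (Flags V))) β =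
      (legPerm E τ).trans β := rfl
  rw [hβ]
  by_cases hA : Adm (.refl _) β σ
  · rw [if_pos ((adm_legPerm ..).mpr hA), if_pos hA]
    exact weight_legPerm (a := fun x => e (v x)) (fun x => he _) τ _ β
  · rw [if_neg (fun h => hA ((adm_legPerm ..).mp h)), if_neg hA]
    simp

end Symmetry

/-! ### Presentations of ribbon graphs -/

theorem finset_filter_finRange {N : ℕ} (s : Finset (Fin N)) :
    (List.finRange N).filter (fun f => f ∈ s) = ofFn (s.orderEmbOfFin rfl) := by
  have h1 : ((List.finRange N).filter (fun f => f ∈ s)).toFinset = s := by ext; simp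
  have h2 : s.sort = (List.finRange N).filter (fun f => f ∈ s) := by
    conv_lhs => rw [← h1]
    rw [List.toFinset_sort _ ((List.nodup_finRange N).filter _)]
    exact List.Pairwise.filter _ ((List.pairwise_lt_finRange N).imp le_of_lt)
  rw [← h2, List.ofFn_eq_map, Finset.listMap_orderEmbOfFin_finRange]

theorem prod_orderEmbOfFin {N : ℕ} {M : Type*} [CommMonoid M] (s : Finset (Fin N)) (f : Fin N → M) :
    ∏ x ∈ s, f x = ∏ i, f (s.orderEmbOfFin rfl i) := by
  conv_lhs => rw [← Finset.map_orderEmbOfFin_univ s rfl]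
  rw [Finset.prod_map]
  rfl

namespace RibbonGraph

variable {N n : ℕ} (Γ : RibbonGraph N n)

theorem rot_rot_ne (f : Fin N) : Γ.rot (Γ.rot f) ≠ f := fun h =>
  Γ.rot_ne f (by conv_lhs => rw [← h, Γ.rot_rot_rot])

theorem mem_vertexFlags {f : Fin N} : f ∈ Γ.vertexFlags ↔ Γ.vertexOf f = f := by
  simp [vertexFlags, vertexOf]

theorem vertexOf_rot (f : Fin N) : Γ.vertexOf (Γ.rot f) = Γ.vertexOf f := by
  unfold vertexOf
  rw [Γ.rot_rot_rot, ← min_assoc, min_comm]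

theorem vertexOf_cases (f : Fin N) :
    Γ.vertexOf f = f ∨ Γ.vertexOf f = Γ.rot f ∨ Γ.vertexOf f = Γ.rot (Γ.rot f) := by
  unfold vertexOf
  rcases min_choice f (min (Γ.rot f) (Γ.rot (Γ.rot f))) with h | h
  · exact .inl h
  · rw [h]
    exact .inr (min_choice _ _)

theorem vertexOf_mem (f : Fin N) : Γ.vertexOf f ∈ Γ.vertexFlags := by
  rw [mem_vertexFlags]
  rcases Γ.vertexOf_cases f with h | h | h <;> rw [h] <;> simp only [vertexOf_rot, h]

/-- The first flag of the `i`-th vertex. -/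
def vertexFlag (i : Fin Γ.vertexFlags.card) : Fin N := Γ.vertexFlags.orderEmbOfFin rfl i

theorem vertexOf_vertexFlag (i) : Γ.vertexOf (Γ.vertexFlag i) = Γ.vertexFlag i :=
  Γ.mem_vertexFlags.mp (orderEmbOfFin_mem _ _ _)

/-- The flags, listed vertex by vertex. -/
def flagsFun (x : Flags Γ.vertexFlags.card) : Fin N :=
  ![Γ.vertexFlag x.1, Γ.rot (Γ.vertexFlag x.1), Γ.rot (Γ.rot (Γ.vertexFlag x.1))] x.2

theorem vertexOf_flagsFun (x) : Γ.vertexOf (Γ.flagsFun x) = Γ.vertexFlag x.1 := by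
  obtain ⟨i, b⟩ := x
  fin_cases b <;> simp [flagsFun, vertexOf_rot, vertexOf_vertexFlag]

theorem vertexRank_flagsFun (x) : Γ.vertexRank (Γ.flagsFun x) = 3 * Γ.vertexFlag x.1 + x.2 := by
  unfold vertexRank
  rw [vertexOf_flagsFun]
  obtain ⟨i, b⟩ := x
  fin_cases b <;> simp [flagsFun, Γ.rot_ne, Γ.rot_rot_ne]

theorem flagsFun_bijective : Function.Bijective Γ.flagsFun := by
  constructor
  · intro x y h
    have h1 := congrArg Γ.vertexRank h
    have h2 : Γ.vertexFlag x.1 = Γ.vertexFlag y.1 := by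
      rw [← vertexOf_flagsFun, ← vertexOf_flagsFun, h]
    rw [vertexRank_flagsFun, vertexRank_flagsFun, h2] at h1
    refine Prod.ext ((Γ.vertexFlags.orderEmbOfFin rfl).injective h2) (Fin.ext ?_)
    omega
  · intro f
    obtain ⟨i, hi⟩ : ∃ i, Γ.vertexFlag i = Γ.vertexOf f := by
      have := Γ.vertexOf_mem f
      rw [← mem_coe, ← Finset.range_orderEmbOfFin _ rfl] at this
      exact this
    rcases Γ.vertexOf_cases f with h | h | h
    · exact ⟨(i, 0), by simp [flagsFun, hi, h]⟩
    · exact ⟨(i, 2), by simp [flagsFun, hi, h, Γ.rot_rot_rot]⟩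
    · exact ⟨(i, 1), by simp [flagsFun, hi, h, Γ.rot_rot_rot]⟩

def vertexEquiv : Flags Γ.vertexFlags.card ≃ Fin N := ofBijective _ Γ.flagsFun_bijective

theorem rotOf_vertexEquiv : rotOf Γ.vertexEquiv = Γ.rot := by
  refine Equiv.ext fun y => ?_
  obtain ⟨⟨i, b⟩, rfl⟩ := Γ.vertexEquiv.surjective y
  rw [rotOf_apply]
  change Γ.flagsFun _ = Γ.rot (Γ.flagsFun _)
  fin_cases b <;> simp [flagsFun, Γ.rot_rot_rot]

/-- The first flag of the `i`-th edge. -/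
def edgeFlag (i : Fin Γ.edgeFlags.card) : Fin N := Γ.edgeFlags.orderEmbOfFin rfl i

theorem edgeFlag_lt (i) : Γ.edgeFlag i < Γ.inv (Γ.edgeFlag i) :=
  (mem_filter.mp (orderEmbOfFin_mem Γ.edgeFlags rfl i)).2

/-- The flags, listed edge by edge, followed by the legs. -/
def endsFun : Ends Γ.edgeFlags.card n → Fin N :=
  Sum.elim (fun x => ![Γ.edgeFlag x.1, Γ.inv (Γ.edgeFlag x.1)] x.2) Γ.leg

theorem inv_leg (x) : Γ.inv (Γ.leg x) = Γ.leg x := (Γ.isLeg_iff _).mp ⟨x, rfl⟩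

theorem edgeRank_endsFun (x) : Γ.edgeRank (Γ.endsFun x) =
    Sum.elim (fun y : Fin _ × Fin 2 => 2 * (Γ.edgeFlag y.1 : ℕ) + (y.2 : ℕ)) (fun y : Fin n => 2 * N + (y : ℕ)) x := by
  unfold edgeRank
  rcases x with ⟨i, b⟩ | x
  · have h := Γ.edgeFlag_lt i
    fin_cases b
    · simp [endsFun, h.ne', h, min_eq_left h.le]
    · simp [endsFun, Γ.inv_inv, h.ne, not_lt.mpr h.le, min_eq_right h.le]
  · simp [endsFun, Γ.inv_leg, Γ.leg_injective.eq_iff, Finset.filter_eq']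

theorem edgeRank_lt_iff (x y) : Γ.edgeRank (Γ.endsFun x) < Γ.edgeRank (Γ.endsFun y) ↔
    endRank x < endRank y := by
  rw [edgeRank_endsFun, edgeRank_endsFun]
  have hm : ∀ i j, Γ.edgeFlag i < Γ.edgeFlag j ↔ i < j := fun i j =>
    (Γ.edgeFlags.orderEmbOfFin rfl).lt_iff_lt
  rcases x with ⟨i, b⟩ | x <;> rcases y with ⟨j, b'⟩ | y <;> simp only [elim_inl, elim_inr, endRank]
  · rcases lt_trichotomy i j with h | rfl | h
    · have := (hm _ _).mpr h
      simp only [lt_def] at this h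
      omega
    · omega
    · have := (hm _ _).mpr h
      simp only [lt_def] at this h
      omega
  · have := (Γ.edgeFlag i).2
    omega
  · have := (Γ.edgeFlag j).2
    omega
  · omega

theorem endsFun_bijective : Function.Bijective Γ.endsFun := by
  constructor
  · intro x y h
    have h1 := Γ.edgeRank_lt_iff x y
    have h2 := Γ.edgeRank_lt_iff y x
    rw [h] at h1 h2
    apply endRank_injective
    omega
  · intro f
    have mem : ∀ g, g < Γ.inv g → ∃ i, Γ.edgeFlag i = g := fun g hg => by
      have : g ∈ (Γ.edgeFlags : Set (Fin N)) := by simpa [edgeFlags] using hg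
      rwa [← Finset.range_orderEmbOfFin _ rfl] at this
    rcases lt_trichotomy f (Γ.inv f) with h | h | h
    · obtain ⟨i, rfl⟩ := mem f h
      exact ⟨.inl (i, 0), rfl⟩
    · obtain ⟨x, rfl⟩ := (Γ.isLeg_iff f).mpr h.symm
      exact ⟨.inr x, rfl⟩
    · obtain ⟨i, hi⟩ := mem (Γ.inv f) (by rwa [Γ.inv_inv])
      exact ⟨.inl (i, 1), by simp [endsFun, hi, Γ.inv_inv]⟩

def endsEquiv : Ends Γ.edgeFlags.card n ≃ Fin N := ofBijective _ Γ.endsFun_bijective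

theorem legOf_endsEquiv : legOf Γ.endsEquiv = Γ.leg := rfl

theorem invOf_endsEquiv : invOf Γ.endsEquiv = Γ.inv := by
  refine Equiv.ext fun y => ?_
  obtain ⟨⟨i, b⟩ | x, rfl⟩ := Γ.endsEquiv.surjective y
  · rw [invOf_inl]
    change Γ.endsFun (.inl (i, b + 1)) = Γ.inv (Γ.endsFun (.inl (i, b)))
    fin_cases b <;> simp [endsFun, Γ.inv_inv]
  · rw [invOf_inr]
    exact (Γ.inv_leg x).symm

theorem conn : Conn Γ.rot Γ.inv := ⟨⟨⟨0, Γ.nonempty⟩⟩, Γ.connected⟩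

theorem contraction_eq {k : Type*} [Field k] {ι : Type*} [Fintype ι] (par : ι ⊕ ι → ZMod 2)
    (m : ι ⊕ ι → ι ⊕ ι → ι ⊕ ι → k) (t : ι ⊕ ι → ι ⊕ ι → k) (a : Fin n → ι ⊕ ι → k) :
    Γ.contraction par m t a = ∑ φ with Sum.isRight ∘ φ = Γ.out,
      term par m (fun _ => t) Γ.vertexEquiv Γ.endsEquiv a φ := by
  unfold contraction
  refine sum_congr (by ext; simp [funext_iff]) fun φ _ => ?_
  unfold term
  rw [prod_orderEmbOfFin Γ.vertexFlags, prod_orderEmbOfFin Γ.edgeFlags]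
  have h : koszulSign (par ∘ φ) Γ.edgeRank Γ.vertexRank =
      koszulSign (par ∘ φ) (endRank ∘ Γ.endsEquiv.symm) (flagRank ∘ Γ.vertexEquiv.symm) := by
    refine koszulSign_congr ?_ ?_
    · intro x y
      obtain ⟨x, rfl⟩ := Γ.endsEquiv.surjective x
      obtain ⟨y, rfl⟩ := Γ.endsEquiv.surjective y
      simp only [comp_apply, symm_apply_apply]
      exact Γ.edgeRank_lt_iff x y
    · intro x y
      obtain ⟨x, rfl⟩ := Γ.vertexEquiv.surjective x
      obtain ⟨y, rfl⟩ := Γ.vertexEquiv.surjective y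
      have hm : ∀ i j, Γ.vertexFlag i < Γ.vertexFlag j ↔ i < j := fun i j =>
        (Γ.vertexFlags.orderEmbOfFin rfl).lt_iff_lt
      change Γ.vertexRank (Γ.flagsFun x) < Γ.vertexRank (Γ.flagsFun y) ↔ _
      rw [vertexRank_flagsFun, vertexRank_flagsFun]
      simp only [comp_apply, symm_apply_apply, flagRank]
      have hx := hm x.1 y.1
      have hy := hm y.1 x.1
      simp only [lt_def] at hx hy
      omega
  rw [h]
  rfl

theorem orientation_eq (k : Type u) [Field k] :
    Γ.orientation k = orient (exteriorCoef k) Γ.vertexEquiv Γ.endsEquiv := by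
  unfold orientation orient glueList vertProd edgeList
  rw [finset_filter_finRange, finset_filter_finRange, rotOf_vertexEquiv, map_ofFn,
    ← List.foldl_map (f := fun f => (f, Γ.inv f))
      (g := fun (s : Perm (Fin N) × ExteriorAlgebra k (Fin N → k)) p =>
        (swap p.1 p.2 * s.1, glueCycles s.1 p.1 p.2 s.2)), map_ofFn]
  rfl

end RibbonGraph

/-! ### Oriented graphs -/

theorem orient_scalarCoef (k : Type u) [Field k] {Y : Type} [DecidableEq Y] {V E n : ℕ}
    (α : Flags V ≃ Y) (β : Ends E n ≃ Y) : orient (scalarCoef k) α β = (1 : (scalarCoef k).C Y) := by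
  have key : ∀ (L : List (Y × Y)) (s : Perm Y × (scalarCoef k).C Y), (glueList (scalarCoef k) L s).2 = s.2 := by
    intro L
    induction L with
    | nil => intro s; rfl
    | cons p L ih => intro s; rw [glueList_cons, ih]; rfl
  unfold orient
  rw [key]
  refine List.prod_eq_one fun x hx => ?_
  obtain ⟨i, rfl⟩ := (mem_ofFn' _ _).mp hx
  rfl

/-- Every vertex has exactly one exit, and every edge is oriented. -/
def IsOriented {Y : Type} (ρ i : Perm Y) (o : Y → Bool) : Prop :=
  (∀ f, ∃! g, ρ.SameCycle f g ∧ o g = true) ∧ ∀ f, i f ≠ f → o (i f) = !o f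

theorem IsOriented.permCongr {Y Z : Type} {ρ i : Perm Y} {o : Y → Bool} (h : IsOriented ρ i o)
    (e : Y ≃ Z) : IsOriented (e.permCongr ρ) (e.permCongr i) (o ∘ e.symm) := by
  have hs : ∀ x y, (e.permCongr ρ).SameCycle x y ↔ ρ.SameCycle (e.symm x) (e.symm y) := by
    intro x y
    have : ∀ z : ℤ, (e.permCongr ρ) ^ z = e.permCongr (ρ ^ z) := fun z =>
      (map_zpow e.permCongrHom ρ z).symm
    simp [Perm.SameCycle, this, permCongr_apply, ← Equiv.eq_symm_apply]
  refine ⟨fun f => ?_, fun f hf => ?_⟩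
  · obtain ⟨g, hg, hu⟩ := h.1 (e.symm f)
    refine ⟨e g, by simpa [hs] using hg, fun g' hg' => ?_⟩
    rw [← e.symm_apply_eq]
    exact hu _ (by simpa [hs] using hg')
  · have := h.2 (e.symm f) (by simpa [permCongr_apply, ← Equiv.eq_symm_apply] using hf)
    simpa [permCongr_apply] using this

/-- Tensors joining one exit with two entries, and one exit with one entry. -/
structure IsColoured {k : Type u} [Field k] {ι : Type*} (m : ι ⊕ ι → ι ⊕ ι → ι ⊕ ι → k)
    (t : ι ⊕ ι → ι ⊕ ι → k) : Prop where
  vertex : ∀ x y z, m x y z ≠ 0 → [x.isRight, y.isRight, z.isRight] ∈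
    [[true, false, false], [false, true, false], [false, false, true]]
  edge : ∀ x y, t x y ≠ 0 → y.isRight = !x.isRight

section Coloured

variable {k : Type u} [Field k] {ι : Type*} {V E n : ℕ} {Y Z : Type}
  (W : Coef k) (par : ι ⊕ ι → ZMod 2) (m : ι ⊕ ι → ι ⊕ ι → ι ⊕ ι → k) (t : ι ⊕ ι → ι ⊕ ι → k)

/-- The part of the weight with exits marked in the second and entries in the first copy. -/
def colouredWeight [Fintype ι] [Fintype Y] [DecidableEq Y] (α : Flags V ≃ Y) (β : Ends E n ≃ Y)
    (a : Fin n → ι ⊕ ι → k) (o : Y → Bool) : W.C (Fin n) :=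
  ∑ φ with Sum.isRight ∘ φ = o, W.res (legOf β) (oterm W par m (fun _ => t) α β a φ)

variable {W par m t}

theorem colouredWeight_trans [Fintype ι] [Fintype Y] [DecidableEq Y] [Fintype Z] [DecidableEq Z]
    (α : Flags V ≃ Y) (β : Ends E n ≃ Y) (a : Fin n → ι ⊕ ι → k) (o : Z → Bool) (e : Y ≃ Z) :
    colouredWeight W par m t (α.trans e) (β.trans e) a o =
      colouredWeight W par m t α β a (o ∘ e) := by
  unfold colouredWeight
  refine Finset.sum_equiv (e.symm.arrowCongr (.refl _)) (fun φ => ?_) fun φ _ => ?_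
  · simp only [Finset.mem_filter_univ]
    change _ ↔ (Sum.isRight ∘ φ) ∘ e = o ∘ e
    exact e.surjective.injective_comp_right.eq_iff.symm
  · have := res_oterm_trans (W := W) par m (fun _ => t) α β a e φ
    change _ = W.res (legOf β) (oterm W par m (fun _ => t) α β a (φ ∘ e))
    rw [← this, W.res_res]
    rfl

theorem colouredWeight_congr [Fintype ι] [Fintype Y] [DecidableEq Y] (hm : IsCyclicTensor par W.c m)
    (ht : IsEdgeTensor par W.c t) {α α' : Flags V ≃ Y} {β β' : Ends E n ≃ Y}
    (hα : rotOf α' = rotOf α) (hβ : invOf β' = invOf β) (hl : legOf β' = legOf β)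
    (a : Fin n → ι ⊕ ι → k) (o : Y → Bool) :
    colouredWeight W par m t α' β' a o = colouredWeight W par m t α β a o := by
  unfold colouredWeight
  simp only [oterm_vertex_symm hm hα, oterm_edge_symm ht α hβ hl, hl]

theorem sum_colouredWeight [Fintype ι] [Fintype Y] [DecidableEq Y] (α : Flags V ≃ Y)
    (β : Ends E n ≃ Y) (a : Fin n → ι ⊕ ι → k) :
    ∑ o, colouredWeight W par m t α β a o = weight W par m (fun _ => t) α β a := by
  unfold colouredWeight
  rw [weight_eq_res, oweight_eq_sum, map_sum]
  exact Finset.sum_fiberwise _ _ _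

theorem isOriented_of_term [Fintype ι] [Fintype Y] [DecidableEq Y]
    (hc : IsColoured m t) (α : Flags V ≃ Y) (β : Ends E n ≃ Y) {a : Fin n → ι ⊕ ι → k} {φ : Y → ι ⊕ ι}
    (h : term par m (fun _ => t) α β a φ ≠ 0) :
    IsOriented (rotOf α) (invOf β) (Sum.isRight ∘ φ) := by
  unfold term at h
  have h1 := right_ne_zero_of_mul (left_ne_zero_of_mul (left_ne_zero_of_mul h))
  have h2 := right_ne_zero_of_mul (left_ne_zero_of_mul h)
  rw [prod_ne_zero_iff] at h1 h2
  constructor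
  · intro f
    obtain ⟨⟨i, b⟩, rfl⟩ := α.surjective f
    have h3 := hc.vertex _ _ _ (h1 i (mem_univ _))
    have hu : ∃ b₀, ∀ b, (φ (α (i, b))).isRight = true ↔ b = b₀ := by
      simp only [mem_cons, List.cons.injEq, List.not_mem_nil, or_false, and_true] at h3
      rcases h3 with h3 | h3 | h3
      · exact ⟨0, fun b => by fin_cases b <;> simp [h3]⟩
      · exact ⟨1, fun b => by fin_cases b <;> simp [h3]⟩
      · exact ⟨2, fun b => by fin_cases b <;> simp [h3]⟩
    obtain ⟨b₀, hb⟩ := hu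
    refine ⟨α (i, b₀), ⟨(sameCycle_rotOf_iff α _ _).mpr rfl, (hb _).mpr rfl⟩, fun g hg => ?_⟩
    obtain ⟨⟨j, b'⟩, rfl⟩ := α.surjective g
    obtain rfl : i = j := (sameCycle_rotOf_iff α _ _).mp hg.1
    rw [(hb b').mp hg.2]
  · intro f hf
    obtain ⟨⟨e, b⟩ | x, rfl⟩ := β.surjective f
    · have h3 := hc.edge _ _ (h2 e (mem_univ _))
      rw [invOf_inl]
      fin_cases b
      · exact h3
      · simp only [comp_apply]
        change (φ (β (.inl (e, 0)))).isRight = !(φ (β (.inl (e, 1)))).isRight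
        rw [h3, Bool.not_not]
    · exact absurd (invOf_inr β x) hf

theorem isOriented_of_colouredWeight [Fintype ι] [Fintype Y] [DecidableEq Y]
    (hc : IsColoured m t) (α : Flags V ≃ Y) (β : Ends E n ≃ Y) {a : Fin n → ι ⊕ ι → k} {o : Y → Bool}
    (h : colouredWeight W par m t α β a o ≠ 0) : IsOriented (rotOf α) (invOf β) o := by
  obtain ⟨φ, hφ, h⟩ := Finset.exists_ne_zero_of_sum_ne_zero h
  rw [← (mem_filter.mp hφ).2]
  refine isOriented_of_term (par := par) (a := a) hc α β fun h0 => h ?_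
  rw [oterm, h0, zero_smul, map_zero]

end Coloured

namespace RibbonGraph

variable {N n V E : ℕ}

/-- The graph with given vertices, edges and legs. -/
def ofPresentation (α : Flags V ≃ Fin N) (β : Ends E n ≃ Fin N) (o : Fin N → Bool)
    (hc : Conn (rotOf α) (invOf β)) (ho : IsOriented (rotOf α) (invOf β) o) : RibbonGraph N n where
  rot := rotOf α
  inv := invOf β
  leg := legOf β
  out := o
  rot_ne f := by
    obtain ⟨x, rfl⟩ := α.surjective f
    rw [rotOf_apply]
    simp [Prod.ext_iff]
  rot_rot_rot f := by
    obtain ⟨⟨i, b⟩, rfl⟩ := α.surjective f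
    have h : ∀ b : Fin 3, b + 1 + 1 + 1 = b := by decide
    rw [rotOf_apply, rotOf_apply, rotOf_apply]
    exact congrArg α (Prod.ext rfl (h b))
  inv_inv f := by
    obtain ⟨⟨e, b⟩ | x, rfl⟩ := β.surjective f
    · rw [invOf_inl, invOf_inl]
      congr 3
      revert b
      decide
    · rw [invOf_inr, invOf_inr]
  leg_injective := legOf_injective β
  isLeg_iff f := by
    constructor
    · rintro ⟨x, rfl⟩
      exact invOf_inr β x
    · intro h
      obtain ⟨⟨e, b⟩ | x, rfl⟩ := β.surjective f
      · rw [invOf_inl] at h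
        simp at h
      · exact ⟨x, rfl⟩
  nonempty := by
    obtain ⟨f⟩ := hc.1
    exact f.pos
  connected := hc.2
  vertex_exit := ho.1
  edge_oriented := ho.2

variable (Γ : RibbonGraph N n)

theorem three_mul_card_vertexFlags : 3 * Γ.vertexFlags.card = N := by
  have := card_congr Γ.vertexEquiv
  simp at this
  omega

theorem two_mul_card_edgeFlags : 2 * Γ.edgeFlags.card + n = N := by
  have := card_congr Γ.endsEquiv
  simp at this
  omega

theorem isOriented : IsOriented Γ.rot Γ.inv Γ.out := ⟨Γ.vertex_exit, Γ.edge_oriented⟩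

theorem contraction_smul_orient {k : Type u} [Field k] {ι : Type*} [Fintype ι] {W : Coef k}
    {par : ι ⊕ ι → ZMod 2} {m : ι ⊕ ι → ι ⊕ ι → ι ⊕ ι → k} {t : ι ⊕ ι → ι ⊕ ι → k}
    (hm : IsCyclicTensor par W.c m) (ht : IsEdgeTensor par W.c t) (a : Fin n → ι ⊕ ι → k)
    {α : Flags V ≃ Fin N} {β : Ends E n ≃ Fin N} (hα : rotOf α = Γ.rot) (hβ : invOf β = Γ.inv)
    (hl : legOf β = Γ.leg) :
    Γ.contraction par m t a • W.res Γ.leg (orient W Γ.vertexEquiv Γ.endsEquiv) =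
      colouredWeight W par m t α β a Γ.out := by
  have h1 := card_congr α
  have h2 := card_congr β
  have h3 := Γ.three_mul_card_vertexFlags
  have h4 := Γ.two_mul_card_edgeFlags
  simp at h1 h2
  obtain rfl : V = Γ.vertexFlags.card := by omega
  obtain rfl : E = Γ.edgeFlags.card := by omega
  rw [contraction_eq, colouredWeight_congr hm ht (hα.trans Γ.rotOf_vertexEquiv.symm)
    (hβ.trans Γ.invOf_endsEquiv.symm) (hl.trans Γ.legOf_endsEquiv.symm), sum_smul]
  unfold colouredWeight oterm
  simp only [map_smul]
  rfl

end RibbonGraph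

/-! ### Isomorphism classes of ribbon graphs -/

/-- Connected graphs with numbered vertices and edges, and oriented edges. -/
abbrev NumberedGraph (V E : ℕ) {n : ℕ} (σ : Perm (Fin n)) :=
  {x : (Ends E n ≃ Flags V) × (Flags V → Bool) //
    Adm (.refl _) x.1 σ ∧ IsOriented (rotOf (.refl (Flags V))) (invOf x.1) x.2}

theorem invOf_sumCongr_trans {E n : ℕ} {Y : Type} {g : Perm (Fin E × Fin 2)}
    (hg : Commute g (shift E 2)) (β : Ends E n ≃ Y) :
    invOf ((sumCongr g 1 : Perm (Ends E n)).trans β) = invOf β := by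
  have h : ∀ (β : Ends E n ≃ Y) y, invOf β (β (.inl y)) = β (.inl (shift E 2 y)) :=
    fun β y => invOf_inl β y.1 y.2
  refine Equiv.ext fun y => ?_
  obtain ⟨x, rfl⟩ := ((sumCongr g 1 : Perm (Ends E n)).trans β).surjective y
  rcases x with x | x
  · rw [h]
    simp only [trans_apply, sumCongr_apply, map_inl]
    rw [h]
    congr 2
    exact congrFun (congrArg DFunLike.coe hg.eq) x
  · rw [invOf_inr]
    exact (invOf_inr β x).symm

namespace NumberedGraph

variable {V E n : ℕ} {σ : Perm (Fin n)} {c : ℕ}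

/-- The graph on the set of flags. -/
def graph (x : NumberedGraph V E σ) : RibbonGraph (V * 3) n :=
  .ofPresentation finProdFinEquiv (x.1.1.trans finProdFinEquiv) (x.1.2 ∘ finProdFinEquiv.symm) (by
      rw [← refl_trans finProdFinEquiv, rotOf_trans, refl_trans, invOf_trans]
      exact x.2.1.1.permCongr _)
    (by
      rw [← refl_trans finProdFinEquiv, rotOf_trans, refl_trans, invOf_trans]
      exact x.2.2.permCongr _)

theorem graph_hasBoundary (x : NumberedGraph V E σ) : x.graph.HasBoundary σ :=
  (x.2.1.trans finProdFinEquiv).2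

theorem graph_hasOrder (hV : 0 < V → V + 2 = n + 2 * c) (x : NumberedGraph V E σ) :
    x.graph.HasOrder c := by
  have h1 := x.graph.three_mul_card_vertexFlags
  have h2 := x.graph.two_mul_card_edgeFlags
  have h3 := flags_card x.1.1
  have h4 := hV x.2.1.1.vertices_le.1
  unfold RibbonGraph.HasOrder
  omega

theorem graph_iso_iff (x y : NumberedGraph V E σ) : x.graph.Iso y.graph ↔ ∃ g : Perm (Flags V),
    Commute g (shift V 3) ∧ (∀ u, g (invOf x.1.1 u) = invOf y.1.1 (g u)) ∧
    (∀ i, g (legOf x.1.1 i) = legOf y.1.1 i) ∧ ∀ u, y.1.2 (g u) = x.1.2 u := by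
  have hi : ∀ x : NumberedGraph V E σ, x.graph.inv = finProdFinEquiv.permCongr (invOf x.1.1) :=
    fun x => invOf_trans _ _
  have hr : ∀ x : NumberedGraph V E σ, x.graph.rot = finProdFinEquiv.permCongr (shift V 3) :=
    fun x => rfl
  have hl : ∀ (x : NumberedGraph V E σ) i, x.graph.leg i = finProdFinEquiv (legOf x.1.1 i) :=
    fun x _ => rfl
  have ho : ∀ (x : NumberedGraph V E σ) u, x.graph.out (finProdFinEquiv u) = x.1.2 u :=
    fun x u => congrArg x.1.2 (finProdFinEquiv.symm_apply_apply u)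
  unfold RibbonGraph.Iso
  rw [(finProdFinEquiv (m := V) (n := 3)).permCongr.surjective.exists]
  refine exists_congr fun g => ?_
  rw [hr, hr, hi, hi]
  simp only [hl, (finProdFinEquiv (m := V) (n := 3)).surjective.forall, permCongr_apply,
    symm_apply_apply, Equiv.apply_eq_iff_eq, ho]
  refine and_congr_left' ?_
  exact ⟨fun h => Equiv.ext h, fun h u => congrFun (congrArg DFunLike.coe h.eq) u⟩

theorem legs_pos (x : NumberedGraph V E σ) : Nonempty (Fin n) := by
  obtain ⟨⟨u⟩, _⟩ := x.2.1.1
  exact (x.2.1.2.1 u).nonempty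

/-- Renumbering the vertices and the edges. -/
def renumber (x : NumberedGraph V E σ) (g : {g : Perm (Flags V) // Commute g (shift V 3)})
    (g' : {g : Perm (Fin E × Fin 2) // Commute g (shift E 2)}) : NumberedGraph V E σ :=
  ⟨((sumCongr g'.1 1 : Perm (Ends E n)).trans (x.1.1.trans g.1), x.1.2 ∘ g.1.symm), by
    have h1 : rotOf (.refl (Flags V)) = rotOf ((Equiv.refl (Flags V)).trans g.1) := by
      refine Equiv.ext fun u => ?_
      obtain ⟨u, rfl⟩ := g.1.surjective u
      rw [rotOf_trans, rotOf_refl, permCongr_apply, symm_apply_apply]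
      exact (congrFun (congrArg DFunLike.coe g.2.eq) u).symm
    have h2 := invOf_sumCongr_trans g'.2 (x.1.1.trans g.1)
    refine ⟨(adm_congr h1 h2 rfl).mpr (x.2.1.trans g.1), ?_⟩
    have h3 := x.2.2.permCongr g.1
    rwa [← rotOf_trans, ← invOf_trans, ← h1, ← h2] at h3⟩

theorem card_iso (x : NumberedGraph V E σ) :
    Nat.card {y : NumberedGraph V E σ // x.graph.Iso y.graph} =
      (V.factorial * 3 ^ V) * (E.factorial * 2 ^ E) := by
  rw [← card_commute_shift (V := V) fin_three_nsmul_one,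
    ← card_commute_shift (V := E) fin_two_nsmul_one, ← Nat.card_prod]
  have hF : ∀ g g' u, g.1 (invOf x.1.1 u) = invOf (x.renumber g g').1.1 (g.1 u) := by
    intro g g' u
    have : invOf (x.renumber g g').1.1 = g.1.permCongr (invOf x.1.1) :=
      (invOf_sumCongr_trans g'.2 (x.1.1.trans g.1)).trans (invOf_trans _ _)
    rw [this, permCongr_apply, symm_apply_apply]
  symm
  refine Nat.card_congr (ofBijective (fun g => ⟨x.renumber g.1 g.2,
    (graph_iso_iff _ _).mpr ⟨g.1.1, g.1.2, hF _ _, fun i => rfl, fun u =>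
      congrArg x.1.2 (g.1.1.symm_apply_apply u)⟩⟩) ⟨?_, ?_⟩)
  · rintro ⟨g₁, g₁'⟩ ⟨g₂, g₂'⟩ h
    have h := congrArg (fun y => y.1.1.1) h
    have hg : ∀ u, g₁.1 u = g₂.1 u := by
      obtain ⟨i⟩ := x.legs_pos
      intro u
      have hc := x.2.1.1.2 (legOf x.1.1 i) u
      induction hc with
      | refl => exact congrFun (congrArg DFunLike.coe h) (.inr i)
      | @tail u w _ huw ih =>
        rcases huw with rfl | rfl
        · rw [rotOf_refl]
          have h1 := congrFun (congrArg DFunLike.coe g₁.2.eq) u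
          have h2 := congrFun (congrArg DFunLike.coe g₂.2.eq) u
          simp only [mul_apply] at h1 h2
          rw [h1, h2, ih]
        · have h' : (x.renumber g₁ g₁').1.1 = (x.renumber g₂ g₂').1.1 := h
          rw [hF _ g₁', hF _ g₂', h', ih]
    obtain rfl : g₁ = g₂ := Subtype.ext (Equiv.ext hg)
    refine Prod.ext rfl (Subtype.ext (Equiv.ext fun y => ?_))
    have := congrFun (congrArg DFunLike.coe h) (.inl y)
    exact inl_injective ((x.1.1.trans g₁.1).injective this)
  · rintro ⟨y, hy⟩
    obtain ⟨g, hg, h1, h2, h3⟩ := (graph_iso_iff _ _).mp hy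
    obtain ⟨g', hg', h'⟩ := exists_commute_of_invOf_eq (β := x.1.1.trans g) (β' := y.1.1) (by
        rw [invOf_trans]
        refine Equiv.ext fun u => ?_
        obtain ⟨u, rfl⟩ := g.surjective u
        rw [← h1, permCongr_apply, symm_apply_apply])
      (funext fun i => (h2 i).symm)
    refine ⟨(⟨g, hg⟩, ⟨g', hg'⟩), Subtype.ext (Subtype.ext (Prod.ext h'.symm (funext fun u => ?_)))⟩
    obtain ⟨u, rfl⟩ := g.surjective u
    rw [h3]
    exact congrArg x.1.2 (g.symm_apply_apply u)

/-- The isomorphism class. -/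
def toClass (hV : 0 < V → V + 2 = n + 2 * c) (x : NumberedGraph V E σ) : RibbonClass n σ c :=
  ⟨V * 3, Quotient.mk _ ⟨x.graph, x.graph_hasBoundary, x.graph_hasOrder hV⟩⟩

theorem toClass_eq_iff (hV : 0 < V → V + 2 = n + 2 * c) (x y : NumberedGraph V E σ) :
    x.toClass hV = y.toClass hV ↔ x.graph.Iso y.graph := by
  unfold toClass
  rw [Sigma.mk.injEq, heq_eq_eq, Quotient.eq]
  simp only [true_and]
  rfl

theorem toClass_surjective (hV : V = n + 2 * c - 2) (hE : E = n + 3 * c - 3) :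
    Function.Surjective (toClass (E := E) (σ := σ) (c := c) (V := V) (by omega)) := by
  rintro ⟨N, q⟩
  induction q using Quotient.inductionOn with
  | h Γ =>
    obtain ⟨Γ, hb, ho⟩ := Γ
    have h1 := Γ.three_mul_card_vertexFlags
    have h2 := Γ.two_mul_card_edgeFlags
    have h3 := Γ.nonempty
    unfold RibbonGraph.HasOrder at ho
    obtain ⟨α, hα⟩ : ∃ α : Flags V ≃ Fin N, rotOf α = Γ.rot := by
      obtain rfl : V = Γ.vertexFlags.card := by omega
      exact ⟨_, Γ.rotOf_vertexEquiv⟩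
    obtain ⟨β, hβ, hl⟩ : ∃ β : Ends E n ≃ Fin N, invOf β = Γ.inv ∧ legOf β = Γ.leg := by
      obtain rfl : E = Γ.edgeFlags.card := by omega
      exact ⟨_, Γ.invOf_endsEquiv, Γ.legOf_endsEquiv⟩
    obtain rfl : N = V * 3 := by omega
    have hA : Adm α β σ := by
      unfold Adm
      rw [hα, hβ, hl]
      exact ⟨Γ.conn, hb⟩
    have hA' := hA.trans α.symm
    have hO : IsOriented (rotOf (α.trans α.symm)) (invOf (β.trans α.symm)) (Γ.out ∘ α) := by
      rw [rotOf_trans, invOf_trans, hα, hβ]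
      exact Γ.isOriented.permCongr α.symm
    rw [Equiv.self_trans_symm] at hA' hO
    refine ⟨⟨(β.trans α.symm, Γ.out ∘ α), hA', hO⟩, ?_⟩
    unfold toClass
    rw [Sigma.mk.injEq, heq_eq_eq, Quotient.eq]
    refine ⟨rfl, finProdFinEquiv.symm.trans α, ?_, ?_, ?_, ?_⟩
    · intro f
      obtain ⟨u, rfl⟩ := finProdFinEquiv.surjective f
      change α (finProdFinEquiv.symm (rotOf finProdFinEquiv (finProdFinEquiv u))) =
        Γ.rot (α (finProdFinEquiv.symm (finProdFinEquiv u)))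
      rw [rotOf_apply, symm_apply_apply, symm_apply_apply, ← hα, rotOf_apply]
    · intro f
      change α (finProdFinEquiv.symm (invOf ((β.trans α.symm).trans finProdFinEquiv) f)) =
        Γ.inv (α (finProdFinEquiv.symm f))
      rw [invOf_trans, invOf_trans, hβ]
      simp [permCongr_apply]
    · intro i
      change α (finProdFinEquiv.symm (finProdFinEquiv (α.symm (legOf β i)))) = Γ.leg i
      rw [symm_apply_apply, apply_symm_apply, hl]
    · intro f
      rfl

end NumberedGraph

theorem finite_ribbonClass (n : ℕ) (σ : Perm (Fin n)) (c : ℕ) : Finite (RibbonClass n σ c) :=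
  Finite.of_surjective _ (NumberedGraph.toClass_surjective (σ := σ) rfl rfl)

section Sum

variable {k : Type u} [Field k] {ι : Type*} [Fintype ι] {W : Coef k}
  {par : ι ⊕ ι → ZMod 2} {m : ι ⊕ ι → ι ⊕ ι → ι ⊕ ι → k} {t : ι ⊕ ι → ι ⊕ ι → k}

theorem contraction_toClass {V E n c : ℕ} {σ : Perm (Fin n)}
    (hm : IsCyclicTensor par W.c m) (ht : IsEdgeTensor par W.c t) (a : Fin n → ι ⊕ ι → k)
    (hV : 0 < V → V + 2 = n + 2 * c) (x : NumberedGraph V E σ) {Γ : RibbonGraph (V * 3) n}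
    (hΓ : Γ.Iso x.graph) :
    Γ.contraction par m t a • W.res Γ.leg (orient W Γ.vertexEquiv Γ.endsEquiv) =
      colouredWeight W par m t (.refl _) x.1.1 a x.1.2 := by
  obtain ⟨e, h1, h2, h3, h4⟩ := hΓ
  rw [Γ.contraction_smul_orient hm ht a (α := Equiv.trans (.refl _) (finProdFinEquiv.trans e.symm))
    (β := x.1.1.trans (finProdFinEquiv.trans e.symm)), colouredWeight_trans]
  · congr 1
    funext u
    simp only [comp_apply, trans_apply, ← h4, apply_symm_apply]
    exact congrArg x.1.2 (finProdFinEquiv.symm_apply_apply u)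
  · refine Equiv.ext fun f => ?_
    rw [refl_trans, rotOf_trans, ← e.apply_eq_iff_eq, h1]
    simp [permCongr_apply]
    rfl
  · refine Equiv.ext fun f => ?_
    rw [← Equiv.trans_assoc, invOf_trans, ← e.apply_eq_iff_eq, h2]
    simp [permCongr_apply]
    rfl
  · funext i
    rw [← e.apply_eq_iff_eq, h3]
    simp [legOf]
    rfl

theorem finsum_ribbonClass [CharZero k] (hm : IsCyclicTensor par W.c m) (ht : IsEdgeTensor par W.c t)
    (hc : IsColoured m t)
    (c n : ℕ) (σ : Perm (Fin n)) (a : Fin n → ι ⊕ ι → k) :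
    ∑ᶠ Γ : RibbonClass n σ c, Γ.2.out.1.contraction par m t a •
        W.res Γ.2.out.1.leg (orient W Γ.2.out.1.vertexEquiv Γ.2.out.1.endsEquiv) =
      (numbering k (n + 2 * c - 2) (n + 3 * c - 3))⁻¹ •
        total W par m (fun _ : Fin (n + 3 * c - 3) => t) (n + 2 * c - 2) n σ a := by
  classical
  have : Finite (RibbonClass n σ c) := finite_ribbonClass n σ c
  have := Fintype.ofFinite (RibbonClass n σ c)
  generalize hV : n + 2 * c - 2 = V
  generalize hE : n + 3 * c - 3 = E
  have hV' : 0 < V → V + 2 = n + 2 * c := by omega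
  have hs := NumberedGraph.toClass_surjective (σ := σ) hV.symm hE.symm
  rw [finsum_eq_sum_of_fintype, eq_inv_smul_iff₀ (numbering_ne_zero _ _)]
  have h1 : total W par m (fun _ : Fin E => t) V n σ a = ∑ x : NumberedGraph V E σ,
      colouredWeight W par m t (.refl _) x.1.1 a x.1.2 := by
    rw [← Finset.sum_subtype (univ.filter fun x : (Ends E n ≃ Flags V) × (Flags V → Bool) =>
        Adm (.refl _) x.1 σ ∧ IsOriented (rotOf (.refl (Flags V))) (invOf x.1) x.2)
      (fun x => Finset.mem_filter_univ x)
      fun x => colouredWeight W par m t (.refl _) x.1 a x.2, sum_filter,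
      sum_prod_type]
    unfold total
    refine sum_congr rfl fun β _ => ?_
    by_cases hA : Adm (.refl _) β σ
    · rw [if_pos hA, ← sum_colouredWeight]
      refine sum_congr rfl fun o _ => ?_
      by_cases hO : IsOriented (rotOf (.refl (Flags V))) (invOf β) o
      · rw [if_pos ⟨hA, hO⟩]
      · rw [if_neg fun h => hO h.2]
        by_contra h
        exact hO (isOriented_of_colouredWeight hc _ _ h)
    · rw [if_neg hA, sum_eq_zero fun o _ => if_neg fun h => hA h.1]
  have h2 : ∀ f : RibbonClass n σ c → W.C (Fin n),
      ∑ x : NumberedGraph V E σ, f (x.toClass hV') = numbering k V E • ∑ Γ, f Γ := by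
    intro f
    rw [Finset.sum_comp f, Finset.image_univ_of_surjective hs, smul_sum]
    refine sum_congr rfl fun Γ _ => ?_
    obtain ⟨x, rfl⟩ := hs Γ
    rw [← Nat.cast_smul_eq_nsmul k]
    congr 1
    have h3 : (univ.filter fun y : NumberedGraph V E σ => y.toClass hV' = x.toClass hV').card =
        (V.factorial * 3 ^ V) * (E.factorial * 2 ^ E) := by
      rw [← x.card_iso, ← Fintype.card_subtype, ← Nat.card_eq_fintype_card]
      refine Nat.card_congr (Equiv.subtypeEquivRight fun y => ?_)
      rw [eq_comm, NumberedGraph.toClass_eq_iff]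
    rw [h3, numbering]
    push_cast
    ring
  rw [h1, ← h2]
  exact sum_congr rfl fun x _ => contraction_toClass hm ht a hV' x
    (Quotient.mk_out (s := ribbonSetoid _ _ _ _) _)

end Sum

/-! ### The tensors of a doubled algebra in coordinates -/

section Coordinates

variable {k : Type u} [Field k] {ι : Type*}

/-- A two-tensor pairing the two copies. -/
def pairOf (f g : ι → ι → k) : ι ⊕ ι → ι ⊕ ι → k
  | .inl i, .inr j => f i j
  | .inr i, .inl j => g i j
  | _, _ => 0

/-- An operator preserving the two copies. -/
def diagOf (f g : ι → ι → k) : ι ⊕ ι → ι ⊕ ι → k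
  | .inl i, .inl j => f i j
  | .inr i, .inr j => g i j
  | _, _ => 0

/-- The three-tensor with given structure constants. -/
def tripleOf (δ : ZMod 2) (p : ι → ZMod 2) (s : ι → ι → ι → k) : ι ⊕ ι → ι ⊕ ι → ι ⊕ ι → k
  | .inl i, .inl j, .inr l => sgn (p j + (δ + 1) * (p i + p j)) * s i j l
  | .inl i, .inr j, .inl l => sgn (p j + δ + (δ + 1) * p i) * s l i j
  | .inr i, .inl j, .inl l => sgn (p j) * s j l i
  | _, _, _ => 0

variable (d : ℕ) {p : ι → ZMod 2} {s : ι → ι → ι → k} {I H P : ι → ι → k}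

theorem zmod_two_cases (a : ZMod 2) : a = 0 ∨ a = 1 := by
  revert a; decide

theorem zmod_two_one_add_one : (1 : ZMod 2) + 1 = 0 := rfl

theorem letterParity_inl (i : ι) : letterParity d p (.inl i) = p i + 1 := rfl

theorem letterParity_inr (i : ι) : letterParity d p (.inr i) = p i + d + 1 := rfl

theorem exists_graded {f : ι → ι → k} {q : ι → ZMod 2} (h : ∀ i j, f i j ≠ 0 → p i = q j) :
    ∃ f' : ι → ι → k, f = fun i j => if p i = q j then f' i j else 0 :=
  ⟨f, funext₂ fun i j => by split_ifs with h0; exacts [rfl, not_not.mp (mt (h i j) h0)]⟩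

theorem exists_graded_triple (h : ∀ i j l, s i j l ≠ 0 → p l = p i + p j) :
    ∃ s' : ι → ι → ι → k, s = fun i j l => if p l = p i + p j then s' i j l else 0 :=
  ⟨s, funext₃ fun i j l => by split_ifs with h0; exacts [rfl, not_not.mp (mt (h i j l) h0)]⟩

theorem isCyclicTensor_tripleOf (hs : ∀ i j l, s i j l ≠ 0 → p l = p i + p j) :
    IsCyclicTensor (letterParity d p) (d + 1) (tripleOf d p s) := by
  constructor
  · intro x y z h
    rcases x with i | i <;> rcases y with j | j <;> rcases z with l | l <;>
      simp only [tripleOf, ne_eq, mul_eq_zero, not_or, not_true_eq_false] at h <;>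
      simp only [letterParity_inl, letterParity_inr, hs _ _ _ h.2]
    all_goals
      rcases zmod_two_cases (d : ZMod 2) with hd | hd <;> simp only [hd] <;>
      generalize p _ = a <;> generalize p _ = b <;> revert a b <;> decide
  · obtain ⟨s', hs'⟩ := exists_graded_triple hs
    clear hs
    rintro (i | i) (j | j) (l | l) <;> simp only [tripleOf, mul_zero]
    all_goals
      simp only [hs']
      split_ifs <;> try simp only [mul_zero]
      simp only [letterParity_inl, letterParity_inr, *]
      generalize p _ = a
      generalize p _ = b
      generalize (d : ZMod 2) = d
      rcases zmod_two_cases a with rfl | rfl <;> rcases zmod_two_cases b with rfl | rfl <;>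
      rcases zmod_two_cases d with rfl | rfl <;> simp [sgn_zero, sgn_one, zmod_two_one_add_one]

theorem isEdgeTensor_pairOf (hH : ∀ i j, H i j ≠ 0 → p i = p j + 1) :
    IsEdgeTensor (letterParity d p) (d + 1)
      (pairOf (fun i j => sgn d * sgn ((d + 1) * p j) * H i j) fun i j => -sgn (p i) * H j i) := by
  constructor
  · intro x y h
    rcases x with i | i <;> rcases y with j | j <;>
      simp only [pairOf, ne_eq, mul_eq_zero, not_or, not_true_eq_false] at h <;>
      simp only [letterParity_inl, letterParity_inr, hH _ _ h.2]
    all_goals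
      rcases zmod_two_cases (d : ZMod 2) with hd | hd <;> simp only [hd] <;>
      generalize p _ = a <;> revert a <;> decide
  · obtain ⟨H', hH'⟩ := exists_graded (q := fun i => p i + 1) hH
    clear hH
    rintro (i | i) (j | j) <;> simp only [pairOf, mul_zero]
    all_goals
      simp only [hH']
      split_ifs <;> try simp only [mul_zero]
      simp only [letterParity_inl, letterParity_inr, *]
      generalize p _ = a
      generalize (d : ZMod 2) = d
      rcases zmod_two_cases a with rfl | rfl <;> rcases zmod_two_cases d with rfl | rfl <;>
      simp [sgn_zero, sgn_one, zmod_two_one_add_one]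

theorem parity_pairOf {f g : ι → ι → k} (hf : ∀ i j, f i j ≠ 0 → p i = p j)
    (hg : ∀ i j, g i j ≠ 0 → p i = p j) (x y : ι ⊕ ι) (h : pairOf f g x y ≠ 0) :
    letterParity d p x + letterParity d p y = d + 1 + 1 := by
  rcases x with i | i <;> rcases y with j | j <;> simp only [pairOf, ne_eq, not_true_eq_false] at h
  · rw [letterParity_inl, letterParity_inr, hf _ _ h]
    linear_combination (p j) * CharTwo.two_eq_zero (R := ZMod 2)
  · rw [letterParity_inl, letterParity_inr, hg _ _ h]
    linear_combination (p j) * CharTwo.two_eq_zero (R := ZMod 2)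

theorem parity_diagOf {f g : ι → ι → k} (hf : ∀ i j, f i j ≠ 0 → p i = p j + 1)
    (hg : ∀ i j, g i j ≠ 0 → p i = p j + 1) (y x : ι ⊕ ι) (h : diagOf f g y x ≠ 0) :
    letterParity d p y = letterParity d p x + 1 := by
  rcases x with i | i <;> rcases y with j | j <;> simp only [diagOf, ne_eq, not_true_eq_false] at h
  · rw [letterParity_inl, letterParity_inl, hf _ _ h]
  · rw [letterParity_inr, letterParity_inr, hg _ _ h]
    ring

variable [Fintype ι] [DecidableEq ι]

theorem isAssociative_tripleOf (hs : ∀ i j l, s i j l ≠ 0 → p l = p i + p j)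
    (ha : ∀ i j h l, ∑ x, s i j x * s x h l = ∑ x, s j h x * s i x l) :
    IsAssociative (letterParity d p) (tripleOf d p s)
      (pairOf (fun i j => if i = j then (sgn ((d + 1) * p i) : k) else 0)
        fun i j => if i = j then 1 else 0) := by
  obtain ⟨s', hs'⟩ := exists_graded_triple hs
  (rintro (i | i) (j | j) (h | h) (l | l) <;>
    simp only [pairOf, tripleOf, sum_sum_type, mul_zero, zero_mul, sum_const_zero,
      add_zero, zero_add, ite_mul, Finset.sum_ite_eq, mem_univ, if_true, neg_zero]) <;> [
    refine Eq.trans (b := (sgn (p i + p h + (d + 1) * (p i + p j + p h)) : k) * _) ?_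
      ((congrArg _ (ha i j h l)).trans ?_);
    refine Eq.trans (b := (sgn (p l + p j + d + (d + 1) * (p i + p j)) : k) * _) ?_
      ((congrArg _ (ha l i j h).symm).trans ?_);
    refine Eq.trans (b := (sgn (d * p i + p h) : k) * _) ?_ ((congrArg _ (ha h l i j)).trans ?_);
    refine Eq.trans (b := (sgn (p j + p l + d) : k) * _) ?_ ((congrArg _ (ha j h l i).symm).trans ?_)]
  all_goals
    clear ha hs
    simp only [mul_sum, ← Finset.sum_neg_distrib]
    refine sum_congr rfl fun x _ => ?_
    simp only [hs']
    split_ifs <;> try simp only [mul_zero, zero_mul, neg_zero]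
    simp only [letterParity_inl, letterParity_inr, *]
    generalize p _ = a
    generalize p _ = b
    generalize p _ = c
    generalize (d : ZMod 2) = d
    rcases zmod_two_cases a with rfl | rfl <;> rcases zmod_two_cases b with rfl | rfl <;>
    rcases zmod_two_cases c with rfl | rfl <;> rcases zmod_two_cases d with rfl | rfl <;>
    simp [sgn_zero, sgn_one, zmod_two_one_add_one, mul_comm]

theorem invariant_tripleOf (hs : ∀ i j l, s i j l ≠ 0 → p l = p i + p j)
    (hI : ∀ i j, I i j ≠ 0 → p i = p j + 1)
    (hd : ∀ i j l, ∑ w, I l w * s i j w =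
      ∑ w, I w i * s w j l + (sgn (p i) : k) * ∑ w, I w j * s i w l) (x y z : ι ⊕ ι) :
    let J := diagOf (fun j i => -I j i) fun j i => -(sgn d * sgn (p j) * I i j)
    let m := tripleOf d p s
    ∑ w, J w x * m w y z + (sgn (letterParity d p x) : k) * ∑ w, J w y * m x w z +
      (sgn (letterParity d p x + letterParity d p y) : k) * ∑ w, J w z * m x y w = 0 := by
  obtain ⟨s', hs'⟩ := exists_graded_triple hs
  obtain ⟨I', hI'⟩ := exists_graded (q := fun i => p i + 1) hI
  have key : ∀ {c a b e X Y Z : k}, Z = X + Y → a = c * X → b = c * Y → e = -(c * Z) →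
      a + b + e = 0 := by
    rintro c _ _ _ X Y _ rfl rfl rfl rfl
    ring
  (rcases x with i | i <;> rcases y with j | j <;> rcases z with l | l <;>
    simp only [diagOf, tripleOf, sum_sum_type, mul_zero, zero_mul, sum_const_zero,
      add_zero, zero_add]) <;> [
    refine key (c := -(sgn (p j + (d + 1) * (p i + p j + 1)) : k)) (hd i j l) ?_ ?_ ?_;
    refine (add_rotate _ _ _).trans ((add_rotate _ _ _).trans
      (key (c := -(sgn (d * p i) : k)) (hd l i j) ?_ ?_ ?_));
    refine (add_rotate _ _ _).trans (key (c := (sgn (p l + d) : k)) (hd j l i) ?_ ?_ ?_)]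
  all_goals
    clear hd hs hI key
    simp only [mul_sum, ← Finset.sum_neg_distrib]
    refine sum_congr rfl fun x _ => ?_
    simp only [hs', hI']
    split_ifs <;> try simp only [mul_zero, zero_mul, neg_zero]
    simp only [letterParity_inl, letterParity_inr, *]
    generalize p _ = a
    generalize p _ = b
    generalize (d : ZMod 2) = d
    rcases zmod_two_cases a with rfl | rfl <;> rcases zmod_two_cases b with rfl | rfl <;>
    rcases zmod_two_cases d with rfl | rfl <;>
    simp [sgn_zero, sgn_one, zmod_two_one_add_one]

theorem variation_pairOf (hH : ∀ i j, H i j ≠ 0 → p i = p j + 1)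
    (hI : ∀ i j, I i j ≠ 0 → p i = p j + 1)
    (hP' : ∀ i j, P i j ≠ 0 → p i = p j)
    (hP : ∀ i j, ∑ x, I i x * H x j + ∑ x, H i x * I x j + P i j = if i = j then 1 else 0)
    (y z : ι ⊕ ι) :
    let J := diagOf (fun j i => -I j i) fun j i => -(sgn d * sgn (p j) * I i j)
    let t := pairOf (fun i j => sgn d * sgn ((d + 1) * p j) * H i j) fun i j => -sgn (p i) * H j i
    ∑ x, J y x * t x z + (sgn (letterParity d p y) : k) * ∑ x, J z x * t y x =
      (sgn (d + 1) : k) * (pairOf (fun i j => if i = j then (sgn ((d + 1) * p i) : k) else 0)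
        (fun i j => if i = j then 1 else 0) y z -
        pairOf (fun i j => sgn ((d + 1) * p i) * P i j) (fun i j => P j i) y z) := by
  obtain ⟨H', hH'⟩ := exists_graded (q := fun i => p i + 1) hH
  obtain ⟨I', hI'⟩ := exists_graded (q := fun i => p i + 1) hI
  have key : ∀ {e u a b c X Y Z δ : k}, X + Y + Z = δ → c = u * (δ - Z) → a = (e * u) * X →
      b = (e * u) * Y → a + b = e * c := by
    rintro e u _ _ _ X Y Z _ rfl rfl rfl rfl
    ring
  (rcases y with i | i <;> rcases z with j | j <;>
    simp only [diagOf, pairOf, sum_sum_type, mul_zero, zero_mul, sum_const_zero,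
      add_zero, zero_add, sub_zero]) <;> [
    refine key (u := (sgn ((d + 1) * p j) : k)) (hP i j) ?_ ?_ ?_;
    refine (add_comm _ _).trans (key (u := 1) (hP j i) (by simp only [one_mul, eq_comm (a := i)]) ?_ ?_)]
  · rcases eq_or_ne i j with rfl | hij
    · simp only [if_true]
      ring
    · by_cases h : P i j = 0
      · simp [h, hij]
      · simp [hij, hP' _ _ h]
  all_goals
    clear hH hI hP hP' key
    simp only [mul_sum]
    refine sum_congr rfl fun x _ => ?_
    simp only [hH', hI']
    split_ifs <;> try simp only [mul_zero, zero_mul, neg_zero]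
    try simp only [letterParity_inl, letterParity_inr, *]
    generalize p _ = a
    generalize (d : ZMod 2) = d
    rcases zmod_two_cases a with rfl | rfl <;> rcases zmod_two_cases d with rfl | rfl <;>
    simp [sgn_zero, sgn_one, zmod_two_one_add_one, mul_comm]

end Coordinates

theorem isColoured {k : Type u} [Field k] {ι : Type*} {f g : ι → ι → k} {δ : ZMod 2}
    {p : ι → ZMod 2} {s : ι → ι → ι → k} : IsColoured (tripleOf δ p s) (pairOf f g) where
  vertex x y z h := by
    rcases x with i | i <;> rcases y with j | j <;> rcases z with l | l <;>
      first | exact absurd rfl h | simp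
  edge x y h := by
    rcases x with i | i <;> rcases y with j | j <;> first | rfl | exact absurd rfl h

/-! ### The tensors of a graded algebra with an odd derivation and an odd operator -/

section Algebra

variable {k : Type u} [Field k] {A : Type*} [NonUnitalRing A] [Module k A]
  {𝒜 : ZMod 2 → Submodule k A} [DirectSum.Decomposition 𝒜]
  {ι : Type*} {κ : Type*} {p : ι → ZMod 2} {q : κ → ZMod 2} (d : ℕ)

theorem parityOp_apply {i : ZMod 2} {a : A} (ha : a ∈ 𝒜 i) : parityOp 𝒜 a = (sgn i : k) • a := by
  have h : parityOp 𝒜 a = ((DirectSum.decompose 𝒜 a 0 : 𝒜 0) : A) - (DirectSum.decompose 𝒜 a 1 : 𝒜 1) := rfl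
  rw [h]
  rcases zmod_two_cases i with rfl | rfl
  · rw [DirectSum.decompose_of_mem_same 𝒜 ha, DirectSum.decompose_of_mem_ne 𝒜 ha zero_ne_one]
    simp [sgn_zero]
  · rw [DirectSum.decompose_of_mem_same 𝒜 ha, DirectSum.decompose_of_mem_ne 𝒜 ha one_ne_zero]
    simp [sgn_one]

theorem parityOp_pow_apply (r : ℕ) {i : ZMod 2} {a : A} (ha : a ∈ 𝒜 i) :
    (parityOp 𝒜 ^ r) a = (sgn (r * i) : k) • a := by
  induction r with
  | zero => simp [sgn_zero]
  | succ r ih =>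
    rw [pow_succ', Module.End.mul_apply, ih, map_smul, parityOp_apply ha, smul_smul, Nat.cast_succ,
      add_mul, one_mul, sgn_add, Int.cast_mul]

/-- A homogeneous element is a combination of basis vectors of its parity. -/
theorem parity_of_repr_ne_zero {M : Type*} [AddCommGroup M] [Module k M] [Fintype κ]
    {f : M →ₗ[k] A} (hf : Function.Injective f) (e : Module.Basis κ k M) (he : ∀ μ, f (e μ) ∈ 𝒜 (q μ))
    {i : ZMod 2} {x : M} (hx : f x ∈ 𝒜 i) {μ : κ} (h : e.repr x μ ≠ 0) : q μ = i := by
  classical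
  by_contra hμ
  refine h ?_
  have h1 : x = ∑ ν, (if q ν = i then e.repr x ν else 0) • e ν := by
    apply hf
    conv_lhs => rw [← DirectSum.decompose_of_mem_same 𝒜 hx, ← e.sum_repr x, map_sum,
      DirectSum.decompose_sum, DirectSum.sum_apply, AddSubmonoidClass.coe_finsetSum]
    rw [map_sum]
    refine sum_congr rfl fun ν _ => ?_
    rw [LinearMap.map_smul, LinearMap.map_smul]
    split_ifs with hν
    · rw [← hν, DirectSum.decompose_of_mem_same 𝒜 (smul_mem _ _ (he ν))]
    · rw [zero_smul, DirectSum.decompose_of_mem_ne 𝒜 (smul_mem _ _ (he ν)) hν]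
  rw [h1, e.repr_sum_self, if_neg hμ]

variable [Fintype ι] (b : Module.Basis ι k A)

theorem apply_eq_sum_repr (φ : A →ₗ[k] k) (a : A) : φ a = ∑ w, b.repr a w * φ (b w) := by
  conv_lhs => rw [← b.sum_repr a, map_sum]
  exact sum_congr rfl fun w _ => by rw [map_smul, smul_eq_mul]

theorem repr_apply_eq_sum (f : Module.End k A) (a : A) (l : ι) :
    b.repr (f a) l = ∑ w, b.repr a w * b.repr (f (b w)) l :=
  apply_eq_sum_repr b (b.coord l ∘ₗ f) a

variable [DecidableEq ι] [Fintype κ] [DecidableEq κ]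

theorem inverseTensor_pairOf (q : κ → ZMod 2) : inverseTensor d (dblParity d q) (Matrix.of (pairOf
      (fun μ ν => if μ = ν then (sgn ((d + 1) * q μ) : k) else 0) fun μ ν => if μ = ν then 1 else 0)) =
    pairOf (fun μ ν => if μ = ν then (sgn ((d + 1) * q μ) : k) else 0)
      fun μ ν => if μ = ν then 1 else 0 := by
  have h : (Matrix.of (pairOf
      (fun μ ν => if μ = ν then (sgn ((d + 1) * q μ) : k) else 0) fun μ ν => if μ = ν then 1 else 0))⁻¹ =
      Matrix.of (pairOf (fun μ ν => if μ = ν then 1 else 0)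
        fun μ ν => if μ = ν then (sgn ((d + 1) * q μ) : k) else 0) := by
    refine Matrix.inv_eq_right_inv ?_
    ext x y
    rw [Matrix.mul_apply, sum_sum_type]
    rcases x with μ | μ <;> rcases y with ν | ν <;> simp [pairOf, Matrix.one_apply]
    split_ifs with h
    · rw [h, sgn_mul_self_cast]
    · rfl
  unfold inverseTensor
  rw [h]
  funext x y
  rcases x with μ | μ <;> rcases y with ν | ν <;> simp [pairOf, dblParity]
  · split_ifs with h
    · rw [← Int.cast_mul, ← sgn_add]
      have : ∀ δ a : ZMod 2, sgn ((δ + 1) * (a + δ) + (δ + 1) * a) = 1 := by decide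
      rw [this, Int.cast_one]
    · rfl

variable {b}

theorem dblPairing_dblBasis (hb : ∀ i, b i ∈ 𝒜 (p i)) :
    (fun x y => dblPairing d (parityOp 𝒜) (dblBasis b x) (dblBasis b y)) =
      pairOf (fun i j => if i = j then (sgn ((d + 1) * p i) : k) else 0)
        fun i j => if i = j then 1 else 0 := by
  funext x y
  rcases x with i | i <;> rcases y with j | j <;>
    simp [pairOf, dblPairing, dblBasis, parityOp_pow_apply _ (hb _), Finsupp.single_apply, eq_comm]

theorem threeTensor_eq [IsScalarTower k A A] [SMulCommClass k A A] [SetLike.GradedMul 𝒜]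
    (hb : ∀ i, b i ∈ 𝒜 (p i)) : threeTensor d (parityOp 𝒜) b p =
      tripleOf d p fun i j l => b.repr (b i * b j) l := by
  funext x y z
  rcases x with i | i <;> rcases y with j | j <;> rcases z with l | l <;>
    simp [tripleOf, threeTensor, dblPairing, dblMul, dblBasis, dblParity, sgn_add, mul_assoc, mul_smul_comm,
      parityOp_pow_apply _ (hb _), parityOp_pow_apply _ (SetLike.mul_mem_graded (hb _) (hb _))]

theorem propagator_eq (hb : ∀ i, b i ∈ 𝒜 (p i)) (H : Module.End k A) :
    propagator d (parityOp 𝒜) H b p =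
      pairOf (fun i j => sgn d * sgn ((d + 1) * p j) * b.repr (H (b j)) i)
        fun i j => -sgn (p i) * b.repr (H (b i)) j := by
  funext x y
  unfold propagator
  rw [dblPairing_dblBasis d hb, inverseTensor_pairOf, sum_sum_type]
  have hd : ((-1 : k) ^ d) = (sgn d : k) := by rw [sgn_natCast]; simp
  have h1 := sgn_mul_self_cast (k := k) (d : ZMod 2)
  rcases x with i | i <;> rcases y with j | j <;>
    simp [pairOf, dblCoord, dblH, dblBasis, parityOp_apply (hb _), pow_succ, hd]
  · ring
  · linear_combination (sgn (p i) : k) * b.repr (H (b i)) j * h1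

theorem neg_dblCoord_dblI (hb : ∀ i, b i ∈ 𝒜 (p i)) (I : Module.End k A) :
    (fun y x => -dblCoord b (dblI d (parityOp 𝒜) I (dblBasis b x)) y) =
      diagOf (fun j i => -b.repr (I (b i)) j)
        fun j i => -(sgn d * sgn (p j) * b.repr (I (b j)) i) := by
  funext y x
  have hd : ((-1 : k) ^ d) = (sgn d : k) := by rw [sgn_natCast]; simp
  rcases x with i | i <;> rcases y with j | j <;>
    simp [diagOf, dblCoord, dblI, dblBasis, parityOp_apply (hb _), hd, mul_assoc]

/-! The image of the projector -/

variable {P : Module.End k A} {e : Module.Basis κ k (LinearMap.range P)}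

theorem rangeRestrict_coe (hP : IsIdempotentElem P) (x : LinearMap.range P) :
    P.rangeRestrict (x : A) = x := by
  obtain ⟨_, a, rfl⟩ := x
  exact Subtype.ext (congrArg (fun f : Module.End k A => f a) hP.eq)

theorem apply_proj_eq_sum (φ : A →ₗ[k] k) (a : A) :
    φ (P a) = ∑ μ, e.repr (P.rangeRestrict a) μ * φ (e μ) := by
  have h : P a = (P.rangeRestrict a : A) := rfl
  conv_lhs => rw [h, ← e.sum_repr (P.rangeRestrict a), AddSubmonoidClass.coe_finsetSum, map_sum]
  exact sum_congr rfl fun w _ => by rw [Submodule.coe_smul, map_smul, smul_eq_mul]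

theorem imgTensor_eq (hP : IsIdempotentElem P) (he : ∀ μ, (e μ : A) ∈ 𝒜 (q μ)) :
    imgTensor d (parityOp 𝒜) P e q =
      pairOf (fun μ ν => if μ = ν then (sgn ((d + 1) * q μ) : k) else 0)
        fun μ ν => if μ = ν then 1 else 0 := by
  unfold imgTensor
  rw [← inverseTensor_pairOf]
  congr 2
  funext x y
  rcases x with μ | μ <;> rcases y with ν | ν <;>
    simp [pairOf, dblPairing, imgBasis, parityOp_pow_apply _ (he _), rangeRestrict_coe hP,
      Finsupp.single_apply, eq_comm]

theorem dblCoord_imgBasis (u : κ ⊕ κ) (x : ι ⊕ ι) : dblCoord b (imgBasis P e u) x =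
    match u, x with
    | .inl μ, .inl i => b.repr (e μ) i
    | .inr μ, .inr i => e.coord μ (P.rangeRestrict (b i))
    | _, _ => 0 := by
  rcases u with μ | μ <;> rcases x with i | i <;> simp [dblCoord, imgBasis]

end Algebra

section Master

variable {k : Type u} [Field k] {A : Type*} [NonUnitalRing A] [Module k A]
  [IsScalarTower k A A] [SMulCommClass k A A]
  {𝒜 : ZMod 2 → Submodule k A} [DirectSum.Decomposition 𝒜]
  {ι : Type*} [Fintype ι] [DecidableEq ι] {κ : Type*} [Fintype κ] [DecidableEq κ]
  {p : ι → ZMod 2} {q : κ → ZMod 2} {I H : Module.End k A}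

theorem commute_homotopyProj (hHI : Commute H (I ^ 2)) : Commute (homotopyProj I H) I := by
  unfold homotopyProj
  refine (Commute.one_left I).sub_left ?_
  have h := hHI.eq
  rw [pow_two] at h
  rw [commute_iff_eq, add_mul, mul_add, mul_assoc I H, add_comm, mul_assoc H, h]
  simp only [mul_assoc]

theorem homotopyProj_mem (hI : ∀ i, ∀ a ∈ 𝒜 i, I a ∈ 𝒜 (i + 1))
    (hH : ∀ i, ∀ a ∈ 𝒜 i, H a ∈ 𝒜 (i + 1)) {i : ZMod 2} {a : A} (ha : a ∈ 𝒜 i) :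
    homotopyProj I H a ∈ 𝒜 i := by
  have h : i + 1 + 1 = i := by rw [add_assoc]; exact add_zero i
  have h1 := hI _ _ (hH _ _ ha)
  have h2 := hH _ _ (hI _ _ ha)
  rw [h] at h1 h2
  exact Submodule.sub_mem _ ha (Submodule.add_mem _ h1 h2)

theorem isMasterData [SetLike.GradedMul 𝒜] (d : ℕ) {c : ZMod 2} (hcd : c = d + 1)
    (hI : ∀ i, ∀ a ∈ 𝒜 i, I a ∈ 𝒜 (i + 1))
    (hI_mul : ∀ i, ∀ a ∈ 𝒜 i, ∀ a', I (a * a') = I a * a' + sgn i • (a * I a'))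
    (hH : ∀ i, ∀ a ∈ 𝒜 i, H a ∈ 𝒜 (i + 1))
    (hP : IsIdempotentElem (homotopyProj I H)) (hHI : Commute H (I ^ 2))
    {b : Module.Basis ι k A} (hb : ∀ i, b i ∈ 𝒜 (p i))
    {e : Module.Basis κ k (LinearMap.range (homotopyProj I H))} (he : ∀ μ, (e μ : A) ∈ 𝒜 (q μ)) :
    IsMasterData (letterParity d p) c (threeTensor d (parityOp 𝒜) b p)
      (propagator d (parityOp 𝒜) H b p)
      (pairOf (fun i j => if i = j then (sgn ((d + 1) * p i) : k) else 0)
        fun i j => if i = j then 1 else 0)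
      (pairOf (fun i j => sgn ((d + 1) * p i) * b.repr (homotopyProj I H (b j)) i)
        fun i j => b.repr (homotopyProj I H (b i)) j)
      (fun y x => -dblCoord b (dblI d (parityOp 𝒜) I (dblBasis b x)) y)
      (letterParity d q) (imgTensor d (parityOp 𝒜) (homotopyProj I H) e q)
      (imgI d (parityOp 𝒜) (homotopyProj I H) e I) fun u => dblCoord b (imgBasis (homotopyProj I H) e u) := by
  subst hcd
  have hf {x : A} {j} (hx : x ∈ 𝒜 j) {i} : b.repr x i ≠ 0 → p i = j :=
    parity_of_repr_ne_zero (f := LinearMap.id) injective_id b hb hx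
  have hs : ∀ i j l, b.repr (b i * b j) l ≠ 0 → p l = p i + p j := fun i j l => hf (SetLike.mul_mem_graded (hb i) (hb j))
  have hI' : ∀ i j, b.repr (I (b j)) i ≠ 0 → p i = p j + 1 := fun i j => hf (hI _ _ (hb j))
  have hH' : ∀ i j, b.repr (H (b j)) i ≠ 0 → p i = p j + 1 := fun i j => hf (hH _ _ (hb j))
  have hP' : ∀ i j, b.repr (homotopyProj I H (b j)) i ≠ 0 → p i = p j := fun i j => hf (homotopyProj_mem hI hH (hb j))
  have hE : ∀ u x, dblCoord b (imgBasis (homotopyProj I H) e u) x ≠ 0 →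
      dblParity d p x = dblParity d q u := by
    rintro (μ | μ) (i | i) h <;> rw [dblCoord_imgBasis] at h
    · exact hf (he μ) h
    · exact absurd rfl h
    · exact absurd rfl h
    · have h1 := parity_of_repr_ne_zero (f := Submodule.subtype _) Subtype.val_injective e he
        (x := (homotopyProj I H).rangeRestrict (b i)) (homotopyProj_mem hI hH (hb i)) h
      simp only [dblParity, elim_inr, h1]
  have hc : ∀ a, homotopyProj I H (I a) = I (homotopyProj I H a) := fun a =>
    congrArg (fun f : Module.End k A => f a) (commute_homotopyProj hHI).eq
  have hPe : ∀ μ, homotopyProj I H (e μ) = e μ := fun μ =>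
    congrArg Subtype.val (rangeRestrict_coe hP (e μ))
  rw [threeTensor_eq d hb, propagator_eq d hb, neg_dblCoord_dblI d hb]
  refine ⟨isCyclicTensor_tripleOf d hs, isEdgeTensor_pairOf d (H := fun i j => b.repr (H (b j)) i) hH',
    parity_pairOf d ?_ ?_, parity_pairOf d ?_ ?_, isAssociative_tripleOf d hs ?_,
    parity_diagOf d ?_ ?_, invariant_tripleOf d (I := fun i j => b.repr (I (b j)) i) hs hI' ?_,
    variation_pairOf d (I := fun i j => b.repr (I (b j)) i) (H := fun i j => b.repr (H (b j)) i)
      (P := fun i j => b.repr (homotopyProj I H (b j)) i) hH' hI' hP' ?_, ?_, ?_, ?_⟩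
  · exact fun i j h => congrArg p (by_contra fun hij => h (if_neg hij))
  · exact fun i j h => congrArg p (by_contra fun hij => h (if_neg hij))
  · exact fun i j h => hP' _ _ (right_ne_zero_of_mul h)
  · exact fun i j h => (hP' _ _ h).symm
  · intro i j h l
    have h1 := repr_apply_eq_sum b (LinearMap.mulRight k (b h)) (b i * b j) l
    have h2 := repr_apply_eq_sum b (LinearMap.mulLeft k (b i)) (b j * b h) l
    simp only [LinearMap.mulRight_apply, LinearMap.mulLeft_apply] at h1 h2
    rw [← h1, ← h2, mul_assoc]
  · exact fun j i h => hI' _ _ (neg_ne_zero.mp h)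
  · intro j i h
    rw [hI' _ _ (right_ne_zero_of_mul (neg_ne_zero.mp h)), add_assoc]
    exact (add_zero _).symm
  · intro i j l
    have h1 := repr_apply_eq_sum b I (b i * b j) l
    have h2 := repr_apply_eq_sum b (LinearMap.mulRight k (b j)) (I (b i)) l
    have h3 := repr_apply_eq_sum b (LinearMap.mulLeft k (b i)) (I (b j)) l
    simp only [LinearMap.mulRight_apply, LinearMap.mulLeft_apply] at h2 h3
    simp only [mul_comm (b.repr (I (b _)) l)]
    rw [← h1, ← h2, ← h3, hI_mul _ _ (hb i)]
    simp
  · intro i j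
    have h1 := repr_apply_eq_sum b I (H (b j)) i
    have h2 := repr_apply_eq_sum b H (I (b j)) i
    simp only [mul_comm (b.repr (I (b _)) i), mul_comm (b.repr (H (b _)) i)]
    rw [← h1, ← h2]
    simp [homotopyProj, Finsupp.single_apply, eq_comm]
  · intro x y
    rw [imgTensor_eq d hP he]
    simp only [sum_sum_type, dblCoord_imgBasis]
    rcases x with i | i <;> rcases y with j | j <;> simp [pairOf]
    · have h := apply_proj_eq_sum (e := e) (b.coord i) (b j)
      rw [Module.Basis.coord_apply] at h
      rw [h, mul_sum]
      refine sum_congr rfl fun μ _ => ?_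
      by_cases h0 : b.repr (e μ : A) i = 0
      · simp [h0]
      · have h1 := hE (.inl μ) (.inl i) h0
        simp only [dblParity, elim_inl] at h1
        rw [h1, Module.Basis.coord_apply]
        ring
    · exact apply_proj_eq_sum (e := e) (b.coord j) (b i)
  · intro u x h
    rw [letterParity, hE u x h, letterParity]
  · intro u z
    simp only [sum_sum_type, dblCoord_imgBasis, imgI, diagOf]
    rcases u with μ | μ <;> rcases z with i | i <;> simp [imgCoord, imgBasis, dblI]
    · refine (apply_proj_eq_sum (e := e) (b.coord i) (I (e μ))).symm.trans ?_
      have h := repr_apply_eq_sum b I (e μ) i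
      simp only [mul_comm (b.repr (I (b _)) i)]
      rw [← h, Module.Basis.coord_apply, hc, hPe]
    · have hd : ((-1 : k) ^ d) = (sgn d : k) := by rw [sgn_natCast]; simp
      have h1 := apply_proj_eq_sum (e := e)
        (e.coord μ ∘ₗ (homotopyProj I H).rangeRestrict ∘ₗ I ∘ₗ parityOp 𝒜) (b i)
      have h2 := apply_eq_sum_repr b (e.coord μ ∘ₗ (homotopyProj I H).rangeRestrict) (I (b i))
      have h3 : (homotopyProj I H).rangeRestrict (homotopyProj I H (I (b i))) =
          (homotopyProj I H).rangeRestrict (I (b i)) := rangeRestrict_coe hP (LinearMap.rangeRestrict _ _)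
      simp only [LinearMap.comp_apply, Module.Basis.coord_apply,
        parityOp_apply (homotopyProj_mem hI hH (hb i)), map_smul, ← hc, h3, Finsupp.smul_apply] at h1 h2
      simp only [mul_assoc, ← mul_sum, hd]
      rw [← h2, ← smul_eq_mul (sgn (p i) : k), h1]
      simp only [mul_comm]

end Master

/-! ### The solutions -/

section Solution

variable {k : Type u} [Field k] {K : Type*} [Fintype K] {K' : Type*} [Fintype K']
  {W : Coef k} {par : K → ZMod 2} {m : K → K → K → k} {t T TP : K → K → k} {pK : K' → ZMod 2}
  {J : K → K → k} {g J' : K' → K' → k} {e : K' → K → k}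

theorem solutionOfOrder_equivariant (h : IsMasterData par W.c m t T TP J pK g J' e) (c n : ℕ)
    (σ τ : Perm (Fin n)) (v : Fin n → K') :
    solutionOfOrder W par m t e c n (τ * σ * τ⁻¹) (v ∘ τ.symm) =
      (koszulSign (pK ∘ v) (fun i => (i : ℕ)) (fun i => (τ i : ℕ)) : k) •
        W.res τ.symm (solutionOfOrder W par m t e c n σ v) := by
  unfold solutionOfOrder solution
  rw [wordTotal_equivariant h.even, map_smul, smul_comm]

theorem solutionOfOrder_even (h : IsMasterData par W.c m t T TP J pK g J' e) {c n : ℕ}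
    {σ : Perm (Fin n)} {v : Fin n → K'} (h0 : solutionOfOrder W par m t e c n σ v ≠ 0) :
    ∑ i, pK (v i) = W.c * numCycles σ :=
  wordTotal_even h.cyclic h.edge h.even (right_ne_zero_of_smul h0)

theorem solutionOfOrder_mem_line (c n : ℕ) (σ : Perm (Fin n)) (v : Fin n → K') :
    solutionOfOrder W par m t e c n σ v ∈ W.line σ :=
  smul_mem _ _ (wordTotal_mem_line σ v)

theorem bvExpression_eq (par : K → ZMod 2) (t J : K → K → k) (S : ℕ → WordFunctional k K) :
    bvExpression par t J S = masterExpression (scalarCoef k) par t J S := by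
  funext c n σ v
  have h : ∀ F G : WordFunctional k K, bracket par t F G n σ v =
      ∑ X : Finset (Fin n), coefBracketAt (scalarCoef k) par t F G n σ v X := fun F G =>
    sum_congr rfl fun X _ => sum_congr rfl fun σ' _ =>
      sum_congr rfl fun μ _ => sum_congr rfl fun ν _ => mul_assoc _ _ _
  unfold bvExpression
  simp only [h]
  cases c <;> rfl

theorem extBvExpression_eq (par : K → ZMod 2) (t J : K → K → k) (S : ℕ → ExtWordFunctional k K) :
    extBvExpression par t J S = masterExpression (exteriorCoef k) par t J S := by
  funext c n σ v
  cases c <;> rfl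

end Solution

section Sums

variable {k : Type u} [Field k] [CharZero k] {ι : Type*} [Fintype ι] {K' : Type*}
  {par : ι ⊕ ι → ZMod 2} {m : ι ⊕ ι → ι ⊕ ι → ι ⊕ ι → k} {t : ι ⊕ ι → ι ⊕ ι → k}

theorem ribbonSum_eq (hm : IsCyclicTensor par 0 m) (ht : IsEdgeTensor par 0 t)
    (hc : IsColoured m t) (e : K' → ι ⊕ ι → k)
    (c n : ℕ) (σ : Perm (Fin n)) (v : Fin n → K') :
    ribbonSum par m t c n σ (fun x => e (v x)) =
      solutionOfOrder (scalarCoef k) par m t e c n σ v := by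
  refine Eq.trans (finsum_congr fun Γ => ?_)
    (finsum_ribbonClass (W := scalarCoef k) hm ht hc c n σ fun x => e (v x))
  rw [orient_scalarCoef]
  exact (mul_one _).symm

theorem extRibbonSum_eq (hm : IsCyclicTensor par 1 m) (ht : IsEdgeTensor par 1 t)
    (hc : IsColoured m t) (e : K' → ι ⊕ ι → k)
    (c n : ℕ) (σ : Perm (Fin n)) (v : Fin n → K') :
    extRibbonSum par m t c n σ (fun x => e (v x)) =
      solutionOfOrder (exteriorCoef k) par m t e c n σ v := by
  refine Eq.trans (finsum_congr fun Γ => ?_)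
    (finsum_ribbonClass (W := exteriorCoef k) hm ht hc c n σ fun x => e (v x))
  rw [RibbonGraph.orientation_eq]
  rfl

end Sums

end NCBV

end

theorem mainTheorem6 {k : Type*} [Field k] [CharZero k]
    {A : Type*} [NonUnitalRing A] [Module k A] [IsScalarTower k A A] [SMulCommClass k A A]
    (𝒜 : ZMod 2 → Submodule k A) [DirectSum.Decomposition 𝒜] [SetLike.GradedMul 𝒜]
    (I H : Module.End k A)
    (hI : ∀ i, ∀ a ∈ 𝒜 i, I a ∈ 𝒜 (i + 1))
    (hI_mul : ∀ i, ∀ a ∈ 𝒜 i, ∀ a', I (a * a') = I a * a' + NCBV.sgn i • (a * I a'))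
    (hH : ∀ i, ∀ a ∈ 𝒜 i, H a ∈ 𝒜 (i + 1))
    (hP : IsIdempotentElem (NCBV.homotopyProj I H))
    (hHI : Commute H (I ^ 2))
    {ι : Type*} [Fintype ι] [DecidableEq ι] (b : Module.Basis ι k A) (p : ι → ZMod 2)
    (hb : ∀ i, b i ∈ 𝒜 (p i))
    {κ : Type*} [Fintype κ] [DecidableEq κ]
    (e : Module.Basis κ k (LinearMap.range (NCBV.homotopyProj I H))) (q : κ → ZMod 2)
    (he : ∀ μ, (e μ : A) ∈ 𝒜 (q μ)) :
    (∀ (n : ℕ) (σ : Equiv.Perm (Fin n)) (c : ℕ), Finite (NCBV.RibbonClass n σ c)) ∧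
    ((∀ c, NCBV.IsSymmetricFunctional (NCBV.letterParity 1 q)
        (NCBV.solutionB 𝒜 H b p (NCBV.homotopyProj I H) e c)) ∧
      ∀ (c n : ℕ) (σ : Equiv.Perm (Fin n)) (v : Fin n → κ ⊕ κ),
        NCBV.bvExpression (NCBV.letterParity 1 q)
          (NCBV.imgTensor 1 (NCBV.parityOp 𝒜) (NCBV.homotopyProj I H) e q)
          (NCBV.imgI 1 (NCBV.parityOp 𝒜) (NCBV.homotopyProj I H) e I)
          (NCBV.solutionB 𝒜 H b p (NCBV.homotopyProj I H) e) c n σ v = 0) ∧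
    ((∀ c, NCBV.IsExteriorFunctional (NCBV.letterParity 0 q)
        (NCBV.solutionPiB 𝒜 H b p (NCBV.homotopyProj I H) e c)) ∧
      ∀ (c n : ℕ) (σ : Equiv.Perm (Fin n)) (v : Fin n → κ ⊕ κ),
        NCBV.extBvExpression (NCBV.letterParity 0 q)
          (NCBV.imgTensor 0 (NCBV.parityOp 𝒜) (NCBV.homotopyProj I H) e q)
          (NCBV.imgI 0 (NCBV.parityOp 𝒜) (NCBV.homotopyProj I H) e I)
          (NCBV.solutionPiB 𝒜 H b p (NCBV.homotopyProj I H) e) c n σ v = 0) := by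
  have h1 := NCBV.isMasterData (k := k) 1 (c := 0) rfl hI hI_mul hH hP hHI hb he
  have h0 := NCBV.isMasterData (k := k) 0 (c := 1) rfl hI hI_mul hH hP hHI hb he
  have hc : ∀ d, NCBV.IsColoured (NCBV.threeTensor d (NCBV.parityOp 𝒜) b p)
      (NCBV.propagator d (NCBV.parityOp 𝒜) H b p) := fun d => by
    rw [NCBV.threeTensor_eq d hb, NCBV.propagator_eq d hb]
    exact NCBV.isColoured
  have e1 : NCBV.solutionB 𝒜 H b p (NCBV.homotopyProj I H) e = _ :=
    funext fun c => funext fun n => funext fun σ => funext fun v =>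
      NCBV.ribbonSum_eq h1.cyclic h1.edge (hc 1)
        (fun u => NCBV.dblCoord b (NCBV.imgBasis (NCBV.homotopyProj I H) e u)) c n σ v
  have e0 : NCBV.solutionPiB 𝒜 H b p (NCBV.homotopyProj I H) e = _ :=
    funext fun c => funext fun n => funext fun σ => funext fun v =>
      NCBV.extRibbonSum_eq h0.cyclic h0.edge (hc 0)
        (fun u => NCBV.dblCoord b (NCBV.imgBasis (NCBV.homotopyProj I H) e u)) c n σ v
  rw [e1, e0]
  refine ⟨NCBV.finite_ribbonClass, ⟨fun c => ⟨?_, ?_⟩, ?_⟩, ⟨fun c => ⟨?_, ?_, ?_⟩, ?_⟩⟩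
  · exact fun n σ τ v => NCBV.solutionOfOrder_equivariant (W := NCBV.scalarCoef k) h1 c n σ τ v
  · intro n σ v h
    exact (NCBV.solutionOfOrder_even (W := NCBV.scalarCoef k) h1 h).trans (zero_mul _)
  · intro c n σ v
    exact (congrFun (congrFun (congrFun (congrFun (NCBV.bvExpression_eq _ _ _ _) c) n) σ) v).trans
      (NCBV.master_equation (W := NCBV.scalarCoef k) h1 c n σ v)
  · intro n σ v
    exact NCBV.solutionOfOrder_mem_line (W := NCBV.exteriorCoef k) c n σ v
  · exact fun n σ τ v => NCBV.solutionOfOrder_equivariant (W := NCBV.exteriorCoef k) h0 c n σ τ v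
  · intro n σ v h
    exact (NCBV.solutionOfOrder_even (W := NCBV.exteriorCoef k) h0 h).trans (one_mul _)
  · intro c n σ v
    exact (congrFun (congrFun (congrFun (congrFun (NCBV.extBvExpression_eq _ _ _ _) c) n) σ) v).trans
      (NCBV.master_equation (W := NCBV.exteriorCoef k) h0 c n σ v)
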